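/- **Conventions.** *Labelled shapes and graphs.* Let $\mathbb C$ be a category. A *labelled shape* in $\mathbb C$ is built from a constant $I$ and variables labelled by objects of $\mathbb C$ by means of two binary operations $T\otimes S$ and $[T,S]$. Its variables carry signs: a single variable is positive, and signs are reversed in the first argument of $[-,-]$. A *labelled graph* $T\to S$ is a perfect matching of the variables of $T$ and $S$, with the signs of $T$ reversed, into pairs consisting of one negative and one positive variable, together with a morphism of $\mathbb C$ from the label of the negative one to the label of the positive one for each pair. Graphs are composed by following paths, composing labels and discarding closed loops. A labelled graph is *allowable* if its underlying graph belongs to the smallest class that contains the identities, the associativity, unit and symmetry isomorphisms of $\otimes$, all evaluations $[T,S]\otimes T\to S$ and coevaluations $T\to[S,T\otimes S]$ and is closed under composition, $\otimes$ and $[-,-]$. Labelled shapes and allowable labelled graphs form a category $A\mathbb C$. A functor $F:\mathbb C\to A\mathbb D$ induces $AF:A\mathbb C\to A\mathbb D$, which sends $|T|(x_1,\dots,x_n)$ to $|T|(Fx_1,\dots,Fx_n)$ and replaces each edge with label $g$ by the graph $Fg$. For $\theta: I\to[T,S]$ let $\bar\theta: T\to S$ be its transpose. The product $x_1\otimes\cdots\otimes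 x_m$ is bracketed to the right, and is $I$ for $m=0$; a shape $[x_1\otimes\cdots\otimes x_m,x]$ is said to have shape $X_m$. *Multicategories and slices.* Let $Q$ be a symmetric multicategory with a category of objects $\mathbb C$. The category $\mathrm{elt}(Q)$ has the arrows $f\in Q(x_1,\dots,x_m;x)$ of $Q$ as objects; a morphism from $f$ to $g\in Q(y_1,\dots,y_m;y)$ is a permutation of the inputs together with morphisms of $\mathbb C$ from the inputs of $g$ to the corresponding inputs of $f$ and from $x$ to $y$, such that $f$ composed with them is $g$. The *frame functor* $\phi_Q:\mathrm{elt}(Q)\to A\mathbb C$ sends $f$ to $[x_1\otimes\cdots\otimes x_m,x]$ and a morphism to the graph given by the permutation, labelled by the given morphisms. The *slice* $Q^+$ has category of objects $\mathrm{elt}(Q)$, and $Q^+(f_1,\dots,f_n;f)$ is the set of configurations for composing $f_1,\dots,f_n$ to yield $f$: trees with edges labelled by morphisms of $\mathbb C$, whose nodes are the $f_i$, each once, whose leaves are the inputs of $f$, each once, and whose composite is $f$. The edges of such a tree, with their labels, run from leaves and outputs of nodes to inputs of nodes and the root; read as matching pairs, they form a labelled graph $I\to[\phi_Qf_1\otimes\cdots\otimes\phi_Qf_n,\phi_Qf]$,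 *the graph of the tree*. Write $\mathbb C_0=\mathbb C$, $\mathbb C_1=\mathrm{elt}(Q)$, $\mathbb C_2=\mathrm{elt}(Q^+)$, with frame functors $\phi_1=\phi_Q:\mathbb C_1\to A\mathbb C_0$, $\phi_2=\phi_{Q^+}:\mathbb C_2\to A\mathbb C_1$ and $\phi_3=\phi_{Q^{++}}:\mathrm{elt}(Q^{++})\to A\mathbb C_2$. **Theorem.** For every symmetric multicategory $Q$ with a category of objects $\mathbb C_0$: 1. For each $\alpha\in Q^+(f_1,\dots,f_m;f)$, the graph of the tree $\alpha$ is an allowable morphism $I\to(A\phi_1)(\phi_2\alpha)=[\phi_1f_1\otimes\cdots\otimes\phi_1f_m,\phi_1f]$ of $A\mathbb C_0$, also denoted $\alpha$. 2. For all $j\ge 0$ and $\alpha_1,\dots,\alpha_j,\alpha\in\mathbb C_2$, sending a tree to its graph is a bijection from $Q^{++}(\alpha_1,\dots,\alpha_j;\alpha)$ onto the set of all morphisms $\theta: I\to[\phi_2\alpha_1\otimes\cdots\otimes\phi_2\alpha_j,\ \phi_2\alpha]$ of $A\mathbb C_1$ such that $$(A\phi_1)\bar\theta\circ(\alpha_1\otimes\cdots\otimes\alpha_j)=\alpha\quad\text{in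 }A\mathbb C_0,$$ where $I^{\otimes j}$ is identified with $I$. 3. With this identification, $\mathrm{elt}(Q^{++})$ is the full subcategory of the comma category $(I\downarrow A\phi_2)$ on the objects $(\theta,p)$ such that (i) $p$ has shape $X_m$ for some $m\ge0$, so $p=[\alpha_1\otimes\cdots\otimes\alpha_m,\alpha]\in A\mathbb C_2$, and (ii) $(A\phi_1)\bar\theta\circ(\alpha_1\otimes\cdots\otimes\alpha_m)=\alpha$. That is, there is an isomorphism of categories from $\mathrm{elt}(Q^{++})$ to this full subcategory that sends an arrow $\theta\in Q^{++}(\alpha_1,\dots,\alpha_m;\alpha)$ to its graph over $[\alpha_1\otimes\cdots\otimes\alpha_m,\alpha]$, and its composite with the forgetful functor to $A\mathbb C_2$ is the frame functor $\phi_3$. -/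

import Mathlib

open CategoryTheory
universe u v w u' v' w'
set_option linter.unusedSectionVars false
set_option linter.unusedVariables false

namespace KM

/-- A finite set of variables with signs, labelled by objects of `C`: the variables of a labelled shape.
`P` and `N` are the positive and the negative variables, `lP` and `lN` their labels. -/
structure SignedSet (C : Type u) where
  P : Type
  N : Type
  lP : P → C
  lN : N → C
  [finP : Finite P]
  [finN : Finite N]

attribute [instance] SignedSet.finP SignedSet.finN

namespace SignedSet
variable {C : Type u}

/-- The negative variables of the twisted sum of `X` and `Y`, in which the signs of `X` are reversed. -/
abbrev Src (X Y : SignedSet C) : Type := X.P ⊕ Y.N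

/-- The positive variables of the twisted sum. -/
abbrev Tgt (X Y : SignedSet C) : Type := X.N ⊕ Y.P

abbrev srcLab (X Y : SignedSet C) : Src X Y → C := Sum.elim X.lP Y.lN
abbrev tgtLab (X Y : SignedSet C) : Tgt X Y → C := Sum.elim X.lN Y.lP
end SignedSet
open SignedSet

variable {C : Type u} [Category.{v} C]

/-- A labelled graph from `X` to `Y`: the variables of the twisted sum are paired in mates of opposite
sign, with a morphism of `C`, in the direction from `-` to `+`, for each pair of mates. -/
structure Matching (X Y : SignedSet C) where
  mate : Src X Y → Tgt X Y
  bij : Function.Bijective mate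
  label : ∀ a, srcLab X Y a ⟶ tgtLab X Y (mate a)

namespace Matching
variable {X Y Z W : SignedSet C}

/-- The edge at a negative variable of the twisted sum: its other end and its label. -/
def step (f : Matching X Y) (a : Src X Y) : Σ b : Tgt X Y, (srcLab X Y a ⟶ tgtLab X Y b) :=
  ⟨f.mate a, f.label a⟩

def ofStep (s : ∀ a : Src X Y, Σ b : Tgt X Y, (srcLab X Y a ⟶ tgtLab X Y b))
    (h : Function.Bijective fun a => (s a).1) : Matching X Y :=
  ⟨fun a => (s a).1, h, fun a => (s a).2⟩

@[simp] theorem step_ofStep (s h) : (ofStep s h : Matching X Y).step = s := rfl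

theorem ext_step {f g : Matching X Y} (h : ∀ a, f.step a = g.step a) : f = g := by
  cases f with | mk m b l => cases g with | mk m' b' l' =>
  have hm : m = m' := funext fun a => congrArg Sigma.fst (h a)
  subst hm
  have hl : l = l' := by
    funext a
    have := h a
    simpa [step] using this
  subst hl; rfl

theorem step_inj (f : Matching X Y) {a a' b} {l : srcLab X Y a ⟶ tgtLab X Y b}
    {l' : srcLab X Y a' ⟶ tgtLab X Y b} (h : f.step a = ⟨b, l⟩) (h' : f.step a' = ⟨b, l'⟩) :
    a = a' := by
  apply f.bij.1
  exact (congrArg Sigma.fst h).trans (congrArg Sigma.fst h').symm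

theorem step_surj (f : Matching X Y) (b : Tgt X Y) :
    ∃ (a : Src X Y) (l : srcLab X Y a ⟶ tgtLab X Y b), f.step a = ⟨b, l⟩ := by
  obtain ⟨a, rfl⟩ := f.bij.2 b
  exact ⟨a, f.label a, rfl⟩

/-- labels of the positions of a path through a composite -/
abbrev midLab (X Y Z : SignedSet C) : Src X Y ⊕ Src Y Z → C :=
  Sum.elim (srcLab X Y) (srcLab Y Z)

/-- `Trace f g s t l`: the path from `s` through the edges of `f` and `g`, alternately, leaves the middle
at `t`, and the composite of the labels on it is `l`. -/
inductive Trace (f : Matching X Y) (g : Matching Y Z) :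
    (s : Src X Y ⊕ Src Y Z) → (t : Tgt X Z) → (midLab X Y Z s ⟶ tgtLab X Z t) → Prop
  | exit_left {a : Src X Y} {x : X.N} {l} (h : f.step a = ⟨.inl x, l⟩) :
      Trace f g (.inl a) (.inl x) l
  | cross_left {a : Src X Y} {y : Y.P} {k} {t : Tgt X Z} {l} (h : f.step a = ⟨.inr y, k⟩)
      (r : Trace f g (.inr (.inl y)) t l) : Trace f g (.inl a) t (k ≫ l)
  | exit_right {b : Src Y Z} {z : Z.P} {l} (h : g.step b = ⟨.inr z, l⟩) :
      Trace f g (.inr b) (.inr z) l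
  | cross_right {b : Src Y Z} {y : Y.N} {k} {t : Tgt X Z} {l} (h : g.step b = ⟨.inl y, k⟩)
      (r : Trace f g (.inl (.inr y)) t l) : Trace f g (.inr b) t (k ≫ l)

theorem Trace.cross_left' {f : Matching X Y} {g : Matching Y Z} {a : Src X Y} {y : Y.P} {k}
    {t : Tgt X Z} {l m} (h : f.step a = ⟨.inr y, k⟩) (r : Trace f g (.inr (.inl y)) t l)
    (e : k ≫ l = m) : Trace f g (.inl a) t m := e ▸ .cross_left h r

theorem Trace.cross_right' {f : Matching X Y} {g : Matching Y Z} {b : Src Y Z} {y : Y.N} {k}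
    {t : Tgt X Z} {l m} (h : g.step b = ⟨.inl y, k⟩) (r : Trace f g (.inl (.inr y)) t l)
    (e : k ≫ l = m) : Trace f g (.inr b) t m := e ▸ .cross_right h r

theorem Trace.det {f : Matching X Y} {g : Matching Y Z} {s t l t' l'}
    (h : Trace f g s t l) (h' : Trace f g s t' l') :
    (⟨t, l⟩ : Σ t, (midLab X Y Z s ⟶ tgtLab X Z t)) = ⟨t', l'⟩ := by
  induction h with
  | exit_left h =>
    cases h' with
    | exit_left h2 => have := h.symm.trans h2; cases this; rfl
    | cross_left h2 r => have := h.symm.trans h2; cases this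
  | cross_left h r ih =>
    cases h' with
    | exit_left h2 => have := h.symm.trans h2; cases this
    | cross_left h2 r2 =>
      have := h.symm.trans h2; cases this
      have := ih r2; cases this; rfl
  | exit_right h =>
    cases h' with
    | exit_right h2 => have := h.symm.trans h2; cases this; rfl
    | cross_right h2 r => have := h.symm.trans h2; cases this
  | cross_right h r ih =>
    cases h' with
    | exit_right h2 => have := h.symm.trans h2; cases this
    | cross_right h2 r2 =>
      have := h.symm.trans h2; cases this
      have := ih r2; cases this; rfl

/-- outer starting positions -/
abbrev start (X Y Z : SignedSet C) : Src X Z → Src X Y ⊕ Src Y Z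
  | .inl p => .inl (.inl p)
  | .inr n => .inr (.inr n)

/-- after one step: an outer target, or a new position -/
def hop (f : Matching X Y) (g : Matching Y Z) : Src X Y ⊕ Src Y Z → Tgt X Z ⊕ (Y.P ⊕ Y.N)
  | .inl a => match f.mate a with
    | .inl x => .inl (.inl x)
    | .inr y => .inr (.inl y)
  | .inr b => match g.mate b with
    | .inl y => .inr (.inr y)
    | .inr z => .inl (.inr z)

/-- inner positions -/
def inner (X Y Z : SignedSet C) : Y.P ⊕ Y.N → Src X Y ⊕ Src Y Z
  | .inl y => .inr (.inl y)
  | .inr y => .inl (.inr y)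

theorem inner_inj : Function.Injective (inner X Y Z) := by
  rintro (a | a) (b | b) h <;> simp_all [inner]

theorem hop_inj (f : Matching X Y) (g : Matching Y Z) : Function.Injective (hop f g) := by
  rintro (a | a) (b | b) h
  · congr 1; apply f.bij.1
    rcases h1 : f.mate a with x | x <;> rcases h2 : f.mate b with y | y <;> simp_all [hop]
  · exfalso
    rcases h1 : f.mate a with x | x <;> rcases h2 : g.mate b with y | y <;> simp_all [hop]
  · exfalso
    rcases h1 : g.mate a with x | x <;> rcases h2 : f.mate b with y | y <;> simp_all [hop]
  · congr 1; apply g.bij.1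
    rcases h1 : g.mate a with x | x <;> rcases h2 : g.mate b with y | y <;> simp_all [hop]

theorem hop_inl (f : Matching X Y) (g : Matching Y Z) {s t} (h : hop f g s = .inl t) :
    ∃ l, Trace f g s t l := by
  rcases s with a | a
  · rcases h1 : f.step a with ⟨x | x, l⟩
    · have : f.mate a = .inl x := congrArg Sigma.fst h1
      simp [hop, this] at h; subst h; exact ⟨_, .exit_left h1⟩
    · have : f.mate a = .inr x := congrArg Sigma.fst h1
      simp [hop, this] at h
  · rcases h1 : g.step a with ⟨x | x, l⟩
    · have : g.mate a = .inl x := congrArg Sigma.fst h1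
      simp [hop, this] at h
    · have : g.mate a = .inr x := congrArg Sigma.fst h1
      simp [hop, this] at h; subst h; exact ⟨_, .exit_right h1⟩

theorem hop_inr (f : Matching X Y) (g : Matching Y Z) {s m} (h : hop f g s = .inr m) {t l}
    (ht : Trace f g (inner X Y Z m) t l) : ∃ l, Trace f g s t l := by
  rcases s with a | a
  · rcases h1 : f.step a with ⟨x | x, l⟩
    · have : f.mate a = .inl x := congrArg Sigma.fst h1
      simp [hop, this] at h
    · have : f.mate a = .inr x := congrArg Sigma.fst h1
      simp [hop, this] at h; subst h; exact ⟨_, .cross_left h1 ht⟩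
  · rcases h1 : g.step a with ⟨x | x, l⟩
    · have : g.mate a = .inl x := congrArg Sigma.fst h1
      simp [hop, this] at h; subst h; exact ⟨_, .cross_right h1 ht⟩
    · have : g.mate a = .inr x := congrArg Sigma.fst h1
      simp [hop, this] at h

theorem start_ne_inner (a : Src X Z) (m) : start X Y Z a ≠ inner X Y Z m := by
  rcases a with a | a <;> rcases m with m | m <;> simp [start, inner]

theorem cover (s : Src X Y ⊕ Src Y Z) : (∃ a, s = start X Y Z a) ∨ ∃ m, s = inner X Y Z m := by
  rcases s with (a | a) | (a | a)
  · exact .inl ⟨.inl a, rfl⟩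
  · exact .inr ⟨.inr a, rfl⟩
  · exact .inr ⟨.inl a, rfl⟩
  · exact .inl ⟨.inr a, rfl⟩

theorem hop_surj (f : Matching X Y) (g : Matching Y Z) : Function.Surjective (hop f g) := by
  rintro ((x | z) | (y | y))
  · obtain ⟨a, h⟩ := f.bij.2 (.inl x); exact ⟨.inl a, by simp [hop, h]⟩
  · obtain ⟨a, h⟩ := g.bij.2 (.inr z); exact ⟨.inr a, by simp [hop, h]⟩
  · obtain ⟨a, h⟩ := f.bij.2 (.inr y); exact ⟨.inl a, by simp [hop, h]⟩
  · obtain ⟨a, h⟩ := g.bij.2 (.inl y); exact ⟨.inr a, by simp [hop, h]⟩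

/-- paths from outside terminate -/
theorem exists_trace (f : Matching X Y) (g : Matching Y Z) (a : Src X Z) :
    ∃ t l, Trace f g (start X Y Z a) t l := by
  by_contra hcon
  let B := {s : Src X Y ⊕ Src Y Z // ¬ ∃ t l, Trace f g s t l}
  have key : ∀ s : B, ∃ m, hop f g s.1 = .inr m ∧ ¬ ∃ t l, Trace f g (inner X Y Z m) t l := by
    rintro ⟨s, hs⟩
    rcases h : hop f g s with t | m
    · exact absurd ⟨t, hop_inl f g h⟩ hs
    · exact ⟨m, rfl, fun ⟨t, l, ht⟩ => hs ⟨t, hop_inr f g h ht⟩⟩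
  choose nx h1 h2 using key
  let F : B → B := fun s => ⟨inner X Y Z (nx s), h2 s⟩
  have Finj : Function.Injective F := by
    intro s s' h
    have : nx s = nx s' := inner_inj (congrArg Subtype.val h)
    apply Subtype.ext; apply hop_inj f g; rw [h1, h1, this]
  obtain ⟨s, hs⟩ := Finite.surjective_of_injective Finj ⟨_, hcon⟩
  exact start_ne_inner a _ (congrArg Subtype.val hs).symm

/-- each outer target is reached from outside -/
theorem exists_source (f : Matching X Y) (g : Matching Y Z) (t : Tgt X Z) :
    ∃ a l, Trace f g (start X Y Z a) t l := by
  by_contra hcon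
  let B := {s : Src X Y ⊕ Src Y Z // ∃ l, Trace f g s t l}
  have key : ∀ s : B, ∃ s' : B, ∃ m, s.1 = inner X Y Z m ∧ hop f g s'.1 = .inr m := by
    rintro ⟨s, l, hs⟩
    rcases cover s with ⟨a, rfl⟩ | ⟨m, rfl⟩
    · exact absurd ⟨a, l, hs⟩ hcon
    · obtain ⟨s', h'⟩ := hop_surj f g (.inr m)
      exact ⟨⟨s', hop_inr f g h' hs⟩, m, rfl, h'⟩
  choose pr m h1 h2 using key
  have pinj : Function.Injective pr := by
    intro s s' h
    have : m s = m s' := by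
      have e := h2 s; rw [h, h2 s'] at e; exact (Sum.inr.inj e).symm
    apply Subtype.ext; rw [h1, h1, this]
  obtain ⟨s0, h0⟩ := hop_surj f g (.inl t)
  obtain ⟨s, hs⟩ := Finite.surjective_of_injective pinj ⟨s0, hop_inl f g h0⟩
  have := h2 s
  rw [hs, h0] at this
  cases this

theorem card_eq (f : Matching X Y) (g : Matching Y Z) :
    Nat.card (Src X Z) = Nat.card (Tgt X Z) := by
  have h1 := Nat.card_eq_of_bijective _ f.bij
  have h2 := Nat.card_eq_of_bijective _ g.bij
  simp only [Nat.card_sum] at *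
  omega

/-- label transport between an outer source and the corresponding starting position -/
theorem exists_step (f : Matching X Y) (g : Matching Y Z) (a : Src X Z) :
    ∃ r : Σ t : Tgt X Z, (midLab X Y Z (start X Y Z a) ⟶ tgtLab X Z t),
      Trace f g (start X Y Z a) r.1 r.2 := by
  obtain ⟨t, l, h⟩ := exists_trace f g a
  exact ⟨⟨t, l⟩, h⟩

noncomputable def compStep (f : Matching X Y) (g : Matching Y Z) :
    ∀ a : Src X Z, Σ t : Tgt X Z, (srcLab X Z a ⟶ tgtLab X Z t)
  | .inl p => (exists_step f g (.inl p)).choose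
  | .inr n => (exists_step f g (.inr n)).choose

theorem compStep_fst {f : Matching X Y} {g : Matching Y Z} {a t l}
    (h : Trace f g (start X Y Z a) t l) : (compStep f g a).1 = t := by
  rcases a with a | a
  · exact congrArg Sigma.fst ((exists_step f g (.inl a)).choose_spec.det h)
  · exact congrArg Sigma.fst ((exists_step f g (.inr a)).choose_spec.det h)

/-- The composite: its edges are the paths through `f` and `g`, with the composite labels. Closed loops
in the middle are discarded. -/
noncomputable def comp (f : Matching X Y) (g : Matching Y Z) : Matching X Z :=
  ofStep (compStep f g) <| by
    have hs : Function.Surjective fun a => (compStep f g a).1 := by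
      intro t
      obtain ⟨a, l, h⟩ := exists_source f g t
      exact ⟨a, compStep_fst h⟩
    exact (Nat.bijective_iff_surjective_and_card _).2 ⟨hs, card_eq f g⟩

theorem comp_step_inl {f : Matching X Y} {g : Matching Y Z} {p : X.P} {t l} :
    (f.comp g).step (.inl p) = ⟨t, l⟩ ↔ Trace f g (.inl (.inl p)) t l := by
  have := (exists_step f g (.inl p)).choose_spec
  constructor
  · intro h
    have h' : (exists_step f g (.inl p)).choose = ⟨t, l⟩ := h
    rw [h'] at this; exact this
  · intro h; exact this.det h

theorem comp_step_inr {f : Matching X Y} {g : Matching Y Z} {p : Z.N} {t l} :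
    (f.comp g).step (.inr p) = ⟨t, l⟩ ↔ Trace f g (.inr (.inr p)) t l := by
  have := (exists_step f g (.inr p)).choose_spec
  constructor
  · intro h
    have h' : (exists_step f g (.inr p)).choose = ⟨t, l⟩ := h
    rw [h'] at this; exact this
  · intro h; exact this.det h

/-- The identity graph. -/
def id (X : SignedSet C) : Matching X X :=
  ofStep (fun | .inl p => ⟨.inr p, 𝟙 _⟩ | .inr n => ⟨.inl n, 𝟙 _⟩) <| by
    constructor
    · rintro (a | a) (b | b) h <;> simp_all
    · rintro (b | b)
      · exact ⟨.inr b, rfl⟩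
      · exact ⟨.inl b, rfl⟩

theorem id_comp (f : Matching X Y) : (id X).comp f = f := by
  have key : ∀ a t (l : srcLab X Y a ⟶ tgtLab X Y t), f.step a = ⟨t, l⟩ →
      Trace (id X) f (.inr a) t l := by
    rintro a (t | t) l h
    · exact Trace.cross_right' (f := id X) h (.exit_left (l := 𝟙 _) rfl) (Category.comp_id _)
    · exact .exit_right h
  apply ext_step
  rintro (a | a)
  · rcases h : f.step (.inl a) with ⟨t, l⟩
    rw [comp_step_inl]
    exact Trace.cross_left' (f := id X) (k := 𝟙 _) (a := .inl a) rfl (key _ _ _ h)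
      (Category.id_comp _)
  · rcases h : f.step (.inr a) with ⟨t, l⟩
    rw [comp_step_inr]
    exact key _ _ _ h

theorem comp_id (f : Matching X Y) : f.comp (id Y) = f := by
  have key : ∀ a t (l : srcLab X Y a ⟶ tgtLab X Y t), f.step a = ⟨t, l⟩ →
      Trace f (id Y) (.inl a) t l := by
    rintro a (t | t) l h
    · exact .exit_left h
    · exact Trace.cross_left' (g := id Y) h (.exit_right (l := 𝟙 _) rfl) (Category.comp_id _)
  apply ext_step
  rintro (a | a)
  · rcases h : f.step (.inl a) with ⟨t, l⟩
    rw [comp_step_inl]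
    exact key _ _ _ h
  · rcases h : f.step (.inr a) with ⟨t, l⟩
    rw [comp_step_inr]
    exact Trace.cross_right' (g := id Y) (k := 𝟙 _) (b := .inr a) rfl (key _ _ _ h)
      (Category.id_comp _)

/-- paths through three matchings -/
inductive Trace₃ (f : Matching X Y) (g : Matching Y Z) (h : Matching Z W) :
    (s : Src X Y ⊕ Src Y Z ⊕ Src Z W) → (t : Tgt X W) →
    (Sum.elim (srcLab X Y) (Sum.elim (srcLab Y Z) (srcLab Z W)) s ⟶ tgtLab X W t) → Prop
  | l_exit {a x l} (e : f.step a = ⟨.inl x, l⟩) : Trace₃ f g h (.inl a) (.inl x) l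
  | l_cross {a y k t l} (e : f.step a = ⟨.inr y, k⟩)
      (r : Trace₃ f g h (.inr (.inl (.inl y))) t l) : Trace₃ f g h (.inl a) t (k ≫ l)
  | m_left {a y k t l} (e : g.step a = ⟨.inl y, k⟩)
      (r : Trace₃ f g h (.inl (.inr y)) t l) : Trace₃ f g h (.inr (.inl a)) t (k ≫ l)
  | m_right {a y k t l} (e : g.step a = ⟨.inr y, k⟩)
      (r : Trace₃ f g h (.inr (.inr (.inl y))) t l) : Trace₃ f g h (.inr (.inl a)) t (k ≫ l)
  | r_exit {a x l} (e : h.step a = ⟨.inr x, l⟩) : Trace₃ f g h (.inr (.inr a)) (.inr x) l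
  | r_cross {a y k t l} (e : h.step a = ⟨.inl y, k⟩)
      (r : Trace₃ f g h (.inr (.inl (.inr y))) t l) : Trace₃ f g h (.inr (.inr a)) t (k ≫ l)

theorem Trace₃.det {f : Matching X Y} {g : Matching Y Z} {h : Matching Z W} {s t l t' l'}
    (h1 : Trace₃ f g h s t l) (h2 : Trace₃ f g h s t' l') :
    (⟨t, l⟩ : Σ t, (Sum.elim (srcLab X Y) (Sum.elim (srcLab Y Z) (srcLab Z W)) s ⟶
      tgtLab X W t)) = ⟨t', l'⟩ := by
  induction h1 with
  | l_exit e | r_exit e =>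
    cases h2
    · next e2 => have := e.symm.trans e2; cases this; rfl
    · next e2 _ _ => have := e.symm.trans e2; cases this
  | l_cross e r ih =>
    cases h2
    · next e2 => have := e.symm.trans e2; cases this
    · next e2 _ r2 => have := e.symm.trans e2; cases this; have := ih r2; cases this; rfl
  | m_left e r ih =>
    cases h2
    · next e2 _ r2 => have := e.symm.trans e2; cases this; have := ih r2; cases this; rfl
    · next e2 _ _ => have := e.symm.trans e2; cases this
  | m_right e r ih =>
    cases h2
    · next e2 _ _ => have := e.symm.trans e2; cases this
    · next e2 _ r2 => have := e.symm.trans e2; cases this; have := ih r2; cases this; rfl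
  | r_cross e r ih =>
    cases h2
    · next e2 => have := e.symm.trans e2; cases this
    · next e2 _ r2 => have := e.symm.trans e2; cases this; have := ih r2; cases this; rfl

theorem Trace.toLeft {f : Matching X Y} {g : Matching Y Z} (h : Matching Z W) {s t l}
    (tr : Trace f g s t l) :
    match s, t, l with
    | .inl a, .inl x, l => Trace₃ f g h (.inl a) (.inl x) l
    | .inr b, .inl x, l => Trace₃ f g h (.inr (.inl b)) (.inl x) l
    | .inl a, .inr z, l => ∀ t' l', Trace₃ f g h (.inr (.inr (.inl z))) t' l' →
        Trace₃ f g h (.inl a) t' (l ≫ l')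
    | .inr b, .inr z, l => ∀ t' l', Trace₃ f g h (.inr (.inr (.inl z))) t' l' →
        Trace₃ f g h (.inr (.inl b)) t' (l ≫ l') := by
  induction tr with
  | exit_left e => exact .l_exit e
  | @cross_left a y k t l e r ih =>
    rcases t with t | t
    · exact .l_cross e ih
    · intro t' l' h'
      have := Trace₃.l_cross e (ih t' l' h')
      exact (Category.assoc k l l').symm ▸ this
  | exit_right e => intro t' l' h'; exact .m_right e h'
  | @cross_right b y k t l e r ih =>
    rcases t with t | t
    · exact .m_left e ih
    · intro t' l' h'
      have := Trace₃.m_left e (ih t' l' h')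
      exact (Category.assoc k l l').symm ▸ this

theorem Trace.toRight (f : Matching X Y) {g : Matching Y Z} {h : Matching Z W} {s t l}
    (tr : Trace g h s t l) :
    match s, t, l with
    | .inl a, .inr x, l => Trace₃ f g h (.inr (.inl a)) (.inr x) l
    | .inr b, .inr x, l => Trace₃ f g h (.inr (.inr b)) (.inr x) l
    | .inl a, .inl z, l => ∀ t' l', Trace₃ f g h (.inl (.inr z)) t' l' →
        Trace₃ f g h (.inr (.inl a)) t' (l ≫ l')
    | .inr b, .inl z, l => ∀ t' l', Trace₃ f g h (.inl (.inr z)) t' l' →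
        Trace₃ f g h (.inr (.inr b)) t' (l ≫ l') := by
  induction tr with
  | exit_left e => intro t' l' h'; exact .m_left e h'
  | @cross_left a y k t l e r ih =>
    rcases t with t | t
    · intro t' l' h'
      have := Trace₃.m_right e (ih t' l' h')
      exact (Category.assoc k l l').symm ▸ this
    · exact .m_right e ih
  | exit_right e => exact .r_exit e
  | @cross_right b y k t l e r ih =>
    rcases t with t | t
    · intro t' l' h'
      have := Trace₃.r_cross e (ih t' l' h')
      exact (Category.assoc k l l').symm ▸ this
    · exact .r_cross e ih

theorem Trace.flattenLeft {f : Matching X Y} {g : Matching Y Z} {h : Matching Z W} {s t l}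
    (tr : Trace (f.comp g) h s t l) :
    match s, l with
    | .inl (.inl p), l => Trace₃ f g h (.inl (.inl p)) t l
    | .inl (.inr z), l => Trace₃ f g h (.inr (.inl (.inr z))) t l
    | .inr b, l => Trace₃ f g h (.inr (.inr b)) t l := by
  induction tr with
  | @exit_left a x l e =>
    rcases a with a | a
    · exact (comp_step_inl.1 e).toLeft h
    · exact (comp_step_inr.1 e).toLeft h
  | @cross_left a x k t l e r ih =>
    rcases a with a | a
    · exact (comp_step_inl.1 e).toLeft h _ _ ih
    · exact (comp_step_inr.1 e).toLeft h _ _ ih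
  | exit_right e => exact .r_exit e
  | cross_right e r ih => exact .r_cross e ih

theorem Trace.flattenRight {f : Matching X Y} {g : Matching Y Z} {h : Matching Z W} {s t l}
    (tr : Trace f (g.comp h) s t l) :
    match s, l with
    | .inl a, l => Trace₃ f g h (.inl a) t l
    | .inr (.inl y), l => Trace₃ f g h (.inr (.inl (.inl y))) t l
    | .inr (.inr w), l => Trace₃ f g h (.inr (.inr (.inr w))) t l := by
  induction tr with
  | exit_left e => exact .l_exit e
  | cross_left e r ih => exact .l_cross e ih
  | @exit_right a x l e =>
    rcases a with a | a
    · exact (comp_step_inl.1 e).toRight f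
    · exact (comp_step_inr.1 e).toRight f
  | @cross_right a x k t l e r ih =>
    rcases a with a | a
    · exact (comp_step_inl.1 e).toRight f _ _ ih
    · exact (comp_step_inr.1 e).toRight f _ _ ih

theorem assoc (f : Matching X Y) (g : Matching Y Z) (h : Matching Z W) :
    (f.comp g).comp h = f.comp (g.comp h) := by
  apply ext_step
  rintro (a | a)
  · rcases h1 : ((f.comp g).comp h).step (.inl a) with ⟨t, l⟩
    rcases h2 : (f.comp (g.comp h)).step (.inl a) with ⟨t', l'⟩
    exact (comp_step_inl.1 h1).flattenLeft.det (comp_step_inl.1 h2).flattenRight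
  · rcases h1 : ((f.comp g).comp h).step (.inr a) with ⟨t, l⟩
    rcases h2 : (f.comp (g.comp h)).step (.inr a) with ⟨t', l'⟩
    exact (comp_step_inr.1 h1).flattenLeft.det (comp_step_inr.1 h2).flattenRight

end Matching

/-- Signed sets and labelled graphs. -/
noncomputable instance : Category (SignedSet C) where
  Hom := Matching
  id := Matching.id
  comp := Matching.comp
  id_comp := Matching.id_comp
  comp_id := Matching.comp_id
  assoc := Matching.assoc

namespace Matching
variable {X Y Z W : SignedSet C}

theorem step_of_mate_eq {f : Matching X Y} {a b} (h : f.mate a = b) : ∃ l, f.step a = ⟨b, l⟩ := by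
  subst h; exact ⟨_, rfl⟩

/-- An end together with a morphism into its label. -/
abbrev State {ι : Type} (lab : ι → C) (A : C) : Type v := Σ i, (A ⟶ lab i)

def State.pre {ι : Type} {lab : ι → C} {A B : C} (k : A ⟶ B) (s : State lab B) : State lab A :=
  ⟨s.1, k ≫ s.2⟩

/-- push a label into an end along an edge -/
def push (f : Matching X Y) {A : C} (s : State (srcLab X Y) A) :
    State (tgtLab X Y) A := ⟨f.mate s.1, s.2 ≫ f.label s.1⟩

theorem push_eq {f : Matching X Y} {A : C} {a b l} (h : f.step a = ⟨b, l⟩) (k : A ⟶ srcLab X Y a) :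
    f.push ⟨a, k⟩ = ⟨b, k ≫ l⟩ := by
  cases h; rfl

/-- the vertices of all paths through a composite: the positions and the outer targets -/
abbrev Vertex (X Y Z : SignedSet C) : Type := (Src X Y ⊕ Src Y Z) ⊕ Tgt X Z

abbrev vertexLab (X Y Z : SignedSet C) : Vertex X Y Z → C := Sum.elim (midLab X Y Z) (tgtLab X Z)

def exitLeft {A : C} : State (tgtLab X Y) A → State (vertexLab X Y Z) A
  | ⟨.inl x, k⟩ => ⟨.inr (.inl x), k⟩
  | ⟨.inr y, k⟩ => ⟨.inl (.inr (.inl y)), k⟩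

def exitRight {A : C} : State (tgtLab Y Z) A → State (vertexLab X Y Z) A
  | ⟨.inl y, k⟩ => ⟨.inl (.inl (.inr y)), k⟩
  | ⟨.inr z, k⟩ => ⟨.inr (.inr z), k⟩

inductive Next (f : Matching X Y) (g : Matching Y Z) {A : C} :
    State (vertexLab X Y Z) A → State (vertexLab X Y Z) A → Prop
  | left {a k τ} (h : f.push ⟨a, k⟩ = τ) : Next f g ⟨.inl (.inl a), k⟩ (exitLeft τ)
  | right {b k τ} (h : g.push ⟨b, k⟩ = τ) : Next f g ⟨.inl (.inr b), k⟩ (exitRight τ)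

abbrev Run (f : Matching X Y) (g : Matching Y Z) {A : C} :
    State (vertexLab X Y Z) A → State (vertexLab X Y Z) A → Prop :=
  Relation.ReflTransGen (Next f g)

theorem Trace.run {f : Matching X Y} {g : Matching Y Z} {s t l} (h : Trace f g s t l) {A : C}
    (k : A ⟶ midLab X Y Z s) : Run f g ⟨.inl s, k⟩ ⟨.inr t, k ≫ l⟩ := by
  induction h with
  | exit_left h => exact .single (.left (push_eq h k))
  | @cross_left a y k' t l h r ih =>
    have h2 := ih (k ≫ k')
    exact .head (.left (push_eq h k)) (Category.assoc k k' l ▸ h2)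
  | exit_right h => exact .single (.right (push_eq h k))
  | @cross_right a y k' t l h r ih =>
    have h2 := ih (k ≫ k')
    exact .head (.right (push_eq h k)) (Category.assoc k k' l ▸ h2)

theorem Run.trace {f : Matching X Y} {g : Matching Y Z} {A : C} {s t} {k : A ⟶ midLab X Y Z s} {m}
    (h : Run f g ⟨.inl s, k⟩ ⟨.inr t, m⟩) : ∃ l, Trace f g s t l ∧ m = k ≫ l := by
  have key : ∀ v w : State (vertexLab X Y Z) A, Run f g v w → ∀ t m, w = ⟨.inr t, m⟩ →
      match v with
      | ⟨.inl s, k⟩ => ∃ l, Trace f g s t l ∧ m = k ≫ l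
      | ⟨.inr t', k⟩ => (⟨t', k⟩ : State (tgtLab X Z) A) = ⟨t, m⟩ := by
    intro v w h t m e
    subst e
    induction h using Relation.ReflTransGen.head_induction_on with
    | refl => rfl
    | head h1 h2 ih =>
      cases h1 with
      | @left a k τ h' =>
        rcases h : f.step a with ⟨x | y, l⟩
        · obtain rfl := (push_eq h k).symm.trans h'
          cases ih; exact ⟨_, .exit_left h, rfl⟩
        · obtain rfl := (push_eq h k).symm.trans h'
          obtain ⟨l', h', rfl⟩ := ih
          exact ⟨_, .cross_left h h', Category.assoc _ _ _⟩
      | @right a k τ h' =>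
        rcases h : g.step a with ⟨x | y, l⟩
        · obtain rfl := (push_eq h k).symm.trans h'
          obtain ⟨l', h', rfl⟩ := ih
          exact ⟨_, .cross_right h h', Category.assoc _ _ _⟩
        · obtain rfl := (push_eq h k).symm.trans h'
          cases ih; exact ⟨_, .exit_right h, rfl⟩
  exact key _ _ h t m rfl

def startState {A : C} : State (srcLab X Z) A → State (vertexLab X Y Z) A
  | ⟨.inl p, k⟩ => ⟨.inl (.inl (.inl p)), k⟩
  | ⟨.inr n, k⟩ => ⟨.inl (.inr (.inr n)), k⟩

theorem push_comp_of_run {f : Matching X Y} {g : Matching Y Z} {A : C} {σ : State (srcLab X Z) A}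
    {τ : State (tgtLab X Z) A} (h : Run f g (startState σ) ⟨.inr τ.1, τ.2⟩) :
    (f.comp g).push σ = τ := by
  obtain ⟨t, m⟩ := τ
  obtain ⟨s | s, k⟩ := σ
  · obtain ⟨l, h', e⟩ := Run.trace h
    rw [push_eq (comp_step_inl.2 h')]; exact Sigma.ext rfl (heq_of_eq e.symm)
  · obtain ⟨l, h', e⟩ := Run.trace h
    rw [push_eq (comp_step_inr.2 h')]; exact Sigma.ext rfl (heq_of_eq e.symm)

theorem run_of_push_comp {f : Matching X Y} {g : Matching Y Z} {A : C} (σ : State (srcLab X Z) A) :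
    Run f g (startState σ) ⟨.inr ((f.comp g).push σ).1, ((f.comp g).push σ).2⟩ := by
  obtain ⟨s | s, k⟩ := σ
  · exact (comp_step_inl.1 rfl).run k
  · exact (comp_step_inr.1 rfl).run k

theorem ext_push {f g : Matching X Y} (h : ∀ a, f.push ⟨a, 𝟙 _⟩ = g.push ⟨a, 𝟙 _⟩) : f = g := by
  apply ext_step
  intro a
  have := h a
  rw [push_eq (l := (f.step a).2) rfl, push_eq (l := (g.step a).2) rfl] at this
  simpa using this

/-- the pair of edge end and label at the other end -/
noncomputable def back (f : Matching X Y) (b : Tgt X Y) :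
    Σ a : Src X Y, (srcLab X Y a ⟶ tgtLab X Y b) :=
  ⟨(f.step_surj b).choose, (f.step_surj b).choose_spec.choose⟩

theorem step_back (f : Matching X Y) (b : Tgt X Y) : f.step (f.back b).1 = ⟨b, (f.back b).2⟩ :=
  (f.step_surj b).choose_spec.choose_spec

theorem back_eq {f : Matching X Y} {a b l} (h : f.step a = ⟨b, l⟩) : f.back b = ⟨a, l⟩ := by
  have h' := f.step_back b
  rcases hb : f.back b with ⟨a', l'⟩
  rw [hb] at h'
  obtain rfl := f.step_inj h h'
  have := h.symm.trans h'
  cases this; rfl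

end Matching

section Bind
open Matching
variable {D : Type u'} [Category.{v'} D]

/-- Substitution of signed sets into a signed set: a variable labelled by `c` becomes a copy of the
variables `H c`, with reversed signs if the variable is negative. -/
def SignedSet.bind (X : SignedSet C) (H : C ⥤ SignedSet D) : SignedSet D where
  P := (Σ p : X.P, (H.obj (X.lP p)).P) ⊕ (Σ n : X.N, (H.obj (X.lN n)).N)
  N := (Σ p : X.P, (H.obj (X.lP p)).N) ⊕ (Σ n : X.N, (H.obj (X.lN n)).P)
  lP := Sum.elim (fun s => (H.obj _).lP s.2) (fun s => (H.obj _).lN s.2)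
  lN := Sum.elim (fun s => (H.obj _).lN s.2) (fun s => (H.obj _).lP s.2)

variable {X Y Z : SignedSet C} (H : C ⥤ SignedSet D)

namespace Matching

def placeSrc {A : D} : (a : Src X Y) → (b : Tgt X Y) →
    State (srcLab (H.obj (srcLab X Y a)) (H.obj (tgtLab X Y b))) A →
    State (srcLab (X.bind H) (Y.bind H)) A
  | .inl p, _, ⟨.inl q, k⟩ => ⟨.inl (.inl ⟨p, q⟩), k⟩
  | .inr n, _, ⟨.inl q, k⟩ => ⟨.inr (.inr ⟨n, q⟩), k⟩
  | _, .inl n, ⟨.inr q, k⟩ => ⟨.inl (.inr ⟨n, q⟩), k⟩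
  | _, .inr p, ⟨.inr q, k⟩ => ⟨.inr (.inl ⟨p, q⟩), k⟩

def placeTgt {A : D} : (a : Src X Y) → (b : Tgt X Y) →
    State (tgtLab (H.obj (srcLab X Y a)) (H.obj (tgtLab X Y b))) A →
    State (tgtLab (X.bind H) (Y.bind H)) A
  | .inl p, _, ⟨.inl q, k⟩ => ⟨.inl (.inl ⟨p, q⟩), k⟩
  | .inr n, _, ⟨.inl q, k⟩ => ⟨.inr (.inr ⟨n, q⟩), k⟩
  | _, .inl n, ⟨.inr q, k⟩ => ⟨.inl (.inr ⟨n, q⟩), k⟩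
  | _, .inr p, ⟨.inr q, k⟩ => ⟨.inr (.inl ⟨p, q⟩), k⟩

noncomputable def bindStep (f : Matching X Y) :
    ∀ s : Src (X.bind H) (Y.bind H), State (tgtLab (X.bind H) (Y.bind H)) (srcLab (X.bind H) (Y.bind H) s)
  | .inl (.inl ⟨p, q⟩) => placeTgt H _ _ (Matching.step (H.map (f.step (.inl p)).2) (.inl q))
  | .inr (.inr ⟨n, q⟩) => placeTgt H _ _ (Matching.step (H.map (f.step (.inr n)).2) (.inl q))
  | .inl (.inr ⟨n, q⟩) => placeTgt H _ _ (Matching.step (H.map (f.back (.inl n)).2) (.inr q))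
  | .inr (.inl ⟨p, q⟩) => placeTgt H _ _ (Matching.step (H.map (f.back (.inr p)).2) (.inr q))

theorem bindStep_place {f : Matching X Y} {a b g} (h : f.step a = ⟨b, g⟩) {A : D}
    (ρ : State (srcLab (H.obj (srcLab X Y a)) (H.obj (tgtLab X Y b))) A) :
    State.pre (placeSrc H a b ρ).2 (bindStep H f (placeSrc H a b ρ).1) =
      placeTgt H a b (Matching.push (H.map g) ρ) := by
  have nat : ∀ (a : Src X Y) (b : Tgt X Y) {A' B : D} (k : A' ⟶ B)
      (τ : State (tgtLab (H.obj (srcLab X Y a)) (H.obj (tgtLab X Y b))) B),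
      State.pre k (placeTgt H a b τ) = placeTgt H a b (State.pre k τ) := by
    rintro (a | a) (b | b) A' B k ⟨r | r, l⟩ <;> rfl
  obtain ⟨r | r, k⟩ := ρ
  · rcases a with p | n
    · change State.pre k
        (placeTgt H _ _ (Matching.step (H.map (f.step (.inl p)).2) (.inl r))) = _
      rw [h, nat]; rfl
    · change State.pre k
        (placeTgt H _ _ (Matching.step (H.map (f.step (.inr n)).2) (.inl r))) = _
      rw [h, nat]; rfl
  · rcases b with n | p
    · have e : placeSrc H a (.inl n) ⟨.inr r, k⟩ = ⟨.inl (.inr ⟨n, r⟩), k⟩ := by cases a <;> rfl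
      rw [e]
      change State.pre k
        (placeTgt H _ _ (Matching.step (H.map (f.back (.inl n)).2) (.inr r))) = _
      rw [back_eq h, nat]; rfl
    · have e : placeSrc H a (.inr p) ⟨.inr r, k⟩ = ⟨.inr (.inl ⟨p, r⟩), k⟩ := by cases a <;> rfl
      rw [e]
      change State.pre k
        (placeTgt H _ _ (Matching.step (H.map (f.back (.inr p)).2) (.inr r))) = _
      rw [back_eq h, nat]; rfl

theorem exists_placeSrc (f : Matching X Y) (s : Src (X.bind H) (Y.bind H)) :
    ∃ a b g r, f.step a = ⟨b, g⟩ ∧ placeSrc H a b r = ⟨s, 𝟙 _⟩ := by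
  rcases s with (⟨p, q⟩ | ⟨n, q⟩) | (⟨p, q⟩ | ⟨n, q⟩)
  · exact ⟨.inl p, _, _, ⟨.inl q, 𝟙 _⟩, rfl, rfl⟩
  · refine ⟨_, .inl n, _, ⟨.inr q, 𝟙 _⟩, f.step_back _, ?_⟩
    rcases (f.back (.inl n)).1 with _ | _ <;> rfl
  · refine ⟨_, .inr p, _, ⟨.inr q, 𝟙 _⟩, f.step_back _, ?_⟩
    rcases (f.back (.inr p)).1 with _ | _ <;> rfl
  · exact ⟨.inr n, _, _, ⟨.inl q, 𝟙 _⟩, rfl, rfl⟩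

theorem exists_placeTgt (f : Matching X Y) (t : Tgt (X.bind H) (Y.bind H)) :
    ∃ a b g r, f.step a = ⟨b, g⟩ ∧ ∀ {A : D} (k : A ⟶ tgtLab _ _ r),
      (placeTgt H a b ⟨r, k⟩).1 = t := by
  rcases t with (⟨p, q⟩ | ⟨n, q⟩) | (⟨p, q⟩ | ⟨n, q⟩)
  · exact ⟨.inl p, _, _, .inl q, rfl, fun _ => rfl⟩
  · refine ⟨_, .inl n, _, .inr q, f.step_back _, ?_⟩
    intro A k; rcases (f.back (.inl n)).1 with _ | _ <;> rfl
  · refine ⟨_, .inr p, _, .inr q, f.step_back _, ?_⟩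
    intro A k; rcases (f.back (.inr p)).1 with _ | _ <;> rfl
  · exact ⟨.inr n, _, _, .inl q, rfl, fun _ => rfl⟩

theorem placeTgt_inj {f : Matching X Y} {a b g a' b' g' A A'} (h : f.step a = ⟨b, g⟩)
    (h' : f.step a' = ⟨b', g'⟩) (r : Σ r, (A ⟶ tgtLab _ _ r)) (r' : Σ r, (A' ⟶ tgtLab _ _ r))
    (e : (placeTgt H a b r).1 = (placeTgt H a' b' r').1) : a = a' ∧ b = b' ∧ HEq r.1 r'.1 := by
  have hab : a = a' ∨ b = b' := by
    obtain ⟨r | r, k⟩ := r <;> obtain ⟨r' | r', k'⟩ := r' <;> rcases a with a | a <;>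
      rcases a' with a' | a' <;> rcases b with b | b <;> rcases b' with b' | b' <;>
      first
      | (left; cases e; rfl) | (right; cases e; rfl) | cases e
  have : a = a' ∧ b = b' := by
    rcases hab with rfl | rfl
    · have := h.symm.trans h'; cases this; exact ⟨rfl, rfl⟩
    · exact ⟨f.step_inj h h', rfl⟩
  obtain ⟨rfl, rfl⟩ := this
  refine ⟨rfl, rfl, ?_⟩
  obtain ⟨r | r, k⟩ := r <;> obtain ⟨r' | r', k'⟩ := r' <;> rcases a with a | a <;>
    rcases b with b | b <;> first | (cases e; rfl) | cases e

/-- Each edge with label `g` is replaced by the graph `H g`. -/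
noncomputable def bind (f : Matching X Y) : Matching (X.bind H) (Y.bind H) :=
  ofStep (bindStep H f) <| by
    constructor
    · intro s s' e
      obtain ⟨a, b, g, r, h1, h2⟩ := exists_placeSrc H f s
      obtain ⟨a', b', g', r', h1', h2'⟩ := exists_placeSrc H f s'
      have e1 := congrArg Sigma.fst (bindStep_place H h1 r)
      have e2 := congrArg Sigma.fst (bindStep_place H h1' r')
      rw [h2] at e1
      rw [h2'] at e2
      have e3 := e1.symm.trans (e.trans e2)
      obtain ⟨rfl, rfl, h⟩ := placeTgt_inj H h1 h1' _ _ e3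
      have := h1.symm.trans h1'; cases this
      have h4 : r.1 = r'.1 := (Matching.bij (H.map g)).1 (eq_of_heq h)
      have h5 : s = (placeSrc H a b r).1 := by rw [h2]
      have h6 : s' = (placeSrc H a b r').1 := by rw [h2']
      rw [h5, h6]
      obtain ⟨r, k⟩ := r
      obtain ⟨r', k'⟩ := r'
      cases h4
      rcases r with r | r <;> rcases a with a | a <;> rcases b with b | b <;> rfl
    · intro t
      obtain ⟨a, b, g, r, h1, h2⟩ := exists_placeTgt H f t
      obtain ⟨s, hs⟩ := (Matching.bij (H.map g)).2 r
      have := congrArg Sigma.fst (bindStep_place H h1 ⟨s, 𝟙 _⟩)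
      refine ⟨_, this.trans ?_⟩
      rw [← h2 (𝟙 _ ≫ Matching.label (H.map g) s ≫ eqToHom (by rw [hs]))]
      cases hs
      simp [push]

theorem push_bind {f : Matching X Y} {a b g} (h : f.step a = ⟨b, g⟩) {A : D}
    (ρ : State (srcLab (H.obj (srcLab X Y a)) (H.obj (tgtLab X Y b))) A) :
    (f.bind H).push (placeSrc H a b ρ) = placeTgt H a b (Matching.push (H.map g) ρ) :=
  bindStep_place H h ρ

theorem bind_id : (Matching.id X).bind H = Matching.id (X.bind H) := by
  apply ext_push
  intro s
  obtain ⟨a, b, g, r, h1, h2⟩ := exists_placeSrc H (Matching.id X) s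
  have h3 := push_bind H h1 r
  have h4 : (Matching.id (X.bind H)).push (placeSrc H a b r) =
      placeTgt H a b (Matching.push (H.map g) r) := by
    rcases a with a | a
    · cases h1
      have e : H.map (𝟙 (X.lP a)) = Matching.id _ := H.map_id _
      change _ = placeTgt (X := X) (Y := X) H (.inl a) (.inr a) (Matching.push (H.map (𝟙 (X.lP a))) r)
      rw [e]; rcases r with ⟨r | r, k⟩ <;> rfl
    · cases h1
      have e : H.map (𝟙 (X.lN a)) = Matching.id _ := H.map_id _
      change _ = placeTgt (X := X) (Y := X) H (.inr a) (.inl a) (Matching.push (H.map (𝟙 (X.lN a))) r)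
      rw [e]; rcases r with ⟨r | r, k⟩ <;> rfl
  rw [h2] at h3 h4
  exact h3.trans h4.symm

section
variable {A : D}

/-- a variable of the substituted set at a vertex, of the same sign -/
def vertexP : (v : Vertex X Y Z) → State (H.obj (vertexLab X Y Z v)).lP A →
    State (vertexLab (X.bind H) (Y.bind H) (Z.bind H)) A
  | .inl (.inl (.inl p)), ⟨q, k⟩ => ⟨.inl (.inl (.inl (.inl ⟨p, q⟩))), k⟩
  | .inl (.inl (.inr n)), ⟨q, k⟩ => ⟨.inl (.inl (.inr (.inr ⟨n, q⟩))), k⟩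
  | .inl (.inr (.inl p)), ⟨q, k⟩ => ⟨.inl (.inr (.inl (.inl ⟨p, q⟩))), k⟩
  | .inl (.inr (.inr n)), ⟨q, k⟩ => ⟨.inl (.inr (.inr (.inr ⟨n, q⟩))), k⟩
  | .inr (.inl n), ⟨q, k⟩ => ⟨.inr (.inl (.inr ⟨n, q⟩)), k⟩
  | .inr (.inr p), ⟨q, k⟩ => ⟨.inr (.inr (.inl ⟨p, q⟩)), k⟩

/-- a variable of the substituted set at a vertex, of the opposite sign -/
def vertexN : (v : Vertex X Y Z) → State (H.obj (vertexLab X Y Z v)).lN A →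
    State (vertexLab (X.bind H) (Y.bind H) (Z.bind H)) A
  | .inl (.inl (.inl p)), ⟨q, k⟩ => ⟨.inr (.inl (.inl ⟨p, q⟩)), k⟩
  | .inl (.inl (.inr n)), ⟨q, k⟩ => ⟨.inl (.inr (.inl (.inr ⟨n, q⟩))), k⟩
  | .inl (.inr (.inl p)), ⟨q, k⟩ => ⟨.inl (.inl (.inr (.inl ⟨p, q⟩))), k⟩
  | .inl (.inr (.inr n)), ⟨q, k⟩ => ⟨.inr (.inr (.inr ⟨n, q⟩)), k⟩
  | .inr (.inl n), ⟨q, k⟩ => ⟨.inl (.inl (.inl (.inr ⟨n, q⟩))), k⟩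
  | .inr (.inr p), ⟨q, k⟩ => ⟨.inl (.inr (.inr (.inl ⟨p, q⟩))), k⟩

def edgeSrc (v w : Vertex X Y Z) :
    State (srcLab (H.obj (vertexLab X Y Z v)) (H.obj (vertexLab X Y Z w))) A →
    State (vertexLab (X.bind H) (Y.bind H) (Z.bind H)) A
  | ⟨.inl q, k⟩ => vertexP H v ⟨q, k⟩
  | ⟨.inr q, k⟩ => vertexN H w ⟨q, k⟩

def edgeTgt (v w : Vertex X Y Z) :
    State (tgtLab (H.obj (vertexLab X Y Z v)) (H.obj (vertexLab X Y Z w))) A →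
    State (vertexLab (X.bind H) (Y.bind H) (Z.bind H)) A
  | ⟨.inl q, k⟩ => vertexN H v ⟨q, k⟩
  | ⟨.inr q, k⟩ => vertexP H w ⟨q, k⟩

theorem next_left (f : Matching X Y) (g : Matching Y Z) {a : Src X Y} {b l}
    (h : f.step a = ⟨b, l⟩) {w l'}
    (e : exitLeft (Z := Z) ⟨b, l⟩ = ⟨w, l'⟩) (ρ) :
    Next (f.bind H) (g.bind H) (A := A) (edgeSrc H (.inl (.inl a)) w ρ)
      (edgeTgt H (.inl (.inl a)) w (Matching.push (H.map l') ρ)) := by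
  rcases b with b | b
  · cases e
    have h2 := push_bind H h ρ
    have e : ∀ τ, edgeTgt (X := X) (Y := Y) (Z := Z) (A := A) H (.inl (.inl a)) (.inr (.inl b)) τ =
        exitLeft (placeTgt H a (.inl b) τ) := by
      rintro ⟨q | q, k'⟩ <;> rcases a with a | a <;> rfl
    · refine (congrArg _ ((e _).trans (congrArg _ h2.symm))).mpr ?_
      rcases ρ with ⟨r | r, k⟩ <;> rcases a with a | a <;> exact .left rfl
  · cases e
    have h2 := push_bind H h ρ
    have e : ∀ τ, edgeTgt (X := X) (Y := Y) (Z := Z) (A := A) H (.inl (.inl a)) (.inl (.inr (.inl b))) τ =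
        exitLeft (placeTgt H a (.inr b) τ) := by
      rintro ⟨q | q, k'⟩ <;> rcases a with a | a <;> rfl
    · refine (congrArg _ ((e _).trans (congrArg _ h2.symm))).mpr ?_
      rcases ρ with ⟨r | r, k⟩ <;> rcases a with a | a <;> exact .left rfl

theorem next_right (f : Matching X Y) (g : Matching Y Z) {a : Src Y Z} {b l}
    (h : g.step a = ⟨b, l⟩) {w l'}
    (e : exitRight (X := X) ⟨b, l⟩ = ⟨w, l'⟩) (ρ) :
    Next (f.bind H) (g.bind H) (A := A) (edgeSrc H (.inl (.inr a)) w ρ)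
      (edgeTgt H (.inl (.inr a)) w (Matching.push (H.map l') ρ)) := by
  rcases b with b | b
  · cases e
    have h2 := push_bind H h ρ
    have e : ∀ τ, edgeTgt (X := X) (Y := Y) (Z := Z) (A := A) H (.inl (.inr a)) (.inl (.inl (.inr b))) τ =
        exitRight (placeTgt H a (.inl b) τ) := by
      rintro ⟨q | q, k'⟩ <;> rcases a with a | a <;> rfl
    · refine (congrArg _ ((e _).trans (congrArg _ h2.symm))).mpr ?_
      rcases ρ with ⟨r | r, k⟩ <;> rcases a with a | a <;> exact .right rfl
  · cases e
    have h2 := push_bind H h ρ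
    have e : ∀ τ, edgeTgt (X := X) (Y := Y) (Z := Z) (A := A) H (.inl (.inr a)) (.inr (.inr b)) τ =
        exitRight (placeTgt H a (.inr b) τ) := by
      rintro ⟨q | q, k'⟩ <;> rcases a with a | a <;> rfl
    · refine (congrArg _ ((e _).trans (congrArg _ h2.symm))).mpr ?_
      rcases ρ with ⟨r | r, k⟩ <;> rcases a with a | a <;> exact .right rfl

/-- vertices of an inner composite, placed along a path `v, v', t` -/
def inTriangle (v v' t : Vertex X Y Z) :
    State (vertexLab (H.obj (vertexLab X Y Z v)) (H.obj (vertexLab X Y Z v'))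
      (H.obj (vertexLab X Y Z t))) A → State (vertexLab (X.bind H) (Y.bind H) (Z.bind H)) A
  | ⟨.inl (.inl s), k⟩ => edgeSrc H v v' ⟨s, k⟩
  | ⟨.inl (.inr s), k⟩ => edgeSrc H v' t ⟨s, k⟩
  | ⟨.inr s, k⟩ => edgeTgt H v t ⟨s, k⟩

theorem Run.triangle {f : Matching X Y} {g : Matching Y Z} {v v' t : Vertex X Y Z}
    {k : vertexLab X Y Z v ⟶ vertexLab X Y Z v'} {l : vertexLab X Y Z v' ⟶ vertexLab X Y Z t}
    (h1 : ∀ ρ, Run (f.bind H) (g.bind H) (A := A) (edgeSrc H v v' ρ)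
      (edgeTgt H v v' (Matching.push (H.map k) ρ)))
    (h2 : ∀ ρ, Run (f.bind H) (g.bind H) (A := A) (edgeSrc H v' t ρ)
      (edgeTgt H v' t (Matching.push (H.map l) ρ))) (ρ) :
    Run (f.bind H) (g.bind H) (A := A) (edgeSrc H v t ρ)
      (edgeTgt H v t (Matching.push (H.map (k ≫ l)) ρ)) := by
  have key : ∀ σ τ, Next (H.map k : Matching _ _) (H.map l : Matching _ _) σ τ →
      Run (f.bind H) (g.bind H) (A := A) (inTriangle H v v' t σ) (inTriangle H v v' t τ) := by
    intro σ τ h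
    cases h with
    | @left a k' τ h =>
      subst h
      have := h1 ⟨a, k'⟩
      generalize Matching.push (H.map k) ⟨a, k'⟩ = τ at this
      rcases τ with ⟨q | q, k''⟩ <;> exact this
    | @right a k' τ h =>
      subst h
      have := h2 ⟨a, k'⟩
      generalize Matching.push (H.map l) ⟨a, k'⟩ = τ at this
      rcases τ with ⟨q | q, k''⟩ <;> exact this
  have hm : H.map (k ≫ l) = Matching.comp (H.map k) (H.map l) := H.map_comp k l
  rw [hm]
  rcases ρ with ⟨q | q, m⟩
  · rcases hs : (Matching.comp (H.map k) (H.map l)).step (.inl q) with ⟨t', l'⟩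
    have hr := (comp_step_inl.1 hs).run m
    have := Relation.ReflTransGen.lift' (inTriangle H v v' t) key _ _ hr
    rw [push_eq hs]
    exact this
  · rcases hs : (Matching.comp (H.map k) (H.map l)).step (.inr q) with ⟨t', l'⟩
    have hr := (comp_step_inr.1 hs).run m
    have := Relation.ReflTransGen.lift' (inTriangle H v v' t) key _ _ hr
    rw [push_eq hs]
    exact this

theorem Trace.bind {f : Matching X Y} {g : Matching Y Z} {s t l} (h : Trace f g s t l) (ρ) :
    Run (f.bind H) (g.bind H) (A := A) (edgeSrc H (.inl s) (.inr t) ρ)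
      (edgeTgt H (.inl s) (.inr t) (Matching.push (H.map l) ρ)) := by
  induction h with
  | exit_left h => exact .single (next_left H f g h rfl ρ)
  | cross_left h r ih =>
    exact Run.triangle H (v' := .inl (.inr (.inl _))) (fun ρ => .single (next_left H f g h rfl ρ)) ih ρ
  | exit_right h => exact .single (next_right H f g h rfl ρ)
  | cross_right h r ih =>
    exact Run.triangle H (v' := .inl (.inl (.inr _))) (fun ρ => .single (next_right H f g h rfl ρ)) ih ρ

end

theorem bind_comp (f : Matching X Y) (g : Matching Y Z) :
    (f.comp g).bind H = (f.bind H).comp (g.bind H) := by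
  apply ext_push
  intro s
  obtain ⟨a, b, l, r, h1, h2⟩ := exists_placeSrc H (f.comp g) s
  rw [← h2, push_bind H h1]
  symm
  apply push_comp_of_run
  rcases a with a | a
  · have hr := (comp_step_inl.1 h1).bind H r
    have e : ∀ {A} τ, edgeTgt (X := X) (Y := Y) (Z := Z) (A := A) H (.inl (.inl (.inl a))) (.inr b) τ =
        ⟨.inr (placeTgt (X := X) (Y := Z) H (.inl a) b τ).1, (placeTgt H (.inl a) b τ).2⟩ := by
      rintro A ⟨q | q, k'⟩ <;> rcases b with b | b <;> rfl
    have hr' := (congrArg (Run (f.bind H) (g.bind H) _) (e (Matching.push (H.map l) r))).mp hr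
    rcases r with ⟨r | r, k⟩ <;> rcases b with b | b <;> exact hr'
  · have hr := (comp_step_inr.1 h1).bind H r
    have e : ∀ {A} τ, edgeTgt (X := X) (Y := Y) (Z := Z) (A := A) H (.inl (.inr (.inr a))) (.inr b) τ =
        ⟨.inr (placeTgt (X := X) (Y := Z) H (.inr a) b τ).1, (placeTgt H (.inr a) b τ).2⟩ := by
      rintro A ⟨q | q, k'⟩ <;> rcases b with b | b <;> rfl
    have hr' := (congrArg (Run (f.bind H) (g.bind H) _) (e (Matching.push (H.map l) r))).mp hr
    rcases r with ⟨r | r, k⟩ <;> rcases b with b | b <;> exact hr'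

end Matching
end Bind
end KM

namespace KM
open SignedSet
variable {C : Type u} [Category.{v} C]

namespace SignedSet

/-- The variables of a tensor product. -/
def sum (X Y : SignedSet C) : SignedSet C where
  P := X.P ⊕ Y.P
  N := X.N ⊕ Y.N
  lP := Sum.elim X.lP Y.lP
  lN := Sum.elim X.lN Y.lN

/-- The variables of an internal hom: those of the first argument change sign. -/
def ihom (X Y : SignedSet C) : SignedSet C where
  P := X.N ⊕ Y.P
  N := X.P ⊕ Y.N
  lP := Sum.elim X.lN Y.lP
  lN := Sum.elim X.lP Y.lN

/-- The variables of the unit: none. -/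
def empty : SignedSet C where
  P := Empty
  N := Empty
  lP := Empty.elim
  lN := Empty.elim

/-- One positive variable. -/
def single (A : C) : SignedSet C where
  P := Unit
  N := Empty
  lP := fun _ => A
  lN := Empty.elim

end SignedSet

namespace Matching
variable {X Y Z W X' Y' : SignedSet C}

/-- A matching from its edges and an inverse of its mate function. -/
def ofInv (s : ∀ a : Src X Y, State (tgtLab X Y) (srcLab X Y a)) (inv : Tgt X Y → Src X Y)
    (h : ∀ a, inv (s a).1 = a) (h' : ∀ b, (s (inv b)).1 = b) : Matching X Y :=
  ofStep s ⟨fun a b e => by rw [← h a, ← h b]; exact congrArg inv e, fun b => ⟨inv b, h' b⟩⟩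

def sumLeft {A : C} : State (tgtLab X Y) A → State (tgtLab (X.sum X') (Y.sum Y')) A
  | ⟨.inl x, k⟩ => ⟨.inl (.inl x), k⟩
  | ⟨.inr y, k⟩ => ⟨.inr (.inl y), k⟩

def sumRight {A : C} : State (tgtLab X' Y') A → State (tgtLab (X.sum X') (Y.sum Y')) A
  | ⟨.inl x, k⟩ => ⟨.inl (.inr x), k⟩
  | ⟨.inr y, k⟩ => ⟨.inr (.inr y), k⟩

/-- The tensor product of graphs: disjoint union. -/
def tensor (f : Matching X Y) (g : Matching X' Y') : Matching (X.sum X') (Y.sum Y') :=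
  ofStep (fun
    | .inl (.inl p) => sumLeft (f.step (.inl p))
    | .inl (.inr p) => sumRight (g.step (.inl p))
    | .inr (.inl n) => sumLeft (f.step (.inr n))
    | .inr (.inr n) => sumRight (g.step (.inr n))) <| by
    have e := ((Equiv.sumSumSumComm X.N Y.P X'.N Y'.P).bijective.comp
      (f.bij.sumMap g.bij)).comp (Equiv.sumSumSumComm X.P X'.P Y.N Y'.N).bijective
    refine (congrArg Function.Bijective (?_ : _ = _)).mp e
    funext a
    symm
    rcases a with (a | a) | (a | a)
    · change (sumLeft (f.step (.inl a))).1 = Equiv.sumSumSumComm _ _ _ _ (.inl (f.mate (.inl a)))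
      rcases h : f.step (.inl a) with ⟨b | b, l⟩ <;>
        rw [show f.mate (.inl a) = _ from congrArg Sigma.fst h] <;> rfl
    · change (sumRight (g.step (.inl a))).1 = Equiv.sumSumSumComm _ _ _ _ (.inr (g.mate (.inl a)))
      rcases h : g.step (.inl a) with ⟨b | b, l⟩ <;>
        rw [show g.mate (.inl a) = _ from congrArg Sigma.fst h] <;> rfl
    · change (sumLeft (f.step (.inr a))).1 = Equiv.sumSumSumComm _ _ _ _ (.inl (f.mate (.inr a)))
      rcases h : f.step (.inr a) with ⟨b | b, l⟩ <;>
        rw [show f.mate (.inr a) = _ from congrArg Sigma.fst h] <;> rfl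
    · change (sumRight (g.step (.inr a))).1 = Equiv.sumSumSumComm _ _ _ _ (.inr (g.mate (.inr a)))
      rcases h : g.step (.inr a) with ⟨b | b, l⟩ <;>
        rw [show g.mate (.inr a) = _ from congrArg Sigma.fst h] <;> rfl

def homLeft {A : C} : State (tgtLab X' X) A → State (tgtLab (X.ihom Y) (X'.ihom Y')) A
  | ⟨.inl x, k⟩ => ⟨.inr (.inl x), k⟩
  | ⟨.inr y, k⟩ => ⟨.inl (.inl y), k⟩

def homRight {A : C} : State (tgtLab Y Y') A → State (tgtLab (X.ihom Y) (X'.ihom Y')) A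
  | ⟨.inl x, k⟩ => ⟨.inl (.inr x), k⟩
  | ⟨.inr y, k⟩ => ⟨.inr (.inr y), k⟩

/-- The internal hom of graphs: disjoint union. -/
def ihom (f : Matching X' X) (g : Matching Y Y') : Matching (X.ihom Y) (X'.ihom Y') :=
  ofStep (fun
    | .inl (.inl n) => homLeft (f.step (.inr n))
    | .inl (.inr p) => homRight (g.step (.inl p))
    | .inr (.inl p) => homLeft (f.step (.inl p))
    | .inr (.inr n) => homRight (g.step (.inr n))) <| by
    have e := (((Equiv.sumSumSumComm X.P X'.N Y.N Y'.P).bijective.comp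
      (Equiv.sumCongr (Equiv.sumComm _ _) (Equiv.refl _)).bijective).comp
      (f.bij.sumMap g.bij)).comp ((Equiv.sumCongr (Equiv.sumComm _ _) (Equiv.refl _)).bijective.comp
        (Equiv.sumSumSumComm X.N Y.P X'.P Y'.N).bijective)
    refine (congrArg Function.Bijective (?_ : _ = _)).mp e
    funext a
    symm
    rcases a with (a | a) | (a | a)
    · change (homLeft (f.step (.inr a))).1 = Equiv.sumSumSumComm _ _ _ _
        (Equiv.sumCongr (Equiv.sumComm _ _) (Equiv.refl _) (.inl (f.mate (.inr a))))
      rcases h : f.step (.inr a) with ⟨b | b, l⟩ <;>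
        rw [show f.mate (.inr a) = _ from congrArg Sigma.fst h] <;> rfl
    · change (homRight (g.step (.inl a))).1 = Equiv.sumSumSumComm _ _ _ _
        (Equiv.sumCongr (Equiv.sumComm _ _) (Equiv.refl _) (.inr (g.mate (.inl a))))
      rcases h : g.step (.inl a) with ⟨b | b, l⟩ <;>
        rw [show g.mate (.inl a) = _ from congrArg Sigma.fst h] <;> rfl
    · change (homLeft (f.step (.inl a))).1 = Equiv.sumSumSumComm _ _ _ _
        (Equiv.sumCongr (Equiv.sumComm _ _) (Equiv.refl _) (.inl (f.mate (.inl a))))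
      rcases h : f.step (.inl a) with ⟨b | b, l⟩ <;>
        rw [show f.mate (.inl a) = _ from congrArg Sigma.fst h] <;> rfl
    · change (homRight (g.step (.inr a))).1 = Equiv.sumSumSumComm _ _ _ _
        (Equiv.sumCongr (Equiv.sumComm _ _) (Equiv.refl _) (.inr (g.mate (.inr a))))
      rcases h : g.step (.inr a) with ⟨b | b, l⟩ <;>
        rw [show g.mate (.inr a) = _ from congrArg Sigma.fst h] <;> rfl

/-- `(X ⊗ Y) ⊗ Z ⟶ X ⊗ (Y ⊗ Z)` -/
def assocHom (X Y Z : SignedSet C) : Matching ((X.sum Y).sum Z) (X.sum (Y.sum Z)) :=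
  ofInv (fun
      | .inl (.inl (.inl p)) => ⟨.inr (.inl p), 𝟙 _⟩
      | .inl (.inl (.inr p)) => ⟨.inr (.inr (.inl p)), 𝟙 _⟩
      | .inl (.inr p) => ⟨.inr (.inr (.inr p)), 𝟙 _⟩
      | .inr (.inl n) => ⟨.inl (.inl (.inl n)), 𝟙 _⟩
      | .inr (.inr (.inl n)) => ⟨.inl (.inl (.inr n)), 𝟙 _⟩
      | .inr (.inr (.inr n)) => ⟨.inl (.inr n), 𝟙 _⟩)
    (fun
      | .inr (.inl p) => .inl (.inl (.inl p))
      | .inr (.inr (.inl p)) => .inl (.inl (.inr p))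
      | .inr (.inr (.inr p)) => .inl (.inr p)
      | .inl (.inl (.inl n)) => .inr (.inl n)
      | .inl (.inl (.inr n)) => .inr (.inr (.inl n))
      | .inl (.inr n) => .inr (.inr (.inr n)))
    (by rintro (((_ | _) | _) | (_ | (_ | _))) <;> rfl)
    (by rintro (((_ | _) | _) | (_ | (_ | _))) <;> rfl)

/-- `X ⊗ (Y ⊗ Z) ⟶ (X ⊗ Y) ⊗ Z` -/
def assocInv (X Y Z : SignedSet C) : Matching (X.sum (Y.sum Z)) ((X.sum Y).sum Z) :=
  ofInv (fun
      | .inl (.inl p) => ⟨.inr (.inl (.inl p)), 𝟙 _⟩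
      | .inl (.inr (.inl p)) => ⟨.inr (.inl (.inr p)), 𝟙 _⟩
      | .inl (.inr (.inr p)) => ⟨.inr (.inr p), 𝟙 _⟩
      | .inr (.inl (.inl n)) => ⟨.inl (.inl n), 𝟙 _⟩
      | .inr (.inl (.inr n)) => ⟨.inl (.inr (.inl n)), 𝟙 _⟩
      | .inr (.inr n) => ⟨.inl (.inr (.inr n)), 𝟙 _⟩)
    (fun
      | .inr (.inl (.inl p)) => .inl (.inl p)
      | .inr (.inl (.inr p)) => .inl (.inr (.inl p))
      | .inr (.inr p) => .inl (.inr (.inr p))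
      | .inl (.inl n) => .inr (.inl (.inl n))
      | .inl (.inr (.inl n)) => .inr (.inl (.inr n))
      | .inl (.inr (.inr n)) => .inr (.inr n))
    (by rintro ((_ | (_ | _)) | ((_ | _) | _)) <;> rfl)
    (by rintro ((_ | (_ | _)) | ((_ | _) | _)) <;> rfl)

/-- `X ⊗ I ⟶ X` -/
def unitHom (X : SignedSet C) : Matching (X.sum empty) X :=
  ofInv (fun
      | .inl (.inl p) => ⟨.inr p, 𝟙 _⟩
      | .inr n => ⟨.inl (.inl n), 𝟙 _⟩)
    (fun
      | .inr p => .inl (.inl p)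
      | .inl (.inl n) => .inr n)
    (by rintro ((_ | ⟨⟨⟩⟩) | _) <;> rfl)
    (by rintro ((_ | ⟨⟨⟩⟩) | _) <;> rfl)

/-- `X ⟶ X ⊗ I` -/
def unitInv (X : SignedSet C) : Matching X (X.sum empty) :=
  ofInv (fun
      | .inl p => ⟨.inr (.inl p), 𝟙 _⟩
      | .inr (.inl n) => ⟨.inl n, 𝟙 _⟩)
    (fun
      | .inr (.inl p) => .inl p
      | .inl n => .inr (.inl n))
    (by rintro (_ | (_ | ⟨⟨⟩⟩)) <;> rfl)
    (by rintro (_ | (_ | ⟨⟨⟩⟩)) <;> rfl)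

/-- `X ⊗ Y ⟶ Y ⊗ X` -/
def braid (X Y : SignedSet C) : Matching (X.sum Y) (Y.sum X) :=
  ofInv (fun
      | .inl (.inl p) => ⟨.inr (.inr p), 𝟙 _⟩
      | .inl (.inr p) => ⟨.inr (.inl p), 𝟙 _⟩
      | .inr (.inl n) => ⟨.inl (.inr n), 𝟙 _⟩
      | .inr (.inr n) => ⟨.inl (.inl n), 𝟙 _⟩)
    (fun
      | .inr (.inl p) => .inl (.inr p)
      | .inr (.inr p) => .inl (.inl p)
      | .inl (.inl n) => .inr (.inr n)
      | .inl (.inr n) => .inr (.inl n))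
    (by rintro ((_ | _) | (_ | _)) <;> rfl)
    (by rintro ((_ | _) | (_ | _)) <;> rfl)

/-- Evaluation `[X, Y] ⊗ X ⟶ Y`. -/
def ev (X Y : SignedSet C) : Matching ((X.ihom Y).sum X) Y :=
  ofInv (fun
      | .inl (.inl (.inl n)) => ⟨.inl (.inr n), 𝟙 _⟩
      | .inl (.inl (.inr p)) => ⟨.inr p, 𝟙 _⟩
      | .inl (.inr p) => ⟨.inl (.inl (.inl p)), 𝟙 _⟩
      | .inr n => ⟨.inl (.inl (.inr n)), 𝟙 _⟩)
    (fun
      | .inl (.inr n) => .inl (.inl (.inl n))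
      | .inr p => .inl (.inl (.inr p))
      | .inl (.inl (.inl p)) => .inl (.inr p)
      | .inl (.inl (.inr n)) => .inr n)
    (by rintro (((_ | _) | _) | _) <;> rfl)
    (by rintro (((_ | _) | _) | _) <;> rfl)

/-- Coevaluation `X ⟶ [Y, X ⊗ Y]`. -/
def coev (X Y : SignedSet C) : Matching X (Y.ihom (X.sum Y)) :=
  ofInv (fun
      | .inl p => ⟨.inr (.inr (.inl p)), 𝟙 _⟩
      | .inr (.inl p) => ⟨.inr (.inr (.inr p)), 𝟙 _⟩
      | .inr (.inr (.inl n)) => ⟨.inl n, 𝟙 _⟩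
      | .inr (.inr (.inr n)) => ⟨.inr (.inl n), 𝟙 _⟩)
    (fun
      | .inr (.inr (.inl p)) => .inl p
      | .inr (.inr (.inr p)) => .inr (.inl p)
      | .inl n => .inr (.inr (.inl n))
      | .inr (.inl n) => .inr (.inr (.inr n)))
    (by rintro (_ | (_ | (_ | _))) <;> rfl)
    (by rintro (_ | (_ | (_ | _))) <;> rfl)

/-- The graph with one edge. -/
def single {A B : C} (g : A ⟶ B) : Matching (SignedSet.single A) (SignedSet.single B) :=
  ofInv (fun | .inl _ => ⟨.inr (), g⟩) (fun | .inr _ => .inl ())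
    (by rintro (_ | ⟨⟨⟩⟩); rfl) (by rintro (⟨⟨⟩⟩ | _); rfl)

end Matching

/-- Labelled shapes: a shape is `I`, a variable, a tensor product or an internal hom of shapes, and each
variable is labelled by an object of `C`. -/
inductive LShape (C : Type u) : Type u
  | unit : LShape C
  | of (A : C) : LShape C
  | tensor (T S : LShape C) : LShape C
  | hom (T S : LShape C) : LShape C

/-- The variable set of a labelled shape. -/
def LShape.vars : LShape C → SignedSet C
  | .unit => .empty
  | .of A => .single A
  | .tensor T S => T.vars.sum S.vars
  | .hom T S => T.vars.ihom S.vars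

/-- The allowable labelled graphs. The generators are those of a symmetric monoidal closed category
(identities, the associativity, unit and symmetry isomorphisms, evaluation and coevaluation), together
with all labelled single edges, and the class is closed under composition, `⊗` and `[-, -]`.
Since labels can be moved along the edges of a graph, to its ends, this says that the underlying graph is
allowable: for `C` with one object and one morphism `single` adds nothing to `id`, and in general an
allowable graph all of whose labels are identities is composed at its ends with edges `single`. -/
inductive Allowable : (T S : LShape C) → Matching T.vars S.vars → Prop
  | id (T) : Allowable T T (.id _)
  | comp {T S U f g} (hf : Allowable T S f) (hg : Allowable S U g) : Allowable T U (f.comp g)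
  | tensor {T S T' S' f g} (hf : Allowable T S f) (hg : Allowable T' S' g) :
      Allowable (.tensor T T') (.tensor S S') (f.tensor g)
  | hom {T S T' S' f g} (hf : Allowable T' T f) (hg : Allowable S S' g) :
      Allowable (.hom T S) (.hom T' S') (f.ihom g)
  | assocHom (T S U) : Allowable (.tensor (.tensor T S) U) (.tensor T (.tensor S U)) (.assocHom _ _ _)
  | assocInv (T S U) : Allowable (.tensor T (.tensor S U)) (.tensor (.tensor T S) U) (.assocInv _ _ _)
  | unitHom (T) : Allowable (.tensor T .unit) T (.unitHom _)
  | unitInv (T) : Allowable T (.tensor T .unit) (.unitInv _)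
  | braid (T S) : Allowable (.tensor T S) (.tensor S T) (.braid _ _)
  | ev (T S) : Allowable (.tensor (.hom T S) T) S (.ev _ _)
  | coev (T S) : Allowable T (.hom S (.tensor T S)) (.coev _ _)
  | single {A B : C} (g : A ⟶ B) : Allowable (.of A) (.of B) (.single g)

/-- The category `A C` of labelled shapes and allowable labelled graphs. -/
def AC (C : Type u) : Type u := LShape C

noncomputable instance : Category.{v} (AC C) where
  Hom T S := {f : Matching (LShape.vars T) (LShape.vars S) // Allowable T S f}
  id T := ⟨.id _, .id _⟩
  comp f g := ⟨f.1.comp g.1, .comp f.2 g.2⟩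
  id_comp f := Subtype.ext (Matching.id_comp f.1)
  comp_id f := Subtype.ext (Matching.comp_id f.1)
  assoc f g h := Subtype.ext (Matching.assoc f.1 g.1 h.1)

/-- The functor forgetting everything but the graphs. -/
noncomputable def AC.graph (C : Type u) [Category.{v} C] : AC C ⥤ SignedSet C where
  obj T := LShape.vars T
  map f := f.1

namespace Matching
variable {X Y Z X' Y' Z' X'' Y'' : SignedSet C}

theorem State.pre_id {ι : Type} {lab : ι → C} {A : C} (s : State lab A) :
    State.pre (𝟙 A) s = s := by
  obtain ⟨i, k⟩ := s; simp [State.pre]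

/-- An isomorphism of families of objects, given on morphisms into them. -/
structure Relabel {ι κ : Type} (lab : ι → C) (lab' : κ → C) where
  e : ∀ A : C, State lab A ≃ State lab' A
  nat : ∀ {A B : C} (k : A ⟶ B) (s : State lab B), e A (State.pre k s) = State.pre k (e B s)

namespace Relabel
variable {ι κ μ : Type} {lab : ι → C} {lab' : κ → C} {lab'' : μ → C}

def refl (lab : ι → C) : Relabel lab lab := ⟨fun _ => .refl _, fun _ _ => rfl⟩

theorem nat_symm (r : Relabel lab lab') {A B : C} (k : A ⟶ B) (s : State lab' B) :
    (r.e A).symm (State.pre k s) = State.pre k ((r.e B).symm s) := by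
  rw [Equiv.symm_apply_eq, r.nat, Equiv.apply_symm_apply]

def symm (r : Relabel lab lab') : Relabel lab' lab := ⟨fun A => (r.e A).symm, r.nat_symm⟩

def trans (r : Relabel lab lab') (s : Relabel lab' lab'') : Relabel lab lab'' :=
  ⟨fun A => (r.e A).trans (s.e A), fun k t => by simp [r.nat, s.nat]⟩

variable {ι' κ' : Type} {m : ι' → C} {m' : κ' → C}

/-- The sum of two isomorphisms. -/
def sum (r : Relabel lab lab') (s : Relabel m m') :
    Relabel (Sum.elim lab m) (Sum.elim lab' m') where
  e A :=
    { toFun := fun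
        | ⟨.inl i, k⟩ => ⟨.inl (r.e A ⟨i, k⟩).1, (r.e A ⟨i, k⟩).2⟩
        | ⟨.inr i, k⟩ => ⟨.inr (s.e A ⟨i, k⟩).1, (s.e A ⟨i, k⟩).2⟩
      invFun := fun
        | ⟨.inl i, k⟩ => ⟨.inl ((r.e A).symm ⟨i, k⟩).1, ((r.e A).symm ⟨i, k⟩).2⟩
        | ⟨.inr i, k⟩ => ⟨.inr ((s.e A).symm ⟨i, k⟩).1, ((s.e A).symm ⟨i, k⟩).2⟩
      left_inv := by
        rintro ⟨i | i, k⟩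
        · exact congrArg (fun τ : State lab A => (⟨.inl τ.1, τ.2⟩ : State (Sum.elim lab m) A))
            ((r.e A).symm_apply_apply ⟨i, k⟩)
        · exact congrArg (fun τ : State m A => (⟨.inr τ.1, τ.2⟩ : State (Sum.elim lab m) A))
            ((s.e A).symm_apply_apply ⟨i, k⟩)
      right_inv := by
        rintro ⟨i | i, k⟩
        · exact congrArg (fun τ : State lab' A => (⟨.inl τ.1, τ.2⟩ : State (Sum.elim lab' m') A))
            ((r.e A).apply_symm_apply ⟨i, k⟩)
        · exact congrArg (fun τ : State m' A => (⟨.inr τ.1, τ.2⟩ : State (Sum.elim lab' m') A))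
            ((s.e A).apply_symm_apply ⟨i, k⟩) }
  nat := by
    rintro A B k ⟨i | i, l⟩
    · exact congrArg (fun τ : State lab' A => (⟨.inl τ.1, τ.2⟩ : State (Sum.elim lab' m') A))
        (r.nat k ⟨i, l⟩)
    · exact congrArg (fun τ : State m' A => (⟨.inr τ.1, τ.2⟩ : State (Sum.elim lab' m') A))
        (s.nat k ⟨i, l⟩)

/-- The map on indices. -/
def idx (r : Relabel lab lab') (i : ι) : κ := (r.e _ ⟨i, 𝟙 _⟩).1

theorem e_fst (r : Relabel lab lab') {A : C} (s : State lab A) : (r.e A s).1 = r.idx s.1 := by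
  obtain ⟨i, k⟩ := s
  have := r.nat k ⟨i, 𝟙 _⟩
  rw [show State.pre k (⟨i, 𝟙 _⟩ : State lab _) = ⟨i, k⟩ from
    Sigma.ext rfl (heq_of_eq (Category.comp_id _))] at this
  rw [this]; rfl

theorem idx_symm (r : Relabel lab lab') (i : ι) : r.symm.idx (r.idx i) = i := by
  have h := (r.symm.e_fst (r.e _ ⟨i, 𝟙 _⟩))
  have h2 : r.symm.e _ (r.e _ ⟨i, 𝟙 _⟩) = ⟨i, 𝟙 _⟩ := (r.e _).symm_apply_apply _
  rw [h2] at h; exact h.symm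

theorem idx_bijective (r : Relabel lab lab') : Function.Bijective r.idx :=
  Function.bijective_iff_has_inverse.2 ⟨r.symm.idx, r.idx_symm, r.symm.idx_symm⟩

end Relabel

/-- An isomorphism of signed sets with labels. -/
structure SignedIso (X X' : SignedSet C) where
  p : Relabel X.lP X'.lP
  n : Relabel X.lN X'.lN

namespace SignedIso
def src (r : SignedIso X X') (s : SignedIso Y Y') : Relabel (srcLab X Y) (srcLab X' Y') :=
  r.p.sum s.n
def tgt (r : SignedIso X X') (s : SignedIso Y Y') : Relabel (tgtLab X Y) (tgtLab X' Y') :=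
  r.n.sum s.p
def trans (r : SignedIso X X') (s : SignedIso X' X'') : SignedIso X X'' :=
  ⟨r.p.trans s.p, r.n.trans s.n⟩
def sum (r : SignedIso X X') (s : SignedIso Y Y') : SignedIso (X.sum Y) (X'.sum Y') :=
  ⟨r.p.sum s.p, r.n.sum s.n⟩
def ihom (r : SignedIso X X') (s : SignedIso Y Y') : SignedIso (X.ihom Y) (X'.ihom Y') :=
  ⟨r.n.sum s.p, r.p.sum s.n⟩
end SignedIso

theorem push_pre (f : Matching X Y) {A B : C} (k : A ⟶ B) (s : State (srcLab X Y) B) :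
    f.push (State.pre k s) = State.pre k (f.push s) := by
  simp [push, State.pre]

/-- Transport of a graph along isomorphisms of the ends. -/
def conj (f : Matching X Y) (r : SignedIso X X') (s : SignedIso Y Y') : Matching X' Y' :=
  ofStep (fun a => (r.tgt s).e _ (f.push (((r.src s).e _).symm ⟨a, 𝟙 _⟩))) <| by
    have e := ((r.tgt s).idx_bijective.comp f.bij).comp (r.src s).symm.idx_bijective
    convert e using 1
    funext a
    exact (r.tgt s).e_fst _

theorem push_conj (f : Matching X Y) (r : SignedIso X X') (s : SignedIso Y Y') {A : C}
    (ρ : State (srcLab X Y) A) :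
    (f.conj r s).push ((r.src s).e A ρ) = (r.tgt s).e A (f.push ρ) := by
  have h : ∀ σ : State (srcLab X' Y') A, (f.conj r s).push σ =
      (r.tgt s).e A (f.push (((r.src s).e A).symm σ)) := by
    rintro ⟨a, k⟩
    have h1 : State.pre k (⟨a, 𝟙 _⟩ : State (srcLab X' Y') _) = ⟨a, k⟩ :=
      Sigma.ext rfl (heq_of_eq (Category.comp_id _))
    rw [← h1, Relabel.nat_symm, push_pre, push_pre, Relabel.nat]
    congr 1
    exact Sigma.ext rfl (heq_of_eq (Category.id_comp _))
  rw [h, Equiv.symm_apply_apply]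

theorem ext_push' {f g : Matching X Y} (h : ∀ {A} (ρ : State (srcLab X Y) A), f.push ρ = g.push ρ) :
    f = g := ext_push fun _ => h _

theorem conj_eq {f : Matching X Y} {r : SignedIso X X'} {s : SignedIso Y Y'} {f' : Matching X' Y'}
    (h : ∀ {A} (ρ : State (srcLab X Y) A),
      f'.push ((r.src s).e A ρ) = (r.tgt s).e A (f.push ρ)) : f.conj r s = f' := by
  apply ext_push'
  intro A ρ
  obtain ⟨ρ, rfl⟩ := ((r.src s).e A).surjective ρ
  rw [push_conj, h]


end Matching
end KM

namespace KM
open SignedSet Matching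
variable {C : Type u} [Category.{v} C] {D : Type u'} [Category.{v'} D]

namespace Matching

def bindEmpty (H : C ⥤ SignedSet D) : SignedIso (SignedSet.empty.bind H) .empty where
  p := { e := fun A =>
          { toFun := fun s => nomatch s
            invFun := fun s => nomatch s
            left_inv := fun s => nomatch s
            right_inv := fun s => nomatch s }
         nat := fun k s => nomatch s }
  n := { e := fun A =>
          { toFun := fun s => nomatch s
            invFun := fun s => nomatch s
            left_inv := fun s => nomatch s
            right_inv := fun s => nomatch s }
         nat := fun k s => nomatch s }

def bindSingle (H : C ⥤ SignedSet D) (A : C) : SignedIso ((SignedSet.single A).bind H) (H.obj A) where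
  p := { e := fun B =>
          { toFun := fun | ⟨.inl ⟨(), q⟩, k⟩ => ⟨q, k⟩
            invFun := fun | ⟨q, k⟩ => ⟨.inl ⟨(), q⟩, k⟩
            left_inv := by rintro ⟨⟨⟨⟩, q⟩ | ⟨⟨⟩, q⟩, k⟩; rfl
            right_inv := by rintro ⟨q, k⟩; rfl }
         nat := by rintro A B k ⟨⟨⟨⟩, q⟩ | ⟨⟨⟩, q⟩, l⟩; rfl }
  n := { e := fun B =>
          { toFun := fun | ⟨.inl ⟨(), q⟩, k⟩ => ⟨q, k⟩
            invFun := fun | ⟨q, k⟩ => ⟨.inl ⟨(), q⟩, k⟩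
            left_inv := by rintro ⟨⟨⟨⟩, q⟩ | ⟨⟨⟩, q⟩, k⟩; rfl
            right_inv := by rintro ⟨q, k⟩; rfl }
         nat := by rintro A B k ⟨⟨⟨⟩, q⟩ | ⟨⟨⟩, q⟩, l⟩; rfl }

def bindSum (H : C ⥤ SignedSet D) (X Y : SignedSet C) :
    SignedIso ((X.sum Y).bind H) ((X.bind H).sum (Y.bind H)) where
  p := { e := fun B =>
          { toFun := fun
              | ⟨.inl ⟨.inl p, q⟩, k⟩ => ⟨.inl (.inl ⟨p, q⟩), k⟩
              | ⟨.inl ⟨.inr p, q⟩, k⟩ => ⟨.inr (.inl ⟨p, q⟩), k⟩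
              | ⟨.inr ⟨.inl n, q⟩, k⟩ => ⟨.inl (.inr ⟨n, q⟩), k⟩
              | ⟨.inr ⟨.inr n, q⟩, k⟩ => ⟨.inr (.inr ⟨n, q⟩), k⟩
            invFun := fun
              | ⟨.inl (.inl ⟨p, q⟩), k⟩ => ⟨.inl ⟨.inl p, q⟩, k⟩
              | ⟨.inr (.inl ⟨p, q⟩), k⟩ => ⟨.inl ⟨.inr p, q⟩, k⟩
              | ⟨.inl (.inr ⟨n, q⟩), k⟩ => ⟨.inr ⟨.inl n, q⟩, k⟩
              | ⟨.inr (.inr ⟨n, q⟩), k⟩ => ⟨.inr ⟨.inr n, q⟩, k⟩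
            left_inv := by rintro ⟨⟨p | p, q⟩ | ⟨p | p, q⟩, k⟩ <;> rfl
            right_inv := by rintro ⟨(⟨p, q⟩ | ⟨p, q⟩) | (⟨p, q⟩ | ⟨p, q⟩), k⟩ <;> rfl }
         nat := by rintro A B k ⟨⟨p | p, q⟩ | ⟨p | p, q⟩, k⟩ <;> rfl }
  n := { e := fun B =>
          { toFun := fun
              | ⟨.inl ⟨.inl p, q⟩, k⟩ => ⟨.inl (.inl ⟨p, q⟩), k⟩
              | ⟨.inl ⟨.inr p, q⟩, k⟩ => ⟨.inr (.inl ⟨p, q⟩), k⟩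
              | ⟨.inr ⟨.inl n, q⟩, k⟩ => ⟨.inl (.inr ⟨n, q⟩), k⟩
              | ⟨.inr ⟨.inr n, q⟩, k⟩ => ⟨.inr (.inr ⟨n, q⟩), k⟩
            invFun := fun
              | ⟨.inl (.inl ⟨p, q⟩), k⟩ => ⟨.inl ⟨.inl p, q⟩, k⟩
              | ⟨.inr (.inl ⟨p, q⟩), k⟩ => ⟨.inl ⟨.inr p, q⟩, k⟩
              | ⟨.inl (.inr ⟨n, q⟩), k⟩ => ⟨.inr ⟨.inl n, q⟩, k⟩
              | ⟨.inr (.inr ⟨n, q⟩), k⟩ => ⟨.inr ⟨.inr n, q⟩, k⟩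
            left_inv := by rintro ⟨⟨p | p, q⟩ | ⟨p | p, q⟩, k⟩ <;> rfl
            right_inv := by rintro ⟨(⟨p, q⟩ | ⟨p, q⟩) | (⟨p, q⟩ | ⟨p, q⟩), k⟩ <;> rfl }
         nat := by rintro A B k ⟨⟨p | p, q⟩ | ⟨p | p, q⟩, k⟩ <;> rfl }

def bindIhom (H : C ⥤ SignedSet D) (X Y : SignedSet C) :
    SignedIso ((X.ihom Y).bind H) ((X.bind H).ihom (Y.bind H)) where
  p := { e := fun B =>
          { toFun := fun
              | ⟨.inl ⟨.inl n, q⟩, k⟩ => ⟨.inl (.inr ⟨n, q⟩), k⟩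
              | ⟨.inl ⟨.inr p, q⟩, k⟩ => ⟨.inr (.inl ⟨p, q⟩), k⟩
              | ⟨.inr ⟨.inl p, q⟩, k⟩ => ⟨.inl (.inl ⟨p, q⟩), k⟩
              | ⟨.inr ⟨.inr n, q⟩, k⟩ => ⟨.inr (.inr ⟨n, q⟩), k⟩
            invFun := fun
              | ⟨.inl (.inr ⟨p, q⟩), k⟩ => ⟨.inl ⟨.inl p, q⟩, k⟩
              | ⟨.inr (.inl ⟨p, q⟩), k⟩ => ⟨.inl ⟨.inr p, q⟩, k⟩
              | ⟨.inl (.inl ⟨n, q⟩), k⟩ => ⟨.inr ⟨.inl n, q⟩, k⟩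
              | ⟨.inr (.inr ⟨n, q⟩), k⟩ => ⟨.inr ⟨.inr n, q⟩, k⟩
            left_inv := by rintro ⟨⟨p | p, q⟩ | ⟨p | p, q⟩, k⟩ <;> rfl
            right_inv := by rintro ⟨(⟨p, q⟩ | ⟨p, q⟩) | (⟨p, q⟩ | ⟨p, q⟩), k⟩ <;> rfl }
         nat := by rintro A B k ⟨⟨p | p, q⟩ | ⟨p | p, q⟩, k⟩ <;> rfl }
  n := { e := fun B =>
          { toFun := fun
              | ⟨.inl ⟨.inl n, q⟩, k⟩ => ⟨.inl (.inr ⟨n, q⟩), k⟩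
              | ⟨.inl ⟨.inr p, q⟩, k⟩ => ⟨.inr (.inl ⟨p, q⟩), k⟩
              | ⟨.inr ⟨.inl p, q⟩, k⟩ => ⟨.inl (.inl ⟨p, q⟩), k⟩
              | ⟨.inr ⟨.inr n, q⟩, k⟩ => ⟨.inr (.inr ⟨n, q⟩), k⟩
            invFun := fun
              | ⟨.inl (.inr ⟨p, q⟩), k⟩ => ⟨.inl ⟨.inl p, q⟩, k⟩
              | ⟨.inr (.inl ⟨p, q⟩), k⟩ => ⟨.inl ⟨.inr p, q⟩, k⟩
              | ⟨.inl (.inl ⟨n, q⟩), k⟩ => ⟨.inr ⟨.inl n, q⟩, k⟩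
              | ⟨.inr (.inr ⟨n, q⟩), k⟩ => ⟨.inr ⟨.inr n, q⟩, k⟩
            left_inv := by rintro ⟨⟨p | p, q⟩ | ⟨p | p, q⟩, k⟩ <;> rfl
            right_inv := by rintro ⟨(⟨p, q⟩ | ⟨p, q⟩) | (⟨p, q⟩ | ⟨p, q⟩), k⟩ <;> rfl }
         nat := by rintro A B k ⟨⟨p | p, q⟩ | ⟨p | p, q⟩, k⟩ <;> rfl }

variable {X Y Z X' Y' Z' : SignedSet C}

/-- Crossing an identity edge. -/
def turn {X : SignedSet D} {A : D} : State (srcLab X X) A → State (tgtLab X X) A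
  | ⟨.inl p, k⟩ => ⟨.inr p, k⟩
  | ⟨.inr n, k⟩ => ⟨.inl n, k⟩

theorem push_id_eq {X : SignedSet D} {A : D} (ρ : State (srcLab X X) A) :
    (Matching.id X).push ρ = turn ρ := by
  rcases ρ with ⟨p | p, k⟩ <;> exact Sigma.ext rfl (heq_of_eq (Category.comp_id _))

theorem conj_id (r : SignedIso X X') : (Matching.id X).conj r r = Matching.id X' := by
  apply conj_eq
  intro A ρ
  rw [push_id_eq, push_id_eq]
  rcases ρ with ⟨a | a, k⟩ <;> rfl

/-- Transport of the vertices of paths through a composite. -/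
def conjVertex (r : SignedIso X X') (s : SignedIso Y Y') (t : SignedIso Z Z') :
    Relabel (vertexLab X Y Z) (vertexLab X' Y' Z') :=
  ((r.src s).sum (s.src t)).sum (r.tgt t)

theorem conj_comp (f : Matching X Y) (g : Matching Y Z) (r : SignedIso X X') (s : SignedIso Y Y')
    (t : SignedIso Z Z') : (f.comp g).conj r t = (f.conj r s).comp (g.conj s t) := by
  have key : ∀ A (σ τ : State (vertexLab X Y Z) A), Next f g σ τ →
      Run (f.conj r s) (g.conj s t) ((conjVertex r s t).e A σ) ((conjVertex r s t).e A τ) := by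
    intro A σ τ h
    cases h with
    | @left a k τ h =>
      have e : (conjVertex r s t).e A (exitLeft τ) = exitLeft ((r.tgt s).e A τ) := by
        rcases τ with ⟨b | b, l⟩ <;> rfl
      have h' := push_conj f r s ⟨a, k⟩
      rw [h] at h'
      rw [e]
      exact .single (.left h')
    | @right a k τ h =>
      have e : (conjVertex r s t).e A (exitRight τ) = exitRight ((s.tgt t).e A τ) := by
        rcases τ with ⟨b | b, l⟩ <;> rfl
      have h' := push_conj g s t ⟨a, k⟩
      rw [h] at h'
      rw [e]
      exact .single (.right h')
  apply conj_eq
  intro A ρ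
  apply push_comp_of_run
  have := Relation.ReflTransGen.lift' _ (key A) _ _ (run_of_push_comp (f := f) (g := g) ρ)
  rcases ρ with ⟨a | a, k⟩ <;> exact this

end Matching

variable (F : C ⥤ AC D)

/-- Substitution of shapes into a labelled shape. -/
noncomputable def LShape.bind : LShape C → LShape D
  | .unit => .unit
  | .of A => F.obj A
  | .tensor T S => .tensor (T.bind) (S.bind)
  | .hom T S => .hom (T.bind) (S.bind)

/-- The variables of a substituted shape are the substituted variables. -/
noncomputable def LShape.bindIso : ∀ T : LShape C,
    SignedIso (T.vars.bind (F ⋙ AC.graph D)) (T.bind F).vars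
  | .unit => bindEmpty _
  | .of _ => bindSingle _ _
  | .tensor T S => (bindSum _ _ _).trans ((bindIso T).sum (bindIso S))
  | .hom T S => (bindIhom _ _ _).trans ((bindIso T).ihom (bindIso S))

namespace Matching
variable {F}

/-- The action of `K F` on graphs. -/
noncomputable def subst (F : C ⥤ AC D) {T S : LShape C} (f : Matching T.vars S.vars) :
    Matching (T.bind F).vars (S.bind F).vars :=
  (f.bind (F ⋙ AC.graph D)).conj (T.bindIso F) (S.bindIso F)

theorem subst_id (T : LShape C) : (Matching.id T.vars).subst F = Matching.id _ := by
  rw [subst, bind_id, conj_id]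

theorem subst_comp {T S U : LShape C} (f : Matching T.vars S.vars) (g : Matching S.vars U.vars) :
    (f.comp g).subst F = (f.subst F).comp (g.subst F) := by
  rw [subst, bind_comp, conj_comp _ _ _ (S.bindIso F)]; rfl

noncomputable abbrev inSrc (F : C ⥤ AC D) (T S : LShape C) (a : Src T.vars S.vars) (b : Tgt T.vars S.vars) {A : D}
    (ρ : State (srcLab (F.obj (srcLab _ _ a) : LShape D).vars (F.obj (tgtLab _ _ b) : LShape D).vars) A) :
    State (srcLab (T.bind F).vars (S.bind F).vars) A :=
  ((T.bindIso F).src (S.bindIso F)).e A (placeSrc (F ⋙ AC.graph D) a b ρ)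

noncomputable abbrev inTgt (F : C ⥤ AC D) (T S : LShape C) (a : Src T.vars S.vars) (b : Tgt T.vars S.vars) {A : D}
    (ρ : State (tgtLab (F.obj (srcLab _ _ a) : LShape D).vars (F.obj (tgtLab _ _ b) : LShape D).vars) A) :
    State (tgtLab (T.bind F).vars (S.bind F).vars) A :=
  ((T.bindIso F).tgt (S.bindIso F)).e A (placeTgt (F ⋙ AC.graph D) a b ρ)

theorem push_subst {T S : LShape C} {f : Matching T.vars S.vars} {a b g}
    (h : f.step a = ⟨b, g⟩) {A : D} (ρ) :
    (f.subst F).push (inSrc F T S a b (A := A) ρ) = inTgt F T S a b (Matching.push (F.map g).1 ρ) := by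
  rw [subst, push_conj]
  exact congrArg _ (push_bind (F ⋙ AC.graph D) h ρ)

theorem subst_eq {T S : LShape C} {f : Matching T.vars S.vars} {f'}
    (h : ∀ a b g, f.step a = ⟨b, g⟩ → ∀ {A : D} (ρ),
      f'.push (inSrc F T S a b (A := A) ρ) = inTgt F T S a b (Matching.push (F.map g).1 ρ)) :
    f.subst F = f' := by
  apply conj_eq
  rintro A ⟨s, k⟩
  obtain ⟨a, b, g, r, h1, h2⟩ := exists_placeSrc (F ⋙ AC.graph D) f s
  have h3 := h a b g h1 (State.pre k r)
  have nat : ∀ (a : Src T.vars S.vars) (b : Tgt T.vars S.vars) {A' B : D} (k : A' ⟶ B)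
      (τ : State (srcLab ((F ⋙ AC.graph D).obj (srcLab _ _ a))
        ((F ⋙ AC.graph D).obj (tgtLab _ _ b))) B),
      placeSrc _ a b (State.pre k τ) = State.pre k (placeSrc _ a b τ) := by
    rintro (a | a) (b | b) A' B k ⟨r | r, l⟩ <;> rfl
  have h4 : placeSrc (F ⋙ AC.graph D) a b (State.pre k r) = ⟨s, k⟩ := by
    rw [nat, h2]; exact Sigma.ext rfl (heq_of_eq (Category.comp_id k))
  have h5 := push_bind (F ⋙ AC.graph D) h1 (State.pre k r)
  rw [h4] at h5
  rw [h5, ← h4]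
  exact h3

theorem push_map_id (A : C) {B : D} (ρ : State (srcLab (F.obj A : LShape D).vars (F.obj A : LShape D).vars) B) :
    Matching.push (F.map (𝟙 A)).1 ρ = turn ρ := by
  rw [F.map_id]
  exact push_id_eq ρ

theorem subst_assocHom (T S U : LShape C) :
    subst F (T := (T.tensor S).tensor U) (S := T.tensor (S.tensor U)) (assocHom _ _ _) =
      assocHom _ _ _ := by
  apply subst_eq
  rintro (((a | a) | a) | (a | (a | a))) b g h A ρ <;> cases h <;>
    refine Eq.trans ?_ (congrArg _ (push_map_id _ ρ).symm) <;> rcases ρ with ⟨q | q, k⟩ <;>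
    exact Sigma.ext rfl (heq_of_eq (Category.comp_id _))

theorem subst_assocInv (T S U : LShape C) :
    subst F (S := (T.tensor S).tensor U) (T := T.tensor (S.tensor U)) (assocInv _ _ _) =
      assocInv _ _ _ := by
  apply subst_eq
  rintro ((a | (a | a)) | ((a | a) | a)) b g h A ρ <;> cases h <;>
    refine Eq.trans ?_ (congrArg _ (push_map_id _ ρ).symm) <;> rcases ρ with ⟨q | q, k⟩ <;>
    exact Sigma.ext rfl (heq_of_eq (Category.comp_id _))

theorem subst_braid (T S : LShape C) :
    subst F (T := T.tensor S) (S := S.tensor T) (braid _ _) = braid _ _ := by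
  apply subst_eq
  rintro ((a | a) | (a | a)) b g h A ρ <;> cases h <;>
    refine Eq.trans ?_ (congrArg _ (push_map_id _ ρ).symm) <;> rcases ρ with ⟨q | q, k⟩ <;>
    exact Sigma.ext rfl (heq_of_eq (Category.comp_id _))

theorem subst_unitHom (T : LShape C) :
    subst F (T := T.tensor .unit) (S := T) (unitHom _) = unitHom _ := by
  apply subst_eq
  rintro ((a | ⟨⟨⟩⟩) | a) b g h A ρ <;> cases h <;>
    refine Eq.trans ?_ (congrArg _ (push_map_id _ ρ).symm) <;> rcases ρ with ⟨q | q, k⟩ <;>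
    exact Sigma.ext rfl (heq_of_eq (Category.comp_id _))

theorem subst_unitInv (T : LShape C) :
    subst F (S := T.tensor .unit) (T := T) (unitInv _) = unitInv _ := by
  apply subst_eq
  rintro (a | (a | ⟨⟨⟩⟩)) b g h A ρ <;> cases h <;>
    refine Eq.trans ?_ (congrArg _ (push_map_id _ ρ).symm) <;> rcases ρ with ⟨q | q, k⟩ <;>
    exact Sigma.ext rfl (heq_of_eq (Category.comp_id _))

theorem subst_ev (T S : LShape C) :
    subst F (T := (T.hom S).tensor T) (S := S) (ev _ _) = ev _ _ := by
  apply subst_eq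
  rintro (((a | a) | a) | a) b g h A ρ <;> cases h <;>
    refine Eq.trans ?_ (congrArg _ (push_map_id _ ρ).symm) <;> rcases ρ with ⟨q | q, k⟩ <;>
    exact Sigma.ext rfl (heq_of_eq (Category.comp_id _))

theorem subst_coev (T S : LShape C) :
    subst F (S := S.hom (T.tensor S)) (T := T) (coev _ _) = coev _ _ := by
  apply subst_eq
  rintro (a | (a | (a | a))) b g h A ρ <;> cases h <;>
    refine Eq.trans ?_ (congrArg _ (push_map_id _ ρ).symm) <;> rcases ρ with ⟨q | q, k⟩ <;>
    exact Sigma.ext rfl (heq_of_eq (Category.comp_id _))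

theorem subst_single {A₁ B₁ : C} (g : A₁ ⟶ B₁) :
    subst F (T := .of A₁) (S := .of B₁) (single g) = (F.map g).1 := by
  apply subst_eq
  rintro (a | ⟨⟨⟩⟩) b g h A ρ
  cases h
  have e : ∀ τ, inTgt F (.of A₁) (.of B₁) (.inl ()) (.inr ()) (A := A) τ = τ := by
    rintro ⟨q | q, k⟩ <;> rfl
  refine Eq.trans ?_ (e _).symm
  rcases ρ with ⟨q | q, k⟩ <;> rfl


section
variable {X Y X' Y' : SignedSet D}

def sumSrcL {A : D} : State (srcLab X Y) A → State (srcLab (X.sum X') (Y.sum Y')) A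
  | ⟨.inl x, k⟩ => ⟨.inl (.inl x), k⟩
  | ⟨.inr y, k⟩ => ⟨.inr (.inl y), k⟩

def sumSrcR {A : D} : State (srcLab X' Y') A → State (srcLab (X.sum X') (Y.sum Y')) A
  | ⟨.inl x, k⟩ => ⟨.inl (.inr x), k⟩
  | ⟨.inr y, k⟩ => ⟨.inr (.inr y), k⟩

def homSrcL {A : D} : State (srcLab X' X) A → State (srcLab (X.ihom Y) (X'.ihom Y')) A
  | ⟨.inl x, k⟩ => ⟨.inr (.inl x), k⟩
  | ⟨.inr y, k⟩ => ⟨.inl (.inl y), k⟩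

def homSrcR {A : D} : State (srcLab Y Y') A → State (srcLab (X.ihom Y) (X'.ihom Y')) A
  | ⟨.inl x, k⟩ => ⟨.inl (.inr x), k⟩
  | ⟨.inr y, k⟩ => ⟨.inr (.inr y), k⟩

theorem push_sumL (f : Matching X Y) (g : Matching X' Y') {A : D} (ρ : State (srcLab X Y) A) :
    (f.tensor g).push (sumSrcL ρ) = sumLeft (f.push ρ) := by
  rcases ρ with ⟨a | a, k⟩
  · rcases h : f.step (.inl a) with ⟨b | b, l⟩ <;> rw [push_eq h] <;>
      exact push_eq (f := f.tensor g) (a := .inl (.inl a)) (congrArg sumLeft h : _) k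
  · rcases h : f.step (.inr a) with ⟨b | b, l⟩ <;> rw [push_eq h] <;>
      exact push_eq (f := f.tensor g) (a := .inr (.inl a)) (congrArg sumLeft h : _) k

theorem push_sumR (f : Matching X Y) (g : Matching X' Y') {A : D} (ρ : State (srcLab X' Y') A) :
    (f.tensor g).push (sumSrcR ρ) = sumRight (g.push ρ) := by
  rcases ρ with ⟨a | a, k⟩
  · rcases h : g.step (.inl a) with ⟨b | b, l⟩ <;> rw [push_eq h] <;>
      exact push_eq (f := f.tensor g) (a := .inl (.inr a)) (congrArg sumRight h : _) k
  · rcases h : g.step (.inr a) with ⟨b | b, l⟩ <;> rw [push_eq h] <;>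
      exact push_eq (f := f.tensor g) (a := .inr (.inr a)) (congrArg sumRight h : _) k

theorem push_homL (f : Matching X' X) (g : Matching Y Y') {A : D} (ρ : State (srcLab X' X) A) :
    (f.ihom g).push (homSrcL ρ) = homLeft (f.push ρ) := by
  rcases ρ with ⟨a | a, k⟩
  · rcases h : f.step (.inl a) with ⟨b | b, l⟩ <;> rw [push_eq h] <;>
      exact push_eq (f := f.ihom g) (a := .inr (.inl a)) (congrArg homLeft h : _) k
  · rcases h : f.step (.inr a) with ⟨b | b, l⟩ <;> rw [push_eq h] <;>
      exact push_eq (f := f.ihom g) (a := .inl (.inl a)) (congrArg homLeft h : _) k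

theorem push_homR (f : Matching X' X) (g : Matching Y Y') {A : D} (ρ : State (srcLab Y Y') A) :
    (f.ihom g).push (homSrcR ρ) = homRight (g.push ρ) := by
  rcases ρ with ⟨a | a, k⟩
  · rcases h : g.step (.inl a) with ⟨b | b, l⟩ <;> rw [push_eq h] <;>
      exact push_eq (f := f.ihom g) (a := .inl (.inr a)) (congrArg homRight h : _) k
  · rcases h : g.step (.inr a) with ⟨b | b, l⟩ <;> rw [push_eq h] <;>
      exact push_eq (f := f.ihom g) (a := .inr (.inr a)) (congrArg homRight h : _) k

end

theorem subst_eq' {T S : LShape C} {f : Matching T.vars S.vars} {f'}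
    (h : ∀ a b g, f.step a = ⟨b, g⟩ → ∀ {A : D} (ρ τ), Matching.push (F.map g).1 ρ = τ →
      f'.push (inSrc F T S a b (A := A) ρ) = inTgt F T S a b τ) :
    f.subst F = f' :=
  subst_eq fun a b g h' _ ρ => h a b g h' ρ _ rfl

theorem subst_tensor {T S T' S' : LShape C} (f : Matching T.vars S.vars)
    (g : Matching T'.vars S'.vars) :
    subst F (T := T.tensor T') (S := S.tensor S') (f.tensor g) = (f.subst F).tensor (g.subst F) := by
  have keyL : ∀ (a : Src T.vars S.vars) (b m) (h : f.step a = ⟨b, m⟩) {A : D} (ρ τ), Matching.push (F.map m).1 ρ = τ →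
      ((f.subst F).tensor (g.subst F)).push (sumSrcL (inSrc F T S a b (A := A) ρ)) =
        sumLeft (inTgt F T S a b τ) := by
    rintro a b m h A ρ _ rfl
    rw [push_sumL, push_subst h]
  have keyR : ∀ (a : Src T'.vars S'.vars) (b m) (h : g.step a = ⟨b, m⟩) {A : D} (ρ τ), Matching.push (F.map m).1 ρ = τ →
      ((f.subst F).tensor (g.subst F)).push (sumSrcR (inSrc F T' S' a b (A := A) ρ)) =
        sumRight (inTgt F T' S' a b τ) := by
    rintro a b m h A ρ _ rfl
    rw [push_sumR, push_subst h]
  apply subst_eq'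
  rintro ((a | a) | (a | a)) b l h A ρ τ hτ
  · rcases h' : f.step (.inl a) with ⟨c | c, m⟩ <;>
      cases h.symm.trans (congrArg sumLeft h' : _) <;>
      refine Eq.trans ?_ ((keyL _ _ _ h' ρ τ hτ).trans ?_) <;>
      first
      | (rcases ρ with ⟨q | q, k⟩ <;> rfl)
      | (rcases τ with ⟨q | q, k⟩ <;> rfl)
  · rcases h' : g.step (.inl a) with ⟨c | c, m⟩ <;>
      cases h.symm.trans (congrArg sumRight h' : _) <;>
      refine Eq.trans ?_ ((keyR _ _ _ h' ρ τ hτ).trans ?_) <;>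
      first
      | (rcases ρ with ⟨q | q, k⟩ <;> rfl)
      | (rcases τ with ⟨q | q, k⟩ <;> rfl)
  · rcases h' : f.step (.inr a) with ⟨c | c, m⟩ <;>
      cases h.symm.trans (congrArg sumLeft h' : _) <;>
      refine Eq.trans ?_ ((keyL _ _ _ h' ρ τ hτ).trans ?_) <;>
      first
      | (rcases ρ with ⟨q | q, k⟩ <;> rfl)
      | (rcases τ with ⟨q | q, k⟩ <;> rfl)
  · rcases h' : g.step (.inr a) with ⟨c | c, m⟩ <;>
      cases h.symm.trans (congrArg sumRight h' : _) <;>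
      refine Eq.trans ?_ ((keyR _ _ _ h' ρ τ hτ).trans ?_) <;>
      first
      | (rcases ρ with ⟨q | q, k⟩ <;> rfl)
      | (rcases τ with ⟨q | q, k⟩ <;> rfl)

theorem subst_ihom {T S T' S' : LShape C} (f : Matching T'.vars T.vars)
    (g : Matching S.vars S'.vars) :
    subst F (T := T.hom S) (S := T'.hom S') (f.ihom g) = (f.subst F).ihom (g.subst F) := by
  have keyL : ∀ (a : Src T'.vars T.vars) (b m) (h : f.step a = ⟨b, m⟩) {A : D} (ρ τ), Matching.push (F.map m).1 ρ = τ →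
      ((f.subst F).ihom (g.subst F)).push (homSrcL (inSrc F T' T a b (A := A) ρ)) =
        homLeft (inTgt F T' T a b τ) := by
    rintro a b m h A ρ _ rfl
    rw [push_homL, push_subst h]
  have keyR : ∀ (a : Src S.vars S'.vars) (b m) (h : g.step a = ⟨b, m⟩) {A : D} (ρ τ), Matching.push (F.map m).1 ρ = τ →
      ((f.subst F).ihom (g.subst F)).push (homSrcR (inSrc F S S' a b (A := A) ρ)) =
        homRight (inTgt F S S' a b τ) := by
    rintro a b m h A ρ _ rfl
    rw [push_homR, push_subst h]
  apply subst_eq'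
  rintro ((a | a) | (a | a)) b l h A ρ τ hτ
  · rcases h' : f.step (.inr a) with ⟨c | c, m⟩ <;>
      cases h.symm.trans (congrArg homLeft h' : _) <;>
      refine Eq.trans ?_ ((keyL _ _ _ h' ρ τ hτ).trans ?_) <;>
      first
      | (rcases ρ with ⟨q | q, k⟩ <;> rfl)
      | (rcases τ with ⟨q | q, k⟩ <;> rfl)
  · rcases h' : g.step (.inl a) with ⟨c | c, m⟩ <;>
      cases h.symm.trans (congrArg homRight h' : _) <;>
      refine Eq.trans ?_ ((keyR _ _ _ h' ρ τ hτ).trans ?_) <;>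
      first
      | (rcases ρ with ⟨q | q, k⟩ <;> rfl)
      | (rcases τ with ⟨q | q, k⟩ <;> rfl)
  · rcases h' : f.step (.inl a) with ⟨c | c, m⟩ <;>
      cases h.symm.trans (congrArg homLeft h' : _) <;>
      refine Eq.trans ?_ ((keyL _ _ _ h' ρ τ hτ).trans ?_) <;>
      first
      | (rcases ρ with ⟨q | q, k⟩ <;> rfl)
      | (rcases τ with ⟨q | q, k⟩ <;> rfl)
  · rcases h' : g.step (.inr a) with ⟨c | c, m⟩ <;>
      cases h.symm.trans (congrArg homRight h' : _) <;>
      refine Eq.trans ?_ ((keyR _ _ _ h' ρ τ hτ).trans ?_) <;>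
      first
      | (rcases ρ with ⟨q | q, k⟩ <;> rfl)
      | (rcases τ with ⟨q | q, k⟩ <;> rfl)

/-- Substitution preserves allowability. -/
theorem allowable_subst (F : C ⥤ AC D) {T S : LShape C} {f : Matching T.vars S.vars}
    (h : Allowable T S f) : Allowable (T.bind F) (S.bind F) (f.subst F) := by
  induction h with
  | id T => rw [subst_id]; exact .id _
  | comp _ _ ih ih' => rw [subst_comp]; exact .comp ih ih'
  | tensor _ _ ih ih' => rw [subst_tensor]; exact .tensor ih ih'
  | hom _ _ ih ih' => rw [subst_ihom]; exact .hom ih ih'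
  | assocHom T S U => rw [subst_assocHom]; exact .assocHom _ _ _
  | assocInv T S U => rw [subst_assocInv]; exact .assocInv _ _ _
  | unitHom T => rw [subst_unitHom]; exact .unitHom _
  | unitInv T => rw [subst_unitInv]; exact .unitInv _
  | braid T S => rw [subst_braid]; exact .braid _ _
  | ev T S => rw [subst_ev]; exact .ev _ _
  | coev T S => rw [subst_coev]; exact .coev _ _
  | single g => rw [subst_single]; exact (F.map g).2

end Matching

/-- The functor `A F : A C ⥤ A D` of a functor `F : C ⥤ A D`: it takes `|T|(x₁, …, xₙ)` to
`|T|(F x₁, …, F xₙ)`, and replaces each edge with label `g` of a graph by the graph `F g`. -/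
noncomputable def AC.lift (F : C ⥤ AC D) : AC C ⥤ AC D where
  obj T := LShape.bind F T
  map f := ⟨Matching.subst F f.1, Matching.allowable_subst F f.2⟩
  map_id T := Subtype.ext (Matching.subst_id T)
  map_comp f g := Subtype.ext (Matching.subst_comp f.1 g.1)

end KM

namespace KM
variable {C : Type u} [Category.{v} C]

/-- A symmetric multicategory with category of objects `C`. The inputs of an arrow are indexed by a finite
type rather than by `1, …, n`, so that `act` along bijections of index types includes the action of the
symmetric groups, and the inputs of a composite are indexed by a sigma type. An arrow is given by each
morphism of `C`; the action of morphisms of `C` on arrows is composition with these. -/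
structure SymMulticategory (C : Type u) [Category.{v} C] where
  Hom : ∀ {ι : Type} [Finite ι] (x : ι → C) (y : C), Type w
  /-- the arrow given by a morphism of objects -/
  ofHom : ∀ {x y : C} (_ : x ⟶ y), Hom (fun _ : Unit => x) y
  comp : ∀ {ι : Type} [Finite ι] {κ : ι → Type} [∀ i, Finite (κ i)] {w : ∀ i, κ i → C} {x : ι → C}
    {y : C} (_ : Hom x y) (_ : ∀ i, Hom (w i) (x i)), Hom (fun p : Σ i, κ i => w p.1 p.2) y
  act : ∀ {ι κ : Type} [Finite ι] [Finite κ] (e : κ ≃ ι) {x : ι → C} {y : C}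
    (_ : Hom (fun k => x (e k)) y), Hom x y
  act_refl : ∀ {ι : Type} [Finite ι] {x : ι → C} {y : C} (f : Hom x y), act (Equiv.refl ι) f = f
  act_act : ∀ {ι κ μ : Type} [Finite ι] [Finite κ] [Finite μ] (e : κ ≃ ι) (e' : μ ≃ κ)
    {x : ι → C} {y : C} (f : Hom (fun k => x (e (e' k))) y),
    act e (act e' (x := fun k => x (e k)) f) = act (e'.trans e) f
  id_comp : ∀ {ι : Type} [Finite ι] {x : ι → C} {y : C} (f : Hom x y),
    act (Equiv.uniqueSigma fun _ : Unit => ι) (x := x) (comp (ofHom (𝟙 y)) fun _ => f) = f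
  comp_id : ∀ {ι : Type} [Finite ι] {x : ι → C} {y : C} (f : Hom x y),
    act (Equiv.sigmaUnique ι fun _ => Unit) (x := x) (comp f fun i => ofHom (𝟙 (x i))) = f
  assoc : ∀ {ι : Type} [Finite ι] {κ : ι → Type} [∀ i, Finite (κ i)] {μ : ∀ i, κ i → Type}
    [∀ i k, Finite (μ i k)] {v : ∀ i k, μ i k → C} {w : ∀ i, κ i → C} {x : ι → C} {y : C}
    (f : Hom x y) (g : ∀ i, Hom (w i) (x i)) (h : ∀ i k, Hom (v i k) (w i k)),
    act (Equiv.sigmaAssoc μ) (x := fun q => v q.1 q.2.1 q.2.2)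
      (comp (comp f g) fun p => h p.1 p.2) = comp f fun i => comp (g i) (h i)
  comp_act_left : ∀ {ι ι' : Type} [Finite ι] [Finite ι'] (e : ι' ≃ ι) {κ : ι → Type}
    [∀ i, Finite (κ i)] {w : ∀ i, κ i → C} {x : ι → C} {y : C} (f : Hom (fun i => x (e i)) y)
    (g : ∀ i, Hom (w i) (x i)),
    comp (act e f) g = act (Equiv.sigmaCongrLeft e (β := κ)) (comp f fun i => g (e i))
  comp_act_right : ∀ {ι : Type} [Finite ι] {κ κ' : ι → Type} [∀ i, Finite (κ i)]
    [∀ i, Finite (κ' i)] (e : ∀ i, κ' i ≃ κ i) {w : ∀ i, κ i → C} {x : ι → C} {y : C}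
    (f : Hom x y) (g : ∀ i, Hom (fun k => w i (e i k)) (x i)),
    comp f (fun i => act (e i) (g i)) = act (Equiv.sigmaCongrRight e) (comp f g)
  ofHom_comp : ∀ {x y z : C} (f : x ⟶ y) (g : y ⟶ z),
    act (Equiv.uniqueSigma fun _ : Unit => Unit) (x := fun _ => x)
      (comp (ofHom g) fun _ => ofHom f) = ofHom (f ≫ g)

namespace SymMulticategory
variable (Q : SymMulticategory.{u, v, w} C)

/-- Composition with a morphism of objects at the output. -/
def post {ι : Type} [Finite ι] {x : ι → C} {y y' : C} (f : Q.Hom x y) (t : y ⟶ y') : Q.Hom x y' :=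
  Q.act (Equiv.uniqueSigma fun _ : Unit => ι) (x := x) (Q.comp (Q.ofHom t) fun _ => f)

/-- Composition with morphisms of objects at the inputs. -/
def pre {ι : Type} [Finite ι] {w x : ι → C} {y : C} (f : Q.Hom x y) (b : ∀ i, w i ⟶ x i) :
    Q.Hom w y :=
  Q.act (Equiv.sigmaUnique ι fun _ => Unit) (x := w) (Q.comp f fun i => Q.ofHom (b i))

theorem act_heq {ι κ : Type} [Finite ι] [Finite κ] {e e' : κ ≃ ι} (h : ∀ k, e k = e' k) {x : ι → C}
    {y : C} {f : Q.Hom (fun k => x (e k)) y} {f' : Q.Hom (fun k => x (e' k)) y} (hf : HEq f f') :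
    Q.act e f = Q.act e' f' := by
  obtain rfl := Equiv.ext h
  cases hf; rfl

section
variable {ι κ : Type} [Finite ι] [Finite κ] {y y' y'' : C}

theorem post_id {x : ι → C} (f : Q.Hom x y) : Q.post f (𝟙 y) = f := Q.id_comp f

theorem pre_id {x : ι → C} (f : Q.Hom x y) : Q.pre f (fun i => 𝟙 (x i)) = f := Q.comp_id f

theorem post_act (e : κ ≃ ι) {x : ι → C} (f : Q.Hom (fun k => x (e k)) y) (t : y ⟶ y') :
    Q.post (Q.act e f) t = Q.act e (Q.post f t) := by
  have h1 := Q.comp_act_right (fun _ : Unit => e) (w := fun _ => x) (Q.ofHom t) fun _ => f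
  have h2 := Q.act_act (Equiv.uniqueSigma fun _ : Unit => ι) (Equiv.sigmaCongrRight fun _ : Unit => e)
    (x := x) (Q.comp (Q.ofHom t) fun _ => f)
  have h3 := Q.act_act e (Equiv.uniqueSigma fun _ : Unit => κ) (x := x)
    (Q.comp (Q.ofHom t) fun _ => f)
  exact (congrArg (Q.act _) h1).trans (h2.trans ((Q.act_heq (fun _ => rfl) HEq.rfl).trans h3.symm))

theorem pre_act (e : κ ≃ ι) {w x : ι → C} (f : Q.Hom (fun k => x (e k)) y) (b : ∀ i, w i ⟶ x i) :
    Q.pre (Q.act e f) b = Q.act e (Q.pre f fun k => b (e k)) := by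
  have h1 := Q.comp_act_left e f fun i => Q.ofHom (b i)
  have h2 := Q.act_act (Equiv.sigmaUnique ι fun _ => Unit) (Equiv.sigmaCongrLeft e) (x := w)
    (Q.comp f fun i => Q.ofHom (b (e i)))
  have h3 := Q.act_act e (Equiv.sigmaUnique κ fun _ => Unit) (x := w)
    (Q.comp f fun i => Q.ofHom (b (e i)))
  exact (congrArg (Q.act _) h1).trans (h2.trans ((Q.act_heq (fun _ => rfl) HEq.rfl).trans h3.symm))

theorem post_post {x : ι → C} (f : Q.Hom x y) (t : y ⟶ y') (t' : y' ⟶ y'') :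
    Q.post (Q.post f t) t' = Q.post f (t ≫ t') := by
  let X := Q.comp (Q.comp (Q.ofHom t') fun _ : Unit => Q.ofHom t) fun _ : Σ _ : Unit, Unit => f
  have h1 := Q.comp_act_right (fun _ : Unit => Equiv.uniqueSigma fun _ : Unit => ι) (w := fun _ => x)
    (Q.ofHom t') fun _ => Q.comp (Q.ofHom t) fun _ => f
  have h2 := Q.assoc (Q.ofHom t') (fun _ : Unit => Q.ofHom t) fun _ _ => f
  have h3 := Q.comp_act_left (Equiv.uniqueSigma fun _ : Unit => Unit) (x := fun _ => y)
    (Q.comp (Q.ofHom t') fun _ : Unit => Q.ofHom t) fun _ => f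
  rw [Q.ofHom_comp] at h3
  have h4 := Q.act_act (Equiv.uniqueSigma fun _ : Unit => ι)
    (Equiv.sigmaCongrLeft (β := fun _ => ι) (Equiv.uniqueSigma fun _ : Unit => Unit)) (x := x) X
  have h5 := Q.act_act (Equiv.sigmaCongrRight fun _ : Unit => Equiv.uniqueSigma fun _ : Unit => ι)
    (Equiv.sigmaAssoc fun _ _ => ι) (x := fun p => x p.2) X
  have h6 := Q.act_act (Equiv.uniqueSigma fun _ : Unit => ι)
    (Equiv.sigmaCongrRight fun _ : Unit => Equiv.uniqueSigma fun _ : Unit => ι) (x := x)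
    (Q.act (Equiv.sigmaAssoc fun (_ : Unit) (_ : Unit) => ι) (x := fun q => x q.2.2) X)
  have h7 := Q.act_act ((Equiv.sigmaCongrRight fun _ : Unit => Equiv.uniqueSigma fun _ : Unit => ι).trans
    (Equiv.uniqueSigma fun _ : Unit => ι)) (Equiv.sigmaAssoc fun (_ : Unit) (_ : Unit) => ι) (x := x) X
  refine (congrArg (Q.act _) (h1.trans (congrArg (Q.act _) h2.symm))).trans (h6.trans (h7.trans ?_))
  refine Eq.trans ?_ (h4.symm.trans (congrArg (Q.act _) h3.symm))
  exact Q.act_heq (fun _ => rfl) HEq.rfl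

theorem pre_pre {x x' x'' : ι → C} (f : Q.Hom x y) (b : ∀ i, x' i ⟶ x i) (b' : ∀ i, x'' i ⟶ x' i) :
    Q.pre (Q.pre f b) b' = Q.pre f fun i => b' i ≫ b i := by
  let U : ι → Type := fun _ => Unit
  let X := Q.comp (Q.comp f fun i => Q.ofHom (b i)) fun p : Σ i, U i => Q.ofHom (b' p.1)
  have h1 := Q.comp_act_left (Equiv.sigmaUnique ι U) (x := x')
    (Q.comp f fun i => Q.ofHom (b i)) fun i => Q.ofHom (b' i)
  have h2 := Q.act_act (Equiv.sigmaUnique ι U)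
    (Equiv.sigmaCongrLeft (β := U) (Equiv.sigmaUnique ι U)) (x := x'') X
  have h3 := Q.assoc f (fun i => Q.ofHom (b i)) fun i _ => Q.ofHom (b' i)
  have h4 := Q.comp_act_right (fun i => Equiv.uniqueSigma fun _ : Unit => Unit) (w := fun i _ => x'' i)
    f fun i => Q.comp (Q.ofHom (b i)) fun _ => Q.ofHom (b' i)
  simp only [Q.ofHom_comp] at h4
  have h5 := Q.act_act (Equiv.sigmaUnique ι U)
    (Equiv.sigmaCongrRight fun i => Equiv.uniqueSigma fun _ : Unit => Unit) (x := x'')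
    (Q.act (Equiv.sigmaAssoc fun (_ : ι) (_ : Unit) => Unit) (x := fun q => x'' q.1) X)
  have h6 := Q.act_act ((Equiv.sigmaCongrRight fun i : ι => Equiv.uniqueSigma fun _ : Unit => Unit).trans
    (Equiv.sigmaUnique ι U)) (Equiv.sigmaAssoc fun (_ : ι) (_ : Unit) => Unit) (x := x'') X
  refine (congrArg (Q.act _) h1).trans (h2.trans ?_)
  refine Eq.trans ?_ (congrArg (Q.act _) (h4.trans (congrArg (Q.act _) h3.symm))).symm
  refine Eq.trans ?_ (h5.trans h6).symm
  exact Q.act_heq (fun _ => rfl) HEq.rfl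

theorem pre_post {x x' : ι → C} (f : Q.Hom x y) (b : ∀ i, x' i ⟶ x i) (t : y ⟶ y') :
    Q.pre (Q.post f t) b = Q.post (Q.pre f b) t := by
  let U : ι → Type := fun _ => Unit
  let X := Q.comp (Q.comp (Q.ofHom t) fun _ : Unit => f) fun p => Q.ofHom (b p.2)
  have h1 := Q.comp_act_left (Equiv.uniqueSigma fun _ : Unit => ι) (x := x)
    (Q.comp (Q.ofHom t) fun _ => f) fun i => Q.ofHom (b i)
  have h2 := Q.act_act (Equiv.sigmaUnique ι U)
    (Equiv.sigmaCongrLeft (β := U) (Equiv.uniqueSigma fun _ : Unit => ι)) (x := x') X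
  have h3 := Q.assoc (Q.ofHom t) (fun _ : Unit => f) fun _ i => Q.ofHom (b i)
  have h4 := Q.comp_act_right (fun _ : Unit => Equiv.sigmaUnique ι U) (w := fun _ i => x' i)
    (Q.ofHom t) fun _ => Q.comp f fun i => Q.ofHom (b i)
  have h5 := Q.act_act (Equiv.uniqueSigma fun _ : Unit => ι)
    (Equiv.sigmaCongrRight fun _ : Unit => Equiv.sigmaUnique ι U) (x := x')
    (Q.act (Equiv.sigmaAssoc fun (_ : Unit) (_ : ι) => Unit) (x := fun q => x' q.2.1) X)
  have h6 := Q.act_act ((Equiv.sigmaCongrRight fun _ : Unit => Equiv.sigmaUnique ι U).trans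
    (Equiv.uniqueSigma fun _ : Unit => ι)) (Equiv.sigmaAssoc fun (_ : Unit) (_ : ι) => Unit) (x := x') X
  refine (congrArg (Q.act _) h1).trans (h2.trans ?_)
  refine Eq.trans ?_ (congrArg (Q.act _) (h4.trans (congrArg (Q.act _) h3.symm))).symm
  refine Eq.trans ?_ (h5.trans h6).symm
  exact Q.act_heq (fun _ => rfl) HEq.rfl

end

/-- The objects of `elt Q`: the arrows of `Q(x₁, …, xₙ; x)`. -/
structure Elt where
  n : ℕ
  src : Fin n → C
  tgt : C
  arr : Q.Hom src tgt

variable {Q}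

/-- The morphisms of `elt Q`: a bijection between the inputs and morphisms of objects, such that the first
arrow becomes the second by composition with them. -/
@[ext] structure EltHom (f g : Q.Elt) where
  perm : Fin f.n ≃ Fin g.n
  input : ∀ j, g.src (perm j) ⟶ f.src j
  output : f.tgt ⟶ g.tgt
  comm : Q.act perm (x := g.src) (Q.post (Q.pre f.arr input) output) = g.arr

/-- The category `elt Q` of elements of `Q`. -/
instance : Category Q.Elt where
  Hom := EltHom
  id f := ⟨.refl _, fun j => 𝟙 (f.src j), 𝟙 f.tgt,
    (Q.act_refl _).trans ((congrArg (fun r => Q.post r (𝟙 f.tgt)) (Q.pre_id f.arr)).trans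
      (Q.post_id f.arr))⟩
  comp {f g h} γ δ := ⟨γ.perm.trans δ.perm, fun j => δ.input (γ.perm j) ≫ γ.input j,
    γ.output ≫ δ.output, by
      have h1 := Q.pre_pre f.arr γ.input fun j => δ.input (γ.perm j)
      have h2 := Q.post_post (Q.pre (Q.pre f.arr γ.input) fun j => δ.input (γ.perm j))
        γ.output δ.output
      rw [← Q.pre_post, h1] at h2
      refine (congrArg (Q.act _) h2.symm).trans ?_
      refine (Q.act_act δ.perm γ.perm (x := h.src) _).symm.trans ?_
      refine Eq.trans (congrArg _ ?_) δ.comm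
      refine Eq.trans ?_ (congrArg (fun r => Q.post (Q.pre r δ.input) δ.output) γ.comm)
      rw [Q.pre_act, Q.post_act]⟩
  id_comp γ := by
    refine EltHom.ext (Equiv.ext fun _ => rfl) (heq_of_eq ?_) (Category.id_comp _)
    funext j; exact Category.comp_id _
  comp_id γ := by
    refine EltHom.ext (Equiv.ext fun _ => rfl) (heq_of_eq ?_) (Category.comp_id _)
    funext j; exact Category.id_comp _
  assoc γ δ ε := by
    refine EltHom.ext (Equiv.ext fun _ => rfl) (heq_of_eq ?_) (Category.assoc _ _ _)
    funext j; exact (Category.assoc _ _ _).symm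

end SymMulticategory
end KM

namespace KM
open SymMulticategory
variable {C : Type u} [Category.{v} C] {Q : SymMulticategory.{u, v, w} C}

/-- Trees for composing the arrows `F i`. A node `node i a ch` carries `F i`, its inputs are the
trees `ch j`, and `a` is the label of the edge from its output; a leaf carries a label too. The index is the
object in which the tree ends. -/
inductive Tree {ι L : Type} (F : ι → Q.Elt) (z : L → C) : C → Type (max u v)
  | leaf {x : C} (l : L) (a : z l ⟶ x) : Tree F z x
  | node {x : C} (i : ι) (a : (F i).tgt ⟶ x) (ch : ∀ j, Tree F z ((F i).src j)) : Tree F z x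

namespace Tree
variable {ι κ L L' L'' : Type} {F : ι → Q.Elt} {F' : κ → Q.Elt} {z : L → C} {z' : L' → C}
  {z'' : L'' → C} {x y y' : C}

def postcomp : Tree F z x → (x ⟶ y) → Tree F z y
  | leaf l a, b => leaf l (a ≫ b)
  | node i a ch, b => node i (a ≫ b) ch

def graft {x : C} : Tree F z x → (∀ l, Tree F z' (z l)) → Tree F z' x
  | leaf l a, s => (s l).postcomp a
  | node i a ch, s => node i a fun j => (ch j).graft s

def replace {x : C} (R : ∀ i, Tree F' (F i).src (F i).tgt) : Tree F z x → Tree F' z x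
  | leaf l a => leaf l a
  | node i a ch => ((R i).postcomp a).graft fun j => (ch j).replace R

variable (F) in
/-- The tree with a single node. -/
def corolla (i : ι) : Tree F (F i).src (F i).tgt := node i (𝟙 _) fun j => leaf j (𝟙 _)

/-- Renaming of nodes. -/
def rename (e : κ → ι) (T : Tree (fun k => F (e k)) z x) : Tree F z x :=
  T.replace fun k => corolla F (e k)

theorem postcomp_id (T : Tree F z x) : T.postcomp (𝟙 x) = T := by
  cases T <;> simp [postcomp]

theorem postcomp_postcomp (T : Tree F z x) (a : x ⟶ y) (b : y ⟶ y') :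
    (T.postcomp a).postcomp b = T.postcomp (a ≫ b) := by
  cases T <;> simp [postcomp]

theorem postcomp_graft (T : Tree F z x) (s : ∀ l, Tree F z' (z l)) (a : x ⟶ y) :
    (T.postcomp a).graft s = (T.graft s).postcomp a := by
  cases T with
  | leaf l b => exact (postcomp_postcomp _ _ _).symm
  | node i b ch => rfl

theorem graft_graft (T : Tree F z x) (s : ∀ l, Tree F z' (z l)) (s' : ∀ l, Tree F z'' (z' l)) :
    (T.graft s).graft s' = T.graft fun l => (s l).graft s' := by
  induction T with
  | leaf l a => exact postcomp_graft _ _ _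
  | node i a ch ih => simp only [graft]; congr 1; funext j; exact ih j

theorem graft_leaf (T : Tree F z x) : (T.graft fun l => leaf l (𝟙 _)) = T := by
  induction T with
  | leaf l a => simp [graft, postcomp]
  | node i a ch ih => simp only [graft]; congr 1; funext j; exact ih j

theorem replace_postcomp (R : ∀ i, Tree F' (F i).src (F i).tgt) (T : Tree F z x) (a : x ⟶ y) :
    (T.postcomp a).replace R = (T.replace R).postcomp a := by
  cases T with
  | leaf l b => rfl
  | node i b ch =>
    change ((R i).postcomp (b ≫ a)).graft _ = (((R i).postcomp b).graft _).postcomp a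
    rw [← postcomp_postcomp, postcomp_graft]

theorem replace_graft (R : ∀ i, Tree F' (F i).src (F i).tgt) (T : Tree F z x)
    (s : ∀ l, Tree F z' (z l)) :
    (T.graft s).replace R = (T.replace R).graft fun l => (s l).replace R := by
  induction T with
  | leaf l b => exact replace_postcomp R _ _
  | node i b ch ih =>
    simp only [graft, replace]
    rw [graft_graft]
    congr 1; funext j; exact ih j

theorem replace_replace {μ : Type} {F'' : μ → Q.Elt} (R : ∀ i, Tree F' (F i).src (F i).tgt)
    (R' : ∀ k, Tree F'' (F' k).src (F' k).tgt) (T : Tree F z x) :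
    (T.replace R).replace R' = T.replace fun i => (R i).replace R' := by
  induction T with
  | leaf l b => rfl
  | node i b ch ih =>
    simp only [replace]
    rw [replace_graft, replace_postcomp]
    congr 1; funext j; exact ih j

theorem replace_corolla (R : ∀ i, Tree F' (F i).src (F i).tgt) (i : ι) :
    (corolla F i).replace R = R i := by
  simp only [corolla, replace, postcomp_id, graft_leaf]

theorem replace_id (T : Tree F z x) : T.replace (corolla F) = T := by
  induction T with
  | leaf l a => rfl
  | node i a ch ih =>
    change node i (𝟙 _ ≫ a) (fun j => ((ch j).replace (corolla F)).postcomp (𝟙 _)) = _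
    rw [Category.id_comp]
    congr 1; funext j; rw [postcomp_id]; exact ih j

theorem rename_id (T : Tree F z x) : rename (F := F) (fun i => i) T = T := replace_id T

theorem rename_rename {μ : Type} (e : κ → ι) (e' : μ → κ) (T : Tree (fun m => F (e (e' m))) z x) :
    rename (F := F) e (rename (F := fun k => F (e k)) e' T) = rename (fun m => e (e' m)) T := by
  simp only [rename]
  rw [replace_replace]
  simp only [replace_corolla]

theorem replace_rename (e : κ → ι) {μ : Type} {F'' : μ → Q.Elt}
    (R : ∀ i, Tree F'' (F i).src (F i).tgt) (T : Tree (fun k => F (e k)) z x) :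
    (rename e T).replace R = T.replace fun k => R (e k) := by
  simp only [rename]
  rw [replace_replace]
  simp only [replace_corolla]

theorem rename_replace (e : κ → ι) {μ : Type} {F'' : μ → Q.Elt}
    (R : ∀ m, Tree (fun k => F (e k)) (F'' m).src (F'' m).tgt) (T : Tree F'' z x) :
    rename (F := F) e (T.replace R) = T.replace fun m => rename e (R m) :=
  replace_replace _ _ _

end Tree

/-- `Composes T ν ρ g`: `ν` and `ρ` list the nodes and the leaves of the tree, each once, and `g` is the
result of composing along the tree. -/
inductive Composes {ι L : Type} {F : ι → Q.Elt} {z : L → C} :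
    ∀ {x : C} (_ : Tree F z x) {κ μ : Type} [Finite μ] (_ : κ → ι) (ρ : μ → L)
      (_ : Q.Hom (fun m => z (ρ m)) x), Prop
  | leaf {x : C} (l : L) (a : z l ⟶ x) :
      Composes (.leaf l a) (κ := Empty) (μ := Unit) Empty.elim (fun _ => l) (Q.ofHom a)
  | node {x : C} (i : ι) (a : (F i).tgt ⟶ x) (ch : ∀ j, Tree F z ((F i).src j))
      {κ μ : Fin (F i).n → Type} [∀ j, Finite (μ j)] {ν : ∀ j, κ j → ι} {ρ : ∀ j, μ j → L}
      {g : ∀ j, Q.Hom (fun m => z (ρ j m)) ((F i).src j)}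
      (h : ∀ j, Composes (ch j) (ν j) (ρ j) (g j)) :
      Composes (.node i a ch) (κ := Unit ⊕ Σ j, κ j) (μ := Σ j, μ j)
        (Sum.elim (fun _ => i) fun p => ν p.1 p.2) (fun p => ρ p.1 p.2)
        (Q.post (Q.comp (F i).arr g) a)
  | perm {x : C} {T : Tree F z x} {κ κ' μ μ' : Type} [Finite μ] [Finite μ'] (e : κ' ≃ κ) (d : μ' ≃ μ)
      {ν : κ → ι} {ρ : μ → L} {g : Q.Hom (fun m => z (ρ (d m))) x}
      (h : Composes T (fun k => ν (e k)) (fun m => ρ (d m)) g) : Composes T ν ρ (Q.act d g)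

namespace SymMulticategory
section
variable (Q)
variable {ι : Type} [Finite ι] {κ : ι → Type} [∀ i, Finite (κ i)] {w : ∀ i, κ i → C} {x : ι → C}
    {y y' : C}

theorem comp_post (f : Q.Hom x y) (g : ∀ i, Q.Hom (w i) (x i)) (t : y ⟶ y') :
    Q.comp (Q.post f t) g = Q.post (Q.comp f g) t := by
  let X := Q.comp (Q.comp (Q.ofHom t) fun _ : Unit => f) fun p => g p.2
  have h1 := Q.comp_act_left (Equiv.uniqueSigma fun _ : Unit => ι) (x := x)
    (Q.comp (Q.ofHom t) fun _ => f) g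
  have h3 := Q.assoc (Q.ofHom t) (fun _ : Unit => f) fun _ i => g i
  have h4 := Q.act_act (Equiv.uniqueSigma fun _ : Unit => Σ i, κ i)
    (Equiv.sigmaAssoc fun (_ : Unit) => κ) (x := fun p => w p.1 p.2) X
  refine h1.trans (Eq.trans ?_ (h4.symm.trans (congrArg (Q.act _) h3)))
  exact Q.act_heq (fun _ => rfl) HEq.rfl

theorem comp_pre {x' : ι → C} (f : Q.Hom x y) (b : ∀ i, x' i ⟶ x i) (g : ∀ i, Q.Hom (w i) (x' i)) :
    Q.comp (Q.pre f b) g = Q.comp f (fun i => Q.post (g i) (b i)) := by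
  let U : ι → Type := fun _ => Unit
  let X := Q.comp (Q.comp f fun i => Q.ofHom (b i)) fun p : Σ i, U i => g p.1
  have h1 := Q.comp_act_left (Equiv.sigmaUnique ι U) (x := x')
    (Q.comp f fun i => Q.ofHom (b i)) g
  have h3 := Q.assoc f (fun i => Q.ofHom (b i)) fun i _ => g i
  have h4 := Q.comp_act_right (fun i => Equiv.uniqueSigma fun _ : Unit => κ i) (w := w)
    f fun i => Q.comp (Q.ofHom (b i)) fun _ => g i
  have h5 := Q.act_act (Equiv.sigmaCongrRight fun i => Equiv.uniqueSigma fun _ : Unit => κ i)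
    (Equiv.sigmaAssoc fun i (_ : Unit) => κ i) (x := fun p => w p.1 p.2) X
  refine h1.trans (Eq.trans ?_ (h5.symm.trans ((congrArg (Q.act _) h3).trans h4.symm)))
  exact Q.act_heq (fun _ => rfl) HEq.rfl

theorem comp_ofHom {ι : Type} [Finite ι] {x : ι → C} (f : Q.Hom x y) (t : y ⟶ y') :
    Q.comp (Q.ofHom t) (fun _ => f) =
      Q.act (Equiv.uniqueSigma fun _ : Unit => ι).symm (x := fun p => x p.2) (Q.post f t) := by
  have h := Q.act_act (Equiv.uniqueSigma fun _ : Unit => ι).symm (Equiv.uniqueSigma fun _ : Unit => ι)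
    (x := fun p => x p.2) (Q.comp (Q.ofHom t) fun _ => f)
  refine Eq.trans ?_ h.symm
  refine (Q.act_refl _).symm.trans ?_
  exact Q.act_heq (fun _ => rfl) HEq.rfl

theorem comp_comp {μ : ∀ i, κ i → Type} [∀ i k, Finite (μ i k)] {v : ∀ i k, μ i k → C}
    (f : Q.Hom x y) (g : ∀ i, Q.Hom (w i) (x i)) (h : ∀ i k, Q.Hom (v i k) (w i k)) :
    (Q.comp (Q.comp f g) fun p => h p.1 p.2) =
      Q.act (Equiv.sigmaAssoc μ).symm (x := fun q => v q.1.1 q.1.2 q.2)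
        (Q.comp f fun i => Q.comp (g i) (h i)) := by
  rw [← Q.assoc]
  have h := Q.act_act (Equiv.sigmaAssoc μ).symm (Equiv.sigmaAssoc μ)
    (x := fun q => v q.1.1 q.1.2 q.2) (Q.comp (Q.comp f g) fun p => h p.1 p.2)
  refine Eq.trans ?_ h.symm
  refine (Q.act_refl _).symm.trans ?_
  exact Q.act_heq (fun _ => rfl) HEq.rfl

end
end SymMulticategory

namespace Composes
variable {ι κ L : Type} {F : ι → Q.Elt} {F' : κ → Q.Elt} {z : L → C} {x y : C}

theorem postcomp {T : Tree F z x} {κ μ : Type} [Finite μ] {ν : κ → ι} {ρ : μ → L}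
    {g : Q.Hom (fun m => z (ρ m)) x} (h : Composes T ν ρ g) (a : x ⟶ y) :
    Composes (T.postcomp a) ν ρ (Q.post g a) := by
  induction h with
  | leaf l b =>
    have := Q.ofHom_comp b a
    refine (congrArg (Composes _ _ _) this).mpr (.leaf l (b ≫ a))
  | node i b ch h _ => rw [Q.post_post]; exact .node i (b ≫ a) ch h
  | perm e d h ih => rw [Q.post_act]; exact .perm e d (ih a)

theorem graft {L' : Type} {z' : L' → C} {T : Tree F z x} {κ μ : Type} [Finite μ] {ν : κ → ι}
    {ρ : μ → L} {g : Q.Hom (fun m => z (ρ m)) x} (h : Composes T ν ρ g)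
    {s : ∀ l, Tree F z' (z l)} {κ' μ' : μ → Type} [∀ m, Finite (μ' m)] {ν' : ∀ m, κ' m → ι}
    {ρ' : ∀ m, μ' m → L'} {g' : ∀ m, Q.Hom (fun p => z' (ρ' m p)) (z (ρ m))}
    (h' : ∀ m, Composes (s (ρ m)) (ν' m) (ρ' m) (g' m)) :
    Composes (T.graft s) (κ := κ ⊕ Σ m, κ' m) (μ := Σ m, μ' m)
      (Sum.elim ν fun p => ν' p.1 p.2) (fun p => ρ' p.1 p.2) (Q.comp g g') := by
  induction h with
  | leaf l b =>
    have h1 := (h' ()).postcomp b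
    refine (congrArg (Composes _ _ _) (Q.comp_ofHom (g' ()) b)).mpr ?_
    exact Composes.perm ((Equiv.uniqueSigma κ').symm.trans (Equiv.emptySum Empty _).symm)
      (Equiv.uniqueSigma fun _ : Unit => μ' ()).symm h1
  | @node x i b ch κ μ _ ν ρ g h ih =>
    have h1 := Composes.node i b (fun j => (ch j).graft s) fun j => ih j fun m => h' ⟨j, m⟩
    refine (congrArg (Composes _ _ _) ((Q.comp_post _ _ _).trans ((congrArg (fun r => Q.post r b)
      (Q.comp_comp (F i).arr g fun j m => g' ⟨j, m⟩)).trans (Q.post_act _ _ _)))).mpr ?_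
    let e : ((Unit ⊕ Σ j, κ j) ⊕ Σ m : (Σ j, μ j), κ' m) ≃
      (Unit ⊕ Σ j, (κ j ⊕ Σ m : μ j, κ' ⟨j, m⟩)) :=
      (Equiv.sumAssoc _ _ _).trans (Equiv.sumCongr (Equiv.refl _)
        ((Equiv.sumCongr (Equiv.refl _) (Equiv.sigmaAssoc fun j m => κ' ⟨j, m⟩)).trans
          (Equiv.sigmaSumDistrib _ _).symm))
    refine Composes.perm e.symm _ ?_
    refine (congrArg (fun r => Composes _ r _ _) (?_ : _ = _)).mp h1
    funext r
    rcases r with _ | ⟨j, _ | _⟩ <;> rfl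
  | perm e d h ih =>
    refine (congrArg (Composes _ _ _) (Q.comp_act_left _ _ _)).mpr ?_
    refine Composes.perm (Equiv.sumCongr e (Equiv.sigmaCongrLeft (β := κ') d))
      (Equiv.sigmaCongrLeft (β := μ') d) ?_
    refine (congrArg (fun r => Composes _ r _ _) (?_ : _ = _)).mp (ih fun m => h' (d m))
    funext r
    rcases r with _ | ⟨j, _⟩ <;> rfl

theorem replace {T : Tree F z x} {κ₀ μ : Type} [Finite μ] {ν : κ₀ → ι}
    {ρ : μ → L} {g : Q.Hom (fun m => z (ρ m)) x} (h : Composes T ν ρ g)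
    {R : ∀ i, Tree F' (F i).src (F i).tgt} {κ' : ι → Type} {ν' : ∀ i, κ' i → κ}
    (h' : ∀ i, Composes (R i) (ν' i) (fun j => j) (F i).arr) :
    Composes (T.replace R) (κ := Σ k, κ' (ν k)) (fun p => ν' (ν p.1) p.2) ρ g := by
  induction h with
  | leaf l a =>
    refine (congrArg (Composes _ _ _) (Q.act_refl _)).mp (Composes.perm
      (Equiv.equivEmpty (Σ k : Empty, κ' (Empty.elim k))).symm (Equiv.refl _) ?_)
    refine (congrArg (fun r => Composes _ r _ _) (?_ : _ = _)).mp (Composes.leaf l a)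
    funext r; cases r
  | @node x i a ch κ μ _ ν ρ g h ih =>
    have h1 := ((h' i).postcomp a).graft ih
    refine (congrArg (Composes _ _ _) (Q.act_refl _)).mp ?_
    let e : (Σ k : Unit ⊕ Σ j, κ j, κ' (Sum.elim (fun _ => i) (fun p => ν p.1 p.2) k)) ≃
      (κ' i ⊕ Σ j, Σ k : κ j, κ' (ν j k)) :=
      (Equiv.sumSigmaDistrib _).trans (Equiv.sumCongr (Equiv.uniqueSigma fun _ : Unit => κ' i)
        (Equiv.sigmaAssoc fun j k => κ' (ν j k)))
    refine Composes.perm e.symm (Equiv.refl _) ?_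
    rw [← Q.comp_post]
    refine (congrArg (fun r => Composes _ r _ _) (?_ : _ = _)).mp h1
    funext r
    rcases r with _ | _ <;> rfl
  | perm e d h ih =>
    refine Composes.perm (Equiv.sigmaCongrLeft (β := fun k => κ' _) e) d ?_
    exact ih

theorem corolla' (F : ι → Q.Elt) (i : ι) [Finite L] {z : L → C} {y : C} (d : Fin (F i).n ≃ L)
    (b : ∀ j, z (d j) ⟶ (F i).src j) (t : (F i).tgt ⟶ y) :
    Composes (.node (F := F) i t fun j => .leaf (d j) (b j)) (fun _ : Unit => i) (fun l => l)
      (Q.act d (Q.post (Q.pre (F i).arr b) t)) := by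
  have h := Composes.node i t (fun j => .leaf (d j) (b j)) fun j =>
    Composes.leaf (F := F) (z := z) (d j) (b j)
  refine Composes.perm (Equiv.refl Unit) d ?_
  refine (congrArg (Composes _ _ _) (Q.post_act _ _ _)).mpr ?_
  have : IsEmpty (Σ _ : Fin (F i).n, Empty) := ⟨fun p => p.2.elim⟩
  refine Composes.perm (Equiv.sumEmpty Unit (Σ _ : Fin (F i).n, Empty))
    (Equiv.sigmaUnique (Fin (F i).n) fun _ => Unit) ?_
  refine (congrArg (fun r => Composes _ r _ _) (?_ : _ = _)).mp h
  funext r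
  rcases r with _ | ⟨_, ⟨⟩⟩; rfl

theorem corolla (i : ι) : Composes (Tree.corolla F i) (fun _ : Unit => i) (fun j => j) (F i).arr := by
  have h := corolla' F i (Equiv.refl _) (fun j => 𝟙 ((F i).src j)) (𝟙 (F i).tgt)
  rw [Q.post_id] at h
  exact (congrArg (Composes _ _ _) ((Q.act_refl _).trans (Q.pre_id _))).mp h

theorem rename {e : κ → ι} {T : Tree (fun k => F (e k)) z x} {κ₀ μ : Type} [Finite μ] {ν : κ₀ → κ}
    {ρ : μ → L} {g : Q.Hom (fun m => z (ρ m)) x} (h : Composes T ν ρ g) :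
    Composes (T.rename e) (fun k => e (ν k)) ρ g := by
  have h1 := h.replace fun k => corolla (F := F) (e k)
  refine (congrArg (Composes _ _ _) (Q.act_refl _)).mp (Composes.perm
      (Equiv.sigmaUnique κ₀ fun _ => Unit) (Equiv.refl _) ?_)
  exact h1

theorem perm_nodes {T : Tree F z x} {κ κ' μ : Type} [Finite μ] (e : κ' ≃ κ) {ν : κ → ι} {ρ : μ → L}
    {g : Q.Hom (fun m => z (ρ m)) x} (h : Composes T (fun k => ν (e k)) ρ g) : Composes T ν ρ g :=
  (congrArg (Composes _ _ _) (Q.act_refl _)).mp (Composes.perm e (Equiv.refl _) h)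

end Composes

/-- A configuration for composing the arrows `F i` to yield `f`: a tree whose nodes are the `F i`,
each used once, whose leaves are the inputs of `f`, and whose composite is `f`. -/
@[ext] structure Config {ι : Type} (F : ι → Q.Elt) (f : Q.Elt) where
  tree : Tree F f.src f.tgt
  composes : Composes tree (fun i => i) (fun l => l) f.arr

namespace Config
variable {ι κ : Type}

/-- Reindexing the arrows to be composed. -/
def act (e : κ ≃ ι) {F : ι → Q.Elt} {f : Q.Elt} (c : Config (fun k => F (e k)) f) : Config F f :=
  ⟨c.tree.rename e, by
    have h := c.composes.rename (F := F) (e := e)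
    exact h.perm_nodes e⟩

/-- Composition of configurations: replacing the nodes of a tree by trees. -/
def comp {κ : ι → Type} {G : ∀ i, κ i → Q.Elt} {F : ι → Q.Elt} {f : Q.Elt} (c : Config F f)
    (d : ∀ i, Config (G i) (F i)) : Config (fun p : Σ i, κ i => G p.1 p.2) f :=
  ⟨c.tree.replace fun i => (d i).tree.rename (F := fun p : Σ i, κ i => G p.1 p.2) (Sigma.mk i),
    Composes.replace (ν' := fun i k => (⟨i, k⟩ : Σ i, κ i)) c.composes fun i =>
      (d i).composes.rename (F := fun p : Σ i, κ i => G p.1 p.2)⟩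

/-- The configuration with a single node given by a morphism of `elt Q`. -/
def ofHom {f g : Q.Elt} (γ : f ⟶ g) : Config (fun _ : Unit => f) g :=
  ⟨.node () γ.output fun j => .leaf (γ.perm j) (γ.input j), by
    have h := Composes.corolla' (z := g.src) (fun _ : Unit => f) () γ.perm γ.input γ.output
    exact (congrArg (Composes _ _ _) γ.comm).mp h⟩

end Config

/-- The slice multicategory `Q⁺`: its category of objects is `elt Q`, and an arrow in
`Q⁺(F₁, …, Fₙ; f)` is a configuration for composing `F₁, …, Fₙ` to yield `f`. -/
def SymMulticategory.slice (Q : SymMulticategory.{u, v, w} C) :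
    SymMulticategory.{max u w, v, max u v} Q.Elt where
  Hom F f := Config F f
  ofHom := Config.ofHom
  comp := Config.comp
  act e _ _ := Config.act e
  act_refl c := Config.ext (Tree.rename_id _)
  act_act e e' F f c := Config.ext (Tree.rename_rename (F := F) e e' c.tree)
  id_comp {ι _ F f} c := by
    have h1 := Tree.replace_corolla (F := fun _ : Unit => f)
      (fun i => c.tree.rename (F := fun p : Σ _ : Unit, ι => F p.2) (Sigma.mk i)) ()
    have h2 := Tree.rename_rename (F := F) (Equiv.uniqueSigma fun _ : Unit => ι) (Sigma.mk ()) c.tree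
    exact Config.ext ((congrArg (Tree.rename _) h1).trans (h2.trans (Tree.rename_id _)))
  comp_id {ι _ F f} c := by
    have h1 : ∀ i, Tree.rename (F := fun p : Σ _ : ι, Unit => F p.1) (Sigma.mk i)
        (Tree.corolla (fun _ : Unit => F i) ()) = Tree.corolla (fun p : Σ _ : ι, Unit => F p.1) ⟨i, ()⟩ :=
      fun i => Tree.replace_corolla _ _
    have h2 := Tree.rename_rename (F := F) (Equiv.sigmaUnique ι fun _ => Unit)
      (fun i => ⟨i, ()⟩) c.tree
    refine Config.ext (Eq.trans (congrArg (Tree.rename _) ?_) (h2.trans (Tree.rename_id _)))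
    exact congrArg (fun R => Tree.replace R c.tree) (funext h1)
  assoc {ι _ κ _ μ _ v w x y} f g h := by
    refine Config.ext ?_
    let V : (Σ i, Σ k, μ i k) → Q.Elt := fun q => v q.1 q.2.1 q.2.2
    let V' : (Σ p : Σ i, κ i, μ p.1 p.2) → Q.Elt := fun q => v q.1.1 q.1.2 q.2
    have h1 := Tree.replace_replace
      (fun i => (g i).tree.rename (F := fun p : Σ i, κ i => w p.1 p.2) (Sigma.mk i))
      (fun p => (h p.1 p.2).tree.rename (F := V') (Sigma.mk p)) f.tree
    have h2 := fun i => Tree.replace_rename (F := fun p : Σ i, κ i => w p.1 p.2) (Sigma.mk i)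
      (fun p => (h p.1 p.2).tree.rename (F := V') (Sigma.mk p)) (g i).tree
    have h3 := Tree.rename_replace (F := V) (Equiv.sigmaAssoc μ)
      (fun i => Tree.replace (fun k => (h i k).tree.rename (F := V') (Sigma.mk ⟨i, k⟩)) (g i).tree) f.tree
    refine (congrArg (Tree.rename _) (h1.trans (congrArg (fun R => Tree.replace R f.tree)
      (funext h2)))).trans (h3.trans ?_)
    refine congrArg (fun R => Tree.replace R f.tree) (funext fun i => ?_)
    have h4 := Tree.rename_replace (F := V) (Equiv.sigmaAssoc μ)
      (fun k => (h i k).tree.rename (F := V') (Sigma.mk ⟨i, k⟩)) (g i).tree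
    have h5 := Tree.rename_replace (F := V) (Sigma.mk i)
      (fun k => (h i k).tree.rename (F := fun p : Σ k, μ i k => v i p.1 p.2) (Sigma.mk k)) (g i).tree
    refine h4.trans (Eq.trans ?_ h5.symm)
    refine congrArg (fun R => Tree.replace R (g i).tree) (funext fun k => ?_)
    have h6 := Tree.rename_rename (F := V) (Equiv.sigmaAssoc μ) (Sigma.mk ⟨i, k⟩) (h i k).tree
    have h7 := Tree.rename_rename (F := V) (Sigma.mk i) (Sigma.mk k) (h i k).tree
    exact h6.trans h7.symm
  comp_act_left {ι ι' _ _ e κ _ w x y} f g := by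
    refine Config.ext ?_
    let W : (Σ i, κ i) → Q.Elt := fun q => w q.1 q.2
    have h1 := Tree.replace_rename e (fun i => (g i).tree.rename (F := W) (Sigma.mk i)) f.tree
    have h2 := Tree.rename_replace (F := W) (Equiv.sigmaCongrLeft (β := κ) e)
      (fun i => (g (e i)).tree.rename (F := fun p : Σ i, κ (e i) => w (e p.1) p.2) (Sigma.mk i)) f.tree
    refine h1.trans (Eq.trans ?_ h2.symm)
    refine congrArg (fun R => Tree.replace R f.tree) (funext fun i => ?_)
    exact (Tree.rename_rename (F := W) (Equiv.sigmaCongrLeft (β := κ) e) (Sigma.mk i) _).symm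
  comp_act_right {ι _ κ κ' _ _ e w x y} f g := by
    refine Config.ext ?_
    let W : (Σ i, κ i) → Q.Elt := fun q => w q.1 q.2
    have h1 := Tree.rename_replace (F := W) (Equiv.sigmaCongrRight e)
      (fun i => (g i).tree.rename (F := fun p : Σ i, κ' i => w p.1 (e p.1 p.2)) (Sigma.mk i)) f.tree
    refine Eq.trans ?_ h1.symm
    refine congrArg (fun R => Tree.replace R f.tree) (funext fun i => ?_)
    have h1 := Tree.rename_rename (F := W) (Sigma.mk i) (e i) (g i).tree
    have h2 := Tree.rename_rename (F := W) (Equiv.sigmaCongrRight e) (Sigma.mk i) (g i).tree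
    exact h1.trans h2.symm
  ofHom_comp γ δ := by
    refine Config.ext ?_
    simp [Config.act, Config.comp, Config.ofHom, Tree.rename, Tree.replace, Tree.graft,
      Tree.postcomp, Tree.corolla]
    exact ⟨rfl, rfl⟩

end KM

namespace KM
open SignedSet Matching
variable {C : Type u} [Category.{v} C]

namespace Matching
variable {X X' X'' Y Y' Y'' Z : SignedSet C}

/-- Paths through the first arguments of internal homs. -/
def homVertexL {A : C} : State (vertexLab X'' X' X) A →
    State (vertexLab (X.ihom Y) (X'.ihom Y') (X''.ihom Y'')) A
  | ⟨.inl (.inl (.inl p)), k⟩ => ⟨.inl (.inr (.inr (.inl p))), k⟩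
  | ⟨.inl (.inl (.inr n)), k⟩ => ⟨.inl (.inr (.inl (.inl n))), k⟩
  | ⟨.inl (.inr (.inl p)), k⟩ => ⟨.inl (.inl (.inr (.inl p))), k⟩
  | ⟨.inl (.inr (.inr n)), k⟩ => ⟨.inl (.inl (.inl (.inl n))), k⟩
  | ⟨.inr (.inl n), k⟩ => ⟨.inr (.inr (.inl n)), k⟩
  | ⟨.inr (.inr p), k⟩ => ⟨.inr (.inl (.inl p)), k⟩

/-- Paths through the second arguments of internal homs. -/
def homVertexR {A : C} : State (vertexLab Y Y' Y'') A →
    State (vertexLab (X.ihom Y) (X'.ihom Y') (X''.ihom Y'')) A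
  | ⟨.inl (.inl (.inl p)), k⟩ => ⟨.inl (.inl (.inl (.inr p))), k⟩
  | ⟨.inl (.inl (.inr n)), k⟩ => ⟨.inl (.inl (.inr (.inr n))), k⟩
  | ⟨.inl (.inr (.inl p)), k⟩ => ⟨.inl (.inr (.inl (.inr p))), k⟩
  | ⟨.inl (.inr (.inr n)), k⟩ => ⟨.inl (.inr (.inr (.inr n))), k⟩
  | ⟨.inr (.inl n), k⟩ => ⟨.inr (.inl (.inr n)), k⟩
  | ⟨.inr (.inr p), k⟩ => ⟨.inr (.inr (.inr p)), k⟩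

theorem ihom_comp (f' : Matching X'' X') (f : Matching X' X) (g : Matching Y Y')
    (g' : Matching Y' Y'') : (f'.comp f).ihom (g.comp g') = (f.ihom g).comp (f'.ihom g') := by
  have keyL : ∀ {A : C} (σ τ : State (vertexLab X'' X' X) A), Next f' f σ τ →
      Run (f.ihom g) (f'.ihom g') (homVertexL σ) (homVertexL τ) := by
    intro A σ τ h
    cases h with
    | @left a k τ h =>
      have h' := push_homL f' g' ⟨a, k⟩
      rw [h] at h'
      have e : homVertexL (X := X) (Y := Y) (exitLeft τ) = exitRight (homLeft (Y := Y') (Y' := Y'') τ) := by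
        rcases τ with ⟨b | b, l⟩ <;> rfl
      rw [e]
      rcases a with a | a <;> exact .single (.right h')
    | @right a k τ h =>
      have h' := push_homL f g ⟨a, k⟩
      rw [h] at h'
      have e : homVertexL (X'' := X'') (Y'' := Y'') (exitRight τ) =
          exitLeft (homLeft (Y := Y) (Y' := Y') τ) := by
        rcases τ with ⟨b | b, l⟩ <;> rfl
      rw [e]
      rcases a with a | a <;> exact .single (.left h')
  have keyR : ∀ {A : C} (σ τ : State (vertexLab Y Y' Y'') A), Next g g' σ τ →
      Run (f.ihom g) (f'.ihom g') (homVertexR σ) (homVertexR τ) := by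
    intro A σ τ h
    cases h with
    | @left a k τ h =>
      have h' := push_homR f g ⟨a, k⟩
      rw [h] at h'
      have e : homVertexR (X'' := X'') (Y'' := Y'') (exitLeft τ) =
          exitLeft (homRight (X := X) (X' := X') τ) := by
        rcases τ with ⟨b | b, l⟩ <;> rfl
      rw [e]
      rcases a with a | a <;> exact .single (.left h')
    | @right a k τ h =>
      have h' := push_homR f' g' ⟨a, k⟩
      rw [h] at h'
      have e : homVertexR (X := X) (Y := Y) (exitRight τ) =
          exitRight (homRight (X := X') (X' := X'') τ) := by
        rcases τ with ⟨b | b, l⟩ <;> rfl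
      rw [e]
      rcases a with a | a <;> exact .single (.right h')
  symm
  apply ext_push'
  intro A ρ
  apply push_comp_of_run
  have L := fun ρ => Relation.ReflTransGen.lift' _ keyL _ _ (run_of_push_comp (f := f') (g := f) (A := A) ρ)
  have R := fun ρ => Relation.ReflTransGen.lift' _ keyR _ _ (run_of_push_comp (f := g) (g := g') (A := A) ρ)
  rcases ρ with ⟨(a | a) | (a | a), k⟩
  · have h := push_homL (f'.comp f) (g.comp g') ⟨.inr a, k⟩
    have h2 := L ⟨.inr a, k⟩
    generalize (f'.comp f).push ⟨.inr a, k⟩ = τ at h h2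
    refine (congrArg (fun t : State _ A => Run _ _ _ ⟨.inr t.1, t.2⟩) h).mpr ?_
    rcases τ with ⟨b | b, l⟩ <;> exact h2
  · have h := push_homR (f'.comp f) (g.comp g') ⟨.inl a, k⟩
    have h2 := R ⟨.inl a, k⟩
    generalize (g.comp g').push ⟨.inl a, k⟩ = τ at h h2
    refine (congrArg (fun t : State _ A => Run _ _ _ ⟨.inr t.1, t.2⟩) h).mpr ?_
    rcases τ with ⟨b | b, l⟩ <;> exact h2
  · have h := push_homL (f'.comp f) (g.comp g') ⟨.inl a, k⟩
    have h2 := L ⟨.inl a, k⟩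
    generalize (f'.comp f).push ⟨.inl a, k⟩ = τ at h h2
    refine (congrArg (fun t : State _ A => Run _ _ _ ⟨.inr t.1, t.2⟩) h).mpr ?_
    rcases τ with ⟨b | b, l⟩ <;> exact h2
  · have h := push_homR (f'.comp f) (g.comp g') ⟨.inr a, k⟩
    have h2 := R ⟨.inr a, k⟩
    generalize (g.comp g').push ⟨.inr a, k⟩ = τ at h h2
    refine (congrArg (fun t : State _ A => Run _ _ _ ⟨.inr t.1, t.2⟩) h).mpr ?_
    rcases τ with ⟨b | b, l⟩ <;> exact h2

theorem ihom_id : (Matching.id X).ihom (Matching.id Y) = Matching.id (X.ihom Y) := by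
  apply ext_step
  rintro ((a | a) | (a | a)) <;> rfl

theorem single_id (A : C) : Matching.single (𝟙 A) = Matching.id _ := by
  apply ext_step
  rintro (⟨⟨⟩⟩ | ⟨⟨⟩⟩); rfl

end Matching

/-- Positive variables indexed by a finite type. -/
def SignedSet.family {ι : Type} [Finite ι] (x : ι → C) : SignedSet C where
  P := ι
  N := Empty
  lP := x
  lN := Empty.elim

namespace Matching
variable {ι κ μ : Type} [Finite ι] [Finite κ] [Finite μ]

/-- The graph of a bijection with labels. -/
def reindex {x : ι → C} {y : κ → C} (σ : ι ≃ κ) (t : ∀ j, y (σ j) ⟶ x j) :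
    Matching (family y) (family x) :=
  ofInv (fun
      | .inl i => ⟨.inr (σ.symm i), eqToHom (congrArg y (σ.apply_symm_apply i).symm) ≫ t (σ.symm i)⟩)
    (fun | .inr j => .inl (σ j))
    (by rintro (i | ⟨⟨⟩⟩); exact congrArg Sum.inl (σ.apply_symm_apply i))
    (by rintro (⟨⟨⟩⟩ | j); exact congrArg Sum.inr (σ.symm_apply_apply j))

theorem push_reindex {x : ι → C} {y : κ → C} (σ : ι ≃ κ) (t : ∀ j, y (σ j) ⟶ x j) {A : C} (j : ι)
    (k : A ⟶ y (σ j)) : (reindex σ t).push ⟨.inl (σ j), k⟩ = ⟨.inr j, k ≫ t j⟩ := by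
  have h : ∀ (i : ι) (h : i = j), (⟨.inr i, k ≫ eqToHom (congrArg (fun i => y (σ i)) h.symm) ≫ t i⟩ :
      State (tgtLab (family y) (family x)) A) = ⟨.inr j, k ≫ t j⟩ := by
    rintro _ rfl
    exact Sigma.ext rfl (heq_of_eq (congrArg (k ≫ ·) (Category.id_comp _)))
  exact h (σ.symm (σ j)) (σ.symm_apply_apply j)

theorem ext_family {x : ι → C} {y : κ → C} (σ : ι ≃ κ) {f g : Matching (family y) (family x)}
    (h : ∀ {A} (j : ι) (k : A ⟶ y (σ j)), f.push ⟨.inl (σ j), k⟩ = g.push ⟨.inl (σ j), k⟩) :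
    f = g := by
  apply ext_push'
  rintro A ⟨i | ⟨⟨⟩⟩, k⟩
  obtain ⟨j, rfl⟩ := σ.surjective i
  exact h j k

theorem reindex_id (x : ι → C) : reindex (Equiv.refl ι) (fun j => 𝟙 (x j)) = Matching.id (family x) := by
  apply ext_family (Equiv.refl ι)
  intro A j k
  exact (push_reindex (Equiv.refl ι) (fun j => 𝟙 (x j)) j k)

theorem comp_push_pos {X Y Z : SignedSet C} {f : Matching X Y} {g : Matching Y Z} {A : C} {a b c k l m}
    (h : f.push (A := A) ⟨.inl a, k⟩ = ⟨.inr b, l⟩) (h' : g.push (A := A) ⟨.inl b, l⟩ = ⟨.inr c, m⟩) :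
    (f.comp g).push (A := A) ⟨.inl a, k⟩ = ⟨.inr c, m⟩ :=
  push_comp_of_run (.head (.left h) (.single (.right h')))

theorem single_comp {A B D : C} (f : A ⟶ B) (g : B ⟶ D) :
    (Matching.single f).comp (Matching.single g) = Matching.single (f ≫ g) := by
  apply ext_push'
  rintro A' ⟨⟨⟨⟩⟩ | ⟨⟨⟩⟩, k⟩
  exact (comp_push_pos (f := Matching.single f) (g := Matching.single g) (a := ()) (b := ())
    (c := ()) rfl rfl).trans (Sigma.ext rfl (heq_of_eq (Category.assoc _ _ _)))

theorem reindex_comp {x : ι → C} {y : κ → C} {z : μ → C} (σ : ι ≃ κ) (t : ∀ j, y (σ j) ⟶ x j)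
    (τ : κ ≃ μ) (s : ∀ j, z (τ j) ⟶ y j) :
    (reindex τ s).comp (reindex σ t) =
      reindex (x := x) (y := z) (σ.trans τ) (fun j => s (σ j) ≫ t j) := by
  apply ext_family (σ.trans τ)
  intro A j k
  refine (comp_push_pos (push_reindex τ s (σ j) k) (push_reindex σ t j (k ≫ s (σ j)))).trans ?_
  refine Eq.trans ?_ (push_reindex (y := z) (σ.trans τ) (fun j => s (σ j) ≫ t j) j k).symm
  exact Sigma.ext rfl (heq_of_eq (Category.assoc _ _ _))

end Matching

/-- The tensor product of a finite sequence of shapes, bracketed to the right. -/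
def LShape.tens : ∀ n : ℕ, (Fin n → LShape C) → LShape C
  | 0, _ => .unit
  | 1, X => X 0
  | n + 2, X => .tensor (X 0) (tens (n + 1) fun i => X i.succ)

namespace Matching

def toSucc {n : ℕ} (x : Fin (n + 1) → C) {A : C} (s : State x A) :
    State (Sum.elim (fun _ : Unit => x 0) fun i : Fin n => x i.succ) A :=
  Fin.cases (motive := fun i => (A ⟶ x i) → State _ A)
    (fun k => ⟨.inl (), k⟩) (fun i k => ⟨.inr i, k⟩) s.1 s.2

def ofSucc {n : ℕ} (x : Fin (n + 1) → C) {A : C} :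
    State (Sum.elim (fun _ : Unit => x 0) fun i : Fin n => x i.succ) A → State x A
  | ⟨.inl _, k⟩ => ⟨0, k⟩
  | ⟨.inr i, k⟩ => ⟨i.succ, k⟩

def finSucc {n : ℕ} (x : Fin (n + 1) → C) :
    Relabel x (Sum.elim (fun _ : Unit => x 0) fun i : Fin n => x i.succ) where
  e A :=
    { toFun := toSucc x
      invFun := ofSucc x
      left_inv := by
        rintro ⟨i, k⟩
        exact Fin.cases (motive := fun i => ∀ k : A ⟶ x i, ofSucc x (toSucc x ⟨i, k⟩) = ⟨i, k⟩)
          (fun k => rfl) (fun i k => rfl) i k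
      right_inv := by rintro ⟨⟨⟩ | i, k⟩ <;> rfl }
  nat := by
    rintro A B k ⟨i, l⟩
    exact Fin.cases (motive := fun i => ∀ l : B ⟶ x i, toSucc x (State.pre k ⟨i, l⟩) =
      State.pre k (toSucc x ⟨i, l⟩)) (fun k => rfl) (fun i k => rfl) i l

def toOne (x : Fin 1 → C) {A : C} (s : State x A) : State (fun _ : Unit => x 0) A :=
  Fin.cases (motive := fun i => (A ⟶ x i) → State _ A) (fun k => ⟨(), k⟩) (fun i => i.elim0) s.1 s.2

def finOne (x : Fin 1 → C) : Relabel x (fun _ : Unit => x 0) where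
  e A :=
    { toFun := toOne x
      invFun := fun s => ⟨0, s.2⟩
      left_inv := by
        rintro ⟨i, k⟩
        exact Fin.cases (motive := fun i => ∀ k : A ⟶ x i, ⟨0, (toOne x ⟨i, k⟩).2⟩ =
          (⟨i, k⟩ : State x A)) (fun k => rfl) (fun i => i.elim0) i k
      right_inv := by rintro ⟨⟨⟩, k⟩; rfl }
  nat := by
    rintro A B k ⟨i, l⟩
    exact Fin.cases (motive := fun i => ∀ l : B ⟶ x i, toOne x (State.pre k ⟨i, l⟩) =
      State.pre k (toOne x ⟨i, l⟩)) (fun k => rfl) (fun i => i.elim0) i l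

/-- The variables of a tensor product of objects. -/
def tensIso : ∀ (n : ℕ) (x : Fin n → C),
    SignedIso (family x) (LShape.tens n fun i => .of (x i)).vars
  | 0, x =>
    { p := { e := fun A =>
              { toFun := fun s => s.1.elim0
                invFun := fun s => nomatch s
                left_inv := fun s => s.1.elim0
                right_inv := fun s => nomatch s }
             nat := fun k s => s.1.elim0 }
      n := Relabel.refl _ }
  | 1, x =>
    { p := finOne x
      n := Relabel.refl _ }
  | n + 2, x =>
    { p := (finSucc x).trans ((Relabel.refl _).sum (tensIso (n + 1) fun i => x i.succ).p)
      n :=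
        { e := fun A =>
            { toFun := fun s => nomatch s
              invFun := fun
                | ⟨.inr s, k⟩ => (((tensIso (n + 1) fun i => x i.succ).n.e A).symm ⟨s, k⟩).1.elim
              left_inv := fun s => nomatch s
              right_inv := fun
                | ⟨.inr s, k⟩ => (((tensIso (n + 1) fun i => x i.succ).n.e A).symm ⟨s, k⟩).1.elim }
          nat := fun k s => nomatch s } }


/-- A state of a family, as a state of the tensor product of objects. -/
def tensSrc {n : ℕ} {x : Fin n → C} {Y : SignedSet C} {A : C} (s : State x A) :
    State (srcLab (LShape.tens n fun i => .of (x i)).vars Y) A :=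
  ⟨.inl ((tensIso n x).p.e A s).1, ((tensIso n x).p.e A s).2⟩

def tensTgt {n : ℕ} {x : Fin n → C} {Y : SignedSet C} {A : C} (s : State x A) :
    State (tgtLab Y (LShape.tens n fun i => .of (x i)).vars) A :=
  ⟨.inr ((tensIso n x).p.e A s).1, ((tensIso n x).p.e A s).2⟩

/-- The graph of a bijection with labels, between tensor products of objects. -/
def tensReindex {n m : ℕ} {x : Fin n → C} {y : Fin m → C} (σ : Fin n ≃ Fin m)
    (t : ∀ j, y (σ j) ⟶ x j) :
    Matching (LShape.tens m fun i => .of (y i)).vars (LShape.tens n fun i => .of (x i)).vars :=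
  (reindex σ t).conj (tensIso m y) (tensIso n x)

theorem tensReindex_eq {n m : ℕ} {x : Fin n → C} {y : Fin m → C} {σ : Fin n ≃ Fin m}
    {t : ∀ j, y (σ j) ⟶ x j} {f} (h : ∀ {A : C} (j) (k : A ⟶ y (σ j)),
      f.push (tensSrc ⟨σ j, k⟩) = tensTgt ⟨j, k ≫ t j⟩) : tensReindex σ t = f := by
  apply conj_eq
  rintro A ⟨i | ⟨⟨⟩⟩, k⟩
  obtain ⟨j, rfl⟩ := σ.surjective i
  exact (h j k).trans (congrArg (((tensIso m y).tgt (tensIso n x)).e A) (push_reindex σ t j k)).symm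

theorem push_tensReindex {n m : ℕ} {x : Fin n → C} {y : Fin m → C} (σ : Fin n ≃ Fin m)
    (t : ∀ j, y (σ j) ⟶ x j) {A : C} (j) (k : A ⟶ y (σ j)) :
    (tensReindex σ t).push (tensSrc ⟨σ j, k⟩) = tensTgt ⟨j, k ≫ t j⟩ :=
  (push_conj (reindex σ t) (tensIso m y) (tensIso n x) ⟨.inl (σ j), k⟩).trans
    (congrArg (((tensIso m y).tgt (tensIso n x)).e A) (push_reindex σ t j k))

theorem tensReindex_comp {n m l : ℕ} {x : Fin n → C} {y : Fin m → C} {z : Fin l → C} (σ : Fin n ≃ Fin m) (t : ∀ j, y (σ j) ⟶ x j)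
    (τ : Fin m ≃ Fin l) (s : ∀ j, z (τ j) ⟶ y j) :
    (tensReindex τ s).comp (tensReindex σ t) =
      tensReindex (x := x) (y := z) (σ.trans τ) (fun j => s (σ j) ≫ t j) := by
  exact (conj_comp (reindex τ s) (reindex σ t) _ _ _).symm.trans
    (congrArg (fun f => conj f (tensIso l z) (tensIso n x)) (reindex_comp σ t τ s))

theorem tensReindex_id {n : ℕ} (x : Fin n → C) :
    tensReindex (Equiv.refl _) (fun j => 𝟙 (x j)) = Matching.id _ := by
  exact (congrArg (fun f => conj f (tensIso n x) (tensIso n x)) (reindex_id x)).trans (conj_id _)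

theorem allowable_of {n m : ℕ} {x : Fin n → C} {y : Fin m → C} {σ : Fin n ≃ Fin m}
    {t : ∀ j, y (σ j) ⟶ x j} {f} (hf : Allowable _ _ f) (h : ∀ {A : C} (j) (k : A ⟶ y (σ j)),
      f.push (tensSrc ⟨σ j, k⟩) = tensTgt ⟨j, k ≫ t j⟩) : Allowable _ _ (tensReindex σ t) :=
  tensReindex_eq h ▸ hf

/-- The tensor product with an identity on the left. -/
theorem push_succ {n m : ℕ} {x : Fin (n + 2) → C} {y : Fin (m + 2) → C} {σ : Fin (n + 1) ≃ Fin (m + 1)}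
    {g : Matching (SignedSet.single (y 0)) (SignedSet.single (x 0))}
    (t : ∀ j, y (σ j).succ ⟶ x j.succ) {A : C} (j) (k : A ⟶ y (σ j).succ) :
    Matching.push (X := (LShape.tens (m + 2) fun i => .of (y i)).vars)
      (Y := (LShape.tens (n + 2) fun i => .of (x i)).vars)
      (g.tensor (tensReindex (x := fun i => x i.succ) (y := fun i => y i.succ) σ t))
      (tensSrc ⟨(σ j).succ, k⟩) = tensTgt ⟨j.succ, k ≫ t j⟩ := by
  have h := push_sumR g (tensReindex (x := fun i => x i.succ) (y := fun i => y i.succ) σ t)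
    (tensSrc ⟨σ j, k⟩)
  rw [push_tensReindex (x := fun i => x i.succ) (y := fun i => y i.succ) σ t j k] at h
  exact h

/-- Relabelling along the identity bijection is allowable. -/
theorem allowable_labels : ∀ {n : ℕ} {x y : Fin n → C} (t : ∀ j, y j ⟶ x j),
    Allowable _ _ (tensReindex (x := x) (y := y) (Equiv.refl _) t)
  | 0, x, y, t => allowable_of (n := 0) (m := 0) (x := x) (y := y)
      (.id .unit) fun j => j.elim0
  | 1, x, y, t => allowable_of (n := 1) (m := 1) (x := x) (y := y) (σ := .refl _)
      (.single (t 0)) (Fin.cases (fun k => rfl) fun i => i.elim0)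
  | n + 2, x, y, t => allowable_of (n := n + 2) (m := n + 2) (x := x) (y := y) (σ := .refl _)
      (.tensor (.single (t 0)) (allowable_labels fun j : Fin (n + 1) => t j.succ))
      (Fin.cases (fun k => rfl) fun i k => push_succ (σ := .refl _) (fun j => t j.succ) i k)


def IsAllowablePerm (C : Type u) [Category.{v} C] {n : ℕ} (σ : Equiv.Perm (Fin n)) : Prop :=
  ∀ y : Fin n → C, Allowable _ _
    (tensReindex (x := fun j => y (σ j)) (y := y) σ fun j => 𝟙 (y (σ j)))

theorem IsAllowablePerm.trans {n : ℕ} {σ τ : Equiv.Perm (Fin n)} (hσ : IsAllowablePerm C σ)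
    (hτ : IsAllowablePerm C τ) : IsAllowablePerm C (σ.trans τ) := by
  intro y
  have h := Allowable.comp (hτ y) (hσ fun j => y (τ j))
  have e := tensReindex_comp σ (fun j => 𝟙 (y (τ (σ j)))) τ (fun j => 𝟙 (y (τ j)))
  have e2 : (fun j => 𝟙 (y (τ (σ j))) ≫ 𝟙 (y (τ (σ j)))) = fun j => 𝟙 (y (τ (σ j))) :=
    funext fun j => Category.comp_id _
  exact e2 ▸ e ▸ h

/-- The extension of a permutation by a fixed point. -/
def liftPerm {n : ℕ} (σ : Equiv.Perm (Fin n)) : Equiv.Perm (Fin (n + 1)) where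
  toFun := Fin.cases 0 fun i => (σ i).succ
  invFun := Fin.cases 0 fun i => (σ.symm i).succ
  left_inv := Fin.cases rfl fun i => congrArg Fin.succ (σ.symm_apply_apply i)
  right_inv := Fin.cases rfl fun i => congrArg Fin.succ (σ.apply_symm_apply i)

def swapPerm (n : ℕ) : Equiv.Perm (Fin (n + 2)) where
  toFun := Fin.cases (Fin.succ 0) (Fin.cases 0 fun i => i.succ.succ)
  invFun := Fin.cases (Fin.succ 0) (Fin.cases 0 fun i => i.succ.succ)
  left_inv := Fin.cases rfl (Fin.cases rfl fun i => rfl)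
  right_inv := Fin.cases rfl (Fin.cases rfl fun i => rfl)

theorem IsAllowablePerm.lift {n : ℕ} {σ : Equiv.Perm (Fin (n + 1))} (hσ : IsAllowablePerm C σ) :
    IsAllowablePerm C (liftPerm σ) := fun y =>
  allowable_of (n := n + 2) (m := n + 2) (x := fun j => y (liftPerm σ j)) (y := y) (σ := liftPerm σ)
    (.tensor (.single (𝟙 (y 0))) (hσ fun j => y j.succ))
    (Fin.cases (fun k => rfl) fun i k =>
      push_succ (x := fun j => y (liftPerm σ j)) (σ := σ) (fun j => 𝟙 (y (σ j).succ)) i k)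

theorem comp_push_three {X Y Z W : SignedSet C} (f : Matching X Y) (g : Matching Y Z)
    (h : Matching Z W) (a : X.P) (b : Y.P) (c : Z.P) (d : W.P) {l : X.lP a ⟶ Y.lP b}
    {l' : Y.lP b ⟶ Z.lP c} {l'' : Z.lP c ⟶ W.lP d} (h1 : f.step (.inl a) = ⟨.inr b, l⟩)
    (h2 : g.step (.inl b) = ⟨.inr c, l'⟩) (h3 : h.step (.inl c) = ⟨.inr d, l''⟩) {A : C}
    (k : A ⟶ X.lP a) (m : A ⟶ W.lP d) (e : ((k ≫ l) ≫ l') ≫ l'' = m) :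
    (f.comp (g.comp h)).push (A := A) ⟨.inl a, k⟩ = ⟨.inr d, m⟩ := by
  subst e
  exact comp_push_pos (push_eq h1 k) (comp_push_pos (push_eq h2 _) (push_eq h3 _))

theorem isAllowablePerm_swap : ∀ n, IsAllowablePerm C (swapPerm n)
  | 0 => fun y => allowable_of (n := 2) (m := 2) (x := fun j => y (swapPerm 0 j)) (y := y)
      (σ := swapPerm 0) (.braid (.of (y 0)) (.of (y (Fin.succ 0))))
      (Fin.cases (fun k => rfl) (Fin.cases (fun k => rfl) fun i => i.elim0))
  | n + 1 => fun y => by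
    let R := LShape.tens (n + 1) fun i => LShape.of (y i.succ.succ)
    let S₀ := SignedSet.single (y 0)
    let S₁ := SignedSet.single (y (Fin.succ 0))
    have e : ∀ {X Y : C} (k : X ⟶ Y), ((k ≫ 𝟙 Y) ≫ 𝟙 Y) ≫ 𝟙 Y = k ≫ 𝟙 Y := by simp
    refine allowable_of (n := n + 3) (m := n + 3) (x := fun j => y (swapPerm (n + 1) j)) (y := y)
      (σ := swapPerm (n + 1)) (.comp (.assocInv (.of (y 0)) (.of (y (Fin.succ 0))) R)
        (.comp (.tensor (.braid _ _) (.id _)) (.assocHom _ _ _))) ?_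
    refine fun {A} => Fin.cases (fun k => ?_) (Fin.cases (fun k => ?_) fun i k => ?_)
    · exact comp_push_three (assocInv S₀ S₁ R.vars) ((braid S₀ S₁).tensor (.id R.vars))
        (assocHom S₁ S₀ R.vars) (.inr (.inl ())) (.inl (.inr ())) (.inl (.inl ())) (.inl ())
        rfl rfl rfl k (k ≫ 𝟙 _) (e k)
    · exact comp_push_three (assocInv S₀ S₁ R.vars) ((braid S₀ S₁).tensor (.id R.vars))
        (assocHom S₁ S₀ R.vars) (.inl ()) (.inl (.inl ())) (.inl (.inr ())) (.inr (.inl ()))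
        rfl rfl rfl k (k ≫ 𝟙 _) (e k)
    · let τ := (tensIso (n + 1) fun i => y i.succ.succ).p.e A ⟨i, k⟩
      refine (comp_push_three (assocInv S₀ S₁ R.vars) ((braid S₀ S₁).tensor (.id R.vars))
        (assocHom S₁ S₀ R.vars) (.inr (.inr τ.1)) (.inr τ.1) (.inr τ.1) (.inr (.inr τ.1))
        rfl rfl rfl τ.2 (τ.2 ≫ 𝟙 _) (e τ.2)).trans ?_
      have e2 : (⟨i.succ.succ, k ≫ 𝟙 _⟩ : State (fun j => y (swapPerm (n + 1) j)) A) =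
          ⟨i.succ.succ, k⟩ := Sigma.ext rfl (heq_of_eq (Category.comp_id _))
      refine Eq.trans ?_ (congrArg tensTgt e2.symm)
      exact Sigma.ext rfl (heq_of_eq (Category.comp_id _))

theorem isAllowablePerm_swap_succ : ∀ (n : ℕ) (i : Fin n),
    IsAllowablePerm C (Equiv.swap i.castSucc i.succ)
  | 0, i => i.elim0
  | n + 1, i => by
    refine Fin.cases ?_ (fun i => ?_) i
    · convert isAllowablePerm_swap (C := C) n using 1
      ext j : 1
      refine Fin.cases ?_ (Fin.cases ?_ fun j => ?_) j
      · exact Equiv.swap_apply_left _ _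
      · exact Equiv.swap_apply_right _ _
      · refine (Equiv.swap_apply_of_ne_of_ne (Fin.succ_ne_zero _) fun h => ?_).trans rfl
        exact Fin.succ_ne_zero _ (Fin.succ_injective _ h)
    · convert (isAllowablePerm_swap_succ n i).lift using 1
      ext j : 1
      refine Fin.cases ?_ (fun j => ?_) j
      · exact Equiv.swap_apply_of_ne_of_ne (fun h => nomatch congrArg Fin.val h) fun h => nomatch congrArg Fin.val h
      · change Equiv.swap i.castSucc.succ i.succ.succ j.succ = (Equiv.swap i.castSucc i.succ j).succ
        exact (Fin.succ_injective _).swap_apply _ _ _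

theorem isAllowablePerm : ∀ {n : ℕ} (σ : Equiv.Perm (Fin n)), IsAllowablePerm C σ
  | 0, σ => by
    obtain rfl : σ = Equiv.refl _ := Equiv.ext fun i => i.elim0
    exact fun y => allowable_labels fun j => 𝟙 (y j)
  | n + 1, σ => by
    have h : σ ∈ Submonoid.closure (Set.range fun i : Fin n => Equiv.swap i.castSucc i.succ) := by
      rw [Equiv.Perm.mclosure_swap_castSucc_succ]; trivial
    induction h using Submonoid.closure_induction with
    | mem x hx => obtain ⟨i, rfl⟩ := hx; exact isAllowablePerm_swap_succ n i
    | one => exact fun y => allowable_labels fun j => 𝟙 (y j)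
    | mul σ τ _ _ hσ hτ => exact hτ.trans hσ

theorem allowable_tensReindex {n m : ℕ} {x : Fin n → C} {y : Fin m → C} (σ : Fin n ≃ Fin m)
    (t : ∀ j, y (σ j) ⟶ x j) : Allowable _ _ (tensReindex σ t) := by
  obtain rfl : n = m := by simpa using Fintype.card_congr σ
  have h := Allowable.comp (isAllowablePerm σ y) (allowable_labels t)
  have e := tensReindex_comp (Equiv.refl _) t σ (fun j => 𝟙 (y (σ j)))
  have e2 : (fun j => 𝟙 (y (σ j)) ≫ t j) = t := funext fun j => Category.id_comp _
  exact e2 ▸ e ▸ h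

end Matching
end KM

namespace KM
open SignedSet Matching
variable {C : Type u} [Category.{v} C] {D : Type u'} [Category.{v'} D]
  {E : Type w'} [Category.{v'} E]

namespace SymMulticategory

/-- The shape `[x₁ ⊗ ⋯ ⊗ xₙ, x]` of an arrow in `Q(x₁, …, xₙ; x)`. -/
def shape {n : ℕ} (x : Fin n → C) (y : C) : AC C :=
  LShape.hom (.tens n fun i => .of (x i)) (.of y)

/-- The frame functor: `f ∈ Q(x₁, …, xₙ; x)` goes to `[x₁ ⊗ ⋯ ⊗ xₙ, x]`, and a morphism of `elt Q`,
which is a bijection and morphisms of objects, to the graph with these edges and labels. -/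
noncomputable def frame (Q : SymMulticategory.{u, v, w} C) : Q.Elt ⥤ AC C where
  obj f := shape f.src f.tgt
  map γ := ⟨(tensReindex γ.perm γ.input).ihom (Matching.single γ.output),
    .hom (allowable_tensReindex γ.perm γ.input) (.single γ.output)⟩
  map_id f := Subtype.ext (by
    have h1 := tensReindex_id f.src
    have h2 := Matching.single_id f.tgt
    exact (congrArg₂ Matching.ihom h1 h2).trans ihom_id)
  map_comp {f g h} γ δ := Subtype.ext (by
    have h1 := tensReindex_comp γ.perm γ.input δ.perm δ.input
    have h2 := Matching.single_comp γ.output δ.output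
    exact (congrArg₂ Matching.ihom h1.symm h2.symm).trans (ihom_comp _ _ _ _))

end SymMulticategory

namespace AC

/-- The unit object. -/
def I : AC C := LShape.unit

/-- The morphism `S ⟶ T` that corresponds to a point `I ⟶ [S, T]` under
`A C (I, [S, T]) ≅ A C (I ⊗ S, T) ≅ A C (S, T)`. -/
noncomputable def bar {S T : LShape C} (θ : (I : AC C) ⟶ LShape.hom S T) : (show AC C from S) ⟶ T :=
  (show (show AC C from S) ⟶ LShape.tensor S .unit from ⟨_, .unitInv S⟩) ≫
    (show (show AC C from LShape.tensor S .unit) ⟶ LShape.tensor .unit S from ⟨_, .braid S .unit⟩) ≫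
    (show (show AC C from LShape.tensor .unit S) ⟶ LShape.tensor (.hom S T) S from
      ⟨_, .tensor θ.2 (.id S)⟩) ≫
    (show (show AC C from LShape.tensor (.hom S T) S) ⟶ T from ⟨_, .ev S T⟩)

/-- The tensor product `I ≅ I ⊗ ⋯ ⊗ I ⟶ F x₁ ⊗ ⋯ ⊗ F xₙ = A F (x₁ ⊗ ⋯ ⊗ xₙ)` of points, followed
by a second functor. -/
noncomputable def tensorPoints (F : C ⥤ AC D) (G : D ⥤ AC E) : ∀ {n : ℕ} (x : Fin n → C)
    (_ : ∀ i, (I : AC E) ⟶ (lift G).obj (F.obj (x i))),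
    (I : AC E) ⟶ (lift G).obj ((lift F).obj (LShape.tens n fun i => .of (x i)))
  | 0, _, _ => 𝟙 I
  | 1, _, p => p 0
  | n + 2, x, p =>
    (show (I : AC E) ⟶ LShape.tensor .unit .unit from ⟨_, .unitInv .unit⟩) ≫
      (show (show AC E from LShape.tensor .unit .unit) ⟶
          LShape.tensor ((lift G).obj (F.obj (x 0)))
            ((lift G).obj ((lift F).obj (.tens (n + 1) fun i => .of (x i.succ)))) from
        ⟨_, .tensor (p 0).2 (tensorPoints F G (fun i : Fin (n + 1) => x i.succ) fun i => p i.succ).2⟩)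

end AC

namespace SymMulticategory
variable {Q : SymMulticategory.{u, v, w} C}

/-- A position in the `i`-th factor, as a position in `A F (x₁ ⊗ ⋯ ⊗ xₙ)`: positive variables. -/
def factorP (F : C ⥤ AC D) : ∀ {n : ℕ} (x : Fin n → C) (i : Fin n) {A : D}
    (_ : State (LShape.vars (F.obj (x i))).lP A),
    State (LShape.vars ((AC.lift F).obj (.tens n fun i => .of (x i)))).lP A
  | 0, _, i, _, _ => i.elim0
  | 1, x, i, A, s => Fin.cases (motive := fun i => State (LShape.vars (F.obj (x i))).lP A →
      State (LShape.vars (F.obj (x 0))).lP A) (fun s => s) (fun i => i.elim0) i s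
  | n + 2, x, i, A, s => Fin.cases (motive := fun i => State (LShape.vars (F.obj (x i))).lP A →
      State (LShape.vars ((AC.lift F).obj (.tens (n + 2) fun i => .of (x i)))).lP A)
      (fun s => ⟨.inl s.1, s.2⟩)
      (fun i s => ⟨.inr (factorP F (fun i : Fin (n + 1) => x i.succ) i s).1,
        (factorP F (fun i : Fin (n + 1) => x i.succ) i s).2⟩) i s

/-- A position in the `i`-th factor, as a position in `A F (x₁ ⊗ ⋯ ⊗ xₙ)`: negative variables. -/
def factorN (F : C ⥤ AC D) : ∀ {n : ℕ} (x : Fin n → C) (i : Fin n) {A : D}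
    (_ : State (LShape.vars (F.obj (x i))).lN A),
    State (LShape.vars ((AC.lift F).obj (.tens n fun i => .of (x i)))).lN A
  | 0, _, i, _, _ => i.elim0
  | 1, x, i, A, s => Fin.cases (motive := fun i => State (LShape.vars (F.obj (x i))).lN A →
      State (LShape.vars (F.obj (x 0))).lN A) (fun s => s) (fun i => i.elim0) i s
  | n + 2, x, i, A, s => Fin.cases (motive := fun i => State (LShape.vars (F.obj (x i))).lN A →
      State (LShape.vars ((AC.lift F).obj (.tens (n + 2) fun i => .of (x i)))).lN A)
      (fun s => ⟨.inl s.1, s.2⟩)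
      (fun i s => ⟨.inr (factorN F (fun i : Fin (n + 1) => x i.succ) i s).1,
        (factorN F (fun i : Fin (n + 1) => x i.succ) i s).2⟩) i s

section
variable {n : ℕ} (F : Fin n → Q.Elt) (f : Q.Elt)

/-- The shape `[φ F₁ ⊗ ⋯ ⊗ φ Fₙ, φ f] = A φ [F₁ ⊗ ⋯ ⊗ Fₙ, f]`, with the frame functor `φ`. -/
noncomputable abbrev ladder : AC C := (AC.lift Q.frame).obj (shape F f)

/-- The output of the `i`-th node. -/
noncomputable def nodeOut (i : Fin n) {A : C} (k : A ⟶ (F i).tgt) :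
    State (srcLab (LShape.vars (AC.I : AC C)) (LShape.vars (ladder F f))) A :=
  let s := factorP Q.frame F i ⟨.inr (), k⟩
  ⟨.inr (.inl s.1), s.2⟩

/-- The `l`-th leaf. -/
def leafOut (l : Fin f.n) {A : C} (k : A ⟶ f.src l) :
    State (srcLab (LShape.vars (AC.I : AC C)) (LShape.vars (ladder F f))) A :=
  let s := (tensIso f.n f.src).p.e A ⟨l, k⟩
  ⟨.inr (.inr (.inl s.1)), s.2⟩

/-- The `j`-th input of the `i`-th node. -/
noncomputable def nodeIn (i : Fin n) (j : Fin (F i).n) {A : C} (k : A ⟶ (F i).src j) :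
    State (tgtLab (LShape.vars (AC.I : AC C)) (LShape.vars (ladder F f))) A :=
  let t := (tensIso (F i).n (F i).src).p.e A ⟨j, k⟩
  let s := factorN Q.frame F i ⟨.inl t.1, t.2⟩
  ⟨.inr (.inl s.1), s.2⟩

/-- The root. -/
def rootIn {A : C} (k : A ⟶ f.tgt) :
    State (tgtLab (LShape.vars (AC.I : AC C)) (LShape.vars (ladder F f))) A :=
  ⟨.inr (.inr (.inr ())), k⟩

variable {F f}

/-- The edges of a graph that lead from the leaves and nodes of a tree into the position `t` and the
inputs of the nodes are, with their labels, the edges of the tree. -/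
def HasEdges (θ : (AC.I : AC C) ⟶ ladder F f) : ∀ {x : C} (_ : Tree F f.src x)
    (_ : ∀ {A : C} (_ : A ⟶ x),
      State (tgtLab (LShape.vars (AC.I : AC C)) (LShape.vars (ladder F f))) A), Prop
  | _, .leaf l a, t => θ.1.push (leafOut F f l (𝟙 _)) = t a
  | _, .node i a ch, t => θ.1.push (nodeOut F f i (𝟙 _)) = t a ∧
      ∀ j, HasEdges θ (ch j) fun k => nodeIn F f i j k

/-- The morphism of `A C` whose graph is the given tree. -/
def IsGraph (θ : (AC.I : AC C) ⟶ ladder F f) (T : Tree F f.src f.tgt) : Prop :=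
  HasEdges θ T fun k => rootIn F f k

end

section
variable (G : ∀ α : Q.slice.Elt, (AC.I : AC C) ⟶ (AC.lift Q.frame).obj (Q.slice.frame.obj α))

/-- The condition `A φ₁ (bar θ) ∘ (α₁ ⊗ ⋯ ⊗ αₘ) = α` on a morphism `θ : I ⟶ [φ₂ α₁ ⊗ ⋯ ⊗ φ₂ αₘ, φ₂ α]`,
when the arrow `α` of the slice is regarded as the morphism `G α : I ⟶ A φ₁ (φ₂ α)`. -/
def CompositeIs {m : ℕ} (α : Fin m → Q.slice.Elt) (α' : Q.slice.Elt)
    (θ : (AC.I : AC Q.Elt) ⟶ (AC.lift Q.slice.frame).obj (shape α α')) : Prop :=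
  AC.tensorPoints Q.slice.frame Q.frame α (fun i => G (α i)) ≫ (AC.lift Q.frame).map (AC.bar θ) = G α'

/-- The objects `(θ, p)` of the comma category `I ↓ A φ₂` such that `p = [α₁ ⊗ ⋯ ⊗ αₘ, α]` for some
`m ≥ 0` and `A φ₁ (bar θ) ∘ (α₁ ⊗ ⋯ ⊗ αₘ) = α`. -/
def IsComposite : ObjectProperty (StructuredArrow (AC.I : AC Q.Elt) (AC.lift Q.slice.frame)) :=
  fun X => ∃ (m : ℕ) (α : Fin m → Q.slice.Elt) (α' : Q.slice.Elt)
    (θ : (AC.I : AC Q.Elt) ⟶ (AC.lift Q.slice.frame).obj (shape α α')),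
    X = StructuredArrow.mk (Y := shape α α') θ ∧ CompositeIs G α α' θ

end

end SymMulticategory

end KM

/-! A graph `I ⟶ [φ F₁ ⊗ ⋯ ⊗ φ Fₙ, φ f]` pairs the sources (node outputs and leaves) bijectively
with the targets (node inputs and the root). Read upwards from the root, such a pairing unfolds into
a tree. The unfolding can go wrong in only one way: some nodes and leaves may never reach the root,
because they lie on cycles or feed into them. The theorem rests on three facts.

Allowable graphs are trees (`exists_tree`). A residuated commutative monoid is a model of the
generators of allowability, so an assignment of values that is constant along the edges of an
allowable graph gives its source a value at most that of its target (`Allowable.value_le`). The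
monoid `0 < 1 < 2` with unit `1` and `2 ⊗ 2 = 2` suffices. Give an edge the value `1` if it leads to
the root, and `2` otherwise. Then each `φ Fᵢ` has the value of its output edge, and `φ f` has the
value `1` if all leaves reach the root and `0` otherwise. The inequality `1 ≤ hom₃ (⨂ φ Fᵢ) (φ f)`
forces every node and leaf to reach the root (`exists_dist`). The distance to the root then makes
the unfolding finite and its branches disjoint, so each node and each leaf occurs exactly once.

Trees are allowable (`exists_graph`). A tree is an iterated evaluation: each node `[x₁ ⊗ ⋯ ⊗ xₖ, x]`
is evaluated at the tensor product of its subtrees. This is a graph to the root from the product of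
the nodes and leaves in the order of the tree. That order is corrected by a permutation, since all
graphs between shapes built by `⊗` alone are allowable (`LShape.TensorOnly.allowable`), and the
leaves are then moved to the right by the adjunction. A configuration and its graph determine each
other (`Edges.tree_unique`, `Edges.unique`).

Composition of graphs is composition of trees. Let `θ` be the graph of a tree whose nodes are the
configurations `αᵢ`. Under `A φ₁` an edge of `θ`, which is labelled by a morphism of `elt Q`,
becomes an edge between outputs together with edges running back between inputs. Following paths
through `α₁ ⊗ ⋯ ⊗ αₘ` and then `A φ₁ (bar θ)` therefore traces the tree in which each node `αᵢ` is
replaced by its own tree (`BarEdges.runs`), and this is how composites in `Q⁺` are formed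
(`Composes.rename_tree`). So the condition in statement 2 says that the tree `θ` composes to `α`,
which gives the bijection.

For statement 3, a morphism of `elt Q⁺⁺` is a tree with one node, and the commuting triangle of the
comma category is the condition of statement 2 with `m = 1`, one slice higher. Hence the functor to
the comma category is full and faithful, and it is bijective on objects by statement 2. -/

namespace KM
-- Positions with given labels, and trees interpreted by a relation
open SignedSet Matching SymMulticategory
variable {C : Type u} [Category.{v} C] {D : Type u'} [Category.{v'} D]

/-- A position whose label is `x`. -/
structure Pos {ι : Type} (lab : ι → C) (x : C) where
  idx : ι
  eq : lab idx = x

namespace Pos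
variable {ι : Type} {lab : ι → C} {x : C}

/-- A morphism into `x`, as a state at a position labelled by `x`. -/
def st (p : Pos lab x) {A : C} (k : A ⟶ x) : State lab A := ⟨p.idx, k ≫ eqToHom p.eq.symm⟩

/-- Labels of variables of a tensor product equal the expected objects only propositionally. `Pos`
and `st` confine the resulting `eqToHom` to one place; naturality in `A` then lets every edge be
tested at an identity. -/
theorem pre_st (p : Pos lab x) {A B : C} (l : A ⟶ B) (k : B ⟶ x) :
    State.pre l (p.st k) = p.st (l ≫ k) := by
  simp [State.pre, st]

theorem st_mk (i : ι) {A : C} (k : A ⟶ lab i) : (⟨i, rfl⟩ : Pos lab (lab i)).st k = ⟨i, k⟩ := by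
  simp [st]

theorem st_inj (p : Pos lab x) {A : C} {k k' : A ⟶ x} (h : p.st k = p.st k') : k = k' := by
  have h : k ≫ eqToHom p.eq.symm = k' ≫ eqToHom p.eq.symm := by simpa [st] using h
  exact (cancel_mono _).1 h

theorem exists_st (p : Pos lab x) {A : C} (s : State lab A) (h : s.1 = p.idx) :
    ∃ k, s = p.st k := by
  obtain ⟨i, k⟩ := s
  obtain ⟨j, rfl⟩ := p
  obtain rfl : i = j := h
  exact ⟨k, by simp [st]⟩

theorem ext_idx {p q : Pos lab x} (h : p.idx = q.idx) : p = q := by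
  cases p; cases q; cases h; rfl

end Pos

namespace Tree
variable {Q : SymMulticategory.{u, v, w} C}
  {ι κ L L' L'' : Type} {F : ι → Q.Elt} {F' : κ → Q.Elt} {z : L → C} {z' : L' → C} {x y : C}

/-- Each edge of the tree, from a leaf or the output of a node to the input of a node or to the root,
is an instance of the relation `r`, when these ends are interpreted by the given states. -/
def Runs {S T : C → Type v'} (r : ∀ A, S A → T A → Prop) (NO : ∀ i A, (A ⟶ (F i).tgt) → S A)
    (NI : ∀ i j A, (A ⟶ (F i).src j) → T A) (LS : ∀ l A, (A ⟶ z l) → S A) :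
    ∀ {x : C} (_ : Tree F z x) (_ : ∀ A, (A ⟶ x) → T A), Prop
  | _, leaf l a, t => ∀ A (k : A ⟶ z l), r A (LS l A k) (t A (k ≫ a))
  | _, node i a ch, t => (∀ A (k : A ⟶ (F i).tgt), r A (NO i A k) (t A (k ≫ a))) ∧
      ∀ j, Runs r NO NI LS (ch j) (NI i j)

/-- The two interpretations are compared by relations rather than by maps, because a state of one
graph may correspond to a state of another only after some edges have been followed. -/
theorem Runs.imp {U V U' V' : C → Type v'} {r : ∀ A, U A → V A → Prop} {r' : ∀ A, U' A → V' A → Prop}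
    {NO : ∀ i A, (A ⟶ (F i).tgt) → U A}
    {NI : ∀ i j A, (A ⟶ (F i).src j) → V A} {LS : ∀ l A, (A ⟶ z l) → U A}
    {NO' : ∀ i A, (A ⟶ (F i).tgt) → U' A}
    {NI' : ∀ i j A, (A ⟶ (F i).src j) → V' A} {LS' : ∀ l A, (A ⟶ z l) → U' A}
    (RS : ∀ A, U A → U' A → Prop) (RT : ∀ A, V A → V' A → Prop)
    (hr : ∀ A s t s' t', r A s t → RS A s s' → RT A t t' → r' A s' t')
    (hNO : ∀ i A k, RS A (NO i A k) (NO' i A k)) (hNI : ∀ i j A k, RT A (NI i j A k) (NI' i j A k))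
    (hLS : ∀ l A k, RS A (LS l A k) (LS' l A k)) {T : Tree F z x} {t : ∀ A, (A ⟶ x) → V A}
    {t' : ∀ A, (A ⟶ x) → V' A} (h : T.Runs r NO NI LS t) (ht : ∀ A k, RT A (t A k) (t' A k)) :
    T.Runs r' NO' NI' LS' t' := by
  induction T with
  | leaf l a => exact fun A k => hr _ _ _ _ _ (h A k) (hLS _ _ _) (ht _ _)
  | node i a ch ih =>
    exact ⟨fun A k => hr _ _ _ _ _ (h.1 A k) (hNO _ _ _) (ht _ _),
      fun j => ih j (h.2 j) fun A k => hNI _ _ _ _⟩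

section
variable {S : C → Type v'} {r : ∀ A, S A → S A → Prop} {NO : ∀ i A, (A ⟶ (F i).tgt) → S A}
  {NI : ∀ i j A, (A ⟶ (F i).src j) → S A} {LS : ∀ l A, (A ⟶ z l) → S A}

/-- From here on the ends of edges share one type of states and `r` is transitive, so an edge of the
tree may be realised by a path, and paths may be prolonged at the root. -/
theorem Runs.postcomp (tr : ∀ A s t u, r A s t → r A t u → r A s u) {T : Tree F z x}
    {t : ∀ A, (A ⟶ x) → S A} (h : T.Runs r NO NI LS t) {a : x ⟶ y} {t' : ∀ A, (A ⟶ y) → S A}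
    (ht : ∀ A k, r A (t A k) (t' A (k ≫ a))) : (T.postcomp a).Runs r NO NI LS t' := by
  cases T with
  | leaf l b => intro A k; rw [← Category.assoc]; exact tr _ _ _ _ (h A k) (ht _ _)
  | node i b ch =>
    exact ⟨fun A k => by rw [← Category.assoc]; exact tr _ _ _ _ (h.1 A k) (ht _ _), h.2⟩

theorem Runs.graft (tr : ∀ A s t u, r A s t → r A t u → r A s u) {LS' : ∀ l A, (A ⟶ z' l) → S A}
    {T : Tree F z x} {t : ∀ A, (A ⟶ x) → S A} (h : T.Runs r NO NI LS t)
    {s : ∀ l, Tree F z' (z l)} (hs : ∀ l, (s l).Runs r NO NI LS' (LS l)) :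
    (T.graft s).Runs r NO NI LS' t := by
  induction T with
  | leaf l b => exact (hs l).postcomp tr h
  | node i b ch ih => exact ⟨h.1, fun j => ih j (h.2 j)⟩

/-- Seen from the tree `R i` inside a node the roles are exchanged: an input `NI i j`, where a path
of `T` arrives, is where a leaf of `R i` starts, and the output `NO i`, where a path of `T` departs,
is the root of `R i`. So the paths join. -/
theorem Runs.replace (tr : ∀ A s t u, r A s t → r A t u → r A s u)
    {NO' : ∀ i A, (A ⟶ (F' i).tgt) → S A} {NI' : ∀ i j A, (A ⟶ (F' i).src j) → S A}
    {T : Tree F z x} {t : ∀ A, (A ⟶ x) → S A} (h : T.Runs r NO NI LS t)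
    {R : ∀ i, Tree F' (F i).src (F i).tgt} (hR : ∀ i, (R i).Runs r NO' NI' (NI i) (NO i)) :
    (T.replace R).Runs r NO' NI' LS t := by
  induction T with
  | leaf l b => exact h
  | node i b ch ih => exact ((hR i).postcomp tr h.1).graft tr fun j => ih j (h.2 j)

end
end Tree
end KM

/-! ### Tensor products of sequences of shapes, and substitution into them -/

namespace KM
open SignedSet Matching SymMulticategory
variable {C : Type u} [Category.{v} C] {D : Type u'} [Category.{v'} D]

/-- `TensorOf S W`: the shape `W` is the tensor product, bracketed to the right, of the shapes `S i`. -/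
inductive TensorOf : ∀ {n : ℕ} (_ : Fin n → LShape C) (_ : LShape C), Type u
  | zero {S : Fin 0 → LShape C} : TensorOf S .unit
  | one {S : Fin 1 → LShape C} : TensorOf S (S 0)
  | succ {n : ℕ} {S : Fin (n + 2) → LShape C} {W : LShape C}
      (t : TensorOf (fun i : Fin (n + 1) => S i.succ) W) : TensorOf S (.tensor (S 0) W)

namespace TensorOf

def tens : ∀ {n : ℕ} (S : Fin n → LShape C), TensorOf S (.tens n S)
  | 0, _ => .zero
  | 1, _ => .one
  | _ + 2, _ => .succ (tens _)

/-- A tensor product into which shapes are substituted is no longer of the form `LShape.tens` of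
variables. `TensorOf` is stable under substitution, so its lemmas apply at every level of nesting.
-/
noncomputable def bind (H : C ⥤ AC D) : ∀ {n : ℕ} {S : Fin n → LShape C} {W : LShape C} (_ : TensorOf S W),
    TensorOf (fun i => (S i).bind H) (W.bind H)
  | _, _, _, .zero => .zero
  | _, S, _, .one => .one (S := fun i => LShape.bind H (S i))
  | _, S, _, .succ t => .succ (S := fun i => LShape.bind H (S i)) (t.bind H)

/-- The positive variables of a factor, as positive variables of the tensor product. -/
def tinP : ∀ {n : ℕ} {S : Fin n → LShape C} {W : LShape C} (_ : TensorOf S W) (i : Fin n) {A : C}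
    (_ : State (S i).vars.lP A), State W.vars.lP A
  | _, _, _, .zero, i, _, _ => i.elim0
  | _, S, _, .one, i, A, s => Fin.cases (motive := fun i => State (S i).vars.lP A →
      State (S 0).vars.lP A) (fun s => s) (fun i => i.elim0) i s
  | _, S, _, .succ (W := W) t, i, A, s => Fin.cases (motive := fun i => State (S i).vars.lP A →
      State (LShape.tensor (S 0) W).vars.lP A) (fun s => ⟨.inl s.1, s.2⟩)
      (fun i s => ⟨.inr (t.tinP i s).1, (t.tinP i s).2⟩) i s

/-- The negative variables of a factor, as negative variables of the tensor product. -/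
def tinN : ∀ {n : ℕ} {S : Fin n → LShape C} {W : LShape C} (_ : TensorOf S W) (i : Fin n) {A : C}
    (_ : State (S i).vars.lN A), State W.vars.lN A
  | _, _, _, .zero, i, _, _ => i.elim0
  | _, S, _, .one, i, A, s => Fin.cases (motive := fun i => State (S i).vars.lN A →
      State (S 0).vars.lN A) (fun s => s) (fun i => i.elim0) i s
  | _, S, _, .succ (W := W) t, i, A, s => Fin.cases (motive := fun i => State (S i).vars.lN A →
      State (LShape.tensor (S 0) W).vars.lN A) (fun s => ⟨.inl s.1, s.2⟩)
      (fun i s => ⟨.inr (t.tinN i s).1, (t.tinN i s).2⟩) i s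

def posP : ∀ {n : ℕ} {S : Fin n → LShape C} {W : LShape C} (_ : TensorOf S W) (i : Fin n) {x : C}
    (_ : Pos (S i).vars.lP x), Pos W.vars.lP x
  | _, _, _, .zero, i, _, _ => i.elim0
  | _, S, _, .one, i, x, s => Fin.cases (motive := fun i => Pos (S i).vars.lP x →
      Pos (S 0).vars.lP x) (fun s => s) (fun i => i.elim0) i s
  | _, S, _, .succ (W := W) t, i, x, s => Fin.cases (motive := fun i => Pos (S i).vars.lP x →
      Pos (LShape.tensor (S 0) W).vars.lP x) (fun s => ⟨.inl s.1, s.2⟩)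
      (fun i s => ⟨.inr (t.posP i s).1, (t.posP i s).2⟩) i s

def posN : ∀ {n : ℕ} {S : Fin n → LShape C} {W : LShape C} (_ : TensorOf S W) (i : Fin n) {x : C}
    (_ : Pos (S i).vars.lN x), Pos W.vars.lN x
  | _, _, _, .zero, i, _, _ => i.elim0
  | _, S, _, .one, i, x, s => Fin.cases (motive := fun i => Pos (S i).vars.lN x →
      Pos (S 0).vars.lN x) (fun s => s) (fun i => i.elim0) i s
  | _, S, _, .succ (W := W) t, i, x, s => Fin.cases (motive := fun i => Pos (S i).vars.lN x →
      Pos (LShape.tensor (S 0) W).vars.lN x) (fun s => ⟨.inl s.1, s.2⟩)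
      (fun i s => ⟨.inr (t.posN i s).1, (t.posN i s).2⟩) i s

variable {n : ℕ} {S : Fin n → LShape C} {W : LShape C}

theorem tinP_st (t : TensorOf S W) (i : Fin n) {x : C} (p : Pos (S i).vars.lP x) {A : C}
    (k : A ⟶ x) : t.tinP i (p.st k) = (t.posP i p).st k := by
  induction t with
  | zero => exact i.elim0
  | one => exact Fin.cases (motive := fun i => ∀ p, TensorOf.one.tinP i (p.st k) =
      (TensorOf.one.posP i p).st k) (fun p => rfl) (fun i => i.elim0) i p
  | succ t ih =>
    refine Fin.cases (motive := fun i => ∀ p, t.succ.tinP i (p.st k) =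
      (t.succ.posP i p).st k) (fun p => rfl) (fun i p => ?_) i p
    have := ih i p
    exact congrArg (fun s : State _ A => (⟨.inr s.1, s.2⟩ : State (LShape.vars (.tensor _ _)).lP A)) this

theorem tinN_st (t : TensorOf S W) (i : Fin n) {x : C} (p : Pos (S i).vars.lN x) {A : C}
    (k : A ⟶ x) : t.tinN i (p.st k) = (t.posN i p).st k := by
  induction t with
  | zero => exact i.elim0
  | one => exact Fin.cases (motive := fun i => ∀ p, TensorOf.one.tinN i (p.st k) =
      (TensorOf.one.posN i p).st k) (fun p => rfl) (fun i => i.elim0) i p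
  | succ t ih =>
    refine Fin.cases (motive := fun i => ∀ p, t.succ.tinN i (p.st k) =
      (t.succ.posN i p).st k) (fun p => rfl) (fun i p => ?_) i p
    have := ih i p
    exact congrArg (fun s : State _ A => (⟨.inr s.1, s.2⟩ : State (LShape.vars (.tensor _ _)).lN A)) this

theorem posP_surj (t : TensorOf S W) (q : W.vars.P) :
    ∃ i p, (t.posP i ⟨p, rfl⟩).idx = q := by
  induction t with
  | zero => exact q.elim
  | one => exact ⟨0, q, rfl⟩
  | succ t ih =>
    rcases q with q | q
    · exact ⟨0, q, rfl⟩
    · obtain ⟨i, p, h⟩ := ih q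
      exact ⟨i.succ, p, congrArg Sum.inr h⟩

theorem posN_surj (t : TensorOf S W) (q : W.vars.N) :
    ∃ i p, (t.posN i ⟨p, rfl⟩).idx = q := by
  induction t with
  | zero => exact q.elim
  | one => exact ⟨0, q, rfl⟩
  | succ t ih =>
    rcases q with q | q
    · exact ⟨0, q, rfl⟩
    · obtain ⟨i, p, h⟩ := ih q
      exact ⟨i.succ, p, congrArg Sum.inr h⟩

/-- With `posP_surj`, this makes the variables of a tensor product the disjoint union of those of
its factors. The labels are left out of the conclusion, as they are determined by the indices. -/
theorem posP_inj (t : TensorOf S W) : ∀ {i j : Fin n} {x y : C} {p : Pos (S i).vars.lP x}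
    {q : Pos (S j).vars.lP y}, (t.posP i p).idx = (t.posP j q).idx →
    (⟨i, p.idx⟩ : Σ i, (S i).vars.P) = ⟨j, q.idx⟩ := by
  induction t with
  | zero => exact fun {i} => i.elim0
  | @one S =>
    intro i j
    induction i using Fin.cases with
    | succ i => exact i.elim0
    | zero =>
      induction j using Fin.cases with
      | succ i => exact i.elim0
      | zero => exact fun h => congrArg (Sigma.mk (β := fun i => (S i).vars.P) 0) h
  | @succ n S W t ih =>
    intro i j
    induction i using Fin.cases with
    | zero =>
      induction j using Fin.cases with
      | zero =>
        exact fun h => congrArg (Sigma.mk (β := fun i => (S i).vars.P) 0) (Sum.inl_injective h)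
      | succ j => exact fun h => nomatch h
    | succ i =>
      induction j using Fin.cases with
      | zero => exact fun h => nomatch h
      | succ j =>
        exact fun h => congrArg (fun s : Σ i : Fin (n + 1), (S i.succ).vars.P =>
          (⟨s.1.succ, s.2⟩ : Σ i, (S i).vars.P)) (ih (Sum.inr_injective h))

theorem posN_inj (t : TensorOf S W) : ∀ {i j : Fin n} {x y : C} {p : Pos (S i).vars.lN x}
    {q : Pos (S j).vars.lN y}, (t.posN i p).idx = (t.posN j q).idx →
    (⟨i, p.idx⟩ : Σ i, (S i).vars.N) = ⟨j, q.idx⟩ := by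
  induction t with
  | zero => exact fun {i} => i.elim0
  | @one S =>
    intro i j
    induction i using Fin.cases with
    | succ i => exact i.elim0
    | zero =>
      induction j using Fin.cases with
      | succ i => exact i.elim0
      | zero => exact fun h => congrArg (Sigma.mk (β := fun i => (S i).vars.N) 0) h
  | @succ n S W t ih =>
    intro i j
    induction i using Fin.cases with
    | zero =>
      induction j using Fin.cases with
      | zero =>
        exact fun h => congrArg (Sigma.mk (β := fun i => (S i).vars.N) 0) (Sum.inl_injective h)
      | succ j => exact fun h => nomatch h
    | succ i =>
      induction j using Fin.cases with
      | zero => exact fun h => nomatch h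
      | succ j =>
        exact fun h => congrArg (fun s : Σ i : Fin (n + 1), (S i.succ).vars.N =>
          (⟨s.1.succ, s.2⟩ : Σ i, (S i).vars.N)) (ih (Sum.inr_injective h))

section
variable {S' : Fin n → LShape C} {W' : LShape C}

/-- A position of a pair of factors, as a position of the tensor products. -/
def tinSrc (t : TensorOf S W) (t' : TensorOf S' W') (i : Fin n) {A : C} :
    State (srcLab (S i).vars (S' i).vars) A → State (srcLab W.vars W'.vars) A
  | ⟨.inl p, k⟩ => ⟨.inl (t.tinP i ⟨p, k⟩).1, (t.tinP i ⟨p, k⟩).2⟩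
  | ⟨.inr p, k⟩ => ⟨.inr (t'.tinN i ⟨p, k⟩).1, (t'.tinN i ⟨p, k⟩).2⟩

def tinTgt (t : TensorOf S W) (t' : TensorOf S' W') (i : Fin n) {A : C} :
    State (tgtLab (S i).vars (S' i).vars) A → State (tgtLab W.vars W'.vars) A
  | ⟨.inl p, k⟩ => ⟨.inl (t.tinN i ⟨p, k⟩).1, (t.tinN i ⟨p, k⟩).2⟩
  | ⟨.inr p, k⟩ => ⟨.inr (t'.tinP i ⟨p, k⟩).1, (t'.tinP i ⟨p, k⟩).2⟩

end

/-- The tensor product of a sequence of graphs. -/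
def map : ∀ {n : ℕ} {S S' : Fin n → LShape C} {W W' : LShape C} (_ : TensorOf S W)
    (_ : TensorOf S' W') (_ : ∀ i, Matching (S i).vars (S' i).vars), Matching W.vars W'.vars
  | _, _, _, _, _, .zero, .zero, _ => .id _
  | _, S, S', _, _, .one, .one, m => m 0
  | _, S, S', _, _, .succ t, .succ t', m => (m 0).tensor (t.map t' fun i => m i.succ)

theorem allowable_map : ∀ {n : ℕ} {S S' : Fin n → LShape C} {W W' : LShape C} (t : TensorOf S W)
    (t' : TensorOf S' W') {m : ∀ i, Matching (S i).vars (S' i).vars},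
    (∀ i, Allowable _ _ (m i)) → Allowable W W' (t.map t' m)
  | _, _, _, _, _, .zero, .zero, _, _ => .id .unit
  | _, S, S', _, _, .one, .one, _, h => h 0
  | _, S, S', _, _, .succ t, .succ t', _, h => .tensor (h 0) (allowable_map t t' fun i => h i.succ)

/-- A tensor product of graphs is a disjoint union, so it acts on each factor separately. -/
theorem push_map : ∀ {n : ℕ} {S S' : Fin n → LShape C} {W W' : LShape C} (t : TensorOf S W)
    (t' : TensorOf S' W') (m : ∀ i, Matching (S i).vars (S' i).vars) (i : Fin n) {A : C}
    (ρ : State (srcLab (S i).vars (S' i).vars) A),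
    (t.map t' m).push (tinSrc t t' i ρ) = tinTgt t t' i ((m i).push ρ)
  | _, _, _, _, _, .zero, .zero, _, i, _, _ => i.elim0
  | _, S, S', _, _, .one, .one, m, i, A, ρ => by
    have id1 : ∀ ρ, tinSrc (TensorOf.one (S := S)) (TensorOf.one (S := S')) 0 (A := A) ρ = ρ := by
      rintro ⟨_ | _, k⟩ <;> rfl
    have id2 : ∀ ρ, tinTgt (TensorOf.one (S := S)) (TensorOf.one (S := S')) 0 (A := A) ρ = ρ := by
      rintro ⟨_ | _, k⟩ <;> rfl
    revert ρ
    refine Fin.cases ?_ (fun i => i.elim0) i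
    intro ρ
    rw [id1, id2]; rfl
  | _, S, S', _, _, .succ (W := W) t, .succ (W := W') t', m, i, A, ρ => by
    revert ρ
    refine Fin.cases ?_ (fun i => ?_) i
    · intro ρ
      have h := push_sumL (m 0) (t.map t' fun i => m i.succ) ρ
      have id1 : tinSrc (TensorOf.succ (S := S) t) (TensorOf.succ (S := S') t') 0 ρ = sumSrcL ρ := by
        rcases ρ with ⟨_ | _, k⟩ <;> rfl
      have id2 : ∀ τ, tinTgt (TensorOf.succ (S := S) t) (TensorOf.succ (S := S') t') 0 (A := A) τ =
          sumLeft τ := by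
        rintro ⟨_ | _, k⟩ <;> rfl
      rw [id1, id2]; exact h
    · intro ρ
      have h := push_sumR (m 0) (t.map t' fun i => m i.succ) (tinSrc t t' i ρ)
      rw [push_map t t' (fun i => m i.succ) i ρ] at h
      have id1 : tinSrc (TensorOf.succ (S := S) t) (TensorOf.succ (S := S') t') i.succ ρ =
          sumSrcR (tinSrc t t' i ρ) := by
        rcases ρ with ⟨_ | _, k⟩ <;> rfl
      have id2 : ∀ τ, tinTgt (TensorOf.succ (S := S) t) (TensorOf.succ (S := S') t') i.succ (A := A) τ =
          sumRight (tinTgt t t' i τ) := by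
        rintro ⟨_ | _, k⟩ <;> rfl
      rw [id1, id2]; exact h

end TensorOf

section Place
variable (H : D ⥤ AC C)

/-- The variables of `H x`, at a position labelled by `x` of a shape into which `H` is substituted. -/
noncomputable def placePP {T : LShape D} {A : C} : ∀ {x : D} (_ : Pos T.vars.lP x) (_ : State (LShape.vars (H.obj x)).lP A),
    State (T.bind H).vars.lP A
  | _, ⟨a, rfl⟩, ⟨q, k⟩ => (T.bindIso H).p.e A ⟨.inl ⟨a, q⟩, k⟩

/-- In these names the first letter is the sign of the position in `T` and the second the sign of
the variable of `H x`. The sign of the resulting variable is their product. -/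
noncomputable def placePN {T : LShape D} {A : C} : ∀ {x : D} (_ : Pos T.vars.lP x) (_ : State (LShape.vars (H.obj x)).lN A),
    State (T.bind H).vars.lN A
  | _, ⟨a, rfl⟩, ⟨q, k⟩ => (T.bindIso H).n.e A ⟨.inl ⟨a, q⟩, k⟩

noncomputable def placeNP {T : LShape D} {A : C} : ∀ {x : D} (_ : Pos T.vars.lN x) (_ : State (LShape.vars (H.obj x)).lP A),
    State (T.bind H).vars.lN A
  | _, ⟨a, rfl⟩, ⟨q, k⟩ => (T.bindIso H).n.e A ⟨.inr ⟨a, q⟩, k⟩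

noncomputable def placeNN {T : LShape D} {A : C} : ∀ {x : D} (_ : Pos T.vars.lN x) (_ : State (LShape.vars (H.obj x)).lN A),
    State (T.bind H).vars.lP A
  | _, ⟨a, rfl⟩, ⟨q, k⟩ => (T.bindIso H).p.e A ⟨.inr ⟨a, q⟩, k⟩

variable {T S : LShape D} {x y : D} {A : C}

/-- Leaving a source through a positive variable. -/
noncomputable def srcOut : Pos (srcLab T.vars S.vars) x → State (LShape.vars (H.obj x)).lP A →
    State (srcLab (T.bind H).vars (S.bind H).vars) A
  | ⟨.inl p, h⟩, s => ⟨.inl (placePP H ⟨p, h⟩ s).1, (placePP H ⟨p, h⟩ s).2⟩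
  | ⟨.inr n, h⟩, s => ⟨.inr (placeNP H ⟨n, h⟩ s).1, (placeNP H ⟨n, h⟩ s).2⟩

/-- Entering a source through a negative variable. -/
noncomputable def srcIn : Pos (srcLab T.vars S.vars) x → State (LShape.vars (H.obj x)).lN A →
    State (tgtLab (T.bind H).vars (S.bind H).vars) A
  | ⟨.inl p, h⟩, s => ⟨.inl (placePN H ⟨p, h⟩ s).1, (placePN H ⟨p, h⟩ s).2⟩
  | ⟨.inr n, h⟩, s => ⟨.inr (placeNN H ⟨n, h⟩ s).1, (placeNN H ⟨n, h⟩ s).2⟩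

/-- Entering a target through a positive variable. -/
noncomputable def tgtOut : Pos (tgtLab T.vars S.vars) x → State (LShape.vars (H.obj x)).lP A →
    State (tgtLab (T.bind H).vars (S.bind H).vars) A
  | ⟨.inl n, h⟩, s => ⟨.inl (placeNP H ⟨n, h⟩ s).1, (placeNP H ⟨n, h⟩ s).2⟩
  | ⟨.inr p, h⟩, s => ⟨.inr (placePP H ⟨p, h⟩ s).1, (placePP H ⟨p, h⟩ s).2⟩

/-- Leaving a target through a negative variable. -/
noncomputable def tgtIn : Pos (tgtLab T.vars S.vars) x → State (LShape.vars (H.obj x)).lN A →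
    State (srcLab (T.bind H).vars (S.bind H).vars) A
  | ⟨.inl n, h⟩, s => ⟨.inl (placeNN H ⟨n, h⟩ s).1, (placeNN H ⟨n, h⟩ s).2⟩
  | ⟨.inr p, h⟩, s => ⟨.inr (placePN H ⟨p, h⟩ s).1, (placePN H ⟨p, h⟩ s).2⟩

/-- The end of an edge of `H.map g`, at the ends of an edge labelled by `g`. -/
noncomputable def edgeEnd (a : Pos (srcLab T.vars S.vars) x) (b : Pos (tgtLab T.vars S.vars) y) :
    State (tgtLab (LShape.vars (H.obj x)) (LShape.vars (H.obj y))) A →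
    State (tgtLab (T.bind H).vars (S.bind H).vars) A
  | ⟨.inl q, k⟩ => srcIn H a ⟨q, k⟩
  | ⟨.inr q, k⟩ => tgtOut H b ⟨q, k⟩

theorem inTgt_eq (a : Src T.vars S.vars) (b : Tgt T.vars S.vars) (τ) :
    inTgt H T S a b (A := A) τ = edgeEnd H ⟨a, rfl⟩ ⟨b, rfl⟩ τ := by
  rcases τ with ⟨q | q, k⟩ <;> rcases a with a | a <;> rcases b with b | b <;> rfl

/-- Each edge `a → b` with label `g` is replaced by the graph `H g`. At a positive variable of `H x`
this graph is entered at its source. -/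
theorem push_srcOut {f : Matching T.vars S.vars} {a : Pos (srcLab T.vars S.vars) x}
    {b : Pos (tgtLab T.vars S.vars) y} {g : x ⟶ y} (h : f.push (a.st (𝟙 x)) = b.st g) (q)
    (k : A ⟶ (LShape.vars (H.obj x)).lP q) :
    (f.subst H).push (srcOut H a ⟨q, k⟩) = edgeEnd H a b (Matching.push (H.map g).1 ⟨.inl q, k⟩) := by
  obtain ⟨a, rfl⟩ := a
  obtain ⟨b, rfl⟩ := b
  have h' : f.step a = ⟨b, g⟩ := by
    have h2 : (⟨f.mate a, f.label a⟩ : State _ _) = ⟨b, g⟩ := by simpa [Pos.st, push] using h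
    exact h2
  have h2 := push_subst (F := H) h' (A := A) ⟨.inl q, k⟩
  rw [inTgt_eq] at h2
  rw [← h2]; rcases a with a | a <;> rfl

/-- The same graph `H g` entered at its target, through a negative variable of `H y`: the original
edge is traversed backwards. -/
theorem push_tgtIn {f : Matching T.vars S.vars} {a : Pos (srcLab T.vars S.vars) x}
    {b : Pos (tgtLab T.vars S.vars) y} {g : x ⟶ y} (h : f.push (a.st (𝟙 x)) = b.st g) (q)
    (k : A ⟶ (LShape.vars (H.obj y)).lN q) :
    (f.subst H).push (tgtIn H b ⟨q, k⟩) = edgeEnd H a b (Matching.push (H.map g).1 ⟨.inr q, k⟩) := by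
  obtain ⟨a, rfl⟩ := a
  obtain ⟨b, rfl⟩ := b
  have h' : f.step a = ⟨b, g⟩ := by
    have h2 : (⟨f.mate a, f.label a⟩ : State _ _) = ⟨b, g⟩ := by simpa [Pos.st, push] using h
    exact h2
  have h2 := push_subst (F := H) h' (A := A) ⟨.inr q, k⟩
  rw [inTgt_eq] at h2
  rw [← h2]; rcases a with a | a <;> rcases b with b | b <;> rfl

end Place

namespace TensorOf
variable (H : D ⥤ AC C) {n : ℕ} {S : Fin n → LShape D} {W : LShape D}

/-- Substituting into a factor and then including the factor in the product is the same as including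
first. There is one such lemma for each pair of signs. -/
theorem placePP_posP (t : TensorOf S W) (i : Fin n) {x : D} (p : Pos (S i).vars.lP x) {A : C}
    (s : State (LShape.vars (H.obj x)).lP A) :
    placePP H (t.posP i p) s = (t.bind H).tinP i (placePP H p s) := by
  induction t with
  | zero => exact i.elim0
  | @one S =>
    revert p
    exact Fin.cases (fun p => rfl) (fun i => i.elim0) i
  | @succ n S W t ih =>
    revert p
    refine Fin.cases (fun p => ?_) (fun i p => ?_) i
    · obtain ⟨p, rfl⟩ := p
      rfl
    · have h := ih i p
      -- `placePP` reduces only where the label equation of the position is `rfl`; destructuring the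
      -- position in the tail makes it so.
      rcases e : t.posP i p with ⟨p', rfl⟩
      rw [e] at h
      have e' : t.succ.posP i.succ p = ⟨.inr p', rfl⟩ :=
        Pos.ext_idx (congrArg Sum.inr (congrArg Pos.idx e))
      rw [e']
      exact congrArg (fun s : State _ A =>
        (⟨.inr s.1, s.2⟩ : State (LShape.vars (.tensor _ _)).lP A)) h

theorem placePN_posP (t : TensorOf S W) (i : Fin n) {x : D} (p : Pos (S i).vars.lP x) {A : C}
    (s : State (LShape.vars (H.obj x)).lN A) :
    placePN H (t.posP i p) s = (t.bind H).tinN i (placePN H p s) := by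
  induction t with
  | zero => exact i.elim0
  | @one S =>
    revert p
    exact Fin.cases (fun p => rfl) (fun i => i.elim0) i
  | @succ n S W t ih =>
    revert p
    refine Fin.cases (fun p => ?_) (fun i p => ?_) i
    · obtain ⟨p, rfl⟩ := p
      rfl
    · have h := ih i p
      rcases e : t.posP i p with ⟨p', rfl⟩
      rw [e] at h
      have e' : t.succ.posP i.succ p = ⟨.inr p', rfl⟩ :=
        Pos.ext_idx (congrArg Sum.inr (congrArg Pos.idx e))
      rw [e']
      exact congrArg (fun s : State _ A =>
        (⟨.inr s.1, s.2⟩ : State (LShape.vars (.tensor _ _)).lN A)) h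

theorem placeNP_posN (t : TensorOf S W) (i : Fin n) {x : D} (p : Pos (S i).vars.lN x) {A : C}
    (s : State (LShape.vars (H.obj x)).lP A) :
    placeNP H (t.posN i p) s = (t.bind H).tinN i (placeNP H p s) := by
  induction t with
  | zero => exact i.elim0
  | @one S =>
    revert p
    exact Fin.cases (fun p => rfl) (fun i => i.elim0) i
  | @succ n S W t ih =>
    revert p
    refine Fin.cases (fun p => ?_) (fun i p => ?_) i
    · obtain ⟨p, rfl⟩ := p
      rfl
    · have h := ih i p
      rcases e : t.posN i p with ⟨p', rfl⟩
      rw [e] at h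
      have e' : t.succ.posN i.succ p = ⟨.inr p', rfl⟩ :=
        Pos.ext_idx (congrArg Sum.inr (congrArg Pos.idx e))
      rw [e']
      exact congrArg (fun s : State _ A =>
        (⟨.inr s.1, s.2⟩ : State (LShape.vars (.tensor _ _)).lN A)) h

theorem placeNN_posN (t : TensorOf S W) (i : Fin n) {x : D} (p : Pos (S i).vars.lN x) {A : C}
    (s : State (LShape.vars (H.obj x)).lN A) :
    placeNN H (t.posN i p) s = (t.bind H).tinP i (placeNN H p s) := by
  induction t with
  | zero => exact i.elim0
  | @one S =>
    revert p
    exact Fin.cases (fun p => rfl) (fun i => i.elim0) i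
  | @succ n S W t ih =>
    revert p
    refine Fin.cases (fun p => ?_) (fun i p => ?_) i
    · obtain ⟨p, rfl⟩ := p
      rfl
    · have h := ih i p
      rcases e : t.posN i p with ⟨p', rfl⟩
      rw [e] at h
      have e' : t.succ.posN i.succ p = ⟨.inr p', rfl⟩ :=
        Pos.ext_idx (congrArg Sum.inr (congrArg Pos.idx e))
      rw [e']
      exact congrArg (fun s : State _ A =>
        (⟨.inr s.1, s.2⟩ : State (LShape.vars (.tensor _ _)).lP A)) h

end TensorOf
end KM

/-! ### Variables of `[x₁ ⊗ ⋯ ⊗ xₙ, x]`, and the frame functor on edges -/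

namespace KM
open SignedSet Matching SymMulticategory
variable {C : Type u} [Category.{v} C] {D : Type u'} [Category.{v'} D]

/-- `factorP`, `factorN` and `tensIso`, in which the graph of a tree is expressed, are inclusions of
factors. These three lemmas reduce them to `TensorOf`. -/
theorem factorP_eq (F : C ⥤ AC D) : ∀ {n : ℕ} (x : Fin n → C) (i : Fin n) {A : D}
    (s : State (LShape.vars (F.obj (x i))).lP A),
    factorP F x i s = ((TensorOf.tens fun i => .of (x i)).bind F).tinP i s
  | 0, _, i, _, _ => i.elim0
  | 1, x, i, A, s => by
    revert s
    exact Fin.cases (fun s => rfl) (fun i => i.elim0) i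
  | n + 2, x, i, A, s => by
    revert s
    refine Fin.cases (fun s => rfl) (fun i s => ?_) i
    have h := factorP_eq F (fun i : Fin (n + 1) => x i.succ) i s
    exact congrArg (fun s : State _ A =>
      (⟨.inr s.1, s.2⟩ : State (LShape.vars (.tensor _ _)).lP A)) h

theorem factorN_eq (F : C ⥤ AC D) : ∀ {n : ℕ} (x : Fin n → C) (i : Fin n) {A : D}
    (s : State (LShape.vars (F.obj (x i))).lN A),
    factorN F x i s = ((TensorOf.tens fun i => .of (x i)).bind F).tinN i s
  | 0, _, i, _, _ => i.elim0
  | 1, x, i, A, s => by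
    revert s
    exact Fin.cases (fun s => rfl) (fun i => i.elim0) i
  | n + 2, x, i, A, s => by
    revert s
    refine Fin.cases (fun s => rfl) (fun i s => ?_) i
    have h := factorN_eq F (fun i : Fin (n + 1) => x i.succ) i s
    exact congrArg (fun s : State _ A =>
      (⟨.inr s.1, s.2⟩ : State (LShape.vars (.tensor _ _)).lN A)) h

theorem tensIso_eq : ∀ {n : ℕ} (x : Fin n → C) (l : Fin n) {A : C} (k : A ⟶ x l),
    (tensIso n x).p.e A ⟨l, k⟩ = (TensorOf.tens fun i => .of (x i)).tinP l ⟨(), k⟩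
  | 0, _, i, _, _ => i.elim0
  | 1, x, i, A, k => by
    revert k
    exact Fin.cases (fun s => rfl) (fun i => i.elim0) i
  | n + 2, x, i, A, k => by
    revert k
    refine Fin.cases (fun s => rfl) (fun i k => ?_) i
    have h := tensIso_eq (fun i : Fin (n + 1) => x i.succ) i k
    exact congrArg (fun s : State (LShape.vars (.tens (n + 1) fun i => .of (x i.succ))).lP A =>
      (⟨.inr s.1, s.2⟩ : State (LShape.vars (.tens (n + 2) fun i => .of (x i))).lP A)) h

/-- The `j`-th variable of `x₁ ⊗ ⋯ ⊗ xₙ`. -/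
def tensPos {n : ℕ} (x : Fin n → C) (j : Fin n) :
    Pos (LShape.tens n fun i => .of (x i)).vars.lP (x j) :=
  (TensorOf.tens fun i => .of (x i)).posP j (⟨(), rfl⟩ : Pos (LShape.vars (.of (x j))).lP (x j))

theorem tensIso_st {n : ℕ} (x : Fin n → C) (l : Fin n) {A : C} (k : A ⟶ x l) :
    (tensIso n x).p.e A ⟨l, k⟩ = (tensPos x l).st k := by
  refine (tensIso_eq x l k).trans (Eq.trans ?_ (TensorOf.tinP_st (TensorOf.tens fun i => .of (x i)) l
    (⟨(), rfl⟩ : Pos (LShape.vars (.of (x l))).lP (x l)) k))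
  exact congrArg _ (Pos.st_mk (lab := (LShape.vars (.of (x l))).lP) () k).symm

theorem tensPos_surj {n : ℕ} (x : Fin n → C) (q : (LShape.tens n fun i => .of (x i)).vars.P) :
    ∃ j, (tensPos x j).idx = q := by
  obtain ⟨i, ⟨⟩, h⟩ := TensorOf.posP_surj (TensorOf.tens fun i => .of (x i)) q
  exact ⟨i, h⟩

theorem tensPos_inj {n : ℕ} (x : Fin n → C) {i j : Fin n}
    (h : (tensPos x i).idx = (tensPos x j).idx) : i = j :=
  congrArg Sigma.fst (TensorOf.posP_inj (TensorOf.tens fun i => .of (x i)) h)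

theorem tens_isEmpty {n : ℕ} (x : Fin n → C) : IsEmpty (LShape.tens n fun i => .of (x i)).vars.N :=
  ⟨fun q => by
    obtain ⟨i, ⟨⟩, h⟩ := TensorOf.posN_surj (TensorOf.tens fun i => .of (x i)) q⟩

/-- The input `j` of the shape `[x₁ ⊗ ⋯ ⊗ xₙ, x]`. -/
def shapeIn {n : ℕ} (x : Fin n → C) (y : C) (j : Fin n) : Pos (LShape.vars (shape x y)).lN (x j) :=
  ⟨.inl (tensPos x j).idx, (tensPos x j).eq⟩

/-- The output of the shape `[x₁ ⊗ ⋯ ⊗ xₙ, x]`. -/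
def shapeOut {n : ℕ} (x : Fin n → C) (y : C) : Pos (LShape.vars (shape x y)).lP y := ⟨.inr (), rfl⟩

/-- The inputs are the only negative variables of an arrow's shape and the output is the only
positive one, because a tensor product of variables has no negative variables. -/
theorem shapeP_surj {n : ℕ} {x : Fin n → C} {y : C} (q : (LShape.vars (shape x y)).P) :
    q = (shapeOut x y).idx := by
  rcases q with q | ⟨⟩
  · exact (tens_isEmpty x).elim q
  · rfl

theorem shapeN_surj {n : ℕ} {x : Fin n → C} {y : C} (q : (LShape.vars (shape x y)).N) :
    ∃ j, q = (shapeIn x y j).idx := by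
  rcases q with q | ⟨⟨⟩⟩
  obtain ⟨j, rfl⟩ := tensPos_surj x q
  exact ⟨j, rfl⟩

theorem shapeOut_st {n : ℕ} (x : Fin n → C) (y : C) {A : C} (k : A ⟶ y) :
    (shapeOut x y).st k = ⟨.inr (), k⟩ :=
  Pos.st_mk (lab := (LShape.vars (shape x y)).lP) (.inr ()) k

theorem push_frame_out {Q : SymMulticategory.{u, v, w} C} {f g : Q.Elt} (γ : f ⟶ g) {A : C}
    (k : A ⟶ f.tgt) : Matching.push (Q.frame.map γ).1
      (⟨.inl (.inr ()), k⟩ : State (srcLab (LShape.vars (shape f.src f.tgt)) _) A) =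
      ⟨.inr (.inr ()), k ≫ γ.output⟩ :=
  push_homR (tensReindex γ.perm γ.input) (Matching.single γ.output)
    (⟨.inl (), k⟩ : State (srcLab (SignedSet.single f.tgt) (SignedSet.single g.tgt)) A)

/-- Input edges run against `γ`, from the inputs of `g` to those of `f`, since inputs sit in the
first argument of the internal hom. -/
theorem push_frame_in {Q : SymMulticategory.{u, v, w} C} {f g : Q.Elt} (γ : f ⟶ g) (j : Fin f.n)
    {A : C} (k : A ⟶ g.src (γ.perm j)) : Matching.push (Q.frame.map γ).1
      ⟨.inr (shapeIn g.src g.tgt (γ.perm j)).idx, ((shapeIn g.src g.tgt (γ.perm j)).st k).2⟩ =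
      ⟨.inl (shapeIn f.src f.tgt j).idx, ((shapeIn f.src f.tgt j).st (k ≫ γ.input j)).2⟩ := by
  have h := push_homL (Y := SignedSet.single f.tgt) (Y' := SignedSet.single g.tgt)
    (tensReindex γ.perm γ.input) (Matching.single γ.output) (tensSrc ⟨γ.perm j, k⟩)
  have e := push_tensReindex γ.perm γ.input j k
  have e1 := congrArg (fun s : State (LShape.vars (.tens g.n fun i => .of (g.src i))).lP A =>
    (homSrcL ⟨.inl s.1, s.2⟩ : State (srcLab (LShape.vars (shape f.src f.tgt))
      (LShape.vars (shape g.src g.tgt))) A)) (tensIso_st g.src (γ.perm j) k)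
  have e2 := congrArg (fun s : State (LShape.vars (.tens f.n fun i => .of (f.src i))).lP A =>
    (homLeft ⟨.inr s.1, s.2⟩ : State (tgtLab (LShape.vars (shape f.src f.tgt))
      (LShape.vars (shape g.src g.tgt))) A)) (tensIso_st f.src j (k ≫ γ.input j))
  exact (congrArg _ e1.symm).trans (h.trans ((congrArg homLeft e).trans e2))

end KM

/-! ### Trees and their graphs determine each other -/

namespace KM
open SignedSet Matching SymMulticategory
variable {C : Type u} [Category.{v} C] {D : Type u'} [Category.{v'} D]

namespace SymMulticategory
variable {Q : SymMulticategory.{u, v, w} C} {n : ℕ} (F : Fin n → Q.Elt) (f : Q.Elt)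

noncomputable abbrev ladderSrc : Src (LShape.vars (AC.I : AC C)) (LShape.vars (ladder F f)) → C :=
  srcLab (LShape.vars (AC.I : AC C)) (LShape.vars (ladder F f))

noncomputable abbrev ladderTgt : Tgt (LShape.vars (AC.I : AC C)) (LShape.vars (ladder F f)) → C :=
  tgtLab (LShape.vars (AC.I : AC C)) (LShape.vars (ladder F f))

/-- `φ F₁ ⊗ ⋯ ⊗ φ Fₙ` as a tensor product. -/
noncomputable def nodeTens : TensorOf (fun i => (LShape.of (F i)).bind Q.frame)
    (LShape.bind Q.frame (.tens n fun i => .of (F i))) :=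
  (TensorOf.tens fun i => .of (F i)).bind Q.frame

/-- The output is positive in `φ Fᵢ`, negative once `φ Fᵢ` stands in the first argument of the hom,
and so a source of a graph out of `I`. For the same reason the inputs of nodes are targets, whereas
for `f` the inputs are sources and the output is the target called root. -/
noncomputable def nodeOutPos (i : Fin n) : Pos (ladderSrc F f) (F i).tgt :=
  ⟨.inr (.inl ((nodeTens F).posP i (shapeOut (F i).src (F i).tgt)).idx),
    ((nodeTens F).posP i (shapeOut (F i).src (F i).tgt)).eq⟩

noncomputable def leafPos (l : Fin f.n) : Pos (ladderSrc F f) (f.src l) :=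
  ⟨.inr (.inr (.inl (tensPos f.src l).idx)), (tensPos f.src l).eq⟩

noncomputable def nodeInPos (i : Fin n) (j : Fin (F i).n) : Pos (ladderTgt F f) ((F i).src j) :=
  ⟨.inr (.inl ((nodeTens F).posN i (shapeIn (F i).src (F i).tgt j)).idx),
    ((nodeTens F).posN i (shapeIn (F i).src (F i).tgt j)).eq⟩

noncomputable def rootPos : Pos (ladderTgt F f) f.tgt := ⟨.inr (.inr (.inr ())), rfl⟩

theorem nodeOut_eq (i : Fin n) {A : C} (k : A ⟶ (F i).tgt) :
    nodeOut F f i k = (nodeOutPos F f i).st k := by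
  have h := (factorP_eq Q.frame F i ⟨.inr (), k⟩).trans
    ((congrArg ((nodeTens F).tinP i) (shapeOut_st (F i).src (F i).tgt k).symm).trans
      ((nodeTens F).tinP_st i (shapeOut (F i).src (F i).tgt) k))
  exact congrArg (fun s : State (LShape.vars (LShape.bind Q.frame (.tens n fun i => .of (F i)))).lP A =>
    (⟨.inr (.inl s.1), s.2⟩ : State (ladderSrc F f) A)) h

theorem leafOut_eq (l : Fin f.n) {A : C} (k : A ⟶ f.src l) :
    leafOut F f l k = (leafPos F f l).st k :=
  congrArg (fun s : State (LShape.vars (LShape.tens f.n fun i => .of (f.src i))).lP A =>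
    (⟨.inr (.inr (.inl s.1)), s.2⟩ : State (ladderSrc F f) A)) (tensIso_st f.src l k)

theorem shapeIn_st {m : ℕ} (x : Fin m → C) (y : C) (j : Fin m) {A : C} (k : A ⟶ x j) :
    (shapeIn x y j).st k = ⟨.inl ((tensIso m x).p.e A ⟨j, k⟩).1, ((tensIso m x).p.e A ⟨j, k⟩).2⟩ :=
  congrArg (fun s : State (LShape.vars (LShape.tens m fun i => .of (x i))).lP A =>
    (⟨.inl s.1, s.2⟩ : State (LShape.vars (shape x y)).lN A)) (tensIso_st x j k).symm

theorem nodeIn_eq (i : Fin n) (j : Fin (F i).n) {A : C} (k : A ⟶ (F i).src j) :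
    nodeIn F f i j k = (nodeInPos F f i j).st k := by
  have h := (factorN_eq Q.frame F i _).trans
    ((congrArg ((nodeTens F).tinN i) (shapeIn_st (F i).src (F i).tgt j k).symm).trans
      ((nodeTens F).tinN_st i (shapeIn (F i).src (F i).tgt j) k))
  exact congrArg (fun s : State (LShape.vars (LShape.bind Q.frame (.tens n fun i => .of (F i)))).lN A =>
    (⟨.inr (.inl s.1), s.2⟩ : State (ladderTgt F f) A)) h

theorem rootIn_eq {A : C} (k : A ⟶ f.tgt) : rootIn F f k = (rootPos F f).st k :=
  (Pos.st_mk (lab := ladderTgt F f) (.inr (.inr (.inr ()))) k).symm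

theorem src_cases (a : Src (LShape.vars (AC.I : AC C)) (LShape.vars (ladder F f))) :
    (∃ i, a = (nodeOutPos F f i).idx) ∨ ∃ l, a = (leafPos F f l).idx := by
  rcases a with ⟨⟨⟩⟩ | q | q | ⟨⟨⟩⟩
  · obtain ⟨i, p, rfl⟩ := (nodeTens F).posP_surj q
    obtain rfl := shapeP_surj p
    exact .inl ⟨i, rfl⟩
  · obtain ⟨j, rfl⟩ := tensPos_surj f.src q
    exact .inr ⟨j, rfl⟩

variable {F f}

theorem nodeOutPos_inj {i i' : Fin n} (h : (nodeOutPos F f i).idx = (nodeOutPos F f i').idx) : i = i' :=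
  congrArg Sigma.fst ((nodeTens F).posP_inj (Sum.inl_injective (Sum.inr_injective h)))

theorem leafPos_inj {l l' : Fin f.n} (h : (leafPos F f l).idx = (leafPos F f l').idx) : l = l' :=
  tensPos_inj f.src (Sum.inl_injective (Sum.inr_injective (Sum.inr_injective h)))

theorem nodeOutPos_ne {i : Fin n} {l : Fin f.n} : (nodeOutPos F f i).idx ≠ (leafPos F f l).idx :=
  fun h => nomatch h

theorem nodeInPos_ne {i : Fin n} {j : Fin (F i).n} : (nodeInPos F f i j).idx ≠ (rootPos F f).idx :=
  fun h => nomatch h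

theorem nodeInPos_inj {i i' : Fin n} {j : Fin (F i).n} {j' : Fin (F i').n}
    (h : (nodeInPos F f i j).idx = (nodeInPos F f i' j').idx) :
    (⟨i, j⟩ : Σ i, Fin (F i).n) = ⟨i', j'⟩ := by
  have h1 := (nodeTens F).posN_inj (Sum.inl_injective (Sum.inr_injective h))
  obtain rfl : i = i' := congrArg Sigma.fst h1
  have h2 := eq_of_heq (Sigma.mk.inj h1).2
  exact congrArg _ (tensPos_inj _ (Sum.inl_injective h2))

/-- The edges of a graph that lead into the position `p` and the inputs of nodes are those of the tree. -/
def Edges (θ : (AC.I : AC C) ⟶ ladder F f) : ∀ {x : C} (_ : Tree F f.src x)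
    (_ : Pos (ladderTgt F f) x), Prop
  | _, .leaf l a, p => θ.1.push ((leafPos F f l).st (𝟙 _)) = p.st a
  | _, .node i a ch, p => θ.1.push ((nodeOutPos F f i).st (𝟙 _)) = p.st a ∧
      ∀ j, Edges θ (ch j) (nodeInPos F f i j)

theorem hasEdges_iff (θ : (AC.I : AC C) ⟶ ladder F f) {x : C} (T : Tree F f.src x)
    {t : ∀ {A : C} (_ : A ⟶ x), State (ladderTgt F f) A} {p : Pos (ladderTgt F f) x}
    (h : ∀ {A : C} (k : A ⟶ x), t k = p.st k) : HasEdges θ T t ↔ Edges θ T p := by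
  induction T with
  | leaf l a => exact Iff.of_eq (congrArg₂ (fun s t => θ.1.push s = t) (leafOut_eq F f l _) (h _))
  | node i a ch ih =>
    exact and_congr (Iff.of_eq (congrArg₂ (fun s t => θ.1.push s = t) (nodeOut_eq F f i _) (h _)))
      (forall_congr' fun j => ih j (nodeIn_eq F f i j))

theorem isGraph_iff (θ : (AC.I : AC C) ⟶ ladder F f) (T : Tree F f.src f.tgt) :
    IsGraph θ T ↔ Edges θ T (rootPos F f) :=
  hasEdges_iff θ T (rootIn_eq F f)

/-- Naturality: an edge known at the identity is known at every morphism. This is what makes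
`Edges`, which tests identities only, equivalent to `Tree.Runs`, which tests all morphisms. -/
theorem push_st {X Y : SignedSet C} {θ : Matching X Y} {x y : C} {p : Pos (srcLab X Y) x}
    {q : Pos (tgtLab X Y) y} {a : x ⟶ y} (h : θ.push (p.st (𝟙 _)) = q.st a) {A : C} (k : A ⟶ x) :
    θ.push (p.st k) = q.st (k ≫ a) := by
  rw [← Pos.pre_st, ← h, ← push_pre, Pos.pre_st, Category.comp_id]

theorem edges_iff_runs (θ : (AC.I : AC C) ⟶ ladder F f) {x : C} (T : Tree F f.src x)
    (p : Pos (ladderTgt F f) x) : Edges θ T p ↔ T.Runs (fun A s t => θ.1.push s = t)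
      (fun i A k => (nodeOutPos F f i).st k) (fun i j A k => (nodeInPos F f i j).st k)
      (fun l A k => (leafPos F f l).st k) (fun A k => p.st k) := by
  induction T with
  | leaf l a =>
    exact ⟨fun h A k => push_st h k, fun h => (h _ (𝟙 _)).trans (by rw [Category.id_comp])⟩
  | node i a ch ih =>
    exact ⟨fun h => ⟨fun A k => push_st h.1 k, fun j => (ih j _).1 (h.2 j)⟩,
      fun h => ⟨(h.1 _ (𝟙 _)).trans (by rw [Category.id_comp]), fun j => (ih j _).2 (h.2 j)⟩⟩

theorem mate_eq {X Y : SignedSet C} {θ : Matching X Y} {x y : C} {p : Pos (srcLab X Y) x}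
    {q : Pos (tgtLab X Y) y} {a : x ⟶ y} (h : θ.push (p.st (𝟙 _)) = q.st a) : θ.mate p.idx = q.idx :=
  congrArg Sigma.fst h

/-- A graph is the graph of at most one tree. -/
theorem Edges.tree_unique {θ : (AC.I : AC C) ⟶ ladder F f} {x : C} {T T' : Tree F f.src x}
    {p : Pos (ladderTgt F f) x} (h : Edges θ T p) (h' : Edges θ T' p) : T = T' := by
  induction T with
  | leaf l a =>
    cases T' with
    | leaf l' a' =>
      obtain rfl := leafPos_inj (θ.1.bij.1 ((mate_eq h).trans (mate_eq h').symm))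
      exact congrArg _ (p.st_inj (h.symm.trans h'))
    | node i' a' ch' => exact (nodeOutPos_ne (θ.1.bij.1 ((mate_eq h'.1).trans (mate_eq h).symm))).elim
  | node i a ch ih =>
    cases T' with
    | leaf l' a' => exact (nodeOutPos_ne (θ.1.bij.1 ((mate_eq h.1).trans (mate_eq h').symm))).elim
    | node i' a' ch' =>
      obtain rfl := nodeOutPos_inj (θ.1.bij.1 ((mate_eq h.1).trans (mate_eq h'.1).symm))
      exact congrArg₂ _ (p.st_inj (h.1.symm.trans h'.1)) (funext fun j => ih j (h.2 j) (h'.2 j))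

/-- Both graphs have the edges prescribed by the tree at the nodes and leaves listed by `ν` and `ρ`.
For a configuration these lists are complete, so the graphs coincide. -/
theorem Edges.push_eq {θ θ' : (AC.I : AC C) ⟶ ladder F f} {x : C} {T : Tree F f.src x}
    {κ μ : Type} [Finite μ] {ν : κ → Fin n} {ρ : μ → Fin f.n} {g} (hT : Composes T ν ρ g)
    {p : Pos (ladderTgt F f) x} (h : Edges θ T p) (h' : Edges θ' T p) :
    (∀ k, θ.1.push ((nodeOutPos F f (ν k)).st (𝟙 _)) = θ'.1.push ((nodeOutPos F f (ν k)).st (𝟙 _))) ∧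
    ∀ m, θ.1.push ((leafPos F f (ρ m)).st (𝟙 _)) = θ'.1.push ((leafPos F f (ρ m)).st (𝟙 _)) := by
  induction hT with
  | leaf l a => exact ⟨fun k => k.elim, fun _ => Eq.trans h (Eq.symm h')⟩
  | node i a ch hch ih =>
    refine ⟨?_, fun m => (ih m.1 (h.2 m.1) (h'.2 m.1)).2 m.2⟩
    rintro (_ | k)
    · exact h.1.trans h'.1.symm
    · exact (ih k.1 (h.2 k.1) (h'.2 k.1)).1 k.2
  | perm e d hT ih =>
    obtain ⟨h1, h2⟩ := ih h h'
    exact ⟨e.surjective.forall.2 h1, d.surjective.forall.2 h2⟩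

/-- A configuration has at most one graph. -/
theorem Edges.unique {θ θ' : (AC.I : AC C) ⟶ ladder F f} (c : Config F f)
    (h : IsGraph θ c.tree) (h' : IsGraph θ' c.tree) : θ = θ' := by
  rw [isGraph_iff] at h h'
  obtain ⟨h1, h2⟩ := Edges.push_eq c.composes h h'
  refine Subtype.ext (ext_push fun a => ?_)
  -- Returns from the expected label to the label that the position has by definition.
  have key : ∀ {x} (p : Pos (ladderSrc F f) x), θ.1.push (p.st (𝟙 _)) = θ'.1.push (p.st (𝟙 _)) →
      θ.1.push ⟨p.idx, 𝟙 _⟩ = θ'.1.push ⟨p.idx, 𝟙 _⟩ := by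
    rintro x ⟨a, rfl⟩ h
    rw [Pos.st_mk] at h; exact h
  rcases src_cases F f a with ⟨i, rfl⟩ | ⟨l, rfl⟩
  · exact key _ (h1 i)
  · exact key _ (h2 l)

end SymMulticategory
end KM

/-! ### Values of shapes in a three-element residuated monoid -/

namespace KM
open SignedSet Matching SymMulticategory
variable {C : Type u} [Category.{v} C] {D : Type u'} [Category.{v'} D]

/-- The tensor product of the residuated monoid `0 < 1 < 2` with unit `1` and `2 ⊗ 2 = 2`. -/
def tensor₃ (a b : Fin 3) : Fin 3 := if a = 0 ∨ b = 0 then 0 else max a b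

/-- The internal hom of the residuated monoid `0 < 1 < 2`. -/
def hom₃ (a b : Fin 3) : Fin 3 := if a = 0 then 2 else if a = 1 then b else if b = 2 then 2 else 0

/-- The value of a shape at values of its variables. -/
def LShape.value : ∀ (T : LShape C) (_ : T.vars.P → Fin 3) (_ : T.vars.N → Fin 3), Fin 3
  | .unit, _, _ => 1
  | .of _, p, _ => p ()
  | .tensor T S, p, n => tensor₃ (T.value (fun i => p (.inl i)) fun i => n (.inl i))
      (S.value (fun i => p (.inr i)) fun i => n (.inr i))
  | .hom T S, p, n => hom₃ (T.value (fun i => n (.inl i)) fun i => p (.inl i))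
      (S.value (fun i => p (.inr i)) fun i => n (.inr i))

section
variable {X Y Z : SignedSet C}

open Classical in
/-- Values at the positions of paths through a composite, constant along paths. -/
noncomputable def midValue (f : Matching X Y) (g : Matching Y Z) (b : Tgt X Z → Fin 3)
    (s : Src X Y ⊕ Src Y Z) : Fin 3 :=
  if h : ∃ t l, Trace f g s t l then b h.choose else 1

theorem midValue_eq {f : Matching X Y} {g : Matching Y Z} {b : Tgt X Z → Fin 3} {s t l}
    (h : Trace f g s t l) : midValue f g b s = b t := by
  have h' : ∃ t l, Trace f g s t l := ⟨t, l, h⟩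
  rw [midValue, dif_pos h']
  exact congrArg b (congrArg Sigma.fst (h'.choose_spec.choose_spec.det h))

theorem midValue_congr {f : Matching X Y} {g : Matching Y Z} {b : Tgt X Z → Fin 3} {s s'}
    (h : (∃ t l, Trace f g s t l) ↔ ∃ t l, Trace f g s' t l)
    (h' : ∀ t l, Trace f g s' t l → ∃ l', Trace f g s t l') :
    midValue f g b s = midValue f g b s' := by
  by_cases h1 : ∃ t l, Trace f g s' t l
  · obtain ⟨t, l, h2⟩ := h1
    obtain ⟨l', h3⟩ := h' t l h2
    rw [midValue_eq h2, midValue_eq h3]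
  · rw [midValue, midValue, dif_neg h1, dif_neg (mt h.1 h1)]

/-- Following one edge does not change where the path finally exits. If it never exits, it lies on a
closed loop, and the default value `1` is assigned to the entire loop, so the value is constant
there too. -/
theorem midValue_left (f : Matching X Y) (g : Matching Y Z) (b : Tgt X Z → Fin 3) (a : Src X Y) :
    midValue f g b (.inl a) = Sum.elim (fun x => b (.inl x)) (fun y => midValue f g b (.inr (.inl y)))
      (f.mate a) := by
  rcases h : f.step a with ⟨x | y, l⟩
  · rw [show f.mate a = _ from congrArg Sigma.fst h]
    exact midValue_eq (.exit_left h)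
  · rw [show f.mate a = _ from congrArg Sigma.fst h]
    refine midValue_congr ⟨?_, ?_⟩ fun t m r => ⟨_, .cross_left h r⟩
    · rintro ⟨t, m, r⟩
      cases r with
      | exit_left h' => cases h.symm.trans h'
      | cross_left h' r => cases h.symm.trans h'; exact ⟨_, _, r⟩
    · rintro ⟨t, m, r⟩
      exact ⟨_, _, .cross_left h r⟩

theorem midValue_right (f : Matching X Y) (g : Matching Y Z) (b : Tgt X Z → Fin 3) (a : Src Y Z) :
    midValue f g b (.inr a) = Sum.elim (fun y => midValue f g b (.inl (.inr y))) (fun x => b (.inr x))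
      (g.mate a) := by
  rcases h : g.step a with ⟨y | x, l⟩
  · rw [show g.mate a = _ from congrArg Sigma.fst h]
    refine midValue_congr ⟨?_, ?_⟩ fun t m r => ⟨_, .cross_right h r⟩
    · rintro ⟨t, m, r⟩
      cases r with
      | exit_right h' => cases h.symm.trans h'
      | cross_right h' r => cases h.symm.trans h'; exact ⟨_, _, r⟩
    · rintro ⟨t, m, r⟩
      exact ⟨_, _, .cross_right h r⟩
  · rw [show g.mate a = _ from congrArg Sigma.fst h]
    exact midValue_eq (.exit_right h)

end

theorem sumLeft_elim {X Y X' Y' : SignedSet C} {A : C} (b : Tgt (X.sum X') (Y.sum Y') → Fin 3)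
    (τ : State (tgtLab X Y) A) : b (sumLeft τ).1 =
      Sum.elim (fun x => b (.inl (.inl x))) (fun y => b (.inr (.inl y))) τ.1 := by
  rcases τ with ⟨_ | _, _⟩ <;> rfl

theorem sumRight_elim {X Y X' Y' : SignedSet C} {A : C} (b : Tgt (X.sum X') (Y.sum Y') → Fin 3)
    (τ : State (tgtLab X' Y') A) : b (sumRight τ).1 =
      Sum.elim (fun x => b (.inl (.inr x))) (fun y => b (.inr (.inr y))) τ.1 := by
  rcases τ with ⟨_ | _, _⟩ <;> rfl

theorem homLeft_elim {X Y X' Y' : SignedSet C} {A : C} (b : Tgt (X.ihom Y) (X'.ihom Y') → Fin 3)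
    (τ : State (tgtLab X' X) A) : b (homLeft τ).1 =
      Sum.elim (fun x => b (.inr (.inl x))) (fun y => b (.inl (.inl y))) τ.1 := by
  rcases τ with ⟨_ | _, _⟩ <;> rfl

theorem homRight_elim {X Y X' Y' : SignedSet C} {A : C} (b : Tgt (X.ihom Y) (X'.ihom Y') → Fin 3)
    (τ : State (tgtLab Y Y') A) : b (homRight τ).1 =
      Sum.elim (fun x => b (.inl (.inr x))) (fun y => b (.inr (.inr y))) τ.1 := by
  rcases τ with ⟨_ | _, _⟩ <;> rfl

/-- Monotonicity is what closure under `⊗` requires; `hom₃_mono`, antitone in the first argument,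
serves `[-, -]`. -/
theorem tensor₃_mono : ∀ {a a' b b' : Fin 3}, a ≤ a' → b ≤ b' → tensor₃ a b ≤ tensor₃ a' b' := by
  decide

theorem hom₃_mono : ∀ {a a' b b' : Fin 3}, a' ≤ a → b ≤ b' → hom₃ a b ≤ hom₃ a' b' := by
  decide

/-- Values that are constant along the edges of an allowable graph do not decrease from its source to its
target. -/
theorem Allowable.value_le {T S : LShape C} {f : Matching T.vars S.vars} (h : Allowable T S f) :
    ∀ b : Tgt T.vars S.vars → Fin 3,
      T.value (fun i => b (f.mate (.inl i))) (fun i => b (.inl i)) ≤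
      S.value (fun i => b (.inr i)) (fun i => b (f.mate (.inr i))) := by
  induction h with
  | id T => exact fun b => le_rfl
  | @comp T S U f g hf hg ih ih' =>
    intro b
    -- A variable in the middle is valued by the outer target at which its path ends. Both factors
    -- then carry assignments constant along their edges, and these agree on the middle shape.
    have h1 := ih (Sum.elim (fun x => b (.inl x)) fun y => midValue f g b (.inr (.inl y)))
    have h2 := ih' (Sum.elim (fun y => midValue f g b (.inl (.inr y))) fun x => b (.inr x))
    simp only [← midValue_left, ← midValue_right, Sum.elim_inl, Sum.elim_inr] at h1 h2
    have e1 : ∀ i, midValue f g b (.inl (.inl i)) = b ((f.comp g).mate (.inl i)) := fun i =>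
      midValue_eq (comp_step_inl.1 rfl)
    have e2 : ∀ i, midValue f g b (.inr (.inr i)) = b ((f.comp g).mate (.inr i)) := fun i =>
      midValue_eq (comp_step_inr.1 rfl)
    simp only [e1] at h1
    simp only [e2] at h2
    exact h1.trans h2
  | @tensor T S T' S' f g hf hg ih ih' =>
    intro b
    have h1 := ih (Sum.elim (fun x => b (.inl (.inl x))) fun y => b (.inr (.inl y)))
    have h2 := ih' (Sum.elim (fun x => b (.inl (.inr x))) fun y => b (.inr (.inr y)))
    have e1 := fun a => sumLeft_elim b (f.step a)
    have e2 := fun a => sumRight_elim b (g.step a)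
    refine le_of_eq_of_le ?_ ((tensor₃_mono h1 h2).trans_eq ?_)
    · refine congrArg₂ tensor₃ (congrArg₂ _ (funext fun i => e1 (.inl i)) rfl)
        (congrArg₂ _ (funext fun i => e2 (.inl i)) rfl)
    · exact (congrArg₂ tensor₃ (congrArg₂ _ rfl (funext fun i => e1 (.inr i)))
        (congrArg₂ _ rfl (funext fun i => e2 (.inr i)))).symm
  | @hom T S T' S' f g hf hg ih ih' =>
    intro b
    have h1 := ih (Sum.elim (fun x => b (.inr (.inl x))) fun y => b (.inl (.inl y)))
    have h2 := ih' (Sum.elim (fun x => b (.inl (.inr x))) fun y => b (.inr (.inr y)))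
    have e1 := fun a => homLeft_elim b (f.step a)
    have e2 := fun a => homRight_elim b (g.step a)
    refine le_of_eq_of_le ?_ ((hom₃_mono h1 h2).trans_eq ?_)
    · refine congrArg₂ hom₃ (congrArg₂ _ rfl (funext fun i => e1 (.inr i)))
        (congrArg₂ _ (funext fun i => e2 (.inl i)) rfl)
    · exact (congrArg₂ hom₃ (congrArg₂ _ (funext fun i => e1 (.inl i)) rfl)
        (congrArg₂ _ rfl (funext fun i => e2 (.inr i)))).symm
  -- The structural generators are the laws of a residuated commutative monoid, which are finitely
  -- many inequalities.
  | assocHom T S U =>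
    exact fun b => (by decide : ∀ x y z, tensor₃ (tensor₃ x y) z ≤ tensor₃ x (tensor₃ y z)) _ _ _
  | assocInv T S U =>
    exact fun b => (by decide : ∀ x y z, tensor₃ x (tensor₃ y z) ≤ tensor₃ (tensor₃ x y) z) _ _ _
  | unitHom T => exact fun b => (by decide : ∀ x, tensor₃ x 1 ≤ x) _
  | unitInv T => exact fun b => (by decide : ∀ x, x ≤ tensor₃ x 1) _
  | braid T S => exact fun b => (by decide : ∀ x y, tensor₃ x y ≤ tensor₃ y x) _ _
  | ev T S => exact fun b => (by decide : ∀ x y, tensor₃ (hom₃ x y) x ≤ y) _ _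
  | coev T S => exact fun b => (by decide : ∀ x y, x ≤ hom₃ y (tensor₃ x y)) _ _
  | single g => exact fun b => le_rfl

/-- The values of the factors of a tensor product. -/
def TensorOf.value {n : ℕ} {S : Fin n → LShape C} {W : LShape C} (t : TensorOf S W)
    (p : W.vars.P → Fin 3) (q : W.vars.N → Fin 3) (i : Fin n) : Fin 3 :=
  (S i).value (fun x => p (t.posP i ⟨x, rfl⟩).idx) fun x => q (t.posN i ⟨x, rfl⟩).idx

theorem TensorOf.value_succ_zero {n : ℕ} {S : Fin (n + 2) → LShape C} {W : LShape C}
    (t : TensorOf (fun i : Fin (n + 1) => S i.succ) W) (p : (LShape.tensor (S 0) W).vars.P → Fin 3)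
    (q : (LShape.tensor (S 0) W).vars.N → Fin 3) : (TensorOf.succ (S := S) t).value p q 0 =
      (S 0).value (fun x => p (.inl x)) fun x => q (.inl x) := rfl

/-- Away from `0` the operation `tensor₃` is the maximum, and the empty product is `1`. -/
theorem TensorOf.value_eq {n : ℕ} {S : Fin n → LShape C} {W : LShape C} (t : TensorOf S W)
    {p : W.vars.P → Fin 3} {q : W.vars.N → Fin 3} (h : ∀ i, t.value p q i ≠ 0) :
    W.value p q ≠ 0 ∧ (W.value p q = 1 ↔ ∀ i, t.value p q i = 1) := by
  induction t with
  | zero => exact ⟨one_ne_zero, fun _ i => i.elim0, fun _ => rfl⟩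
  | one => exact ⟨h 0, fun h => Fin.cases h fun i => i.elim0, fun h => h 0⟩
  | @succ n S W t ih =>
    have h1 := ih (p := fun x => p (.inr x)) (q := fun x => q (.inr x)) fun i => h i.succ
    have h0 := h 0
    rw [TensorOf.value_succ_zero] at h0
    have key : ∀ a b : Fin 3, a ≠ 0 → b ≠ 0 → tensor₃ a b ≠ 0 ∧ (tensor₃ a b = 1 ↔ a = 1 ∧ b = 1) := by
      decide
    obtain ⟨h2, h3⟩ := key _ _ h0 h1.1
    refine ⟨h2, h3.trans ?_⟩
    rw [h1.2]
    exact (Fin.forall_fin_succ (P := fun i => (TensorOf.succ (S := S) t).value p q i = 1)).symm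

end KM

/-! ### Allowable graphs are trees -/

namespace KM
open SignedSet Matching SymMulticategory
variable {C : Type u} [Category.{v} C] {D : Type u'} [Category.{v'} D]

namespace SymMulticategory
variable {Q : SymMulticategory.{u, v, w} C} {n : ℕ} {F : Fin n → Q.Elt} {f : Q.Elt}

/-- The position `t` is followed by `k` nodes on the way to the root. -/
inductive Dist (θ : (AC.I : AC C) ⟶ ladder F f) :
    ℕ → Tgt (LShape.vars (AC.I : AC C)) (LShape.vars (ladder F f)) → Prop
  | root {t} (h : t = (rootPos F f).idx) : Dist θ 0 t
  | step {k t i j} (h : t = (nodeInPos F f i j).idx) (r : Dist θ k (θ.1.mate (nodeOutPos F f i).idx)) :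
      Dist θ (k + 1) t

/-- The way down is forced: a node input determines its node, and `mate` gives the only edge out of
that node. -/
theorem Dist.unique {θ : (AC.I : AC C) ⟶ ladder F f} {k t} (h : Dist θ k t) :
    ∀ {k'}, Dist θ k' t → k = k' := by
  induction h with
  | root h =>
    intro k' h'
    cases h' with
    | root => rfl
    | step h2 => exact (nodeInPos_ne (h2.symm.trans h)).elim
  | step h r ih =>
    intro k' h'
    cases h' with
    | root h2 => exact (nodeInPos_ne (h.symm.trans h2)).elim
    | step h2 r2 =>
      cases nodeInPos_inj (h.symm.trans h2)
      exact congrArg _ (ih r2)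

/-- With nonzero inputs, their product `a` is `1` or `2`. For output `1` the value `hom₃ a 1` is `1`
or `0` accordingly, and for output `2` the value `hom₃ a 2` is always `2`. -/
theorem value_shape_eq {m : ℕ} (x : Fin m → C) (y : C) {p : (LShape.vars (shape x y)).P → Fin 3}
    {q : (LShape.vars (shape x y)).N → Fin 3} (hq : ∀ j, q (shapeIn x y j).idx ≠ 0) :
    (p (shapeOut x y).idx = 1 → (LShape.value (shape x y) p q ≠ 2 ∧
      (LShape.value (shape x y) p q = 1 ↔ ∀ j, q (shapeIn x y j).idx = 1))) ∧
    (p (shapeOut x y).idx = 2 → LShape.value (shape x y) p q = 2) := by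
  obtain ⟨h1, h2⟩ := (TensorOf.tens fun i => .of (x i)).value_eq (p := fun i => q (.inl i))
    (q := fun i => p (.inl i)) hq
  have key : ∀ a : Fin 3, a ≠ 0 → hom₃ a 2 = 2 ∧ hom₃ a 1 ≠ 2 ∧ (hom₃ a 1 = 1 ↔ a = 1) := by decide
  obtain ⟨h3, h4, h5⟩ := key _ h1
  constructor
  · intro h
    have e : LShape.value (shape x y) p q = hom₃ _ 1 := congrArg (hom₃ _) h
    rw [e]
    exact ⟨h4, h5.trans h2⟩
  · intro h
    exact (congrArg (hom₃ _) h).trans h3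

open Classical in
/-- Paths in an allowable graph `I ⟶ [φ F₁ ⊗ ⋯ ⊗ φ Fₙ, φ f]` lead to the root. -/
theorem exists_dist (θ : (AC.I : AC C) ⟶ ladder F f)
    (a : Src (LShape.vars (AC.I : AC C)) (LShape.vars (ladder F f))) :
    ∃ k, Dist θ k (θ.1.mate a) := by
  -- Targets from which the root is reached get `1`, all others `2`. The value `0` is reserved for
  -- the contradiction.
  let b : Tgt (LShape.vars (AC.I : AC C)) (LShape.vars (ladder F f)) → Fin 3 :=
    fun t => if ∃ k, Dist θ k t then 1 else 2
  have hb : ∀ t, b t ≠ 0 := fun t => by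
    simp only [b]; split_ifs <;> decide
  have hb1 : ∀ {t}, b t = 1 → ∃ k, Dist θ k t := fun {t} h => by
    by_contra h'
    simp only [b, if_neg h'] at h
    exact absurd h (by decide)
  have hb1' : ∀ {t}, (∃ k, Dist θ k t) → b t = 1 := fun {t} h => if_pos h
  have hb2 : ∀ {t}, b t ≠ 1 → b t = 2 := fun {t} h =>
    (by decide : ∀ x : Fin 3, x ≠ 0 → x ≠ 1 → x = 2) _ (hb t) h
  have hle := Allowable.value_le θ.2 b
  let p : (LShape.vars (ladder F f)).P → Fin 3 := fun i => b (.inr i)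
  let q : (LShape.vars (ladder F f)).N → Fin 3 := fun i => b (θ.1.mate (.inr i))
  -- If the output edge of a node leads to the root, so do all inputs of the node, and its value is
  -- `hom₃ 1 1 = 1`. Otherwise its value is `hom₃ _ 2 = 2`, whatever its inputs are.
  have hnode : ∀ i, (nodeTens F).value (fun x => q (.inl x)) (fun x => p (.inl x)) i =
      b (θ.1.mate (nodeOutPos F f i).idx) := by
    intro i
    have hv := value_shape_eq (F i).src (F i).tgt
      (p := fun x => q (.inl ((nodeTens F).posP i ⟨x, rfl⟩).idx))
      (q := fun x => p (.inl ((nodeTens F).posN i ⟨x, rfl⟩).idx)) fun j => hb _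
    by_cases h : b (θ.1.mate (nodeOutPos F f i).idx) = 1
    · obtain ⟨k, hk⟩ := hb1 h
      refine ((hv.1 h).2.2 fun j => ?_).trans h.symm
      refine hb1' ⟨k + 1, .step (i := i) (j := j) ?_ hk⟩
      have e : ∀ {y} (p' : Pos (LShape.vars (shape (F i).src (F i).tgt)).lN y),
          ((nodeTens F).posN i ⟨p'.idx, rfl⟩).idx = ((nodeTens F).posN i p').idx := by
        rintro y ⟨_, rfl⟩; rfl
      exact congrArg (fun q => Sum.inr (Sum.inl q)) (e _)
    · exact (hv.2 (hb2 h)).trans (hb2 h).symm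
  obtain ⟨h1, h2⟩ := (nodeTens F).value_eq (p := fun x => q (.inl x)) (q := fun x => p (.inl x))
    (fun i => by rw [hnode]; exact hb _)
  have hroot := (value_shape_eq f.src f.tgt (p := fun x => p (.inr x)) (q := fun x => q (.inr x))
    fun j => hb _).1 (hb1' ⟨0, .root rfl⟩)
  -- The unit shape has value `1`.
  have hle' : 1 ≤ hom₃ (LShape.value (LShape.bind Q.frame (.tens n fun i => .of (F i)))
      (fun x => q (.inl x)) fun x => p (.inl x)) (LShape.value (shape f.src f.tgt)
        (fun x => p (.inr x)) fun x => q (.inr x)) := hle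
  -- If `x = 2` then `hom₃ x y = 0`, because `y ≠ 2`. So `x = 1` and `hom₃ x y = y`, which leaves `y
  -- = 1`. The first equation says that every node reaches the root, the second that every leaf
  -- does.
  obtain ⟨e1, e2⟩ := (by decide : ∀ x y : Fin 3, x ≠ 0 → y ≠ 2 → 1 ≤ hom₃ x y → x = 1 ∧ y = 1) _ _ h1
    hroot.1 hle'
  rcases src_cases F f a with ⟨i, rfl⟩ | ⟨l, rfl⟩
  · exact hb1 ((hnode i).symm.trans (h2.1 e1 i))
  · exact hb1 (hroot.2.1 e2 l)

/-- The source `s` is above the target `b`. -/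
inductive Down (θ : (AC.I : AC C) ⟶ ladder F f) :
    ∀ (_ : Tgt (LShape.vars (AC.I : AC C)) (LShape.vars (ladder F f)))
      (_ : Src (LShape.vars (AC.I : AC C)) (LShape.vars (ladder F f))), Prop
  | base {b s} (h : θ.1.mate s = b) : Down θ b s
  | step {b s i} (h : θ.1.mate (nodeOutPos F f i).idx = b) (j)
      (r : Down θ (nodeInPos F f i j).idx s) : Down θ b s

namespace Down
variable {θ : (AC.I : AC C) ⟶ ladder F f}

/-- Going up never decreases the distance to the root. This excludes a node lying above one of its
own inputs. -/
theorem dist {b s} (h : Down θ b s) : ∀ {k}, Dist θ k b → ∃ k', k ≤ k' ∧ Dist θ k' (θ.1.mate s) := by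
  induction h with
  | base h => exact fun hk => ⟨_, le_rfl, h ▸ hk⟩
  | step h j r ih =>
    intro k hk
    obtain ⟨k', h1, h2⟩ := ih (.step rfl (h ▸ hk))
    exact ⟨k', by omega, h2⟩

/-- `Down` is built from its lower end, while induction on the distance of `s` works at the upper
end. This lemma and `cases_snoc` are the constructor and the case distinction there. -/
theorem snoc {b s i j} (h : θ.1.mate s = (nodeInPos F f i j).idx)
    (r : Down θ b (nodeOutPos F f i).idx) : Down θ b s := by
  generalize e : (nodeOutPos F f i).idx = s' at r
  induction r with
  | base h' => subst e; exact .step h' j (.base h)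
  | step h' j' r ih => exact .step h' j' (ih e)

theorem cases_snoc {b s} (h : Down θ b s) : θ.1.mate s = b ∨
    ∃ i j, θ.1.mate s = (nodeInPos F f i j).idx ∧ Down θ b (nodeOutPos F f i).idx := by
  induction h with
  | base h => exact .inl h
  | step h j r ih =>
    rcases ih with ih | ⟨i', j', h1, h2⟩
    · exact .inr ⟨_, j, ih, .base h⟩
    · exact .inr ⟨i', j', h1, .step h j h2⟩

/-- The way down from `s` is unique and passes through at most one position at each distance. Hence
the subtrees at distinct inputs of a node are disjoint. -/
theorem eq_of_dist {b b' k} (hb : Dist θ k b) (hb' : Dist θ k b') {m s} (hs : Dist θ m (θ.1.mate s))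
    (h : Down θ b s) (h' : Down θ b' s) : b = b' := by
  induction m generalizing s with
  | zero =>
    have key : ∀ {b}, Down θ b s → θ.1.mate s = b := fun h => by
      rcases h.cases_snoc with h | ⟨i, j, h1, h2⟩
      · exact h
      · cases hs with
        | root e => exact (nodeInPos_ne (h1.symm.trans e)).elim
    exact (key h).symm.trans (key h')
  | succ m ih =>
    have key : ∀ {b b'}, Dist θ k b → Dist θ k b' → θ.1.mate s = b → ∀ {i j},
        θ.1.mate s = (nodeInPos F f i j).idx → Down θ b' (nodeOutPos F f i).idx → False := by
      intro b b' hb hb' e i j h1 h2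
      obtain ⟨k', h3, h4⟩ := h2.dist hb'
      have := (e ▸ hb : Dist θ k (θ.1.mate s)).unique (.step h1 h4)
      omega
    rcases h.cases_snoc with h | ⟨i, j, h1, h2⟩ <;> rcases h'.cases_snoc with h' | ⟨i', j', h1', h2'⟩
    · exact h.symm.trans h'
    · exact (key hb hb' h h1' h2').elim
    · exact (key hb' hb h' h1 h2).elim
    · cases nodeInPos_inj (h1.symm.trans h1')
      cases hs with
      | step e r =>
        cases nodeInPos_inj (h1.symm.trans e)
        exact ih r h2 h2'

theorem root (s) : Down θ (rootPos F f).idx s := by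
  obtain ⟨k, hk⟩ := exists_dist θ s
  induction k generalizing s with
  | zero => cases hk with | root h => exact .base h
  | succ k ih => cases hk with | step h r => exact snoc h (ih _ r)

end Down

/-- The tree is unfolded from the root: the source of the edge into a position is a leaf or a node,
and a node is followed by the trees at its inputs. Distances are bounded, so this terminates. -/
theorem exists_edges (θ : (AC.I : AC C) ⟶ ladder F f) :
    ∃ T : Tree F f.src f.tgt, Edges θ T (rootPos F f) := by
  choose d hd using fun i => exists_dist θ (nodeOutPos F f i).idx
  obtain ⟨B, hB⟩ : ∃ B, ∀ i, d i ≤ B := ⟨Finset.univ.sup d, fun i => Finset.le_sup (Finset.mem_univ i)⟩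
  -- `m` bounds the remaining height. At `m = 0` the distance `k` of the position exceeds `B`; a
  -- node output attached there would have distance `k`, so only a leaf is possible.
  suffices key : ∀ (m k : ℕ), B < k + m → ∀ {x : C} (p : Pos (ladderTgt F f) x), Dist θ k p.idx →
      ∃ T : Tree F f.src x, Edges θ T p from key (B + 1) 0 (by omega) _ (.root rfl)
  intro m
  induction m with
  | zero =>
    intro k hk x p hp
    have : ∀ {y} (s : Pos (ladderSrc F f) y), θ.1.mate s.idx = p.idx →
      ∃ a, θ.1.push (s.st (𝟙 _)) = p.st a := fun s h => p.exists_st _ h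
    obtain ⟨s, hs⟩ := θ.1.bij.2 p.idx
    rcases src_cases F f s with ⟨i, rfl⟩ | ⟨l, rfl⟩
    · have := (hd i).unique (hs ▸ hp)
      have := hB i
      omega
    · obtain ⟨a, ha⟩ := this _ hs
      exact ⟨.leaf l a, ha⟩
  | succ m ih =>
    intro k hk x p hp
    have : ∀ {y} (s : Pos (ladderSrc F f) y), θ.1.mate s.idx = p.idx →
      ∃ a, θ.1.push (s.st (𝟙 _)) = p.st a := fun s h => p.exists_st _ h
    obtain ⟨s, hs⟩ := θ.1.bij.2 p.idx
    rcases src_cases F f s with ⟨i, rfl⟩ | ⟨l, rfl⟩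
    · obtain ⟨a, ha⟩ := this _ hs
      choose ch hch using fun j => ih (k + 1) (by omega) (nodeInPos F f i j) (.step rfl (hs ▸ hp))
      exact ⟨.node i a ch, ha, hch⟩
    · obtain ⟨a, ha⟩ := this _ hs
      exact ⟨.leaf l a, ha⟩

/-- Composability demands that nodes and leaves occur once each. Indexing them by the sources above
`p` keeps the claim inductive: the sources above a node's position are that node and the disjoint
union of the sources above its inputs. -/
theorem exists_composes (θ : (AC.I : AC C) ⟶ ladder F f) {x : C} (T : Tree F f.src x)
    (p : Pos (ladderTgt F f) x) (h : Edges θ T p) {k : ℕ} (hk : Dist θ k p.idx) :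
    ∃ g, Composes T (fun i : {i // Down θ p.idx (nodeOutPos F f i).idx} => i.1)
      (fun l : {l // Down θ p.idx (leafPos F f l).idx} => l.1) g := by
  induction T generalizing k with
  | leaf l a =>
    have h0 := mate_eq h
    have key : ∀ s, Down θ p.idx s → s = (leafPos F f l).idx := fun s hs => by
      cases hs with
      | base h1 => exact θ.1.bij.1 (h1.trans h0.symm)
      | step h1 => exact (nodeOutPos_ne (θ.1.bij.1 (h1.trans h0.symm))).elim
    have : IsEmpty {i // Down θ p.idx (nodeOutPos F f i).idx} :=
      ⟨fun i => nodeOutPos_ne (key _ i.2)⟩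
    let d : Unit ≃ {l // Down θ p.idx (leafPos F f l).idx} :=
      { toFun := fun _ => ⟨l, .base h0⟩
        invFun := fun _ => ()
        left_inv := fun _ => rfl
        right_inv := fun l' => Subtype.ext (leafPos_inj (key _ l'.2)).symm }
    refine ⟨Q.act d (x := fun l' => f.src l'.1) (Q.ofHom a),
      Composes.perm (Equiv.equivOfIsEmpty Empty _) d ?_⟩
    refine (congrArg (fun r => Composes _ r _ _) (?_ : _ = _)).mp (Composes.leaf l a)
    funext r; exact r.elim
  | node i a ch ih =>
    obtain ⟨h0, hch⟩ := h
    have h0 := mate_eq h0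
    have hk' : ∀ j, Dist θ (k + 1) (nodeInPos F f i j).idx := fun j => .step rfl (h0 ▸ hk)
    choose g hg using fun j => ih j _ (hch j) (hk' j)
    have key : ∀ s, Down θ p.idx s → s = (nodeOutPos F f i).idx ∨
        ∃ j, Down θ (nodeInPos F f i j).idx s := fun s hs => by
      cases hs with
      | base h1 => exact .inl (θ.1.bij.1 (h1.trans h0.symm))
      | step h1 j r =>
        cases nodeOutPos_inj (θ.1.bij.1 (h1.trans h0.symm))
        exact .inr ⟨j, r⟩
    have inj : ∀ {j j' s}, Down θ (nodeInPos F f i j).idx s → Down θ (nodeInPos F f i j').idx s →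
        j = j' := fun {j j' s} h1 h2 => by
      obtain ⟨m, hm⟩ := exists_dist θ s
      cases nodeInPos_inj (Down.eq_of_dist (hk' j) (hk' j') hm h1 h2)
      rfl
    -- The output edge of node `i` has distance `k`, but every source above its inputs has an edge
    -- of distance at least `k + 1`.
    have ne : ∀ j, ¬ Down θ (nodeInPos F f i j).idx (nodeOutPos F f i).idx := fun j hj => by
      obtain ⟨k', h1, h2⟩ := hj.dist (hk' j)
      have := h2.unique (h0 ▸ hk)
      omega
    let e : (Unit ⊕ Σ j, {i' // Down θ (nodeInPos F f i j).idx (nodeOutPos F f i').idx}) ≃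
        {i // Down θ p.idx (nodeOutPos F f i).idx} :=
      Equiv.ofBijective (Sum.elim (fun _ => ⟨i, .base h0⟩) fun r => ⟨r.2.1, .step h0 r.1 r.2.2⟩) (by
        constructor
        · rintro (⟨⟩ | ⟨j, i', h'⟩) (⟨⟩ | ⟨j', i'', h''⟩) e
          · rfl
          · cases congrArg Subtype.val e
            exact (ne _ h'').elim
          · cases congrArg Subtype.val e
            exact (ne _ h').elim
          · cases congrArg Subtype.val e
            cases inj h' h''
            rfl
        · rintro ⟨i', hi'⟩
          rcases key _ hi' with h | ⟨j, h⟩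
          · cases nodeOutPos_inj h
            exact ⟨.inl (), rfl⟩
          · exact ⟨.inr ⟨j, i', h⟩, rfl⟩)
    let d : (Σ j, {l // Down θ (nodeInPos F f i j).idx (leafPos F f l).idx}) ≃
        {l // Down θ p.idx (leafPos F f l).idx} :=
      Equiv.ofBijective (fun r => ⟨r.2.1, .step h0 r.1 r.2.2⟩) (by
        constructor
        · rintro ⟨j, i', h'⟩ ⟨j', i'', h''⟩ e
          cases congrArg Subtype.val e
          cases inj h' h''
          rfl
        · rintro ⟨i', hi'⟩
          rcases key _ hi' with h | ⟨j, h⟩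
          · exact (nodeOutPos_ne h.symm).elim
          · exact ⟨⟨j, i', h⟩, rfl⟩)
    refine ⟨Q.act d (x := fun l' => f.src l'.1) (Q.post (Q.comp (F i).arr g) a),
      Composes.perm e d ?_⟩
    refine (congrArg (fun r => Composes _ r _ _) (?_ : _ = _)).mp (Composes.node i a ch hg)
    funext r
    rcases r with _ | _ <;> rfl

/-- An allowable graph `I ⟶ [φ F₁ ⊗ ⋯ ⊗ φ Fₙ, φ f]` is the graph of a tree, which has each `Fᵢ` once as a
node and each input of `f` once as a leaf. -/
theorem exists_tree (θ : (AC.I : AC C) ⟶ ladder F f) : ∃ T : Tree F f.src f.tgt, IsGraph θ T ∧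
    ∃ g, Composes T (fun i => i) (fun l => l) g := by
  obtain ⟨T, hT⟩ := exists_edges θ
  refine ⟨T, (isGraph_iff θ T).2 hT, ?_⟩
  obtain ⟨g, hg⟩ := exists_composes θ T _ hT (.root rfl)
  exact ⟨_, Composes.perm (Equiv.subtypeUnivEquiv fun i => Down.root _)
    (Equiv.subtypeUnivEquiv fun l => Down.root _) hg⟩

end SymMulticategory
end KM

/-! ### The closed structure: graphs `X ⟶ Y` and points `I ⟶ [X, Y]` -/

namespace KM
open SignedSet Matching SymMulticategory
variable {C : Type u} [Category.{v} C] {D : Type u'} [Category.{v'} D]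

namespace Matching
variable {X Y Z W X' Y' Z' X'' Y'' : SignedSet C}

section
variable {A : C}

theorem push_unitHom_inl (p) (k : A ⟶ X.lP p) : (unitHom X).push (⟨.inl (.inl p), k⟩ :
    State (srcLab (X.sum .empty) X) A) = ⟨.inr p, k⟩ := Sigma.ext rfl (heq_of_eq (Category.comp_id k))

theorem push_unitHom_inr (n) (k : A ⟶ X.lN n) : (unitHom X).push (⟨.inr n, k⟩ :
    State (srcLab (X.sum .empty) X) A) = ⟨.inl (.inl n), k⟩ := Sigma.ext rfl (heq_of_eq (Category.comp_id k))

theorem push_unitInv_inl (p) (k : A ⟶ X.lP p) : (unitInv X).push (⟨.inl p, k⟩ :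
    State (srcLab X (X.sum .empty)) A) = ⟨.inr (.inl p), k⟩ := Sigma.ext rfl (heq_of_eq (Category.comp_id k))

theorem push_unitInv_inr (n) (k : A ⟶ X.lN n) : (unitInv X).push (⟨.inr (.inl n), k⟩ :
    State (srcLab X (X.sum .empty)) A) = ⟨.inl n, k⟩ := Sigma.ext rfl (heq_of_eq (Category.comp_id k))

theorem push_braid_inl_inl (p) (k : A ⟶ X.lP p) : (braid X Y).push (⟨.inl (.inl p), k⟩ :
    State (srcLab (X.sum Y) (Y.sum X)) A) = ⟨.inr (.inr p), k⟩ :=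
  Sigma.ext rfl (heq_of_eq (Category.comp_id k))

theorem push_braid_inl_inr (p) (k : A ⟶ Y.lP p) : (braid X Y).push (⟨.inl (.inr p), k⟩ :
    State (srcLab (X.sum Y) (Y.sum X)) A) = ⟨.inr (.inl p), k⟩ :=
  Sigma.ext rfl (heq_of_eq (Category.comp_id k))

theorem push_braid_inr_inl (n) (k : A ⟶ Y.lN n) : (braid X Y).push (⟨.inr (.inl n), k⟩ :
    State (srcLab (X.sum Y) (Y.sum X)) A) = ⟨.inl (.inr n), k⟩ :=
  Sigma.ext rfl (heq_of_eq (Category.comp_id k))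

theorem push_braid_inr_inr (n) (k : A ⟶ X.lN n) : (braid X Y).push (⟨.inr (.inr n), k⟩ :
    State (srcLab (X.sum Y) (Y.sum X)) A) = ⟨.inl (.inl n), k⟩ :=
  Sigma.ext rfl (heq_of_eq (Category.comp_id k))

theorem push_ev_out (p) (k : A ⟶ Y.lP p) : (ev X Y).push (⟨.inl (.inl (.inr p)), k⟩ :
    State (srcLab ((X.ihom Y).sum X) Y) A) = ⟨.inr p, k⟩ :=
  Sigma.ext rfl (heq_of_eq (Category.comp_id k))

theorem push_ev_out' (n) (k : A ⟶ X.lN n) : (ev X Y).push (⟨.inl (.inl (.inl n)), k⟩ :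
    State (srcLab ((X.ihom Y).sum X) Y) A) = ⟨.inl (.inr n), k⟩ :=
  Sigma.ext rfl (heq_of_eq (Category.comp_id k))

theorem push_ev_in (p) (k : A ⟶ X.lP p) : (ev X Y).push (⟨.inl (.inr p), k⟩ :
    State (srcLab ((X.ihom Y).sum X) Y) A) = ⟨.inl (.inl (.inl p)), k⟩ :=
  Sigma.ext rfl (heq_of_eq (Category.comp_id k))

theorem push_ev_in' (n) (k : A ⟶ Y.lN n) : (ev X Y).push (⟨.inr n, k⟩ :
    State (srcLab ((X.ihom Y).sum X) Y) A) = ⟨.inl (.inl (.inr n)), k⟩ :=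
  Sigma.ext rfl (heq_of_eq (Category.comp_id k))

end

section
variable {A : C}

/-- Tensor–hom adjunction on sources. -/
def curSrc : State (srcLab (X.sum Y) Z) A → State (srcLab X (Y.ihom Z)) A
  | ⟨.inl (.inl p), k⟩ => ⟨.inl p, k⟩
  | ⟨.inl (.inr p), k⟩ => ⟨.inr (.inl p), k⟩
  | ⟨.inr n, k⟩ => ⟨.inr (.inr n), k⟩

/-- Tensor–hom adjunction on targets. -/
def curTgt : State (tgtLab (X.sum Y) Z) A → State (tgtLab X (Y.ihom Z)) A
  | ⟨.inl (.inl p), k⟩ => ⟨.inl p, k⟩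
  | ⟨.inl (.inr p), k⟩ => ⟨.inr (.inl p), k⟩
  | ⟨.inr n, k⟩ => ⟨.inr (.inr n), k⟩

/-- The graph `X ⟶ [Y, Z]` that corresponds to a graph `X ⊗ Y ⟶ Z`. -/
noncomputable def curry (f : Matching (X.sum Y) Z) : Matching X (Y.ihom Z) :=
  (coev X Y).comp ((Matching.id Y).ihom f)

theorem next_coev (f : Matching (X.sum Y) Z) (a) {b} {k : A ⟶ srcLab X (Y.ihom (X.sum Y)) a}
    {k' : A ⟶ tgtLab X (Y.ihom (X.sum Y)) b}
    (h : (coev X Y).push ⟨a, k⟩ = ⟨b, k'⟩) {τ} (hτ : exitLeft ⟨b, k'⟩ = τ) :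
    Next (coev X Y) ((Matching.id Y).ihom f) ⟨.inl (.inl a), k⟩ τ := hτ ▸ .left h

/-- Currying only moves the variables of `Y` to the other side; no edge changes otherwise. The proof
follows the detours through the coevaluation before and after the edge of `f`. -/
theorem push_curry (f : Matching (X.sum Y) Z) (s : State (srcLab (X.sum Y) Z) A) :
    f.curry.push (curSrc s) = curTgt (f.push s) := by
  have h1 : Run (coev X Y) ((Matching.id Y).ihom f) (startState (curSrc s))
      (exitRight (homRight (f.push s))) := by
    rcases s with ⟨(p | p) | n, k⟩
    · exact .head (next_coev f (.inl p) (b := .inr (.inr (.inl p))) (k' := k)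
        (Sigma.ext rfl (heq_of_eq (Category.comp_id k))) rfl)
        (.single (.right (push_homR (Matching.id Y) f ⟨.inl (.inl p), k⟩)))
    · exact .head (.right ((push_homL (Matching.id Y) f ⟨.inl p, k⟩).trans
          (congrArg (fun k => homLeft ⟨.inr p, k⟩) (Category.comp_id k))))
        (.head (next_coev f (.inr (.inl p)) (b := .inr (.inr (.inr p))) (k' := k)
          (Sigma.ext rfl (heq_of_eq (Category.comp_id k))) rfl)
          (.single (.right (push_homR (Matching.id Y) f ⟨.inl (.inr p), k⟩))))
    · exact .single (.right (push_homR (Matching.id Y) f ⟨.inr n, k⟩))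
  -- The way out after the edge of `f`: nothing for `Z`, the coevaluation for `X`, and the
  -- coevaluation followed by the identity of `Y` for `Y`.
  have h2 : ∀ t : State (tgtLab (X.sum Y) Z) A, Run (coev X Y) ((Matching.id Y).ihom f)
      (exitRight (homRight t)) ⟨.inr (curTgt t).1, (curTgt t).2⟩ := by
    rintro ⟨(p | p) | n, k⟩
    · exact .single (next_coev f (.inr (.inr (.inl p))) (b := .inl p) (k' := k)
        (Sigma.ext rfl (heq_of_eq (Category.comp_id k))) rfl)
    · exact .head (next_coev f (.inr (.inr (.inr p))) (b := .inr (.inl p)) (k' := k)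
        (Sigma.ext rfl (heq_of_eq (Category.comp_id k))) rfl)
        (.single (.right ((push_homL (Matching.id Y) f ⟨.inr p, k⟩).trans
          (congrArg (fun k => homLeft ⟨.inl p, k⟩) (Category.comp_id k)))))
    · exact .refl
  exact push_comp_of_run (h1.trans (h2 _))

end

/-- How the ends of a second graph `Y ⟶ Z` become ends of a composite `X ⟶ Z` when `f` leads
straight across: `PreSrc` goes back along `f` from a source of the second graph, `PreTgt` goes
forward along `f` from one of its targets. -/
inductive PreSrc (f : Matching X Y) {A : C} : State (srcLab Y Z) A → State (srcLab X Z) A → Prop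
  | inl {p k q l} (h : f.push ⟨.inl p, k⟩ = ⟨.inr q, l⟩) : PreSrc f ⟨.inl q, l⟩ ⟨.inl p, k⟩
  | inr (n k) : PreSrc f ⟨.inr n, k⟩ ⟨.inr n, k⟩

inductive PreTgt (f : Matching X Y) {A : C} : State (tgtLab Y Z) A → State (tgtLab X Z) A → Prop
  | inl {p k q l} (h : f.push ⟨.inr p, k⟩ = ⟨.inl q, l⟩) : PreTgt f ⟨.inl p, k⟩ ⟨.inl q, l⟩
  | inr (n k) : PreTgt f ⟨.inr n, k⟩ ⟨.inr n, k⟩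

/-- Precomposition with a graph that leads straight across is a mere translation of ends: the path
has one edge of `g` and at most one edge of `f` on either side. -/
theorem PreSrc.push {f : Matching X Y} {g : Matching Y Z} {A : C} {s : State (srcLab Y Z) A}
    {s' : State (srcLab X Z) A} {t : State (tgtLab Y Z) A} {t' : State (tgtLab X Z) A}
    (hs : PreSrc f s s') (hg : g.push s = t) (ht : PreTgt f t t') : (f.comp g).push s' = t' := by
  have h1 : Run f g (startState s') ⟨.inl (.inr s.1), s.2⟩ := by
    cases hs with
    | inl h => exact .single (.left h)
    | inr n k => exact .refl
  have h2 : Run f g ⟨.inl (.inr s.1), s.2⟩ (exitRight t) := .single (.right hg)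
  have h3 : Run f g (exitRight t) ⟨.inr t'.1, t'.2⟩ := by
    cases ht with
    | inl h => exact .single (.left h)
    | inr n k => exact .refl
  exact push_comp_of_run (h1.trans (h2.trans h3))

end Matching

namespace Matching
variable {X Y : SignedSet C} {A : C}

/-- The correspondence of points `I ⟶ [X, Y]` and graphs `X ⟶ Y`, on sources. -/
def pointSrc : State (srcLab X Y) A → State (srcLab SignedSet.empty (X.ihom Y)) A
  | ⟨.inl p, k⟩ => ⟨.inr (.inl p), k⟩
  | ⟨.inr n, k⟩ => ⟨.inr (.inr n), k⟩

/-- The correspondence of points `I ⟶ [X, Y]` and graphs `X ⟶ Y`, on targets. -/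
def pointTgt : State (tgtLab X Y) A → State (tgtLab SignedSet.empty (X.ihom Y)) A
  | ⟨.inl p, k⟩ => ⟨.inr (.inl p), k⟩
  | ⟨.inr n, k⟩ => ⟨.inr (.inr n), k⟩

/-- Targets of a graph `X ⟶ Y` as targets of a graph `I ⊗ X ⟶ Y`. -/
def evTgt : State (tgtLab X Y) A → State (tgtLab (SignedSet.empty.sum X) Y) A
  | ⟨.inl p, k⟩ => ⟨.inl (.inr p), k⟩
  | ⟨.inr n, k⟩ => ⟨.inr n, k⟩

theorem pointTgt_inj {s t : State (tgtLab X Y) A} (h : pointTgt s = pointTgt t) : s = t := by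
  rcases s with ⟨_ | _, _⟩ <;> rcases t with ⟨_ | _, _⟩ <;> cases h <;> rfl

/-- The graph `I ⟶ [X, Y]` that corresponds to a graph `X ⟶ Y`. -/
noncomputable def point (f : Matching X Y) : Matching SignedSet.empty (X.ihom Y) :=
  curry (((braid SignedSet.empty X).comp (unitHom X)).comp f)

theorem push_point (f : Matching X Y) (s : State (srcLab X Y) A) :
    f.point.push (pointSrc s) = pointTgt (f.push s) := by
  have hp : ∀ p (k : A ⟶ X.lP p), ((braid SignedSet.empty X).comp (unitHom X)).push
      (⟨.inl (.inr p), k⟩ : State (srcLab (SignedSet.empty.sum X) X) A) = ⟨.inr p, k⟩ := fun p k =>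
    comp_push_pos (push_braid_inl_inr p k) (push_unitHom_inl p k)
  have hn : ∀ p (k : A ⟶ X.lN p), ((braid SignedSet.empty X).comp (unitHom X)).push
      (⟨.inr p, k⟩ : State (srcLab (SignedSet.empty.sum X) X) A) = ⟨.inl (.inr p), k⟩ := fun p k =>
    (PreSrc.inr p k).push (push_unitHom_inr p k) (.inl (push_braid_inr_inl p k))
  have h : ∀ t, f.push s = t → f.point.push (pointSrc s) = pointTgt t := by
    rintro t ht
    rcases s with ⟨p | p, k⟩ <;> rcases t with ⟨q | q, l⟩
    · exact (push_curry _ ⟨.inl (.inr p), k⟩).trans (congrArg curTgt ((PreSrc.inl (hp p k)).push ht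
        (.inl (hn q l))))
    · exact (push_curry _ ⟨.inl (.inr p), k⟩).trans (congrArg curTgt ((PreSrc.inl (hp p k)).push ht
        (.inr q l)))
    · exact (push_curry _ ⟨.inr p, k⟩).trans (congrArg curTgt ((PreSrc.inr p k).push ht
        (.inl (hn q l))))
    · exact (push_curry _ ⟨.inr p, k⟩).trans (congrArg curTgt ((PreSrc.inr p k).push ht
        (.inr q l)))
  exact h _ rfl

end Matching

theorem Allowable.curry {T S U : LShape C} {f : Matching (LShape.tensor T S).vars U.vars}
    (h : Allowable (.tensor T S) U f) : Allowable T (.hom S U) f.curry :=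
  .comp (.coev T S) (.hom (.id S) h)

theorem Allowable.point {T S : LShape C} {f : Matching T.vars S.vars} (h : Allowable T S f) :
    Allowable .unit (.hom T S) f.point :=
  .curry (T := .unit) (.comp (.comp (.braid .unit T) (.unitHom T)) h)

namespace AC

/-- The edges of `bar θ` are those of `θ`: the unit, the symmetry and the evaluation only rename
ends. -/
theorem push_bar {S T : LShape C} (θ : (I : AC C) ⟶ LShape.hom S T) {A : C}
    (s : State (srcLab S.vars T.vars) A) :
    pointTgt (Matching.push (bar θ).1 s) = Matching.push θ.1 (pointSrc s) := by
  have hp : ∀ p (k : A ⟶ S.vars.lP p), ((unitInv S.vars).comp (braid S.vars .empty)).push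
      (⟨.inl p, k⟩ : State (srcLab S.vars (SignedSet.empty.sum S.vars)) A) = ⟨.inr (.inr p), k⟩ := fun p k =>
    comp_push_pos (push_unitInv_inl p k) (push_braid_inl_inl p k)
  have hn : ∀ p (k : A ⟶ S.vars.lN p), ((unitInv S.vars).comp (braid S.vars .empty)).push
      (⟨.inr (.inr p), k⟩ : State (srcLab S.vars (SignedSet.empty.sum S.vars)) A) = ⟨.inl p, k⟩ := fun p k =>
    (@PreSrc.inr C _ S.vars (S.vars.sum .empty) (SignedSet.empty.sum S.vars) (unitInv S.vars) A
      (.inr p) k).push (push_braid_inr_inr p k) (.inl (push_unitInv_inr p k))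
  let R := @Run C _ _ _ _ (Matching.tensor θ.1 (Matching.id S.vars)) (ev S.vars T.vars) A
  have hev : ∀ {s : State (srcLab ((S.vars.ihom T.vars).sum S.vars) T.vars) A} {t},
      (ev S.vars T.vars).push s = t → R ⟨.inl (.inr s.1), s.2⟩ (exitRight t) :=
    fun h => .single (.right h)
  have h3 : ∀ t : State (tgtLab SignedSet.empty (S.vars.ihom T.vars)) A, ∀ t', pointTgt t' = t →
      R (exitLeft (sumLeft t)) ⟨.inr (evTgt t').1, (evTgt t').2⟩ := by
    rintro _ ⟨p | p, k⟩ rfl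
    · exact (hev (push_ev_out' p k)).trans
        (.single (.left ((push_sumR θ.1 (Matching.id S.vars) ⟨.inr p, k⟩).trans
          (congrArg (fun k => sumRight ⟨.inl p, k⟩) (Category.comp_id k)))))
    · exact hev (push_ev_out p k)
  -- Unit and symmetry together lead straight across, so this bracketing lets `PreSrc.push` dispose
  -- of them; paths are then needed only in `θ ⊗ id` followed by evaluation.
  have assoc : (bar θ).1 = ((unitInv S.vars).comp (braid S.vars .empty)).comp
      ((Matching.tensor θ.1 (Matching.id S.vars)).comp (ev S.vars T.vars)) := (Matching.assoc _ _ _).symm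
  rw [assoc]
  -- `I` has no variables, so all targets of `θ` lie in `[S, T]`.
  have surj : ∃ t', pointTgt t' = θ.1.push (pointSrc s) := by
    rcases θ.1.push (pointSrc s) with ⟨e | p | n, k⟩
    · exact Empty.elim e
    · exact ⟨⟨.inl p, k⟩, rfl⟩
    · exact ⟨⟨.inr n, k⟩, rfl⟩
  obtain ⟨t', ht⟩ := surj
  rw [← ht]
  congr 1
  rcases s with ⟨p | p, k⟩
  · refine (PreSrc.inl (hp p k)).push (t := evTgt t') (push_comp_of_run ?_) ?_
    · have h1 : R ⟨.inl (.inl (.inl (.inr p))), k⟩ (exitLeft (sumLeft (θ.1.push (pointSrc ⟨.inl p, k⟩)))) :=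
        .trans (.single (.left ((push_sumR θ.1 (Matching.id S.vars) ⟨.inl p, k⟩).trans
          (congrArg (fun k => sumRight ⟨.inr p, k⟩) (Category.comp_id k)))))
        ((hev (push_ev_in p k)).trans
        (.single (.left (push_sumL θ.1 (Matching.id S.vars) (pointSrc ⟨.inl p, k⟩)))))
      exact h1.trans (h3 _ _ ht)
    · rcases t' with ⟨q | q, l⟩
      · exact .inl (hn q l)
      · exact @PreTgt.inr C _ S.vars (SignedSet.empty.sum S.vars) T.vars _ A q l
  · refine (@PreSrc.inr C _ S.vars (SignedSet.empty.sum S.vars) T.vars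
      ((unitInv S.vars).comp (braid S.vars .empty)) A p k).push (t := evTgt t') (push_comp_of_run ?_) ?_
    · have h1 : R ⟨.inl (.inr (.inr p)), k⟩ (exitLeft (sumLeft (θ.1.push (pointSrc ⟨.inr p, k⟩)))) :=
        (hev (push_ev_in' p k)).trans
        (.single (.left (push_sumL θ.1 (Matching.id S.vars) (pointSrc ⟨.inr p, k⟩))))
      exact h1.trans (h3 _ _ ht)
    · rcases t' with ⟨q | q, l⟩
      · exact .inl (hn q l)
      · exact @PreTgt.inr C _ S.vars (SignedSet.empty.sum S.vars) T.vars _ A q l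

/-- The point `I ⟶ [S, T]` that corresponds to a morphism `S ⟶ T`. -/
noncomputable def unbar {S T : LShape C} (h : (show AC C from S) ⟶ T) : (I : AC C) ⟶ LShape.hom S T :=
  ⟨Matching.point h.1, h.2.point⟩

/-- Lets results about points `I ⟶ [S, T]`, such as `exists_tree`, be applied to arbitrary morphisms
`S ⟶ T`. -/
theorem bar_unbar {S T : LShape C} (h : (show AC C from S) ⟶ T) : bar (unbar h) = h :=
  Subtype.ext (ext_push' fun ρ => pointTgt_inj ((push_bar _ ρ).trans (push_point h.1 ρ)))

end AC
end KM

/-! ### All graphs between shapes without internal homs are allowable -/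

namespace KM
open SignedSet Matching SymMulticategory
variable {C : Type u} [Category.{v} C] {D : Type u'} [Category.{v'} D]

/-- Shapes in which no internal hom occurs. -/
inductive LShape.TensorOnly : LShape C → Prop
  | unit : TensorOnly .unit
  | of (x) : TensorOnly (.of x)
  | tensor {T S} (hT : TensorOnly T) (hS : TensorOnly S) : TensorOnly (.tensor T S)

theorem LShape.TensorOnly.isEmpty {T : LShape C} (h : T.TensorOnly) : IsEmpty T.vars.N := by
  induction h with
  | unit => exact inferInstanceAs (IsEmpty Empty)
  | of x => exact inferInstanceAs (IsEmpty Empty)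
  | @tensor T S hT hS ih ih' => exact inferInstanceAs (IsEmpty (T.vars.N ⊕ S.vars.N))

theorem LShape.TensorOnly.tens : ∀ {n : ℕ} {S : Fin n → LShape C} (_ : ∀ i, (S i).TensorOnly),
    (LShape.tens n S).TensorOnly
  | 0, _, _ => .unit
  | 1, _, h => h 0
  | n + 2, _, h => .tensor (h 0) (tens (n := n + 1) fun i => h i.succ)

/-- Allowable graphs `T ⟶ S` and `S ⟶ T` such that the composite is the identity on the positive
variables of `T`. -/
def PosRetract (T S : LShape C) : Prop :=
  ∃ (f : Matching T.vars S.vars) (g : Matching S.vars T.vars), Allowable T S f ∧ Allowable S T g ∧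
    ∀ {A : C} (p) (k : A ⟶ T.vars.lP p), ∃ q l, f.push ⟨.inl p, k⟩ = ⟨.inr q, l⟩ ∧
      g.push ⟨.inl q, l⟩ = ⟨.inr p, k⟩

namespace PosRetract
variable {T S U T' S' : LShape C}

theorem refl (T : LShape C) : PosRetract T T :=
  ⟨.id _, .id _, .id _, .id _, fun p k => ⟨p, k, Sigma.ext rfl (heq_of_eq (Category.comp_id k)),
    Sigma.ext rfl (heq_of_eq (Category.comp_id k))⟩⟩

theorem trans (h : PosRetract T S) (h' : PosRetract S U) : PosRetract T U := by
  obtain ⟨f, g, hf, hg, h⟩ := h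
  obtain ⟨f', g', hf', hg', h'⟩ := h'
  refine ⟨f.comp f', g'.comp g, hf.comp hf', hg'.comp hg, fun p k => ?_⟩
  obtain ⟨q, l, h1, h2⟩ := h p k
  obtain ⟨r, m, h3, h4⟩ := h' q l
  exact ⟨r, m, comp_push_pos h1 h3, comp_push_pos h4 h2⟩

theorem tensor (h : PosRetract T S) (h' : PosRetract T' S') :
    PosRetract (.tensor T T') (.tensor S S') := by
  obtain ⟨f, g, hf, hg, h⟩ := h
  obtain ⟨f', g', hf', hg', h'⟩ := h'
  refine ⟨f.tensor f', g.tensor g', hf.tensor hf', hg.tensor hg', ?_⟩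
  rintro A (p | p) k
  · obtain ⟨q, l, h1, h2⟩ := h p k
    exact ⟨.inl q, l, (push_sumL f f' ⟨.inl p, k⟩).trans (congrArg sumLeft h1),
      (push_sumL g g' ⟨.inl q, l⟩).trans (congrArg sumLeft h2)⟩
  · obtain ⟨q, l, h1, h2⟩ := h' p k
    exact ⟨.inr q, l, (push_sumR f f' ⟨.inl p, k⟩).trans (congrArg sumRight h1),
      (push_sumR g g' ⟨.inl q, l⟩).trans (congrArg sumRight h2)⟩

theorem unit (T : LShape C) : PosRetract (.tensor T .unit) T := by
  refine ⟨_, _, .unitHom T, .unitInv T, ?_⟩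
  rintro A (p | ⟨⟨⟩⟩) k
  exact ⟨p, k, push_unitHom_inl p k, push_unitInv_inl p k⟩

theorem braid (T S : LShape C) : PosRetract (.tensor T S) (.tensor S T) := by
  refine ⟨_, _, .braid T S, .braid S T, ?_⟩
  rintro A (p | p) k
  · exact ⟨_, _, push_braid_inl_inl p k, push_braid_inl_inr p k⟩
  · exact ⟨_, _, push_braid_inl_inr p k, push_braid_inl_inl p k⟩

theorem assoc (T S U : LShape C) :
    PosRetract (.tensor (.tensor T S) U) (.tensor T (.tensor S U)) := by
  refine ⟨_, _, .assocHom T S U, .assocInv T S U, ?_⟩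
  rintro A ((p | p) | p) k
  · exact ⟨.inl p, k, Sigma.ext rfl (heq_of_eq (Category.comp_id k)),
      Sigma.ext rfl (heq_of_eq (Category.comp_id k))⟩
  · exact ⟨.inr (.inl p), k, Sigma.ext rfl (heq_of_eq (Category.comp_id k)),
      Sigma.ext rfl (heq_of_eq (Category.comp_id k))⟩
  · exact ⟨.inr (.inr p), k, Sigma.ext rfl (heq_of_eq (Category.comp_id k)),
      Sigma.ext rfl (heq_of_eq (Category.comp_id k))⟩

theorem cons (x : C) : ∀ {n : ℕ} (y : Fin n → C), ∃ (m : ℕ) (z : Fin m → C),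
    PosRetract (.tensor (.of x) (.tens n fun i => .of (y i))) (.tens m fun i => .of (z i))
  | 0, _ => ⟨1, fun _ => x, unit _⟩
  | n + 1, y => ⟨n + 2, Fin.cons x y, refl _⟩

/-- The factors on the left are moved one at a time by associativity onto a product that is already
bracketed to the right. -/
theorem append (hS : ∃ (m : ℕ) (z : Fin m → C), PosRetract S (.tens m fun i => .of (z i))) :
    ∀ {n : ℕ} (y : Fin n → C), ∃ (m : ℕ) (z : Fin m → C),
      PosRetract (.tensor (.tens n fun i => .of (y i)) S) (.tens m fun i => .of (z i))
  | 0, _ => by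
    obtain ⟨m, z, h⟩ := hS
    exact ⟨m, z, (braid .unit S).trans ((unit S).trans h)⟩
  | 1, y => by
    obtain ⟨m, z, h⟩ := hS
    obtain ⟨m', z', h'⟩ := cons (y 0) z
    exact ⟨m', z', ((refl _).tensor h).trans h'⟩
  | n + 2, y => by
    obtain ⟨m, z, h⟩ := append hS fun i : Fin (n + 1) => y i.succ
    obtain ⟨m', z', h'⟩ := cons (y 0) z
    exact ⟨m', z', (assoc _ _ _).trans (((refl _).tensor h).trans h')⟩

end PosRetract

theorem LShape.TensorOnly.retract {T : LShape C} (h : T.TensorOnly) :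
    ∃ (n : ℕ) (x : Fin n → C), PosRetract T (.tens n fun i => .of (x i)) := by
  induction h with
  | unit => exact ⟨0, Fin.elim0, .refl _⟩
  | of x => exact ⟨1, fun _ => x, .refl _⟩
  | tensor hT hS ih ih' =>
    obtain ⟨n, x, h⟩ := ih
    obtain ⟨m, y, h'⟩ := PosRetract.append ih' x
    exact ⟨m, y, (h.tensor (.refl _)).trans h'⟩

/-- A positive variable of the source. -/
def Pos.inl {X Y : SignedSet C} {x : C} (p : Pos X.lP x) : Pos (srcLab X Y) x := ⟨.inl p.idx, p.eq⟩

/-- A positive variable of the target. -/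
def Pos.inr {X Y : SignedSet C} {x : C} (p : Pos Y.lP x) : Pos (tgtLab X Y) x := ⟨.inr p.idx, p.eq⟩

/-- Neither side has negative variables, so the graph is a bijection of factors with labels, that
is, a `tensReindex`, and these are allowable since adjacent transpositions generate the symmetric
group. -/
theorem allowable_tens {n m : ℕ} {x : Fin n → C} {y : Fin m → C}
    (f : Matching (LShape.tens m fun i => .of (y i)).vars (LShape.tens n fun i => .of (x i)).vars) :
    Allowable _ _ f := by
  have h1 : ∀ j, ∃ i t, f.push ((tensPos y i).inl.st (𝟙 _)) = (tensPos x j).inr.st t := by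
    intro j
    obtain ⟨a | a, h⟩ := f.bij.2 (.inr (tensPos x j).idx)
    · obtain ⟨i, rfl⟩ := tensPos_surj y a
      exact ⟨i, (tensPos x j).inr.exists_st _ h⟩
    · exact (tens_isEmpty x).elim a
  choose σ t hσ using h1
  have hb : Function.Bijective σ := by
    constructor
    · intro j j' h
      have h1 : f.mate (tensPos y (σ j)).inl.idx = (tensPos x j).inr.idx := congrArg Sigma.fst (hσ j)
      have h2 : f.mate (tensPos y (σ j')).inl.idx = (tensPos x j').inr.idx := congrArg Sigma.fst (hσ j')
      rw [h] at h1
      exact tensPos_inj x (Sum.inr_injective (h1.symm.trans h2))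
    · intro i
      rcases h : f.mate (tensPos y i).inl.idx with a | a
      · exact (tens_isEmpty y).elim a
      · obtain ⟨j, rfl⟩ := tensPos_surj x a
        have h2 : f.mate (tensPos y (σ j)).inl.idx = (tensPos x j).inr.idx := congrArg Sigma.fst (hσ j)
        exact ⟨j, tensPos_inj y (Sum.inl_injective (f.bij.1 (h2.trans h.symm)))⟩
  have h := tensReindex_eq (σ := Equiv.ofBijective σ hb) (t := t) (f := f) fun {A} j k => by
    have h1 := push_st (hσ j) k
    have e1 := congrArg (fun s : State (LShape.vars (.tens m fun i => .of (y i))).lP A =>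
      (⟨.inl s.1, s.2⟩ : State (srcLab (LShape.vars (.tens m fun i => .of (y i)))
        (LShape.vars (.tens n fun i => .of (x i)))) A)) (tensIso_st y (σ j) k)
    have e2 := congrArg (fun s : State (LShape.vars (.tens n fun i => .of (x i))).lP A =>
      (⟨.inr s.1, s.2⟩ : State (tgtLab (LShape.vars (.tens m fun i => .of (y i)))
        (LShape.vars (.tens n fun i => .of (x i)))) A)) (tensIso_st x j (k ≫ t j))
    exact (congrArg f.push e1).trans (h1.trans e2.symm)
  exact h ▸ allowable_tensReindex _ _

/-- All graphs between tensor products of objects are allowable. -/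
theorem LShape.TensorOnly.allowable {T S : LShape C} (hT : T.TensorOnly) (hS : S.TensorOnly)
    (m : Matching T.vars S.vars) : Allowable T S m := by
  obtain ⟨n, x, f, g, hf, hg, h⟩ := hT.retract
  obtain ⟨n', x', f', g', hf', hg', h'⟩ := hS.retract
  -- Conjugation by the two retractions reduces `m` to a graph between products bracketed to the
  -- right. With no negative variables, agreement on positive ones is equality.
  have key : m = f.comp ((g.comp (m.comp f')).comp g') := by
    apply ext_push'
    rintro A ⟨p | p, k⟩
    · obtain ⟨q, l, h1, h2⟩ := h p k
      rcases e : m.push ⟨.inl p, k⟩ with ⟨r | r, k'⟩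
      · exact (hT.isEmpty.false r).elim
      · obtain ⟨q', l', h1', h2'⟩ := h' r k'
        have e1 : (m.comp f').push ⟨.inl p, k⟩ = ⟨.inr q', l'⟩ := comp_push_pos e h1'
        have e2 : (g.comp (m.comp f')).push ⟨.inl q, l⟩ = ⟨.inr q', l'⟩ := comp_push_pos h2 e1
        have e3 : ((g.comp (m.comp f')).comp g').push ⟨.inl q, l⟩ = ⟨.inr r, k'⟩ := comp_push_pos e2 h2'
        exact (comp_push_pos h1 e3).symm
    · exact (hS.isEmpty.false p).elim
  rw [key]
  exact hf.comp ((allowable_tens _).comp hg')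

/-- A bijection of positive variables that preserves labels, as a graph. -/
def Matching.ofEquiv {X Y : SignedSet C} [hX : IsEmpty X.N] [hY : IsEmpty Y.N] (σ : X.P ≃ Y.P)
    (h : ∀ p, X.lP p = Y.lP (σ p)) : Matching X Y :=
  ofInv (fun
      | .inl p => ⟨.inr (σ p), eqToHom (h p)⟩
      | .inr n => hY.elim n)
    (fun
      | .inr p => .inl (σ.symm p)
      | .inl n => hX.elim n)
    (by rintro (p | n); exacts [congrArg Sum.inl (σ.symm_apply_apply p), hY.elim n])
    (by rintro (n | p); exacts [hX.elim n, congrArg Sum.inr (σ.apply_symm_apply p)])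

theorem Matching.push_ofEquiv {X Y : SignedSet C} [IsEmpty X.N] [IsEmpty Y.N] {σ : X.P ≃ Y.P}
    {h : ∀ p, X.lP p = Y.lP (σ p)} {x : C} {p : Pos X.lP x} {q : Pos Y.lP x} (e : σ p.idx = q.idx) :
    (ofEquiv σ h).push (p.inl.st (𝟙 x)) = q.inr.st (𝟙 x) := by
  obtain ⟨p, rfl⟩ := p
  obtain ⟨q, hq⟩ := q
  subst e
  change (⟨.inr (σ p), (𝟙 _ ≫ eqToHom rfl) ≫ eqToHom (h p)⟩ : State (tgtLab X Y) (X.lP p)) =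
    ⟨.inr (σ p), 𝟙 _ ≫ eqToHom hq.symm⟩
  congr 1
  simp

end KM

/-! ### The graph of a tree as an iterated evaluation -/

namespace KM
open SignedSet Matching SymMulticategory
variable {C : Type u} [Category.{v} C] {D : Type u'} [Category.{v'} D]

section
variable {X Y : SignedSet C} {A : C}

/-- A positive state of the source. -/
def inlSrc (s : State X.lP A) : State (srcLab X Y) A := ⟨.inl s.1, s.2⟩

/-- A negative state of the source. -/
def inlTgt (s : State X.lN A) : State (tgtLab X Y) A := ⟨.inl s.1, s.2⟩

end

namespace Matching

theorem comp_push_exit {X Y Z : SignedSet C} {f : Matching X Y} {g : Matching Y Z} {A : C} {a b k l}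
    (h : f.push (A := A) ⟨.inl a, k⟩ = ⟨.inl b, l⟩) : (f.comp g).push (A := A) ⟨.inl a, k⟩ = ⟨.inl b, l⟩ :=
  push_comp_of_run (.single (.left h))

variable {n : ℕ} {x : Fin n → C} {y y' : C} {W : SignedSet C}

/-- Evaluation of `[x₁ ⊗ ⋯ ⊗ xₙ, y]` at a graph into `x₁ ⊗ ⋯ ⊗ xₙ`. -/
noncomputable def apply (E : Matching W (LShape.tens n fun i => .of (x i)).vars) (a : y ⟶ y') :
    Matching ((LShape.vars (shape x y)).sum W) (SignedSet.single y') :=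
  (((Matching.id (LShape.vars (shape x y))).tensor E).comp
    (ev (LShape.tens n fun i => .of (x i)).vars (SignedSet.single y))).comp (.single a)

theorem push_apply_out (E : Matching W (LShape.tens n fun i => .of (x i)).vars) (a : y ⟶ y') {A : C}
    (k : A ⟶ y) : (E.apply a).push (⟨.inl (.inl (.inr ())), k⟩ :
      State (srcLab ((LShape.vars (shape x y)).sum W) (SignedSet.single y')) A) =
      ⟨.inr (), k ≫ a⟩ := by
  have h1 := (push_sumL (Matching.id (LShape.vars (shape x y))) E ⟨.inl (.inr ()), k⟩).trans
    (congrArg (fun k : A ⟶ y => sumLeft (⟨Sum.inr (Sum.inr ()), k⟩ :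
      State (tgtLab (LShape.vars (shape x y)) (LShape.vars (shape x y))) A)) (Category.comp_id k))
  have h2 := push_ev_out (X := (LShape.tens n fun i => .of (x i)).vars) (Y := SignedSet.single y) () k
  exact comp_push_pos (comp_push_pos h1 h2) rfl

/-- A target of a graph into `x₁ ⊗ ⋯ ⊗ xₙ`, as a target of the evaluation at it. -/
def applyTgt {A : C} : State (tgtLab W (LShape.tens n fun i => .of (x i)).vars) A →
    State (tgtLab ((LShape.vars (shape x y)).sum W) (SignedSet.single y')) A
  | ⟨.inl w, k⟩ => ⟨.inl (.inr w), k⟩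
  | ⟨.inr p, k⟩ => ⟨.inl (.inl (.inl p)), k⟩

/-- A path that enters through `W` leaves through `W` again or ends at an input of the evaluated
shape. The label `a` affects only the output edge. -/
theorem push_apply_in (E : Matching W (LShape.tens n fun i => .of (x i)).vars) (a : y ⟶ y') {A : C}
    (s : State W.lP A) : (E.apply a).push (⟨.inl (.inr s.1), s.2⟩ :
      State (srcLab ((LShape.vars (shape x y)).sum W) (SignedSet.single y')) A) =
      applyTgt (E.push (inlSrc s)) := by
  have h0 := push_sumR (Matching.id (LShape.vars (shape x y))) E (inlSrc s)
  rcases e : E.push (inlSrc s) with ⟨w | p, k⟩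
  · exact comp_push_exit (comp_push_exit (h0.trans (congrArg sumRight e)))
  · have h1 := push_ev_in (X := (LShape.tens n fun i => .of (x i)).vars) (Y := SignedSet.single y) p k
    have h2 := (push_sumL (Matching.id (LShape.vars (shape x y))) E ⟨.inr (.inl p), k⟩).trans
      (congrArg (fun k => sumLeft (⟨Sum.inl (Sum.inl p), k⟩ :
        State (tgtLab (LShape.vars (shape x y)) (LShape.vars (shape x y))) A)) (Category.comp_id k))
    have h3 := push_comp_of_run (f := (Matching.id (LShape.vars (shape x y))).tensor E)
      (g := ev (LShape.tens n fun i => .of (x i)).vars (SignedSet.single y)) (A := A)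
      (σ := ⟨.inl (.inr s.1), s.2⟩) (τ := ⟨.inl (.inl (.inl p)), k⟩) ?_
    · exact comp_push_exit h3
    -- The edge of `E`, the evaluation, and back through the identity to the input of the shape.
    exact .head (.left (h0.trans (congrArg sumRight e))) (.head (.right h1) (.single (.left h2)))

end Matching

section
variable (H : D ⥤ AC C) {T S : LShape D} {x : D} {A : C}

theorem placePP_inl (p : Pos T.vars.lP x) (s : State (LShape.vars (H.obj x)).lP A) :
    placePP H (⟨.inl p.idx, p.eq⟩ : Pos (LShape.tensor T S).vars.lP x) s =
      ⟨.inl (placePP H p s).1, (placePP H p s).2⟩ := by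
  obtain ⟨p, rfl⟩ := p; rfl

theorem placePP_inr (p : Pos S.vars.lP x) (s : State (LShape.vars (H.obj x)).lP A) :
    placePP H (⟨.inr p.idx, p.eq⟩ : Pos (LShape.tensor T S).vars.lP x) s =
      ⟨.inr (placePP H p s).1, (placePP H p s).2⟩ := by
  obtain ⟨p, rfl⟩ := p; rfl

theorem placePN_inl (p : Pos T.vars.lP x) (s : State (LShape.vars (H.obj x)).lN A) :
    placePN H (⟨.inl p.idx, p.eq⟩ : Pos (LShape.tensor T S).vars.lP x) s =
      ⟨.inl (placePN H p s).1, (placePN H p s).2⟩ := by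
  obtain ⟨p, rfl⟩ := p; rfl

theorem placePN_inr (p : Pos S.vars.lP x) (s : State (LShape.vars (H.obj x)).lN A) :
    placePN H (⟨.inr p.idx, p.eq⟩ : Pos (LShape.tensor T S).vars.lP x) s =
      ⟨.inr (placePN H p s).1, (placePN H p s).2⟩ := by
  obtain ⟨p, rfl⟩ := p; rfl

end

namespace Tree
variable {Q : SymMulticategory.{u, v, w} C} {ι L : Type} {F : ι → Q.Elt} {z : L → C} {x : C}

/-- The tensor product of the nodes and leaves of a tree. -/
def ctx : ∀ {x : C} (_ : Tree F z x), LShape (Discrete (ι ⊕ L))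
  | _, leaf l _ => .of ⟨.inr l⟩
  | _, node i _ ch => .tensor (.of ⟨.inl i⟩) (.tens _ fun j => (ch j).ctx)

/-- The labels of `T.ctx` are indices of nodes and leaves in a discrete category; their shapes are
substituted later by `ctxObj`. Therefore `T.ctx` has no internal homs, and reordering its factors is
allowable. -/
theorem tensorOnly_ctx (T : Tree F z x) : T.ctx.TensorOnly := by
  induction T with
  | leaf l a => exact .of _
  | node i a ch ih => exact .tensor (.of _) (.tens ih)

variable (F z) in
/-- The shapes of the nodes and leaves. -/
noncomputable def ctxObj : Discrete (ι ⊕ L) ⥤ AC C :=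
  Discrete.functor (Sum.elim (fun i => Q.frame.obj (F i)) fun l => LShape.of (z l))

/-- The children of a node, as a tensor product. -/
noncomputable def ctxTens {m : ℕ} {y : Fin m → C} (ch : ∀ j, Tree F z (y j)) :
    TensorOf (fun j => (ch j).ctx.bind (ctxObj F z)) (LShape.bind (ctxObj F z) (.tens m fun j => (ch j).ctx)) :=
  (TensorOf.tens fun j => (ch j).ctx).bind (ctxObj F z)

/-- The graph of a tree, from the tensor product of its nodes and leaves. -/
noncomputable def eval : ∀ {x : C} (T : Tree F z x), Matching (T.ctx.bind (ctxObj F z)).vars (SignedSet.single x)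
  | _, leaf _ a => .single a
  | _, node i a ch => Matching.apply (x := (F i).src) (y := (F i).tgt)
      ((ctxTens ch).map (TensorOf.tens fun j => .of ((F i).src j)) fun j => (ch j).eval) a

theorem allowable_eval (T : Tree F z x) : Allowable (T.ctx.bind (ctxObj F z)) (.of x) T.eval := by
  induction T with
  | leaf l a => exact .single a
  | node i a ch ih =>
    exact .comp (.comp (.tensor (.id _) (TensorOf.allowable_map _ _ ih))
      (.ev (.tens _ fun j => .of ((F i).src j)) (.of (F i).tgt))) (.single a)

/-- The interpretations `φ` and `ψ` of sources and targets are arbitrary so that the induction goes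
through: the context of a child is a factor of the whole context, and its root is an input of the
parent. -/
theorem eval_runs {U V : C → Type v} {r : ∀ A, U A → V A → Prop} {NO : ∀ i A, (A ⟶ (F i).tgt) → U A}
    {NI : ∀ i j A, (A ⟶ (F i).src j) → V A} {LS : ∀ l A, (A ⟶ z l) → U A} {x : C} (T : Tree F z x)
    (root : ∀ A, (A ⟶ x) → V A) (φ : ∀ A, State (T.ctx.bind (ctxObj F z)).vars.lP A → U A)
    (ψ : ∀ A, State (tgtLab (T.ctx.bind (ctxObj F z)).vars (SignedSet.single x)) A → V A)
    (hr : ∀ A s, r A (φ A s) (ψ A (T.eval.push (inlSrc s))))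
    (hroot : ∀ A k, ψ A ⟨.inr (), k⟩ = root A k)
    (hNO : ∀ i (p : Pos T.ctx.vars.lP ⟨.inl i⟩) A k,
      φ A (placePP (ctxObj F z) p ⟨.inr (), k⟩) = NO i A k)
    (hNI : ∀ i (p : Pos T.ctx.vars.lP ⟨.inl i⟩) j A k,
      ψ A (inlTgt (placePN (ctxObj F z) p ((shapeIn (F i).src (F i).tgt j).st k))) = NI i j A k)
    (hLS : ∀ l (p : Pos T.ctx.vars.lP ⟨.inr l⟩) A k,
      φ A (placePP (ctxObj F z) p ⟨(), k⟩) = LS l A k) :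
    T.Runs r NO NI LS root := by
  induction T with
  | leaf l a =>
    intro A k
    have h := hr A ⟨(), k⟩
    have e1 := hLS l ⟨(), rfl⟩ A k
    have e2 := hroot A (k ≫ a)
    exact (congrArg₂ (r A) e1 e2).mp h
  | node i a ch ih =>
    -- For the `j`-th child, `φ` is preceded by the inclusion of the `j`-th factor, and `ψ` also by
    -- `applyTgt`, which turns the child's root into the `j`-th input of node `i`.
    refine ⟨fun A k => ?_, fun j => ih j _ (fun A s => φ A ⟨.inr ((ctxTens ch).tinP j s).1,
        ((ctxTens ch).tinP j s).2⟩) (fun A t => ψ A (applyTgt ((ctxTens ch).tinTgt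
          (TensorOf.tens fun j => .of ((F i).src j)) j t))) (fun A s => ?_) (fun A k => ?_)
          (fun i' p A k => ?_) (fun i' p j' A k => ?_) (fun l p A k => ?_)⟩
    · have h := hr A ⟨.inl (.inr ()), k⟩
      have e1 := hNO i ⟨.inl (), rfl⟩ A k
      have e2 := hroot A (k ≫ a)
      have e3 := push_apply_out (x := (F i).src) (y := (F i).tgt)
        ((ctxTens ch).map (TensorOf.tens fun j => .of ((F i).src j)) fun j => (ch j).eval) a k
      exact (congrArg₂ (r A) e1 ((congrArg (ψ A) e3).trans e2)).mp h
    · have h := hr A ⟨.inr ((ctxTens ch).tinP j s).1, ((ctxTens ch).tinP j s).2⟩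
      have e1 := push_apply_in (x := (F i).src) (y := (F i).tgt)
        ((ctxTens ch).map (TensorOf.tens fun j => .of ((F i).src j)) fun j => (ch j).eval) a
        ((ctxTens ch).tinP j s)
      have e2 := TensorOf.push_map (ctxTens ch) (TensorOf.tens fun j => .of ((F i).src j))
        (fun j => (ch j).eval) j (inlSrc s)
      exact (congrArg (r A _) (congrArg (ψ A) (e1.trans (congrArg applyTgt e2)))).mp h
    · have e := hNI i ⟨.inl (), rfl⟩ j A k
      refine Eq.trans (congrArg (ψ A) ?_) e
      have e1 := (tensIso_eq (F i).src j k).symm.trans (tensIso_st (F i).src j k)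
      exact congrArg (fun s : State (LShape.vars (.tens _ fun j => .of ((F i).src j))).lP A =>
        (⟨.inl (.inl (.inl s.1)), s.2⟩ : State (tgtLab ((LShape.vars (shape (F i).src (F i).tgt)).sum _)
          (SignedSet.single _)) A)) e1
    · have e := hNO i' ⟨.inr ((TensorOf.tens fun j => (ch j).ctx).posP j p).idx,
        ((TensorOf.tens fun j => (ch j).ctx).posP j p).eq⟩ A k
      refine Eq.trans (congrArg (φ A) (Eq.symm ((placePP_inr _ _ _).trans ?_))) e
      exact congrArg (fun s : State _ A => (⟨.inr s.1, s.2⟩ : State (LShape.vars (.tensor _ _)).lP A))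
        (TensorOf.placePP_posP (ctxObj F z) (TensorOf.tens fun j => (ch j).ctx) j p ⟨.inr (), k⟩)
    · have e := hNI i' ⟨.inr ((TensorOf.tens fun j => (ch j).ctx).posP j p).idx,
        ((TensorOf.tens fun j => (ch j).ctx).posP j p).eq⟩ j' A k
      refine Eq.trans (congrArg (ψ A) (Eq.symm ((congrArg inlTgt (placePN_inr _ _ _)).trans ?_))) e
      exact congrArg (fun s : State _ A => (inlTgt ⟨.inr s.1, s.2⟩ :
        State (tgtLab (LShape.vars (.tensor _ _)) (SignedSet.single _)) A))
        (TensorOf.placePN_posP (ctxObj F z) (TensorOf.tens fun j => (ch j).ctx) j p _)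
    · have e := hLS l ⟨.inr ((TensorOf.tens fun j => (ch j).ctx).posP j p).idx,
        ((TensorOf.tens fun j => (ch j).ctx).posP j p).eq⟩ A k
      refine Eq.trans (congrArg (φ A) (Eq.symm ((placePP_inr _ _ _).trans ?_))) e
      exact congrArg (fun s : State _ A => (⟨.inr s.1, s.2⟩ : State (LShape.vars (.tensor _ _)).lP A))
        (TensorOf.placePP_posP (ctxObj F z) (TensorOf.tens fun j => (ch j).ctx) j p ⟨(), k⟩)

end Tree

/-- The positive variables of a tensor product. -/
noncomputable def TensorOf.sigmaEquiv {n : ℕ} {S : Fin n → LShape C} {W : LShape C} (t : TensorOf S W) :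
    (Σ i, (S i).vars.P) ≃ W.vars.P :=
  Equiv.ofBijective (fun s => (t.posP s.1 ⟨s.2, rfl⟩).idx)
    ⟨fun _ _ h => t.posP_inj h, fun q => by
      obtain ⟨i, p, h⟩ := t.posP_surj q
      exact ⟨⟨i, p⟩, h⟩⟩

/-- The variables of the tensor product of the nodes and leaves of a tree. -/
theorem Composes.exists_equiv {Q : SymMulticategory.{u, v, w} C} {ι L : Type} {F : ι → Q.Elt} {z : L → C}
    {x : C} {T : Tree F z x} {κ μ : Type} [Finite μ] {ν : κ → ι} {ρ : μ → L}
    {g : Q.Hom (fun m => z (ρ m)) x} (h : Composes T ν ρ g) :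
    ∃ e : κ ⊕ μ ≃ T.ctx.vars.P, (∀ k, T.ctx.vars.lP (e (.inl k)) = ⟨.inl (ν k)⟩) ∧
      ∀ m, T.ctx.vars.lP (e (.inr m)) = ⟨.inr (ρ m)⟩ := by
  induction h with
  | leaf l a => exact ⟨Equiv.emptySum Empty Unit, fun k => k.elim, fun m => rfl⟩
  | @node x i a ch κ μ _ ν ρ g h ih =>
    choose e he1 he2 using ih
    let t := TensorOf.tens fun j => (ch j).ctx
    have ht : ∀ j p, (LShape.vars (.tens _ fun j => (ch j).ctx)).lP (t.sigmaEquiv ⟨j, p⟩) =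
      (ch j).ctx.vars.lP p := fun j p => (t.posP j ⟨p, rfl⟩).eq
    refine ⟨(Equiv.sumAssoc _ _ _).trans (Equiv.sumCongr (Equiv.refl Unit)
      (((Equiv.sigmaSumDistrib κ μ).symm.trans (Equiv.sigmaCongrRight e)).trans t.sigmaEquiv)), ?_, ?_⟩
    · rintro (⟨⟩ | ⟨j, k⟩)
      · rfl
      · exact (ht j _).trans (he1 j k)
    · rintro ⟨j, m⟩
      exact (ht j _).trans (he2 j m)
  | perm e d h ih =>
    obtain ⟨e', h1, h2⟩ := ih
    refine ⟨(Equiv.sumCongr e d).symm.trans e', e.surjective.forall.2 fun k => ?_,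
      d.surjective.forall.2 fun m => ?_⟩
    · exact (congrArg (fun k => (Tree.ctx _).vars.lP (e' (.inl k))) (e.symm_apply_apply k)).trans (h1 k)
    · exact (congrArg (fun k => (Tree.ctx _).vars.lP (e' (.inr k))) (d.symm_apply_apply m)).trans (h2 m)

end KM

/-! ### Graphs of configurations are allowable -/

namespace KM
open SignedSet Matching SymMulticategory
variable {C : Type u} [Category.{v} C] {D : Type u'} [Category.{v'} D]

section
variable (H : D ⥤ AC C) {T S : LShape D} {x : D} {A : C}

theorem push_subst_out {f : Matching T.vars S.vars} {a : Pos (srcLab T.vars S.vars) x}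
    {b : Pos (tgtLab T.vars S.vars) x} (h : f.push (a.st (𝟙 x)) = b.st (𝟙 x))
    (s : State (LShape.vars (H.obj x)).lP A) : (f.subst H).push (srcOut H a s) = tgtOut H b s := by
  have e : (H.map (𝟙 x)).1 = Matching.id _ := congrArg Subtype.val (H.map_id x)
  have h1 := push_srcOut H h s.1 s.2
  have h2 := congrArg (fun m => edgeEnd H a b (Matching.push m ⟨.inl s.1, s.2⟩)) e
  refine h1.trans (h2.trans ?_)
  exact congrArg (tgtOut H b) (Sigma.ext rfl (heq_of_eq (Category.comp_id _)) :
    (⟨s.1, s.2 ≫ 𝟙 _⟩ : State (LShape.vars (H.obj x)).lP A) = s)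

theorem push_subst_in {f : Matching T.vars S.vars} {a : Pos (srcLab T.vars S.vars) x}
    {b : Pos (tgtLab T.vars S.vars) x} (h : f.push (a.st (𝟙 x)) = b.st (𝟙 x))
    (s : State (LShape.vars (H.obj x)).lN A) : (f.subst H).push (tgtIn H b s) = srcIn H a s := by
  have e : (H.map (𝟙 x)).1 = Matching.id _ := congrArg Subtype.val (H.map_id x)
  have h1 := push_tgtIn H h s.1 s.2
  have h2 := congrArg (fun m => edgeEnd H a b (Matching.push m ⟨.inr s.1, s.2⟩)) e
  refine h1.trans (h2.trans ?_)
  exact congrArg (srcIn H a) (Sigma.ext rfl (heq_of_eq (Category.comp_id _)) :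
    (⟨s.1, s.2 ≫ 𝟙 _⟩ : State (LShape.vars (H.obj x)).lN A) = s)

end

namespace TensorOf
variable {n : ℕ} {S : Fin n → LShape C} {W W' : LShape C}

/-- `W` and `W'` are products of the same factors but are given by different terms. The tensor
product of identities identifies them without a transport along an equality of shapes. -/
theorem push_map_id_out (t : TensorOf S W) (t' : TensorOf S W') (i : Fin n) {A : C}
    (s : State (S i).vars.lP A) : (t.map t' fun i => Matching.id (S i).vars).push
      ⟨.inl (t.tinP i s).1, (t.tinP i s).2⟩ = ⟨.inr (t'.tinP i s).1, (t'.tinP i s).2⟩ := by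
  have h := push_map t t' (fun i => Matching.id (S i).vars) i ⟨.inl s.1, s.2⟩
  exact h.trans (congrArg (fun s : State (S i).vars.lP A => (⟨.inr (t'.tinP i s).1, (t'.tinP i s).2⟩ :
    State (tgtLab W.vars W'.vars) A)) (Sigma.ext rfl (heq_of_eq (Category.comp_id _)) :
    (⟨s.1, s.2 ≫ 𝟙 _⟩ : State (S i).vars.lP A) = s))

theorem push_map_id_in (t : TensorOf S W) (t' : TensorOf S W') (i : Fin n) {A : C}
    (s : State (S i).vars.lN A) : (t.map t' fun i => Matching.id (S i).vars).push
      ⟨.inr (t'.tinN i s).1, (t'.tinN i s).2⟩ = ⟨.inl (t.tinN i s).1, (t.tinN i s).2⟩ := by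
  have h := push_map t t' (fun i => Matching.id (S i).vars) i ⟨.inr s.1, s.2⟩
  exact h.trans (congrArg (fun s : State (S i).vars.lN A => (⟨.inl (t.tinN i s).1, (t.tinN i s).2⟩ :
    State (tgtLab W.vars W'.vars) A)) (Sigma.ext rfl (heq_of_eq (Category.comp_id _)) :
    (⟨s.1, s.2 ≫ 𝟙 _⟩ : State (S i).vars.lN A) = s))

end TensorOf

/-- The variables of `x₁ ⊗ ⋯ ⊗ xₙ`. -/
noncomputable def tensEquiv {n : ℕ} (x : Fin n → C) : Fin n ≃ (LShape.tens n fun i => .of (x i)).vars.P :=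
  Equiv.ofBijective (fun j => (tensPos x j).idx) ⟨fun _ _ => tensPos_inj x, tensPos_surj x⟩

/-- The graph of a configuration, as an allowable graph. -/
theorem exists_graph {Q : SymMulticategory.{u, v, w} C} {n : ℕ} {F : Fin n → Q.Elt} {f : Q.Elt}
    (c : Config F f) : ∃ θ : (AC.I : AC C) ⟶ ladder F f, IsGraph θ c.tree := by
  obtain ⟨e, he1, he2⟩ := c.composes.exists_equiv
  let T := c.tree
  let H := Tree.ctxObj F f.src
  let x1 : Fin n → Discrete (Fin n ⊕ Fin f.n) := fun i => ⟨.inl i⟩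
  let x2 : Fin f.n → Discrete (Fin n ⊕ Fin f.n) := fun l => ⟨.inr l⟩
  let Γ1 := LShape.tens n fun i => .of (x1 i)
  let Γ2 := LShape.tens f.n fun l => .of (x2 l)
  have hΓ : (LShape.tensor Γ1 Γ2).TensorOnly := .tensor (.tens fun i => .of _) (.tens fun l => .of _)
  -- From the given order, nodes and then leaves, to the order in which they occur in the tree.
  let σ : (LShape.tensor Γ1 Γ2).vars.P ≃ T.ctx.vars.P :=
    (Equiv.sumCongr (tensEquiv x1) (tensEquiv x2)).symm.trans e
  have hσ1 : ∀ i, σ (.inl (tensPos x1 i).idx) = e (.inl i) := fun i =>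
    congrArg e ((Equiv.sumCongr (tensEquiv x1) (tensEquiv x2)).symm_apply_apply (.inl i))
  have hσ2 : ∀ l, σ (.inr (tensPos x2 l).idx) = e (.inr l) := fun l =>
    congrArg e ((Equiv.sumCongr (tensEquiv x1) (tensEquiv x2)).symm_apply_apply (.inr l))
  have hσ : ∀ p, (LShape.tensor Γ1 Γ2).vars.lP p = T.ctx.vars.lP (σ p) := by
    rintro (p | p)
    · obtain ⟨i, rfl⟩ := tensPos_surj x1 p
      exact (tensPos x1 i).eq.trans ((congrArg T.ctx.vars.lP (hσ1 i)).trans (he1 i)).symm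
    · obtain ⟨i, rfl⟩ := tensPos_surj x2 p
      exact (tensPos x2 i).eq.trans ((congrArg T.ctx.vars.lP (hσ2 i)).trans (he2 i)).symm
  have := hΓ.isEmpty
  have := T.tensorOnly_ctx.isEmpty
  let m : Matching (LShape.tensor Γ1 Γ2).vars T.ctx.vars := Matching.ofEquiv σ hσ
  -- The reordering is made among single variables, where everything is allowable; substitution by
  -- `H` then turns it into an allowable reordering of whole frames.
  have hm : Allowable (LShape.tensor Γ1 Γ2) T.ctx m := hΓ.allowable T.tensorOnly_ctx m
  let t1 : TensorOf (fun i => (LShape.of (F i)).bind Q.frame) (Γ1.bind H) :=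
    (TensorOf.tens fun i => .of (x1 i)).bind H
  let t2 : TensorOf (fun l => LShape.of (f.src l)) (Γ2.bind H) :=
    (TensorOf.tens fun i => .of (x2 i)).bind H
  let t3 := TensorOf.tens fun l => LShape.of (f.src l)
  let c1 := (nodeTens F).map t1 fun i => Matching.id _
  let c2 := t3.map t2 fun l => Matching.id _
  let M1 := (m.subst H).comp T.eval
  let M : Matching (LShape.tensor (LShape.bind Q.frame (.tens n fun i => .of (F i)))
    (.tens f.n fun l => .of (f.src l))).vars (LShape.of f.tgt).vars := (c1.tensor c2).comp M1
  have hM : Allowable (.tensor (LShape.bind Q.frame (.tens n fun i => .of (F i)))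
      (.tens f.n fun l => .of (f.src l))) (.of f.tgt) M :=
    .comp (.tensor (TensorOf.allowable_map _ _ fun i => .id _) (TensorOf.allowable_map _ _ fun i => .id _))
      (.comp (allowable_subst H hm) T.allowable_eval)
  let pI : ∀ i, Pos T.ctx.vars.lP (x1 i) := fun i => ⟨e (.inl i), he1 i⟩
  let pL : ∀ l, Pos T.ctx.vars.lP (x2 l) := fun l => ⟨e (.inr l), he2 l⟩
  -- Each node occurs once in the configuration, so its index labels exactly one variable of
  -- `T.ctx`; `uL` says the same of leaves.
  have uI : ∀ i (p : Pos T.ctx.vars.lP (x1 i)), p = pI i := fun i p => by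
    obtain ⟨i' | l, h⟩ := e.surjective p.idx
    · have h1 := (he1 i').symm.trans ((congrArg T.ctx.vars.lP h).trans p.eq)
      obtain rfl : i' = i := Sum.inl_injective (congrArg Discrete.as h1)
      exact Pos.ext_idx h.symm
    · have h1 := (he2 l).symm.trans ((congrArg T.ctx.vars.lP h).trans p.eq)
      exact nomatch congrArg Discrete.as h1
  have uL : ∀ l (p : Pos T.ctx.vars.lP (x2 l)), p = pL l := fun l p => by
    obtain ⟨i | l', h⟩ := e.surjective p.idx
    · have h1 := (he1 i).symm.trans ((congrArg T.ctx.vars.lP h).trans p.eq)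
      exact nomatch congrArg Discrete.as h1
    · have h1 := (he2 l').symm.trans ((congrArg T.ctx.vars.lP h).trans p.eq)
      obtain rfl : l' = l := Sum.inr_injective (congrArg Discrete.as h1)
      exact Pos.ext_idx h.symm
  let aI : ∀ i, Pos (LShape.tensor Γ1 Γ2).vars.lP (x1 i) := fun i =>
    ⟨.inl (tensPos x1 i).idx, (tensPos x1 i).eq⟩
  let aL : ∀ l, Pos (LShape.tensor Γ1 Γ2).vars.lP (x2 l) := fun l =>
    ⟨.inr (tensPos x2 l).idx, (tensPos x2 l).eq⟩
  have mI : ∀ i, m.push ((aI i).inl.st (𝟙 _)) = (pI i).inr.st (𝟙 _) := fun i =>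
    Matching.push_ofEquiv (hσ1 i)
  have mL : ∀ l, m.push ((aL l).inl.st (𝟙 _)) = (pL l).inr.st (𝟙 _) := fun l =>
    Matching.push_ofEquiv (hσ2 l)
  have qI : ∀ i A (s : State (LShape.vars (Q.frame.obj (F i))).lP A),
      placePP H (aI i) s = ⟨.inl (t1.tinP i s).1, (t1.tinP i s).2⟩ := fun i A s =>
    (placePP_inl H (tensPos x1 i) s).trans (congrArg (fun s : State (LShape.vars (Γ1.bind H)).lP A =>
      (⟨.inl s.1, s.2⟩ : State (LShape.vars ((LShape.tensor Γ1 Γ2).bind H)).lP A))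
      (TensorOf.placePP_posP H (TensorOf.tens fun i => .of (x1 i)) i ⟨(), rfl⟩ s))
  have qI' : ∀ i A (s : State (LShape.vars (Q.frame.obj (F i))).lN A),
      placePN H (aI i) s = ⟨.inl (t1.tinN i s).1, (t1.tinN i s).2⟩ := fun i A s =>
    (placePN_inl H (tensPos x1 i) s).trans (congrArg (fun s : State (LShape.vars (Γ1.bind H)).lN A =>
      (⟨.inl s.1, s.2⟩ : State (LShape.vars ((LShape.tensor Γ1 Γ2).bind H)).lN A))
      (TensorOf.placePN_posP H (TensorOf.tens fun i => .of (x1 i)) i ⟨(), rfl⟩ s))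
  have qL : ∀ l A (s : State (LShape.vars (.of (f.src l))).lP A),
      placePP H (aL l) s = ⟨.inr (t2.tinP l s).1, (t2.tinP l s).2⟩ := fun i A s =>
    (placePP_inr H (tensPos x2 i) s).trans (congrArg (fun s : State (LShape.vars (Γ2.bind H)).lP A =>
      (⟨.inr s.1, s.2⟩ : State (LShape.vars ((LShape.tensor Γ1 Γ2).bind H)).lP A))
      (TensorOf.placePP_posP H (TensorOf.tens fun i => .of (x2 i)) i ⟨(), rfl⟩ s))
  -- `M` leads from the product of nodes and leaves to the root. Currying takes the leaves across,
  -- giving a graph into `φ f`, and `point` takes the nodes across.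
  refine ⟨⟨_, hM.curry.point⟩, (isGraph_iff _ _).2 ((edges_iff_runs _ _ _).2 ?_)⟩
  -- An end of the iterated evaluation is carried through the reordering and the identifications
  -- `c1` and `c2` to an end of `M`, and from there by the two adjunctions to an end of the graph
  -- out of `I`.
  let RS : ∀ A, State (srcLab (T.ctx.bind H).vars (SignedSet.single f.tgt)) A →
      State (ladderSrc F f) A → Prop := fun A s s' => ∃ s1 s2, PreSrc (m.subst H) s s1 ∧
    PreSrc (c1.tensor c2) s1 s2 ∧ pointSrc (curSrc s2) = s'
  let RT : ∀ A, State (tgtLab (T.ctx.bind H).vars (SignedSet.single f.tgt)) A →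
      State (ladderTgt F f) A → Prop := fun A s s' => ∃ s1 s2, PreTgt (m.subst H) s s1 ∧
    PreTgt (c1.tensor c2) s1 s2 ∧ pointTgt (curTgt s2) = s'
  have hrun := T.eval_runs (r := fun A s t => T.eval.push s = t)
    (NO := fun i A k => inlSrc (placePP H (pI i) ⟨.inr (), k⟩))
    (NI := fun i j A k => inlTgt (placePN H (pI i) ((shapeIn (F i).src (F i).tgt j).st k)))
    (LS := fun l A k => inlSrc (placePP H (pL l) ⟨(), k⟩)) (fun A k => ⟨.inr (), k⟩)
    (fun A s => inlSrc s) (fun A t => t) (fun A s => rfl) (fun A k => rfl)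
    (fun i p A k => congrArg (fun p : Pos T.ctx.vars.lP (x1 i) => inlSrc (placePP H p ⟨.inr (), k⟩)) (uI i p))
    (fun i p j A k => congrArg (fun p : Pos T.ctx.vars.lP (x1 i) =>
      inlTgt (placePN H p ((shapeIn (F i).src (F i).tgt j).st k))) (uI i p))
    (fun l p A k => congrArg (fun p : Pos T.ctx.vars.lP (x2 l) => inlSrc (placePP H p ⟨(), k⟩)) (uL l p))
  refine hrun.imp RS RT ?_ ?_ ?_ ?_ ?_
  · rintro A s t _ _ h ⟨s1, s2, h1, h2, rfl⟩ ⟨t1, t2, h3, h4, rfl⟩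
    have h5 := h2.push (h1.push h h3) h4
    exact (push_point _ _).trans (congrArg pointTgt ((push_curry M s2).trans (congrArg curTgt h5)))
  · intro i A k
    let s : State (LShape.vars (Q.frame.obj (F i))).lP A := ⟨.inr (), k⟩
    refine ⟨⟨.inl (placePP H (aI i) s).1, (placePP H (aI i) s).2⟩,
      ⟨.inl (.inl ((nodeTens F).tinP i s).1), ((nodeTens F).tinP i s).2⟩,
      .inl (push_subst_out H (mI i) s), ?_, ?_⟩
    · refine (congrArg (fun s : State (LShape.vars ((LShape.tensor Γ1 Γ2).bind H)).lP A =>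
        PreSrc (c1.tensor c2) (⟨.inl s.1, s.2⟩ : State (srcLab _ (SignedSet.single f.tgt)) A) _) (qI i A s)).mpr ?_
      exact .inl ((push_sumL c1 c2 ⟨.inl ((nodeTens F).tinP i s).1, ((nodeTens F).tinP i s).2⟩).trans
        (congrArg sumLeft (TensorOf.push_map_id_out (nodeTens F) t1 i s)))
    · exact (congrArg (fun s : State (LShape.vars (LShape.bind Q.frame (.tens n fun i => .of (F i)))).lP A =>
        (⟨.inr (.inl s.1), s.2⟩ : State (ladderSrc F f) A)) (factorP_eq Q.frame F i s).symm).trans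
          (nodeOut_eq F f i k)
  · intro i j A k
    let s : State (LShape.vars (Q.frame.obj (F i))).lN A := (shapeIn (F i).src (F i).tgt j).st k
    refine ⟨⟨.inl (placePN H (aI i) s).1, (placePN H (aI i) s).2⟩,
      ⟨.inl (.inl ((nodeTens F).tinN i s).1), ((nodeTens F).tinN i s).2⟩,
      .inl (push_subst_in H (mI i) s), ?_, ?_⟩
    · refine (congrArg (fun s : State (LShape.vars ((LShape.tensor Γ1 Γ2).bind H)).lN A =>
        PreTgt (c1.tensor c2) (⟨.inl s.1, s.2⟩ : State (tgtLab _ (SignedSet.single f.tgt)) A) _) (qI' i A s)).mpr ?_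
      exact .inl ((push_sumL c1 c2 ⟨.inr (t1.tinN i s).1, (t1.tinN i s).2⟩).trans
        (congrArg sumLeft (TensorOf.push_map_id_in (nodeTens F) t1 i s)))
    · exact (congrArg (fun s : State (LShape.vars (LShape.bind Q.frame (.tens n fun i => .of (F i)))).lN A =>
        (⟨.inr (.inl s.1), s.2⟩ : State (ladderTgt F f) A))
          ((nodeTens F).tinN_st i (shapeIn (F i).src (F i).tgt j) k))
  · intro l A k
    let s : State (LShape.vars (.of (f.src l))).lP A := ⟨(), k⟩
    refine ⟨⟨.inl (placePP H (aL l) s).1, (placePP H (aL l) s).2⟩,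
      ⟨.inl (.inr (t3.tinP l s).1), (t3.tinP l s).2⟩,
      .inl (push_subst_out H (mL l) s), ?_, ?_⟩
    · refine (congrArg (fun s : State (LShape.vars ((LShape.tensor Γ1 Γ2).bind H)).lP A =>
        PreSrc (c1.tensor c2) (⟨.inl s.1, s.2⟩ : State (srcLab _ (SignedSet.single f.tgt)) A) _) (qL l A s)).mpr ?_
      exact .inl ((push_sumR c1 c2 ⟨.inl (t3.tinP l s).1, (t3.tinP l s).2⟩).trans
        (congrArg sumRight (TensorOf.push_map_id_out t3 t2 l s)))
    · exact (congrArg (fun s : State (LShape.vars (.tens f.n fun i => .of (f.src i))).lP A =>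
        (⟨.inr (.inr (.inl s.1)), s.2⟩ : State (ladderSrc F f) A)) ((tensIso_eq f.src l k).symm.trans
          (tensIso_st f.src l k)))
  · intro A k
    exact ⟨⟨.inr (), k⟩, ⟨.inr (), k⟩, @PreTgt.inr C _ _ _ (SignedSet.single f.tgt) (m.subst H) A () k,
      @PreTgt.inr C _ _ _ (SignedSet.single f.tgt) (c1.tensor c2) A () k, rootIn_eq F f k⟩

end KM

/-! ### Trees of trees -/

namespace KM
open SignedSet Matching SymMulticategory
variable {C : Type u} [Category.{v} C] {D : Type u'} [Category.{v'} D]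

namespace Tree
variable {Q : SymMulticategory.{u, v, w} C} {ι L : Type} {F : ι → Q.slice.Elt} {z : L → Q.Elt}

/-- The leaves of the tree with the single node given by a morphism of `elt Q`. -/
def leaves {κ : Type} {F : κ → Q.Elt} {x y : Q.Elt} (a : x ⟶ y) (j : Fin x.n) : Tree F y.src (x.src j) :=
  leaf (a.perm j) (a.input j)

/-- The composite of a tree of trees. -/
def flat : ∀ {x : Q.Elt} (_ : Tree (Q := Q.slice) F z x), Tree z x.src x.tgt
  | _, leaf l a => node l a.output (leaves a)
  | _, node i a ch => (((Config.tree (F i).arr).replace fun j => (ch j).flat).postcomp a.output).graft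
      (leaves a)

end Tree

/-- The leaves of a tree over `Q⁺` are arrows of `Q` and become the nodes of the flattened tree.
Composition in `Q⁺` is replacement of nodes by trees, which is what `Tree.flat` iterates. Since `ρ`
names the inputs of the composite by leaves, the renamed composite depends on the tree alone. -/
theorem Composes.rename_tree {Q : SymMulticategory.{u, v, w} C} {ι L : Type} {F : ι → Q.slice.Elt}
    {z : L → Q.Elt} {x : Q.Elt} {T : Tree (Q := Q.slice) F z x} {κ μ : Type} [Finite μ] {ν : κ → ι}
    {ρ : μ → L} {g : Q.slice.Hom (fun m => z (ρ m)) x} (h : Composes T ν ρ g) :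
    Tree.rename (F := z) ρ (Config.tree g) = T.flat := by
  induction h with
  | @leaf x l a =>
    change Tree.node l (𝟙 _ ≫ a.output) (fun j => Tree.postcomp _ (𝟙 _)) = Tree.node l a.output _
    rw [Category.id_comp]
    congr 1
    funext j
    exact Tree.postcomp_id _
  | @node x i a ch κ μ _ ν ρ g h ih =>
    let z' := fun p : Σ j, μ j => z (ρ p.1 p.2)
    let c : Tree z' (F i).tgt.src (F i).tgt.tgt := (Config.tree (F i).arr).replace fun j =>
      Tree.rename (F := z') (Sigma.mk j) (Config.tree (g j))
    have h1 : Config.tree (Q.slice.post (Q.slice.comp (F i).arr g) a) =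
        Tree.rename (F := z') (Equiv.uniqueSigma fun _ : Unit => Σ j, μ j)
          (((Tree.rename (F := fun p : Σ _ : Unit, Σ j, μ j => z' p.2) (Sigma.mk ()) c).postcomp
            a.output).graft (Tree.leaves a)) := rfl
    -- Renaming commutes with the label and the reordering of leaves that the edge `a` contributes.
    -- The remaining renamings come from the indexing of multicategory composites by sigma types and
    -- cancel.
    have h2 : ∀ T : Tree z' (F i).tgt.src (F i).tgt.tgt,
        Tree.rename (F := z) (fun p : Σ j, μ j => ρ p.1 p.2) ((T.postcomp a.output).graft (Tree.leaves a)) =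
          ((Tree.rename (F := z) (fun p : Σ j, μ j => ρ p.1 p.2) T).postcomp a.output).graft (Tree.leaves a) :=
      fun T => (Tree.replace_graft _ _ _).trans (congrArg (fun T => Tree.graft T (Tree.leaves a))
        (Tree.replace_postcomp _ _ _))
    have h3 : Tree.rename (F := z') (Equiv.uniqueSigma fun _ : Unit => Σ j, μ j)
          (((Tree.rename (F := fun p : Σ _ : Unit, Σ j, μ j => z' p.2) (Sigma.mk ()) c).postcomp
            a.output).graft (Tree.leaves a)) = (c.postcomp a.output).graft (Tree.leaves a) :=
      (Tree.replace_graft _ _ _).trans (congrArg (fun T => Tree.graft T (Tree.leaves a))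
        ((Tree.replace_postcomp _ _ _).trans (congrArg (fun T => Tree.postcomp T a.output)
          ((Tree.rename_rename (F := z') _ _ _).trans (Tree.rename_id c)))))
    have h4 : Tree.rename (F := z) (fun p : Σ j, μ j => ρ p.1 p.2) c =
        (Config.tree (F i).arr).replace fun j => (ch j).flat :=
      (Tree.rename_replace (F := z) _ _ _).trans (congrArg (fun R => Tree.replace R (Config.tree (F i).arr))
        (funext fun j => (Tree.rename_rename (F := z) _ _ _).trans (ih j)))
    exact (congrArg (Tree.rename (F := z) fun p : Σ j, μ j => ρ p.1 p.2) (h1.trans h3)).trans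
      ((h2 c).trans (congrArg (fun T => (Tree.postcomp T a.output).graft (Tree.leaves a)) h4))
  | perm e d h ih =>
    exact (Tree.rename_rename (F := z) _ _ _).trans ih

end KM

/-! ### Substitution at the inputs of a shape, and tensor products of points -/

namespace KM
open SignedSet Matching SymMulticategory
variable {C : Type u} [Category.{v} C] {D : Type u'} [Category.{v'} D]

section
variable (H : D ⥤ AC C) {n : ℕ} (x : Fin n → D) (y : D) {A : C}

theorem placePP_tensPos (j : Fin n) (s : State (LShape.vars (H.obj (x j))).lP A) :
    placePP H (tensPos x j) s = ((TensorOf.tens fun i => .of (x i)).bind H).tinP j s :=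
  TensorOf.placePP_posP H (TensorOf.tens fun i => .of (x i)) j ⟨(), rfl⟩ s

theorem placePN_tensPos (j : Fin n) (s : State (LShape.vars (H.obj (x j))).lN A) :
    placePN H (tensPos x j) s = ((TensorOf.tens fun i => .of (x i)).bind H).tinN j s :=
  TensorOf.placePN_posP H (TensorOf.tens fun i => .of (x i)) j ⟨(), rfl⟩ s

theorem placeNP_inl {T S : LShape D} {x : D} (p : Pos T.vars.lP x) (s : State (LShape.vars (H.obj x)).lP A) :
    placeNP H (⟨.inl p.idx, p.eq⟩ : Pos (LShape.hom T S).vars.lN x) s =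
      ⟨.inl (placePP H p s).1, (placePP H p s).2⟩ := by
  obtain ⟨p, rfl⟩ := p; rfl

theorem placeNN_inl {T S : LShape D} {x : D} (p : Pos T.vars.lP x) (s : State (LShape.vars (H.obj x)).lN A) :
    placeNN H (⟨.inl p.idx, p.eq⟩ : Pos (LShape.hom T S).vars.lN x) s =
      ⟨.inl (placePN H p s).1, (placePN H p s).2⟩ := by
  obtain ⟨p, rfl⟩ := p; rfl

theorem placeNP_shapeIn (j : Fin n) (s : State (LShape.vars (H.obj (x j))).lP A) :
    placeNP H (shapeIn x y j) s = ⟨.inl (((TensorOf.tens fun i => .of (x i)).bind H).tinP j s).1,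
      (((TensorOf.tens fun i => .of (x i)).bind H).tinP j s).2⟩ :=
  (placeNP_inl H (tensPos x j) s).trans (congrArg (fun s : State (LShape.vars (.bind H (.tens n fun i => .of (x i)))).lP A =>
    (⟨.inl s.1, s.2⟩ : State (LShape.vars (.bind H (shape x y))).lN A)) (placePP_tensPos H x j s))

theorem placeNN_shapeIn (j : Fin n) (s : State (LShape.vars (H.obj (x j))).lN A) :
    placeNN H (shapeIn x y j) s = ⟨.inl (((TensorOf.tens fun i => .of (x i)).bind H).tinN j s).1,
      (((TensorOf.tens fun i => .of (x i)).bind H).tinN j s).2⟩ :=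
  (placeNN_inl H (tensPos x j) s).trans (congrArg (fun s : State (LShape.vars (.bind H (.tens n fun i => .of (x i)))).lN A =>
    (⟨.inl s.1, s.2⟩ : State (LShape.vars (.bind H (shape x y))).lP A)) (placePN_tensPos H x j s))

end

section
variable {E : Type w'} [Category.{v'} E]

theorem push_unitInv_comp {X Z : SignedSet C} {g : Matching (X.sum .empty) Z} {A : C} {n t m l}
    (h : g.push (A := A) ⟨.inr n, t⟩ = ⟨.inr m, l⟩) :
    ((unitInv X).comp g).push (A := A) ⟨.inr n, t⟩ = ⟨.inr m, l⟩ :=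
  (@PreSrc.inr C _ X (X.sum .empty) Z (unitInv X) A n t).push h
    (@PreTgt.inr C _ X (X.sum .empty) Z (unitInv X) A m l)

/-- The tensor product of points is a disjoint union preceded by copies of `I ≅ I ⊗ I`, which have
no variables. So every edge of a factor is an edge of the product. -/
theorem push_tensorPoints (F : C ⥤ AC D) (G : D ⥤ AC E) : ∀ {n : ℕ} (x : Fin n → C)
    (p : ∀ i, (AC.I : AC E) ⟶ (AC.lift G).obj (F.obj (x i))) (i : Fin n) {A : E}
    {s : State (LShape.vars (.bind G (F.obj (x i)))).lN A}
    {t : State (LShape.vars (.bind G (F.obj (x i)))).lP A}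
    (h : Matching.push (p i).1 ⟨.inr s.1, s.2⟩ = ⟨.inr t.1, t.2⟩),
    Matching.push (AC.tensorPoints F G x p).1
      ⟨.inr ((((TensorOf.tens fun i => .of (x i)).bind F).bind G).tinN i s).1,
        ((((TensorOf.tens fun i => .of (x i)).bind F).bind G).tinN i s).2⟩ =
      ⟨.inr ((((TensorOf.tens fun i => .of (x i)).bind F).bind G).tinP i t).1,
        ((((TensorOf.tens fun i => .of (x i)).bind F).bind G).tinP i t).2⟩
  | 0, _, _, i, _, _, _, _ => i.elim0
  | 1, x, p, i, A, s, t, h => by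
    revert s t
    exact Fin.cases (fun s t h => h) (fun i => i.elim0) i
  | n + 2, x, p, i, A, s, t, h => by
    revert s t
    let P := AC.tensorPoints F G (fun i : Fin (n + 1) => x i.succ) fun i => p i.succ
    refine Fin.cases (fun s t h => ?_) (fun i s t h => ?_) i
    · exact push_unitInv_comp ((push_sumL (p 0).1 P.1 ⟨.inr s.1, s.2⟩).trans (congrArg sumLeft h))
    · have h1 := push_tensorPoints F G (fun i : Fin (n + 1) => x i.succ) (fun i => p i.succ) i h
      exact push_unitInv_comp ((push_sumR (p 0).1 P.1 _).trans (congrArg sumRight h1))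

end
end KM

/-! ### Paths through the composite of `α₁ ⊗ ⋯ ⊗ αₘ` with a graph into which frames are substituted
-/

namespace KM
open SignedSet Matching SymMulticategory
variable {C : Type u} [Category.{v} C] {D : Type u'} [Category.{v'} D]

namespace SymMulticategory
variable {Q : SymMulticategory.{u, v, w} C} {n : ℕ} (F : Fin n → Q.Elt) (f : Q.Elt)

/-- `φ F₁ ⊗ ⋯ ⊗ φ Fₙ`. -/
noncomputable abbrev rungs : LShape C := LShape.bind Q.frame (.tens n fun i => .of (F i))

/-- The output of the `i`-th node. -/
noncomputable def barOut (i : Fin n) : Pos (srcLab (rungs F).vars (LShape.vars (shape f.src f.tgt))) (F i).tgt :=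
  ⟨.inl ((nodeTens F).posP i (shapeOut (F i).src (F i).tgt)).idx,
    ((nodeTens F).posP i (shapeOut (F i).src (F i).tgt)).eq⟩

/-- The `j`-th input of the `i`-th node. -/
noncomputable def barIn (i : Fin n) (j : Fin (F i).n) :
    Pos (tgtLab (rungs F).vars (LShape.vars (shape f.src f.tgt))) ((F i).src j) :=
  ⟨.inl ((nodeTens F).posN i (shapeIn (F i).src (F i).tgt j)).idx,
    ((nodeTens F).posN i (shapeIn (F i).src (F i).tgt j)).eq⟩

/-- The `l`-th leaf. -/
noncomputable def barLeaf (l : Fin f.n) :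
    Pos (srcLab (rungs F).vars (LShape.vars (shape f.src f.tgt))) (f.src l) :=
  ⟨.inr (shapeIn f.src f.tgt l).idx, (shapeIn f.src f.tgt l).eq⟩

/-- The root. -/
noncomputable def barRoot : Pos (tgtLab (rungs F).vars (LShape.vars (shape f.src f.tgt))) f.tgt :=
  ⟨.inr (shapeOut f.src f.tgt).idx, rfl⟩

variable {F f}

/-- A target of a graph `φ F₁ ⊗ ⋯ ⊗ φ Fₙ ⟶ φ f`, as a target of a graph `I ⟶ [φ F₁ ⊗ ⋯ ⊗ φ Fₙ, φ f]`. -/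
def pointPos {x : C} : Pos (tgtLab (rungs F).vars (LShape.vars (shape f.src f.tgt))) x → Pos (ladderTgt F f) x
  | ⟨.inl p, h⟩ => ⟨.inr (.inl p), h⟩
  | ⟨.inr p, h⟩ => ⟨.inr (.inr p), h⟩

theorem pointPos_st {x : C} (p : Pos (tgtLab (rungs F).vars (LShape.vars (shape f.src f.tgt))) x) {A : C}
    (k : A ⟶ x) : pointTgt (p.st k) = (pointPos p).st k := by
  rcases p with ⟨p | p, h⟩ <;> rfl

/-- The edges of a graph `φ F₁ ⊗ ⋯ ⊗ φ Fₙ ⟶ φ f` that lead into the position `p` and the inputs of nodes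
are those of the tree. -/
def BarEdges (θ : Matching (rungs F).vars (LShape.vars (shape f.src f.tgt))) : ∀ {x : C} (_ : Tree F f.src x)
    (_ : Pos (tgtLab (rungs F).vars (LShape.vars (shape f.src f.tgt))) x), Prop
  | _, .leaf l a, p => θ.push ((barLeaf F f l).st (𝟙 _)) = p.st a
  | _, .node i a ch, p => θ.push ((barOut F f i).st (𝟙 _)) = p.st a ∧ ∀ j, BarEdges θ (ch j) (barIn F f i j)

theorem barEdges_iff (θ : (AC.I : AC C) ⟶ ladder F f) {x : C} (T : Tree F f.src x)
    (p : Pos (tgtLab (rungs F).vars (LShape.vars (shape f.src f.tgt))) x) :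
    BarEdges (AC.bar θ).1 T p ↔ Edges θ T (pointPos p) := by
  have key : ∀ {y : C} (s : State (srcLab (rungs F).vars (LShape.vars (shape f.src f.tgt))) y) {x' : C}
      (p : Pos (tgtLab (rungs F).vars (LShape.vars (shape f.src f.tgt))) x') (a : y ⟶ x'),
      Matching.push (AC.bar θ).1 s = p.st a ↔ Matching.push θ.1 (pointSrc s) = (pointPos p).st a := by
    intro y s x' p a
    have h := AC.push_bar θ s
    refine ⟨fun h' => h.symm.trans ((congrArg pointTgt h').trans (pointPos_st p a)), fun h' => ?_⟩
    exact pointTgt_inj (h.trans (h'.trans (pointPos_st p a).symm))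
  induction T with
  | leaf l a => exact key _ p a
  | node i a ch ih => exact and_congr (key _ p a) (forall_congr' fun j => ih j (barIn F f i j))

section
variable {X Y : SignedSet C} {T S : LShape Q.Elt} (P : Matching X (T.bind Q.frame).vars)
  {θ : Matching T.vars S.vars} {x y : Q.Elt} {q : Pos (srcLab T.vars S.vars) x}
  {p : Pos (tgtLab T.vars S.vars) y} {a : x ⟶ y}

/-- An edge of `θ` labelled by `a : x ⟶ y` becomes the graph of `a`: this is its output edge, along
`θ`, and `run_input` gives its input edges, against `θ`. -/
theorem run_output (h : θ.push (q.st (𝟙 _)) = p.st a) {A : C} (k : A ⟶ x.tgt) :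
    Run P (θ.subst Q.frame) ⟨.inl (.inr (srcOut Q.frame q ⟨.inr (), k⟩).1), (srcOut Q.frame q ⟨.inr (), k⟩).2⟩
      (exitRight (tgtOut Q.frame p ⟨.inr (), k ≫ a.output⟩)) :=
  .single (.right ((push_srcOut Q.frame h (.inr ()) k).trans (congrArg (edgeEnd Q.frame q p) (push_frame_out a k))))

theorem run_input (h : θ.push (q.st (𝟙 _)) = p.st a) (j : Fin x.n) {A : C} (k : A ⟶ y.src (a.perm j)) :
    Run P (θ.subst Q.frame) ⟨.inl (.inr (tgtIn Q.frame p ((shapeIn y.src y.tgt (a.perm j)).st k)).1),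
        (tgtIn Q.frame p ((shapeIn y.src y.tgt (a.perm j)).st k)).2⟩
      (exitRight (srcIn Q.frame q ((shapeIn x.src x.tgt j).st (k ≫ a.input j)))) :=
  .single (.right ((push_tgtIn Q.frame h _ _).trans (congrArg (edgeEnd Q.frame q p) (push_frame_in a j k))))

end

section
variable {m : ℕ} {α : Fin m → Q.slice.Elt} {α' : Q.slice.Elt}
  {p : ∀ i, (AC.I : AC C) ⟶ (AC.lift Q.frame).obj (Q.slice.frame.obj (α i))}
  {θ : Matching (rungs α).vars (LShape.vars (shape α'.src α'.tgt))}

/-- By induction on the tree over `Q⁺`. Its edges are traversed in the second factor of the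
composite, in both directions, while inside a node `i` the edges of the tree `α i` are traversed in
the first factor. Each edge of the flattened tree is such an alternating path, so the relation used
is `Run` and not a single step. -/
theorem BarEdges.runs (hp : ∀ i, IsGraph (p i) (Config.tree (α i).arr)) {x : Q.Elt}
    {T : Tree (Q := Q.slice) α α'.src x} {q} (h : BarEdges θ T q) : T.flat.Runs
      (fun A => Run (A := A) (AC.tensorPoints Q.slice.frame Q.frame α p).1 (θ.subst Q.frame))
      (fun l A k => ⟨.inl (.inr (srcOut Q.frame (barLeaf α α' l) ⟨.inr (), k⟩).1),
        (srcOut Q.frame (barLeaf α α' l) ⟨.inr (), k⟩).2⟩)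
      (fun l j A k => exitRight (srcIn Q.frame (barLeaf α α' l) ((shapeIn (α'.src l).src (α'.src l).tgt j).st k)))
      (fun l A k => ⟨.inl (.inr (tgtIn Q.frame q ((shapeIn x.src x.tgt l).st k)).1),
        (tgtIn Q.frame q ((shapeIn x.src x.tgt l).st k)).2⟩)
      (fun A k => exitRight (tgtOut Q.frame q ⟨.inr (), k⟩)) := by
  induction T with
  | leaf l a =>
    exact ⟨fun A k => run_output _ h k, fun j A k => run_input _ h j k⟩
  | @node x i a ch ih =>
    -- The tree of `α i`, read inside the composite: its nodes are the inputs of node `i` of `T`,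
    -- its leaves and its root belong to the output of node `i`.
    have h1 : (Config.tree (α i).arr).Runs
        (fun A => Run (A := A) (AC.tensorPoints Q.slice.frame Q.frame α p).1 (θ.subst Q.frame))
        (fun j A k => exitRight (tgtOut Q.frame (barIn α α' i j) ⟨.inr (), k⟩))
        (fun j l A k => ⟨.inl (.inr (tgtIn Q.frame (barIn α α' i j)
          ((shapeIn ((α i).src j).src ((α i).src j).tgt l).st k)).1), (tgtIn Q.frame (barIn α α' i j)
          ((shapeIn ((α i).src j).src ((α i).src j).tgt l).st k)).2⟩)
        (fun l A k => exitRight (srcIn Q.frame (barOut α α' i) ((shapeIn (α i).tgt.src (α i).tgt.tgt l).st k)))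
        (fun A k => ⟨.inl (.inr (srcOut Q.frame (barOut α α' i) ⟨.inr (), k⟩).1),
          (srcOut Q.frame (barOut α α' i) ⟨.inr (), k⟩).2⟩) := by
      let t := (nodeTens α).bind Q.frame
      refine ((edges_iff_runs (p i) _ _).1 ((isGraph_iff (p i) _).1 (hp i))).imp
        (fun A s v => ∃ q : State (LShape.vars (ladder (α i).src (α i).tgt)).lN A,
          s = ⟨.inr q.1, q.2⟩ ∧ ⟨.inl (.inl (.inr (t.tinN i q).1)), (t.tinN i q).2⟩ = v)
        (fun A s v => ∃ q : State (LShape.vars (ladder (α i).src (α i).tgt)).lP A,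
          s = ⟨.inr q.1, q.2⟩ ∧ ⟨.inl (.inr (.inl (t.tinP i q).1)), (t.tinP i q).2⟩ = v) ?_ ?_ ?_ ?_ ?_
      · rintro A _ _ _ _ h ⟨q, rfl, rfl⟩ ⟨q', rfl, rfl⟩
        exact .single (.left (push_tensorPoints Q.slice.frame Q.frame α p i h))
      · intro j A k
        let s : State (LShape.vars (Q.frame.obj ((α i).src j))).lP A := ⟨.inr (), k⟩
        refine ⟨⟨.inl ((nodeTens (α i).src).tinP j s).1, ((nodeTens (α i).src).tinP j s).2⟩, ?_, ?_⟩
        · exact (nodeOut_eq _ _ j k).symm.trans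
            (congrArg (fun s : State (LShape.vars (rungs (α i).src)).lP A =>
              (⟨.inr (.inl s.1), s.2⟩ : State (ladderSrc (α i).src (α i).tgt) A)) (factorP_eq Q.frame _ j s))
        · refine Eq.symm (congrArg (fun s : State (LShape.vars ((rungs α).bind Q.frame)).lN A =>
            (⟨.inl (.inl (.inr s.1)), s.2⟩ : State (vertexLab _ _ _) A)) ?_)
          exact (TensorOf.placeNP_posN Q.frame (nodeTens α) i _ s).trans
            (congrArg (t.tinN i) (placeNP_shapeIn Q.frame (α i).src (α i).tgt j s))
      · intro j l A k
        let s := (shapeIn ((α i).src j).src ((α i).src j).tgt l).st k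
        refine ⟨⟨.inl ((nodeTens (α i).src).tinN j s).1, ((nodeTens (α i).src).tinN j s).2⟩, ?_, ?_⟩
        · exact (congrArg (fun s : State (LShape.vars (rungs (α i).src)).lN A =>
              (⟨.inr (.inl s.1), s.2⟩ : State (ladderTgt (α i).src (α i).tgt) A))
              ((nodeTens (α i).src).tinN_st j _ k)).symm
        · refine Eq.symm (congrArg (fun s : State (LShape.vars ((rungs α).bind Q.frame)).lP A =>
            (⟨.inl (.inr (.inl s.1)), s.2⟩ : State (vertexLab _ _ _) A)) ?_)
          exact (TensorOf.placeNN_posN Q.frame (nodeTens α) i _ s).trans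
            (congrArg (t.tinP i) (placeNN_shapeIn Q.frame (α i).src (α i).tgt j s))
      · intro l A k
        let s := (shapeIn (α i).tgt.src (α i).tgt.tgt l).st k
        refine ⟨⟨.inr s.1, s.2⟩, rfl, ?_⟩
        refine Eq.symm (congrArg (fun s : State (LShape.vars ((rungs α).bind Q.frame)).lN A =>
            (⟨.inl (.inl (.inr s.1)), s.2⟩ : State (vertexLab _ _ _) A)) ?_)
        exact TensorOf.placePN_posP Q.frame (nodeTens α) i (shapeOut (α i).src (α i).tgt) s
      · intro A k
        let s : State (LShape.vars (Q.frame.obj (α i).tgt)).lP A := ⟨.inr (), k⟩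
        refine ⟨⟨.inr s.1, s.2⟩, (rootIn_eq _ _ k).symm, ?_⟩
        refine Eq.symm (congrArg (fun s : State (LShape.vars ((rungs α).bind Q.frame)).lP A =>
            (⟨.inl (.inr (.inl s.1)), s.2⟩ : State (vertexLab _ _ _) A)) ?_)
        exact TensorOf.placePP_posP Q.frame (nodeTens α) i (shapeOut (α i).src (α i).tgt) s
    have tr : ∀ A s t u, Run (A := A) (AC.tensorPoints Q.slice.frame Q.frame α p).1 (θ.subst Q.frame) s t →
        Run (A := A) (AC.tensorPoints Q.slice.frame Q.frame α p).1 (θ.subst Q.frame) t u →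
        Run (A := A) (AC.tensorPoints Q.slice.frame Q.frame α p).1 (θ.subst Q.frame) s u :=
      fun A s t u => Relation.ReflTransGen.trans
    -- The three operations that make up `Tree.flat` at a node: the subtrees replace the nodes of `α
    -- i`, and the edge below the node contributes its output label at the root and its input labels
    -- at the leaves.
    exact ((h1.replace tr fun j => ih j (h.2 j)).postcomp tr fun A k => run_output _ h.1 k).graft tr
      fun l A k => run_input _ h.1 l k

end
end SymMulticategory
end KM

/-! ### The composition condition -/

namespace KM
open SignedSet Matching SymMulticategory
variable {C : Type u} [Category.{v} C] {D : Type u'} [Category.{v'} D]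

namespace SymMulticategory
variable {Q : SymMulticategory.{u, v, w} C} {m : ℕ} {α : Fin m → Q.slice.Elt} {α' : Q.slice.Elt}
  {p : ∀ i, (AC.I : AC C) ⟶ (AC.lift Q.frame).obj (Q.slice.frame.obj (α i))}
  {p' : (AC.I : AC C) ⟶ (AC.lift Q.frame).obj (Q.slice.frame.obj α')}
  {θ : (show AC Q.Elt from rungs α) ⟶ shape α'.src α'.tgt}

/-- The graph of a composite of trees is the composite of the graphs. -/
theorem BarEdges.isGraph (hp : ∀ i, IsGraph (p i) (Config.tree (α i).arr))
    {T : Tree (Q := Q.slice) α α'.src α'.tgt} (h : BarEdges θ.1 T (barRoot α α')) :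
    IsGraph (F := α'.src) (f := α'.tgt)
      (AC.tensorPoints Q.slice.frame Q.frame α p ≫ (AC.lift Q.frame).map θ) T.flat := by
  refine (isGraph_iff _ _).2 ((edges_iff_runs _ _ _).2 ((h.runs hp).imp (fun A s s' => s = startState s')
    (fun A t t' => t = ⟨.inr t'.1, t'.2⟩) ?_ ?_ ?_ ?_ ?_))
  -- A path whose two ends are outer vertices is an edge of the composite graph.
  · rintro A _ _ s t h rfl rfl
    exact push_comp_of_run h
  · intro l A k
    let s : State (LShape.vars (Q.frame.obj (α'.src l))).lP A := ⟨.inr (), k⟩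
    have h1 := (placeNP_shapeIn Q.frame α'.src α'.tgt l s)
    have h2 := (factorP_eq Q.frame α'.src l s).symm
    exact (congrArg (fun s : State (LShape.vars (.bind Q.frame (shape α'.src α'.tgt))).lN A =>
      (⟨.inl (.inr (.inr s.1)), s.2⟩ : State (vertexLab SignedSet.empty
        (LShape.vars (.bind Q.frame (rungs α))) (LShape.vars (ladder α'.src α'.tgt))) A)) h1).trans
      ((congrArg (fun s : State (LShape.vars (rungs α'.src)).lP A =>
      (⟨.inl (.inr (.inr (.inl s.1))), s.2⟩ : State (vertexLab SignedSet.empty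
        (LShape.vars (.bind Q.frame (rungs α))) (LShape.vars (ladder α'.src α'.tgt))) A)) h2).trans
      (congrArg startState (nodeOut_eq α'.src α'.tgt l k)))
  · intro l j A k
    let s := (shapeIn (α'.src l).src (α'.src l).tgt j).st k
    have h1 := (placeNN_shapeIn Q.frame α'.src α'.tgt l s)
    have h2 := (nodeTens α'.src).tinN_st l (shapeIn (α'.src l).src (α'.src l).tgt j) k
    exact (congrArg (fun s : State (LShape.vars (.bind Q.frame (shape α'.src α'.tgt))).lP A =>
      (⟨.inr (.inr s.1), s.2⟩ : State (vertexLab SignedSet.empty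
        (LShape.vars (.bind Q.frame (rungs α))) (LShape.vars (ladder α'.src α'.tgt))) A)) h1).trans
      (congrArg (fun s : State (LShape.vars (rungs α'.src)).lN A =>
      (⟨.inr (.inr (.inl s.1)), s.2⟩ : State (vertexLab SignedSet.empty
        (LShape.vars (.bind Q.frame (rungs α))) (LShape.vars (ladder α'.src α'.tgt))) A)) h2)
  · intro l A k
    rfl
  · intro A k
    exact congrArg (fun s : State (ladderTgt α'.src α'.tgt) A => (⟨.inr s.1, s.2⟩ : State (vertexLab SignedSet.empty
        (LShape.vars (.bind Q.frame (rungs α))) (LShape.vars (ladder α'.src α'.tgt))) A))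
      (rootIn_eq α'.src α'.tgt k)

theorem flat_eq {S : Tree (Q := Q.slice) α α'.src α'.tgt} {κ : Type} {ν : κ → Fin m} {g : Q.slice.Hom α'.src α'.tgt}
    (h : Composes S ν (fun l => l) g) : S.flat = Config.tree g :=
  h.rename_tree.symm.trans (Tree.rename_id (F := α'.src) (Config.tree g))

/-- Both sides are graphs of the same configuration: the flattening of `T`, which is the tree of the
arrow to which `T` composes. -/
theorem BarEdges.comp_eq (hp : ∀ i, IsGraph (p i) (Config.tree (α i).arr))
    (hp' : IsGraph p' (Config.tree α'.arr)) {T : Tree (Q := Q.slice) α α'.src α'.tgt} {κ : Type} {ν : κ → Fin m}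
    (hT : Composes T ν (fun l => l) α'.arr) (h : BarEdges θ.1 T (barRoot α α')) :
    AC.tensorPoints Q.slice.frame Q.frame α p ≫ (AC.lift Q.frame).map θ = p' := by
  have h1 := h.isGraph hp
  rw [flat_eq hT] at h1
  exact Edges.unique α'.arr h1 hp'

/-- `θ`, being allowable, is the graph of a tree over `Q⁺` that composes to some `g`. The composite
graph is then the graph of `g`. As it is also that of `α'`, and a graph has at most one tree, `g` is
the arrow `α'`. -/
theorem exists_config (hp : ∀ i, IsGraph (p i) (Config.tree (α i).arr))
    (hp' : IsGraph p' (Config.tree α'.arr))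
    (h : AC.tensorPoints Q.slice.frame Q.frame α p ≫ (AC.lift Q.frame).map θ = p') :
    ∃ S : Config (Q := Q.slice) α α', BarEdges θ.1 S.tree (barRoot α α') := by
  obtain ⟨T, h1, g, hg⟩ := exists_tree (Q := Q.slice) (F := α) (f := α') (AC.unbar θ)
  have h2 : BarEdges (AC.bar (AC.unbar θ)).1 T (barRoot α α') :=
    (barEdges_iff (AC.unbar θ) T (barRoot α α')).2 ((isGraph_iff _ _).1 h1)
  have h3 : BarEdges θ.1 T (barRoot α α') := (congrArg (fun θ : (show AC Q.Elt from rungs α) ⟶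
    shape α'.src α'.tgt => BarEdges θ.1 T (barRoot α α')) (AC.bar_unbar θ)).mp h2
  have h4 := h3.isGraph hp
  rw [h, flat_eq hg] at h4
  have h5 : g = α'.arr := Config.ext (((isGraph_iff _ _).1 h4).tree_unique ((isGraph_iff _ _).1 hp'))
  exact ⟨⟨T, h5 ▸ hg⟩, h3⟩

end SymMulticategory
end KM

/-! ### Morphisms of `elt Q` as trees with one node -/

namespace KM
open SignedSet Matching SymMulticategory
variable {C : Type u} [Category.{v} C] {D : Type u'} [Category.{v'} D]

namespace SymMulticategory

section
variable {Q : SymMulticategory.{u, v, w} C}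

section
variable {n : ℕ} {F : Fin n → Q.Elt} {f : Q.Elt} {θ θ' : (show AC C from rungs F) ⟶ shape f.src f.tgt}

theorem isGraph_unbar_iff {T : Tree F f.src f.tgt} :
    IsGraph (AC.unbar θ) T ↔ BarEdges θ.1 T (barRoot F f) := by
  have h := (isGraph_iff _ _).trans (barEdges_iff (AC.unbar θ) T (barRoot F f)).symm
  exact h.trans (Iff.of_eq (congrArg (fun θ : (show AC C from rungs F) ⟶ shape f.src f.tgt =>
    BarEdges θ.1 T (barRoot F f)) (AC.bar_unbar θ)))

theorem BarEdges.unique (c : Config F f) (h : BarEdges θ.1 c.tree (barRoot F f))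
    (h' : BarEdges θ'.1 c.tree (barRoot F f)) : θ = θ' :=
  (AC.bar_unbar θ).symm.trans ((congrArg AC.bar (Edges.unique c (isGraph_unbar_iff.2 h)
    (isGraph_unbar_iff.2 h'))).trans (AC.bar_unbar θ'))

theorem BarEdges.tree_unique {T T' : Tree F f.src f.tgt} (h : BarEdges θ.1 T (barRoot F f))
    (h' : BarEdges θ.1 T' (barRoot F f)) : T = T' :=
  ((isGraph_iff _ _).1 (isGraph_unbar_iff.2 h)).tree_unique ((isGraph_iff _ _).1 (isGraph_unbar_iff.2 h'))

end

/-- The graph `φ γ` has one output edge, labelled by `γ.output`, and the input edges given by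
`γ.perm` and `γ.input`. These are the edges of the tree whose only node is `f`. -/
theorem barEdges_frame {f g : Q.Elt} (γ : f ⟶ g) :
    BarEdges (F := fun _ : Fin 1 => f) (f := g) (Q.frame.map γ).1
      (.node 0 γ.output fun j => .leaf (γ.perm j) (γ.input j)) (barRoot _ g) := by
  refine ⟨?_, fun j => ?_⟩
  · have h := push_frame_out γ (𝟙 f.tgt)
    have e1 := shapeOut_st f.src f.tgt (𝟙 f.tgt)
    have e2 := shapeOut_st g.src g.tgt γ.output
    refine (congrArg (fun s : State (LShape.vars (shape f.src f.tgt)).lP f.tgt =>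
      Matching.push (Q.frame.map γ).1 ⟨.inl s.1, s.2⟩) e1).trans (h.trans ?_)
    exact (congrArg (fun k => (⟨.inr (.inr ()), k⟩ : State (tgtLab (LShape.vars (shape f.src f.tgt))
      (LShape.vars (shape g.src g.tgt))) f.tgt)) (Category.id_comp γ.output)).trans
      (congrArg (fun s : State (LShape.vars (shape g.src g.tgt)).lP f.tgt =>
        (⟨.inr s.1, s.2⟩ : State (tgtLab (LShape.vars (shape f.src f.tgt))
          (LShape.vars (shape g.src g.tgt))) f.tgt)) e2.symm)
  · exact (push_frame_in γ j (𝟙 _)).trans (congrArg (fun k =>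
      (⟨.inl (shapeIn f.src f.tgt j).idx, ((shapeIn f.src f.tgt j).st k).2⟩ :
        State (tgtLab (LShape.vars (shape f.src f.tgt)) (LShape.vars (shape g.src g.tgt))) _))
      (Category.id_comp (γ.input j)))

/-- The graph determines the tree with one node, and the tree displays the permutation and all
labels of the morphism. -/
theorem frame_map_injective {f g : Q.Elt} : Function.Injective (Q.frame.map (X := f) (Y := g)) := by
  intro γ δ h
  have h1 : BarEdges (F := fun _ : Fin 1 => f) (f := g) (Q.frame.map δ).1 _ (barRoot _ g) := h ▸ barEdges_frame γ
  have e := BarEdges.tree_unique (F := fun _ : Fin 1 => f) h1 (barEdges_frame δ)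
  obtain ⟨e1, e2⟩ : γ.output = δ.output ∧ (fun j => Tree.leaf (F := fun _ : Fin 1 => f) (γ.perm j) (γ.input j)) =
      fun j => .leaf (δ.perm j) (δ.input j) := by
    injection e with _ _ h1 h2
    exact ⟨h1, h2⟩
  have e3 : γ.perm = δ.perm := Equiv.ext fun j => by
    injection congrFun e2 j
  refine EltHom.ext e3 ?_ e1
  obtain ⟨σ, a, b, c⟩ := γ
  obtain ⟨σ', a', b', c'⟩ := δ
  obtain rfl : σ = σ' := e3
  refine heq_of_eq (funext fun j => ?_)
  injection congrFun e2 j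

end

theorem _root_.KM.Tree.exists_eq_leaf {Q : SymMulticategory.{u, v, w} C} {ι L : Type} {F : ι → Q.Elt} {z : L → C}
    {x : C} {T : Tree F z x} (h : ∀ q i, T.ctx.vars.lP q ≠ ⟨.inl i⟩) : ∃ l a, T = .leaf l a := by
  cases T with
  | leaf l a => exact ⟨l, a, rfl⟩
  | node i a ch => exact (h (.inl ()) i rfl).elim

/-- The only node must occur exactly once. So the tree is not a leaf, its root is that node, and no
node remains for the subtrees. -/
theorem _root_.KM.Config.exists_eq_node {Q : SymMulticategory.{u, v, w} C} {F : Fin 1 → Q.Elt} {f : Q.Elt}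
    (c : Config F f) : ∃ (a : (F 0).tgt ⟶ f.tgt) (σ : Fin (F 0).n → Fin f.n)
      (b : ∀ j, f.src (σ j) ⟶ (F 0).src j), c.tree = .node 0 a fun j => .leaf (σ j) (b j) := by
  obtain ⟨e, he1, he2⟩ := c.composes.exists_equiv
  have uniq : ∀ q i, c.tree.ctx.vars.lP q = ⟨.inl i⟩ → q = e (.inl 0) := by
    intro q i h
    obtain ⟨i' | l, rfl⟩ := e.surjective q
    · exact congrArg (fun i => e (.inl i)) (Subsingleton.elim _ _)
    · exact nomatch congrArg Discrete.as ((he2 l).symm.trans h)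
  have h0 := he1 0
  generalize e (.inl 0) = q0 at uniq h0
  clear he1 he2 e
  generalize c.tree = T at q0 uniq h0
  cases T with
  | leaf l a => exact nomatch congrArg Discrete.as h0
  | node i a ch =>
    obtain rfl : i = 0 := Subsingleton.elim _ _
    have hch : ∀ j, ∃ l b, ch j = .leaf l b := fun j => Tree.exists_eq_leaf fun q i h => by
      have h1 := (((TensorOf.tens fun j => (ch j).ctx).posP j ⟨q, rfl⟩).eq).trans h
      have h2 := uniq (.inr ((TensorOf.tens fun j => (ch j).ctx).posP j ⟨q, rfl⟩).idx) i h1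
      have h3 := uniq (.inl ()) 0 rfl
      exact nomatch h3.trans h2.symm
    choose σ b h using hch
    exact ⟨a, σ, b, congrArg _ (funext h)⟩

section
variable {Q : SymMulticategory.{u, v, w} C} {T T' : Q.slice.Elt}
  {p : (AC.I : AC C) ⟶ (AC.lift Q.frame).obj (Q.slice.frame.obj T)}
  {p' : (AC.I : AC C) ⟶ (AC.lift Q.frame).obj (Q.slice.frame.obj T')}

/-- The case `m = 1` of `BarEdges.comp_eq`, in which the tensor product of points is the point
itself. Applied to `Q.slice`, it is the commuting triangle that makes a morphism of `elt Q⁺⁺` one of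
the comma category. -/
theorem comp_frame_map (hp : IsGraph p (Config.tree T.arr)) (hp' : IsGraph p' (Config.tree T'.arr))
    (γ : T ⟶ T') : p ≫ (AC.lift Q.frame).map (Q.slice.frame.map γ) = p' := by
  have h := Composes.corolla' (z := T'.src) (fun _ : Fin 1 => T) 0 γ.perm γ.input γ.output
  exact BarEdges.comp_eq (α := fun _ : Fin 1 => T) (p := fun _ => p) (fun _ => hp) hp'
    ((congrArg (Composes _ _ _) γ.comm).mp h) (barEdges_frame γ)

/-- The commuting triangle makes `h` the graph of a configuration of the single arrow `T` that
yields `T'`, and such a configuration is a morphism of `elt Q⁺`. -/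
theorem exists_frame_map (hp : IsGraph p (Config.tree T.arr)) (hp' : IsGraph p' (Config.tree T'.arr))
    (h : Q.slice.frame.obj T ⟶ Q.slice.frame.obj T') (e : p ≫ (AC.lift Q.frame).map h = p') :
    ∃ γ : T ⟶ T', Q.slice.frame.map γ = h := by
  obtain ⟨S, hS⟩ := exists_config (α := fun _ : Fin 1 => T) (p := fun _ => p) (fun _ => hp) hp' e
  obtain ⟨a, σ, b, hT⟩ := S.exists_eq_node
  have hS' := hS
  rw [hT] at hS'
  obtain ⟨h1, h2⟩ := hS'
  have h2 : ∀ j, h.1.push ((barLeaf (fun _ : Fin 1 => T) T' (σ j)).st (𝟙 _)) =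
    (barIn (fun _ : Fin 1 => T) T' 0 j).st (b j) := h2
  have inj : ∀ {j j'}, (barIn (fun _ : Fin 1 => T) T' 0 j).idx = (barIn (fun _ : Fin 1 => T) T' 0 j').idx →
    j = j' := fun h => tensPos_inj T.src (Sum.inl_injective (Sum.inl_injective h))
  have inj' : ∀ {j j'}, (barLeaf (fun _ : Fin 1 => T) T' j).idx = (barLeaf (fun _ : Fin 1 => T) T' j').idx →
    j = j' := fun h => tensPos_inj T'.src (Sum.inl_injective (Sum.inr_injective h))
  -- The mate of the leaf `σ j` is the `j`-th input of the node, so `σ` inverts part of the pairing.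
  -- It reaches every leaf, because the only other target, the root, is already paired with the
  -- node.
  have hσ : Function.Bijective σ := by
    constructor
    · intro j j' e
      have e1 := (mate_eq (h2 j)).symm.trans ((congrArg (fun l =>
        h.1.mate (barLeaf (fun _ : Fin 1 => T) T' l).idx) e).trans (mate_eq (h2 j')))
      exact inj e1
    · intro l
      rcases e : h.1.mate (barLeaf (fun _ : Fin 1 => T) T' l).idx with q | q
      · obtain ⟨j, rfl⟩ := shapeN_surj q
        exact ⟨j, inj' (h.1.bij.1 ((mate_eq (h2 j)).trans e.symm))⟩
      · obtain rfl := shapeP_surj q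
        exact nomatch h.1.bij.1 ((mate_eq h1).trans e.symm)
  let d : Fin T.n ≃ Fin T'.n := Equiv.ofBijective σ hσ
  have hc := Composes.corolla' (z := T'.src) (fun _ : Fin 1 => T) 0 d b a
  -- The tree with one node composes to the left side by `hc` and to `T'.arr` by the choice of `S`.
  -- The flattened tree, which depends on neither, is the tree of both.
  have comm : Q.slice.act d (x := T'.src) (Q.slice.post (Q.slice.pre T.arr b) a) = T'.arr := by
    have h3 := flat_eq (α := fun _ : Fin 1 => T) (α' := T') hc
    have h4 := flat_eq (α := fun _ : Fin 1 => T) (α' := T') S.composes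
    rw [hT] at h4
    exact Config.ext (h3.symm.trans h4)
  let γ : T ⟶ T' := ⟨d, b, a, comm⟩
  refine ⟨γ, BarEdges.unique (F := fun _ : Fin 1 => T) S ?_ hS⟩
  rw [hT]
  exact barEdges_frame γ

end

end SymMulticategory
end KM

/-! ### The isomorphism with a full subcategory of the comma category -/

namespace KM
open SignedSet Matching SymMulticategory
variable {C : Type u} [Category.{v} C] {D : Type u'} [Category.{v'} D]

/-- Brackets to the right and factors that are variables make the product readable without
ambiguity, so an object of shape `Xₘ` determines `m` and its inputs. Injectivity on objects depends
on this. -/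
theorem LShape.tens_of_inj : ∀ {n n' : ℕ} {x : Fin n → C} {x' : Fin n' → C},
    LShape.tens n (fun i => .of (x i)) = LShape.tens n' (fun i => .of (x' i)) →
    (⟨n, x⟩ : Σ n, Fin n → C) = ⟨n', x'⟩
  | 0, 0, x, x', _ => congrArg (Sigma.mk 0) (funext fun i => i.elim0)
  | 0, 1, _, _, h => nomatch h
  | 0, _ + 2, _, _, h => nomatch h
  | 1, 0, _, _, h => nomatch h
  | 1, 1, x, x', h => congrArg (Sigma.mk 1) (funext (Fin.cases (LShape.of.inj h) fun i => i.elim0))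
  | 1, _ + 2, _, _, h => nomatch h
  | _ + 2, 0, _, _, h => nomatch h
  | _ + 2, 1, _, _, h => nomatch h
  | n + 2, n' + 2, x, x', h => by
    have h1 := LShape.tensor.inj h
    have h2 := tens_of_inj (x := fun i => x i.succ) (x' := fun i => x' i.succ) h1.2
    obtain rfl : n = n' := Nat.succ_injective (congrArg Sigma.fst h2)
    have h3 := eq_of_heq (Sigma.mk.inj h2).2
    exact congrArg (Sigma.mk (n + 2)) (funext (Fin.cases (LShape.of.inj h1.1) (congrFun h3)))

namespace SymMulticategory

/-- The arrows have different types until the inputs and outputs are known to agree, so their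
equality is asked for only under these equations. -/
theorem Elt.ext_shape {Q : SymMulticategory.{u, v, w} C} {f g : Q.Elt}
    (h : shape f.src f.tgt = shape g.src g.tgt) (h' : ∀ (e : f.n = g.n), HEq f.src g.src → f.tgt = g.tgt →
      HEq f.arr g.arr) : f = g := by
  obtain ⟨n, x, y, a⟩ := f
  obtain ⟨n', x', y', a'⟩ := g
  have h1 := LShape.hom.inj h
  have h2 := LShape.tens_of_inj h1.1
  obtain rfl : n = n' := congrArg Sigma.fst h2
  obtain rfl : x = x' := eq_of_heq (Sigma.mk.inj h2).2
  obtain rfl : y = y' := LShape.of.inj h1.2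
  exact congrArg _ (eq_of_heq (h' rfl .rfl rfl))

section
variable {Q : SymMulticategory.{u, v, w} C}
  {G : ∀ α : Q.slice.Elt, (AC.I : AC C) ⟶ (AC.lift Q.frame).obj (Q.slice.frame.obj α)}

/-- The graph of a configuration. -/
noncomputable def graph {n : ℕ} {F : Fin n → Q.Elt} {f : Q.Elt} (c : Config F f) :
    (AC.I : AC C) ⟶ ladder F f := (exists_graph c).choose

theorem isGraph_graph {n : ℕ} {F : Fin n → Q.Elt} {f : Q.Elt} (c : Config F f) : IsGraph (graph c) c.tree :=
  (exists_graph c).choose_spec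

theorem compositeIs_graph (hG : ∀ α, IsGraph (G α) (Config.tree α.arr)) {m : ℕ} {α : Fin m → Q.slice.Elt} {α' : Q.slice.Elt}
    (T : Config (Q := Q.slice) α α') :
    CompositeIs G α α' (graph T) :=
  BarEdges.comp_eq (fun i => hG (α i)) (hG α') T.composes
    ((barEdges_iff (graph T) T.tree (barRoot α α')).2 ((isGraph_iff _ _).1 (isGraph_graph T)))

/-- Injective because a graph has at most one tree; surjective by `exists_config`, the configuration
found there having no other graph than `θ`. -/
theorem bijective_graph (hG : ∀ α, IsGraph (G α) (Config.tree α.arr)) {m : ℕ}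
    (α : Fin m → Q.slice.Elt) (α' : Q.slice.Elt) :
    Function.Bijective fun T : Q.slice.slice.Hom α α' =>
      (⟨graph T, compositeIs_graph hG T⟩ : {θ : (AC.I : AC Q.Elt) ⟶
        (AC.lift Q.slice.frame).obj (shape α α') // CompositeIs G α α' θ}) := by
  constructor
  · intro T T' h
    have h1 : graph T = graph T' := congrArg Subtype.val h
    have h2 := (isGraph_iff _ _).1 (isGraph_graph T)
    rw [h1] at h2
    exact Config.ext (h2.tree_unique ((isGraph_iff _ _).1 (isGraph_graph T')))
  · rintro ⟨θ, h⟩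
    obtain ⟨S, hS⟩ := exists_config (fun i => hG (α i)) (hG α') h
    exact ⟨S, Subtype.ext (Edges.unique S (isGraph_graph S)
      ((isGraph_iff _ _).2 ((barEdges_iff θ S.tree (barRoot α α')).1 hS)))⟩

/-- The functor from `elt Q⁺⁺` to the comma category. -/
noncomputable def toComma (hG : ∀ α, IsGraph (G α) (Config.tree α.arr)) :
    Q.slice.slice.Elt ⥤ (IsComposite G).FullSubcategory where
  obj T := ⟨StructuredArrow.mk (Y := shape T.src T.tgt) (graph (Q := Q.slice) T.arr),
    ⟨T.n, T.src, T.tgt, _, rfl, compositeIs_graph hG T.arr⟩⟩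
  map {T T'} γ := ObjectProperty.homMk (StructuredArrow.homMk (Q.slice.slice.frame.map γ)
    (comp_frame_map (Q := Q.slice) (isGraph_graph T.arr) (isGraph_graph T'.arr) γ))
  map_id T := ObjectProperty.hom_ext _ (StructuredArrow.hom_ext _ _ (Q.slice.slice.frame.map_id T))
  map_comp γ δ := ObjectProperty.hom_ext _ (StructuredArrow.hom_ext _ _ (Q.slice.slice.frame.map_comp γ δ))

/-- A morphism of the comma category is a morphism of `A C₂` with a commuting triangle, which is the
hypothesis of `exists_frame_map` for `Q.slice`. -/
theorem full_toComma (hG : ∀ α, IsGraph (G α) (Config.tree α.arr)) : (toComma hG).Full where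
  map_surjective {T T'} h := by
    obtain ⟨γ, hγ⟩ := exists_frame_map (Q := Q.slice) (isGraph_graph T.arr) (isGraph_graph T'.arr)
      h.hom.right (StructuredArrow.w h.hom)
    exact ⟨γ, ObjectProperty.hom_ext _ (StructuredArrow.hom_ext _ _ hγ)⟩

theorem faithful_toComma (hG : ∀ α, IsGraph (G α) (Config.tree α.arr)) : (toComma hG).Faithful where
  map_injective {T T'} γ δ h := frame_map_injective
    (congrArg (fun h : (toComma hG).obj T ⟶ (toComma hG).obj T' => h.hom.right) h)

theorem bijective_toComma (hG : ∀ α, IsGraph (G α) (Config.tree α.arr)) :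
    Function.Bijective (toComma hG).obj := by
  constructor
  · intro T T' h
    have h1 : StructuredArrow.mk (S := AC.I) (T := AC.lift Q.slice.frame) (Y := shape T.src T.tgt) (graph (Q := Q.slice) T.arr) =
      StructuredArrow.mk (Y := shape T'.src T'.tgt) (graph (Q := Q.slice) T'.arr) :=
      congrArg ObjectProperty.FullSubcategory.obj h
    refine Elt.ext_shape (congrArg Comma.right h1) ?_
    obtain ⟨n, α, α', T⟩ := T
    obtain ⟨n', β, β', T'⟩ := T'
    intro e1 e2 e3
    obtain rfl : n = n' := e1
    obtain rfl : α = β := eq_of_heq e2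
    obtain rfl : α' = β' := e3
    have h2 : graph (Q := Q.slice) T = graph T' := by
      injection h1 with _ _ h
    exact heq_of_eq ((bijective_graph hG α α').1 (Subtype.ext h2))
  -- An object of the subcategory is, by definition, a `θ` that satisfies the condition, hence the
  -- graph of a configuration.
  · rintro ⟨X, m, α, α', θ, rfl, h⟩
    obtain ⟨T, hT⟩ := (bijective_graph hG α α').2 ⟨θ, h⟩
    obtain rfl : graph T = θ := congrArg Subtype.val hT
    exact ⟨⟨m, α, α', T⟩, rfl⟩

end
end SymMulticategory
end KM

/-- A functor that is full, faithful and bijective on objects is an isomorphism of categories. Since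
a configuration has only one graph, `G` and `Φ` are determined by the `IsGraph` clauses, although
they are bound existentially. -/
theorem mainTheorem4 {C : Type u} [Category.{v} C] (Q : KM.SymMulticategory.{u, v, w} C) :
    ∃ (G : ∀ α : Q.slice.Elt,
        (KM.AC.I : KM.AC C) ⟶ (KM.AC.lift Q.frame).obj (Q.slice.frame.obj α))
      (Φ : ∀ {j : ℕ} (α : Fin j → Q.slice.Elt) (α' : Q.slice.Elt),
        Q.slice.slice.Hom α α' ≃
          {θ : (KM.AC.I : KM.AC Q.Elt) ⟶
              (KM.AC.lift Q.slice.frame).obj (KM.SymMulticategory.shape α α') //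
            KM.SymMulticategory.CompositeIs G α α' θ}),
      (∀ α : Q.slice.Elt, KM.SymMulticategory.IsGraph (G α) (KM.Config.tree α.arr)) ∧
      (∀ {j : ℕ} (α : Fin j → Q.slice.Elt) (α' : Q.slice.Elt) (T : Q.slice.slice.Hom α α'),
        KM.SymMulticategory.IsGraph (Φ α α' T).1 (KM.Config.tree T)) ∧
      ∃ E : Q.slice.slice.Elt ⥤ (KM.SymMulticategory.IsComposite G).FullSubcategory,
        E.Full ∧ E.Faithful ∧ Function.Bijective E.obj ∧
        (∀ T : Q.slice.slice.Elt, (E.obj T).obj = StructuredArrow.mk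
          (Y := KM.SymMulticategory.shape T.src T.tgt)
          (Φ T.src T.tgt T.arr).1) ∧
        E ⋙ (KM.SymMulticategory.IsComposite G).ι ⋙
          StructuredArrow.proj (KM.AC.I : KM.AC Q.Elt) (KM.AC.lift Q.slice.frame) =
            Q.slice.slice.frame := by
  have hG := fun α : Q.slice.Elt => KM.SymMulticategory.isGraph_graph (KM.SymMulticategory.Elt.arr α)
  refine ⟨_, fun α α' => Equiv.ofBijective _ (KM.SymMulticategory.bijective_graph hG α α'), hG,
    fun α α' T => KM.SymMulticategory.isGraph_graph T, KM.SymMulticategory.toComma hG,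
    KM.SymMulticategory.full_toComma hG, KM.SymMulticategory.faithful_toComma hG,
    KM.SymMulticategory.bijective_toComma hG, fun T => rfl, rfl⟩
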